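/- **Setting.** Fix the number of layers $L\ge 3$, the branching bound $\lambda\ge 1$, the overlap fraction $0<f\le 1$ and constants $C,a,d\in\mathbb N$. An event record with parameter $n\ge 2$ consists of at most $n$ hits $\mathbf m_{l,j}$ ($0\le j<n$) in each layer $l<L$, each stored in a word of $w$ bits. The detector's local routines are arbitrary functions on such words, one evaluation of which takes $\tau$ gates, where $w,\tau\le a\lfloor\log_2 n\rfloor^d$: a test for good seeds, the initial state and $\chi^2$ of a seed, the prediction of the state at the next layer, the predicted $\chi^2$ of a hit, the state update for a hit and for a ghost hit, and the quality score of a track after a refit. **The CTF.** (i) *Seeding:* all good triplets of hits of layers $0,1,2$. (ii) *Finding:* for each seed and each layer $l=3,\dots,L-1$, every current candidate is continued by every hit of layer $l$ with $\chi^2<\chi_0^2$, or by one ghost hit if there is none; candidates with too many ghost hits or too large total $\chi^2$ are dropped, and the $\lambda$ candidates with the best quality score $q_l=l-m_{\rm ghost}-\omega\chi^2_{\le l}$ are kept (ties are broken by the track vector). (iii) *Cleaning:* the candidates are visited by decreasing quality, and a candidate is kept unless it overlaps a track kept before; two tracks with $N_1,N_2$ hits overlap if they share at least $\lceil f\min(N_1,N_2)\rceil$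 hits. (iv) *Selection:* the tracks whose refitted score reaches a threshold are output. Let $\mathcal R$ be the list that results if (iv) is applied to the found candidates before (iii). **Quantum model.** Circuits act on registers of $W$ qubits and start in $|0\rangle$. The gates are Hadamard gates, sign flips, and gates that XOR into a register a word operation (cost $O(W^2)$), a local routine (cost $O(\tau+W)$), or a QRAM access (cost $O(W)$) to the event record or to a search tree; time is the number of gates, plus the time of the classical steps. **The algorithm.** Given a circuit $U$ with a track register and a score register, and a number $B$, the algorithm starts with an empty self-balancing search tree $\mathcal T$ and repeats: run quantum minimum finding for the score $\lceil\log_2(2\lambda n^3)\rceil$ times and take the best sample. (Quantum minimum finding starts with the threshold $y=+\infty$. Until $B$ calls to $U^{\pm1}$ have been made, it applies to $U|0\rangle$ a random number $j$ of rounds of amplitude amplification for scores below $y$, where $j$ is uniform in $0\le j<(6/5)^s$, $j\le B$, and $s$ is the number of failures since the last improvement; it then measures, and lowers $y$ to the score found if that is smaller.) If the sample has a finite score, is a track that passes selection, and none of its hit tuples is in $\mathcal T$ in conflict with it, it is output and its tuples are inserted in $\mathcal T$; otherwise the algorithm stops. $U$ reads $\mathcal T$ from the QRAM; $U_i$ denotes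 $U$ when $\mathcal T$ holds the first $i$ tracks of $\mathcal R$. **Theorem.** For every $0<\varepsilon<1$ there are $K,k\in\mathbb N$, depending only on $L,\lambda,f,C,a,d,\varepsilon$, such that for every $n\ge2$ and every detector as above there are a circuit $U$ with at most $K\sqrt n\,\lfloor\log_2 n\rfloor^k$ gates, a number $B\le K\sqrt{n^3}$ and a number $p\ge 1/(Kn^3)$ such that for every event record: 1. If every found candidate that overlaps a found candidate of lower quality which passes selection passes selection itself (for instance, if selection is a cut on the quality score), then $\mathcal R$ is the output of the CTF. 2. Under the promise $|\mathcal R|\le Cn$: (a) for each $i\le|\mathcal R|$, $U_i$ performs seeding, finding, cleaning and selection in superposition: measuring $U_i|0\rangle$ yields each candidate that passes finding and selection and does not overlap the first $i$ tracks of $\mathcal R$, together with its score (an increasing function of $-q_{L-1}$, with the tie-break), with probability between $(1-\varepsilon)p$ and $(1+\varepsilon)p$, and it yields anything else with a score other than $+\infty$ with total probability at most $\varepsilon$; (b) with probability at least $1-\varepsilon$, the algorithm outputs exactly $\mathcal R$, in time at most $Kn^3\lfloor\log_2 n\rfloor^k$, i.e. $\tilde O(n^3)$. -/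

import Mathlib

namespace CTF

/-! ## The detector, the event record and the Combinatorial Track Finder -/

/-- The local routines and cuts of the track reconstruction, in fixed precision.
A word of `w` bits holds a constant number of fixed-precision numbers: the coordinates of a hit,
a state vector with its covariance matrix, or a `χ²` value (an unsigned fixed-point number).
Nothing is assumed about the routines, so that every seeding criterion, every Kalman filter and
every smoother is covered. One evaluation of a routine takes `opCost` gates. -/
structure Detector (L : ℕ) where
  /-- word length -/
  w : ℕ
  /-- gates for one evaluation of a local routine -/
  opCost : ℕ
  /-- the seeding criterion -/
  seedGood : BitVec w → BitVec w → BitVec w → Bool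
  /-- the initial state `p_{2|2}` of a seed -/
  initState : BitVec w → BitVec w → BitVec w → BitVec w
  /-- the initial `χ²` of a seed -/
  initChi : BitVec w → BitVec w → BitVec w → BitVec w
  /-- `p_{l-1|l-1} ↦ p_{l|l-1}` -/
  predict : Fin L → BitVec w → BitVec w
  /-- `χ²_{l|l-1}` of a hit, given `p_{l|l-1}` -/
  chi2 : Fin L → BitVec w → BitVec w → BitVec w
  /-- `p_{l|l}`, given `p_{l|l-1}` and the hit -/
  kalman : Fin L → BitVec w → BitVec w → BitVec w
  /-- `p_{l|l}`, given `p_{l|l-1}`, when a ghost hit is added -/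
  ghost : Fin L → BitVec w → BitVec w
  /-- the cut `χ₀²` on the predicted `χ²` -/
  chi0 : BitVec w
  /-- the value of `1` in the fixed-point scale of quality scores -/
  unit : BitVec w
  /-- the weight `ω` in that scale -/
  omega : BitVec w
  /-- a candidate with more ghost hits is dropped -/
  maxGhosts : ℕ
  /-- a candidate with a larger total `χ²` is dropped -/
  maxChi : ℕ
  /-- the quality score after refitting the whole track with the smoother (`none` for a ghost) -/
  refit : (Fin L → Option (BitVec w)) → BitVec w
  /-- the selection threshold on the refitted score -/
  threshold : BitVec w

/-- Hit number `j` of layer `l`; `none` if there is no such hit. -/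
abbrev Event (L n w : ℕ) := Fin L → Fin n → Option (BitVec w)

/-- A track vector: the label of its hit in every layer, `none` for a ghost hit. -/
abbrev Track (L n : ℕ) := Fin L → Option (Fin n)

/-- A ghost is the digit `0`, the hit `j` is the digit `j + 1`. -/
def digit {n : ℕ} : Option (Fin n) → ℕ
  | none => 0
  | some j => j + 1

/-- The number of a track vector in base `n + 1`. -/
def code {L n : ℕ} (t : Track L n) : ℕ := ∑ l : Fin L, digit (t l) * (n + 1) ^ (l : ℕ)

/-- A candidate track under construction. -/
structure Cand (L n w : ℕ) where
  hits : Track L n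
  state : BitVec w
  chi : ℕ
  ghosts : ℕ

variable {L n : ℕ}

/-- The quality score `q_l = l - m_ghost - ω χ²`, as an integer multiple of the fixed-point
step. -/
def quality (D : Detector L) (l : ℕ) (c : Cand L n D.w) : ℤ :=
  D.unit.toNat * ((l : ℤ) - c.ghosts) - D.omega.toNat * c.chi

/-- `m_ghost + ω χ²`, that is, `l - q_l`. -/
def penalty (D : Detector L) (c : Cand L n D.w) : ℕ :=
  D.unit.toNat * c.ghosts + D.omega.toNat * c.chi

theorem quality_eq (D : Detector L) (l : ℕ) (c : Cand L n D.w) :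
    quality D l c = D.unit.toNat * (l : ℤ) - penalty D c := by
  simp only [quality, penalty]; push_cast; ring

/-- The number that orders the candidates of one layer: `-q` up to a constant, ties being broken
by the track vector. A smaller key is a better candidate. -/
def key (D : Detector L) (c : Cand L n D.w) : ℕ :=
  penalty D c * (n + 1) ^ L + code c.hits

/-- Sort by decreasing quality. -/
def sortCands (D : Detector L) (cs : List (Cand L n D.w)) : List (Cand L n D.w) :=
  cs.insertionSort (fun a b => key D a ≤ key D b)

/-- All continuations of a candidate to layer `l`: one for every hit whose predicted `χ²` is below
the cut, or a single ghost hit if there is none. -/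
def extend (D : Detector L) (E : Event L n D.w) (l : Fin L) (c : Cand L n D.w) :
    List (Cand L n D.w) :=
  let p := D.predict l c.state
  let good := (List.finRange n).filterMap fun j =>
    (E l j).bind fun h =>
      if D.chi2 l p h < D.chi0 then
        some (Cand.mk (Function.update c.hits l (some j)) (D.kalman l p h)
          (c.chi + (D.chi2 l p h).toNat) c.ghosts)
      else none
  if good.isEmpty then [Cand.mk c.hits (D.ghost l p) c.chi (c.ghosts + 1)] else good

/-- One layer of track finding: extend, drop, and keep the best `lam`. -/
def findStep (D : Detector L) (E : Event L n D.w) (lam : ℕ) (cs : List (Cand L n D.w))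
    (l : Fin L) : List (Cand L n D.w) :=
  (sortCands D ((cs.flatMap (extend D E l)).filter
    fun c => c.ghosts ≤ D.maxGhosts ∧ c.chi ≤ D.maxChi)).take lam

/-- The candidate formed by a triplet of hits of layers 0, 1, 2, if it is a good seed. -/
def seed (D : Detector L) (E : Event L n D.w) (hL : 3 ≤ L) (j0 j1 j2 : Fin n) :
    Option (Cand L n D.w) :=
  (E ⟨0, by omega⟩ j0).bind fun h0 =>
  (E ⟨1, by omega⟩ j1).bind fun h1 =>
  (E ⟨2, by omega⟩ j2).bind fun h2 =>
    if D.seedGood h0 h1 h2 then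
      some (Cand.mk
        (fun l => if l.val = 0 then some j0 else if l.val = 1 then some j1
          else if l.val = 2 then some j2 else none)
        (D.initState h0 h1 h2) (D.initChi h0 h1 h2).toNat 0)
    else none

/-- Seed generation: all good triplets. -/
def seeds (D : Detector L) (E : Event L n D.w) (hL : 3 ≤ L) : List (Cand L n D.w) :=
  (List.finRange n).flatMap fun j0 => (List.finRange n).flatMap fun j1 =>
    (List.finRange n).filterMap fun j2 => seed D E hL j0 j1 j2

/-- The output of the track finding stage. -/
def found (D : Detector L) (E : Event L n D.w) (hL : 3 ≤ L) (lam : ℕ) : List (Cand L n D.w) :=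
  (seeds D E hL).flatMap fun s => ((List.finRange L).drop 3).foldl (findStep D E lam) [s]

/-- The number of (real) hits of a track. -/
def numHits (t : Track L n) : ℕ := (Finset.univ.filter fun l => (t l).isSome).card

/-- The number of (real) hits that two tracks share. -/
def shared (t t' : Track L n) : ℕ :=
  (Finset.univ.filter fun l => (t l).isSome ∧ t l = t' l).card

/-- `⌈f N⌉` for a track with `N` hits. -/
def rOf (f : ℚ) (t : Track L n) : ℕ := ⌈f * numHits t⌉₊

/-- Two tracks share too many hits: at least `⌈f min(N₁, N₂)⌉`. -/
def Overlap (f : ℚ) (t t' : Track L n) : Prop := min (rOf f t) (rOf f t') ≤ shared t t'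

instance (f : ℚ) (t t' : Track L n) : Decidable (Overlap f t t') := by
  unfold Overlap; infer_instance

/-- Track cleaning: go through the candidates by decreasing quality and keep those that do not
share too many hits with a track kept before. -/
def clean (D : Detector L) (f : ℚ) (cs : List (Cand L n D.w)) : List (Cand L n D.w) :=
  (sortCands D cs).foldl
    (fun acc c => if ∃ c' ∈ acc, Overlap f c.hits c'.hits then acc else acc ++ [c]) []

/-- The selection criterion: the score after the refit reaches the threshold. -/
def Selected (D : Detector L) (E : Event L n D.w) (t : Track L n) : Prop :=
  D.threshold ≤ D.refit fun l => (t l).bind (E l)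

instance (D : Detector L) (E : Event L n D.w) (t : Track L n) : Decidable (Selected D E t) := by
  unfold Selected; infer_instance

/-- The output of the CTF: seeding, finding, cleaning, selection. -/
def ctfOutput (D : Detector L) (E : Event L n D.w) (hL : 3 ≤ L) (lam : ℕ) (f : ℚ) :
    List (Track L n) :=
  ((clean D f (found D E hL lam)).filter fun c => Selected D E c.hits).map Cand.hits

/-- The candidates that pass finding and selection. -/
def marked (D : Detector L) (E : Event L n D.w) (hL : 3 ≤ L) (lam : ℕ) : List (Cand L n D.w) :=
  (found D E hL lam).filter fun c => Selected D E c.hits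

/-- The output of the CTF when selection is applied to each candidate before the cleaning. -/
def recoOutput (D : Detector L) (E : Event L n D.w) (hL : 3 ≤ L) (lam : ℕ) (f : ℚ) :
    List (Track L n) :=
  (clean D f (marked D E hL lam)).map Cand.hits

/-- Selection respects cleaning: a candidate that beats a selected one in the cleaning stage is
selected, too. This holds, e.g., if selection is a cut on the quality score itself. -/
def SelectionConsistent (D : Detector L) (E : Event L n D.w) (hL : 3 ≤ L) (lam : ℕ) (f : ℚ) :
    Prop :=
  ∀ c ∈ found D E hL lam, ∀ c' ∈ found D E hL lam, key D c < key D c' →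
    Overlap f c.hits c'.hits → Selected D E c'.hits → Selected D E c.hits

/-! ## The search tree of tuples -/

/-- The `m`-tuples of a track: `m` of its hits are kept, the other entries are blank. -/
def tuples (t : Track L n) (m : ℕ) : List (Track L n) :=
  (((List.finRange L).filter fun l => (t l).isSome).sublistsLen m).map
    fun S l => if l ∈ S then t l else none

/-- The number under which a tuple of the tree `𝒯_{i,j}` is stored. All the trees `𝒯_{i,j}` are
kept in one search tree. -/
def tupleKey (i j : ℕ) (t : Track L n) : ℕ := (i * (L + 1) + j) * (n + 1) ^ L + code t

/-- What is inserted with a track: its `m`-tuples into `𝒯_{m,r}`, for `1 ≤ m ≤ r`. -/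
def insertKeys (f : ℚ) (t : Track L n) : List ℕ :=
  (List.range' 1 (rOf f t)).flatMap fun m => (tuples t m).map (tupleKey m (rOf f t))

/-- What is looked up for a track: its `m`-tuples in `𝒯_{m,m}` for `1 ≤ m ≤ r`, and its `r`-tuples
in `𝒯_{r,m}` for `r ≤ m ≤ ⌈f L⌉`. -/
def probeKeys (f : ℚ) (t : Track L n) : List ℕ :=
  ((List.range' 1 (rOf f t)).flatMap fun m => (tuples t m).map (tupleKey m m)) ++
    (List.range' (rOf f t) (⌈f * L⌉₊ + 1 - rOf f t)).flatMap fun m =>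
      (tuples t (rOf f t)).map (tupleKey (rOf f t) m)

/-- Insertion of a track into the self-balancing search tree. -/
def insertTrack (f : ℚ) (T : Ordnode ℕ) (t : Track L n) : Ordnode ℕ :=
  (insertKeys f t).foldl (fun T k => Ordnode.insert k T) T

/-- The tree after the tracks of a list have been inserted. -/
def treeOf (f : ℚ) (ts : List (Track L n)) : Ordnode ℕ := ts.foldl (insertTrack f) Ordnode.nil

/-- The memory cell `a` of a tree whose root is in cell `q`; the children of the node in cell `q`
are in the cells `2 q` and `2 q + 1`. An empty cell holds `0`, a node with key `k` holds `k + 1`. -/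
def treeCell (a : ℕ) : Ordnode ℕ → ℕ → ℕ
  | .nil, _ => 0
  | .node _ l k r, q => if a = q then k + 1 else treeCell a l (2 * q) + treeCell a r (2 * q + 1)

/-! ## Quantum circuits with QRAM -/

instance (W : ℕ) : Fintype (BitVec W) := Fintype.ofEquiv _ BitVec.equivFin.symm.toEquiv

/-- A computational basis state of `R` registers of `W` qubits. -/
abbrev Config (R W : ℕ) := Fin R → BitVec W

/-- Word operations; the two comparisons return `0` or `1`. -/
inductive BinOp
  | add | sub | mul | and | or | lt | eq

def BinOp.eval {W : ℕ} : BinOp → BitVec W → BitVec W → BitVec W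
  | add, a, b => a + b
  | sub, a, b => a - b
  | mul, a, b => a * b
  | and, a, b => a &&& b
  | or, a, b => a ||| b
  | lt, a, b => if a < b then 1#W else 0#W
  | eq, a, b => if a = b then 1#W else 0#W

/-- The values that a single gate can compute from registers: word operations, QRAM accesses to
the event record and to the search tree, and the local routines. A hit `h` is held as `h + 1`,
and `0` stands for no hit. -/
inductive Expr (L R W : ℕ)
  | const (v : BitVec W)
  | copy (a : Fin R)
  | bin (op : BinOp) (a b : Fin R)
  | loadHit (l : Fin L) (a : Fin R)
  | loadTree (a : Fin R)
  | seedGood (a b c : Fin R)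
  | initState (a b c : Fin R)
  | initChi (a b c : Fin R)
  | predict (l : Fin L) (p : Fin R)
  | chi2 (l : Fin L) (p h : Fin R)
  | kalman (l : Fin L) (p h : Fin R)
  | ghost (l : Fin L) (p : Fin R)
  | selected (t : Fin L → Fin R)

/-- What the circuits act upon: the detector's routines and the contents of the QRAM. -/
structure Env (L n : ℕ) where
  D : Detector L
  E : Event L n D.w
  T : Ordnode ℕ

/-- A register as a word of the detector. -/
def toWord {W : ℕ} (w : ℕ) (v : BitVec W) : BitVec w := BitVec.ofNat w v.toNat

/-- A register as a hit. -/
def toHit {W : ℕ} (w : ℕ) (v : BitVec W) : Option (BitVec w) :=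
  if v.toNat = 0 then none else some (BitVec.ofNat w (v.toNat - 1))

/-- The coordinates of the hit that a register holds, `0` if it holds none. -/
def hitWord {W : ℕ} (w : ℕ) (v : BitVec W) : BitVec w := (toHit w v).getD 0

variable {R W : ℕ}

def Expr.eval (V : Env L n) (x : Config R W) : Expr L R W → BitVec W
  | const v => v
  | copy a => x a
  | bin op a b => op.eval (x a) (x b)
  | loadHit l a =>
      if h : (x a).toNat < n then
        match V.E l ⟨(x a).toNat, h⟩ with
        | none => 0
        | some m => BitVec.ofNat W (m.toNat + 1)
      else 0
  | loadTree a => BitVec.ofNat W (treeCell (x a).toNat V.T 1)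
  | seedGood a b c =>
      if V.D.seedGood (hitWord _ (x a)) (hitWord _ (x b)) (hitWord _ (x c)) then 1 else 0
  | initState a b c =>
      toWord W (V.D.initState (hitWord _ (x a)) (hitWord _ (x b)) (hitWord _ (x c)))
  | initChi a b c =>
      toWord W (V.D.initChi (hitWord _ (x a)) (hitWord _ (x b)) (hitWord _ (x c)))
  | predict l p => toWord W (V.D.predict l (toWord _ (x p)))
  | chi2 l p h => toWord W (V.D.chi2 l (toWord _ (x p)) (hitWord _ (x h)))
  | kalman l p h => toWord W (V.D.kalman l (toWord _ (x p)) (hitWord _ (x h)))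
  | ghost l p => toWord W (V.D.ghost l (toWord _ (x p)))
  | selected t => if V.D.threshold ≤ V.D.refit fun l => toHit _ (x (t l)) then 1 else 0

/-- Gates needed to compute a value: linear in the word length for a word read or written and for
a QRAM access (the logarithm of the number `2 ^ W` of cells), quadratic for a word operation. -/
def Expr.cost (τ : ℕ) : Expr L R W → ℕ
  | const _ => W
  | copy _ => W
  | bin _ _ _ => W ^ 2
  | loadHit _ _ => W
  | loadTree _ => W
  | _ => τ + W

/-- Gates. `flip c t e` replaces register `t` by its bitwise sum with the value of `e` (evaluated
with `t` blanked), `had c t i` is the Hadamard gate on qubit `i` of register `t`; both are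
controlled by register `c ≠ 0`, if `c` is given. The other gates change the sign of basis states:
those in which register `c` is not zero, those in which register `a` is below `y`, and the state
in which all registers are zero. Every gate is its own inverse. -/
inductive Gate (L R W : ℕ)
  | flip (c : Option (Fin R)) (t : Fin R) (e : Expr L R W)
  | had (c : Option (Fin R)) (t : Fin R) (i : Fin W)
  | phase (c : Fin R)
  | phaseLt (a : Fin R) (y : BitVec W)
  | phaseZero

def Gate.cost (τ : ℕ) : Gate L R W → ℕ
  | flip _ _ e => e.cost τ + W + 1
  | had _ _ _ => W + 1
  | phase _ => W + 1
  | phaseLt _ _ => W + 1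
  | phaseZero => R * W + 1

/-- The control is on; the target register does not count as a control. -/
def ctrlOn (x : Config R W) (t : Fin R) : Option (Fin R) → Bool
  | none => true
  | some c => Function.update x t 0 c != 0

/-- Add `v` bitwise to register `t`. -/
def xorAt (x : Config R W) (t : Fin R) (v : BitVec W) : Config R W :=
  Function.update x t (x t ^^^ v)

/-- The basis state to which `flip c t e` sends `x`. -/
def flipMap (V : Env L n) (c : Option (Fin R)) (t : Fin R) (e : Expr L R W) (x : Config R W) :
    Config R W :=
  if ctrlOn x t c then xorAt x t (e.eval V (Function.update x t 0)) else x

/-- The action of a gate on a state vector. -/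
noncomputable def Gate.apply (V : Env L n) (ψ : Config R W → ℂ) : Gate L R W → Config R W → ℂ
  | flip c t e, x => ψ (flipMap V c t e x)
  | had c t i, x =>
      if ctrlOn x t c then
        (ψ (xorAt x t (BitVec.twoPow W i)) + (if (x t).getLsbD i then -1 else 1) * ψ x) / √2
      else ψ x
  | phase c, x => if x c = 0 then ψ x else -ψ x
  | phaseLt a y, x => if x a < y then -ψ x else ψ x
  | phaseZero, x => if x = 0 then -ψ x else ψ x

/-- A circuit, to be run from left to right. -/
abbrev Circuit (L R W : ℕ) := List (Gate L R W)

def Circuit.cost (τ : ℕ) (C : Circuit L R W) : ℕ := (C.map (Gate.cost τ)).sum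

/-- The state vector `C |0⟩`. -/
noncomputable def Circuit.run (V : Env L n) (C : Circuit L R W) : Config R W → ℂ :=
  C.foldl (Gate.apply V) (fun x => if x = 0 then 1 else 0)

theorem update_xorAt (x : Config R W) (t : Fin R) (v : BitVec W) :
    Function.update (xorAt x t v) t 0 = Function.update x t 0 := by
  simp [xorAt]

theorem ctrlOn_xorAt (x : Config R W) (t : Fin R) (v : BitVec W) (c : Option (Fin R)) :
    ctrlOn (xorAt x t v) t c = ctrlOn x t c := by
  cases c with
  | none => rfl
  | some c => simp only [ctrlOn, update_xorAt]

theorem xorAt_xorAt (x : Config R W) (t : Fin R) (v : BitVec W) :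
    xorAt (xorAt x t v) t v = x := by
  simp [xorAt]

theorem flipMap_invol (V : Env L n) (c : Option (Fin R)) (t : Fin R) (e : Expr L R W) :
    Function.Involutive (flipMap V c t e) := by
  intro x
  by_cases h : ctrlOn x t c
  · have h1 : flipMap V c t e x = xorAt x t (e.eval V (Function.update x t 0)) := by
      simp [flipMap, h]
    rw [h1]
    simp only [flipMap, ctrlOn_xorAt, h, update_xorAt, xorAt_xorAt, if_true]
  · simp [flipMap, h]

/-- Gates preserve the norm. -/
theorem Gate.norm_apply (V : Env L n) (ψ : Config R W → ℂ) (g : Gate L R W) :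
    ∑ x, ‖g.apply V ψ x‖ ^ 2 = ∑ x, ‖ψ x‖ ^ 2 := by
  cases g with
  | flip c t e =>
    exact Equiv.sum_comp (flipMap_invol V c t e).toPerm fun x => ‖ψ x‖ ^ 2
  | phase c =>
    refine Finset.sum_congr rfl fun x _ => ?_
    simp only [Gate.apply]; split_ifs <;> simp
  | phaseLt a y =>
    refine Finset.sum_congr rfl fun x _ => ?_
    simp only [Gate.apply]; split_ifs <;> simp
  | phaseZero =>
    refine Finset.sum_congr rfl fun x _ => ?_
    simp only [Gate.apply]; split_ifs <;> simp
  | had c t i =>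
    have hinv : Function.Involutive fun x : Config R W => xorAt x t (BitVec.twoPow W i) :=
      fun x => xorAt_xorAt x t _
    have key : ∀ φ : Config R W → ℝ,
        ∑ x, φ (xorAt x t (BitVec.twoPow W i)) = ∑ x, φ x :=
      fun φ => Equiv.sum_comp hinv.toPerm φ
    have hpt : ∀ x : Config R W,
        ‖(Gate.had c t i : Gate L R W).apply V ψ x‖ ^ 2 +
          ‖(Gate.had c t i : Gate L R W).apply V ψ (xorAt x t (BitVec.twoPow W i))‖ ^ 2 =
        ‖ψ x‖ ^ 2 + ‖ψ (xorAt x t (BitVec.twoPow W i))‖ ^ 2 := by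
      intro x
      simp only [Gate.apply, ctrlOn_xorAt, xorAt_xorAt]
      by_cases h : ctrlOn x t c
      · have hb : (xorAt x t (BitVec.twoPow W i) t).getLsbD i = !(x t).getLsbD i := by
          simp [xorAt]
        simp only [h, if_true, hb]
        generalize ψ x = a
        generalize ψ (xorAt x t (BitVec.twoPow W i)) = b
        have h2 : ‖((√2 : ℝ) : ℂ)‖ ^ 2 = 2 := by
          rw [Complex.norm_real, Real.norm_eq_abs, sq_abs, Real.sq_sqrt (by norm_num)]
        have par := parallelogram_law_with_norm ℝ a b
        rw [norm_div, norm_div, div_pow, div_pow, h2]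
        cases (x t).getLsbD i
        · simp only [Bool.not_false, if_true, Bool.false_eq_true, if_false]
          rw [show b + 1 * a = a + b by ring, show a + -1 * b = a - b by ring]
          nlinarith
        · simp only [Bool.not_true, if_true, Bool.false_eq_true, if_false]
          rw [show b + -1 * a = -(a - b) by ring, show a + 1 * b = a + b by ring, norm_neg]
          nlinarith
      · simp [h]
    have hsum := Finset.sum_congr (rfl : (Finset.univ : Finset (Config R W)) = Finset.univ)
      fun x _ => hpt x
    rw [Finset.sum_add_distrib, Finset.sum_add_distrib,
      key fun x => ‖(Gate.had c t i : Gate L R W).apply V ψ x‖ ^ 2,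
      key fun x => ‖ψ x‖ ^ 2] at hsum
    linarith

theorem Circuit.norm_run (V : Env L n) (C : Circuit L R W) :
    ∑ x, ‖C.run V x‖ ^ 2 = 1 := by
  have : ∀ (C : Circuit L R W) (ψ : Config R W → ℂ),
      ∑ x, ‖C.foldl (Gate.apply V) ψ x‖ ^ 2 = ∑ x, ‖ψ x‖ ^ 2 := by
    intro C
    induction C with
    | nil => intro ψ; rfl
    | cons g C ih => intro ψ; rw [List.foldl_cons, ih, Gate.norm_apply]
  rw [Circuit.run, this]
  simp [apply_ite]

/-- The outcome of measuring `C |0⟩` in the computational basis. -/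
noncomputable def Circuit.measure (V : Env L n) (C : Circuit L R W) : PMF (Config R W) :=
  PMF.ofFintype (fun x => ENNReal.ofReal (‖C.run V x‖ ^ 2)) (by
    rw [← ENNReal.ofReal_sum_of_nonneg fun _ _ => by positivity, Circuit.norm_run,
      ENNReal.ofReal_one])

/-! ## Track reconstruction in superposition -/

/-- The circuit for the unitaries `U_i`, with its output registers: the track vector and the
score. It is one circuit for all `i`, since it reads the tracks already found from the QRAM. -/
structure Inner (L : ℕ) where
  R : ℕ
  W : ℕ
  circ : Circuit L R W
  trk : Fin L → Fin R
  score : Fin R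

/-- The value `+∞` of the score register. -/
def Inner.infty (U : Inner L) : BitVec U.W := BitVec.allOnes U.W

/-- The track in the track registers, if they hold one. -/
def Inner.decode (U : Inner L) (n : ℕ) (x : Config U.R U.W) : Option (Track L n) :=
  if h : ∀ l, (x (U.trk l)).toNat ≤ n then
    some fun l => if h0 : (x (U.trk l)).toNat = 0 then none
      else some ⟨(x (U.trk l)).toNat - 1, by have := h l; omega⟩
  else none

/-- Amplitude amplification: `j` rounds for the basis states with score below `y`. -/
def Inner.amplify (U : Inner L) (y : BitVec U.W) (j : ℕ) : Circuit L U.R U.W :=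
  U.circ ++ (List.replicate j
    (Gate.phaseLt U.score y :: U.circ.reverse ++ Gate.phaseZero :: U.circ)).flatten

/-- The state of quantum minimum finding: the best sample, its score, the number of searches that
failed since the last improvement, the number of calls to `U` and `U⁻¹`, and the time. -/
structure QMF (U : Inner L) where
  best : Option (Config U.R U.W)
  y : BitVec U.W
  fails : ℕ
  calls : ℕ
  time : ℕ

/-- One round of quantum minimum finding with exponential searching: choose `j` uniformly among
`0 ≤ j < (6/5)^fails` (and `j ≤ B`), amplify `j` times, measure, and lower the threshold `y` if
the sample has a score below it. -/
noncomputable def qmfRound (V : Env L n) (U : Inner L) (B : ℕ) (s : QMF U) : PMF (QMF U) := do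
  let j ← PMF.uniformOfFintype (Fin (min (⌈((6 : ℚ) / 5) ^ s.fails⌉₊ - 1) B + 1))
  let x ← (U.amplify s.y j).measure V
  let calls := s.calls + (2 * j + 1)
  let time := s.time + (U.amplify s.y j).cost V.D.opCost + U.R * U.W + U.W + 1
  return if x U.score < s.y then QMF.mk (some x) (x U.score) 0 calls time
    else QMF.mk s.best s.y (s.fails + 1) calls time

/-- Rounds are run until `B` calls have been made; every round makes at least one call. -/
noncomputable def qmfLoop (V : Env L n) (U : Inner L) (B : ℕ) : ℕ → QMF U → PMF (QMF U)
  | 0, s => pure s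
  | k + 1, s => if B ≤ s.calls then pure s else do
      let s' ← qmfRound V U B s
      qmfLoop V U B k s'

/-- Quantum minimum finding, with the initial threshold `+∞`. -/
noncomputable def qmf (V : Env L n) (U : Inner L) (B : ℕ) : PMF (QMF U) :=
  qmfLoop V U B B (QMF.mk none U.infty 0 0 0)

/-- The best sample of `m` runs of quantum minimum finding, and the total time. -/
noncomputable def qmfBest (V : Env L n) (U : Inner L) (B : ℕ) :
    ℕ → PMF (Option (Config U.R U.W) × BitVec U.W × ℕ)
  | 0 => pure (none, U.infty, 0)
  | m + 1 => do
      let b ← qmfBest V U B m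
      let s ← qmf V U B
      return if s.y < b.2.1 then (s.best, s.y, b.2.2 + s.time + U.W)
        else (b.1, b.2.1, b.2.2 + s.time + U.W)

/-- The classical time to look up and to insert the tuples of a track in a tree: for every tuple,
a pass through the memory of the tree (with the tuples of this track). -/
def treeTime (f : ℚ) (T : Ordnode ℕ) (t : Track L n) (W : ℕ) : ℕ :=
  ((probeKeys f t).length + (insertKeys f t).length) *
    (T.size + (insertKeys f t).length + 1) * (W + 1)

/-- The main loop: the tracks that are found from now on, and the time. The loop goes on as long
as the best track found passes the criteria and none of its tuples is in the tree. -/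
noncomputable def recoLoop (D : Detector L) (E : Event L n D.w) (lam : ℕ) (f : ℚ) (U : Inner L)
    (B : ℕ) : ℕ → Ordnode ℕ → PMF (List (Track L n) × ℕ)
  | 0, _ => pure ([], 0)
  | k + 1, T => do
      let b ← qmfBest ⟨D, E, T⟩ U B (Nat.clog 2 (2 * lam * n ^ 3))
      match b.1.bind (U.decode n) with
      | none => return ([], b.2.2)
      | some t =>
          let time := b.2.2 + D.opCost + treeTime f T t U.W
          if Selected D E t ∧ ∀ q ∈ probeKeys f t, q ∉ T then do
            let rest ← recoLoop D E lam f U B k (insertTrack f T t)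
            return (t :: rest.1, time + rest.2)
          else return ([], time)

/-- Track reconstruction in superposition: the output and the time. An accepted track is never
accepted again, so that the number of track vectors bounds the number of rounds. -/
noncomputable def reconstruct (D : Detector L) (E : Event L n D.w) (lam : ℕ) (f : ℚ)
    (U : Inner L) (B : ℕ) : PMF (List (Track L n) × ℕ) :=
  recoLoop D E lam f U B ((n + 1) ^ L + 1) Ordnode.nil

/-- The candidates that `U_i` has to mark with their score, when the tracks `ts` have been added
to the output. -/
def valid (D : Detector L) (E : Event L n D.w) (hL : 3 ≤ L) (lam : ℕ) (f : ℚ)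
    (ts : List (Track L n)) : List (Cand L n D.w) :=
  (marked D E hL lam).filter fun c => ∀ t ∈ ts, ¬ Overlap f c.hits t

/-- The basis states in which the track registers hold the candidate `c` and the score register
holds its score. -/
def Inner.shows (U : Inner L) (D : Detector L) (c : Cand L n D.w) : Set (Config U.R U.W) :=
  {x | U.decode n x = some c.hits ∧ (x U.score).toNat = key D c ∧ x U.score < U.infty}

/-- `U` performs seeding, finding, cleaning and selection in superposition, with error
probability at most `ε`: given the tracks `ts` already found, a measurement of `U|0⟩` shows every
valid candidate with the same probability `p`, up to a factor `1 ± ε`, and except with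
probability `ε`, the score is `+∞` if no valid candidate is shown. -/
def Inner.Performs (U : Inner L) (D : Detector L) (E : Event L n D.w) (hL : 3 ≤ L) (lam : ℕ)
    (f : ℚ) (ts : List (Track L n)) (p ε : ℝ) : Prop :=
  let μ : Set (Config U.R U.W) → ENNReal :=
    (U.circ.measure (⟨D, E, treeOf f ts⟩ : Env L n)).toOuterMeasure
  (∀ c ∈ valid D E hL lam f ts, ENNReal.ofReal ((1 - ε) * p) ≤ μ (U.shows D c) ∧
    μ (U.shows D c) ≤ ENNReal.ofReal ((1 + ε) * p)) ∧
  μ {x | x U.score < U.infty ∧ ∀ c ∈ valid D E hL lam f ts, x ∉ U.shows D c} ≤ ENNReal.ofReal ε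

end CTF

/-! Cleaning is greedy, so $\mathcal R$ has a recursive description: its next track is the candidate
of least key that passes selection and overlaps no earlier track of $\mathcal R$
(`recoOutput_next`), and no such candidate is left at the end (`valid_recoOutput`). Reconstruction
is therefore `|R| + 1` minimum searches over the valid candidates. If selection respects cleaning,
an unselected track never blocks a selected one, and the two stages commute (`clean_filter`).

The circuit puts a triplet of hit numbers and a slot number into uniform superposition and follows
that seed through the layers. In one layer the at most `λ` candidates have `O(n)` continuations. The
best `λ` of them are found by bisection on the key, each step of which is a Grover search with an
unknown number of solutions, at a cost of about `√n` (`groverMiss_pow_three`, `Family.runs_bisect`,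
`runs_layer`). Two tracks overlap iff they share a tuple of `min(r, r')` hits, so the comparison
with all earlier tracks is a constant number of lookups in a tree of logarithmic depth
(`overlap_iff_lookup`, `treeDepth_le`). All subroutines write into blank registers only. Hence
branches with different intermediate results never interfere, and error probabilities add up as for
a randomized classical program (`Circuit.normSq_lin_of_blank`, `Runs.bind₂`). Every found candidate
belongs to exactly one input (`Ready.existsUnique_input`), so each valid one is shown with the
probability `p` of an input, of order `n⁻³`, up to an error that repetition makes small compared
with `p` (`Ready.performs`).

Amplitude amplification is a rotation in a plane (`Inner.run_amplify`), and a search with success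
probability `P` takes `O(1/√P)` expected calls (`searchCost_step`). After a success the threshold is
a random score below the old one. With `v` the probability of the minimum and `Q` that of all good
scores below the threshold, the potential `72/√v - 36/√Q` bounds the expected number of remaining
calls, because the sums of `m/√Q` telescope (`sum_restCost_le`). Markov's inequality turns this into
a failure probability for a run of `B = O(√n³)` calls (`loop_miss_le`). Wrong samples of the
imperfect circuit are amplified as well, but by at most `(2j+1)²` (`abs_ampCoef_le`), so that an
inverse polynomial error of the circuit is harmless.

Logarithmically many runs make the failure probability of a round `O(1/n)` (`qmfBest_miss_le`,
`mul_fail_le`), and a union bound over at most `Cn + 1` rounds finishes the proof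
(`recoLoop_miss_le`). The time is `n` rounds times `√n³` calls times `√n` gates, up to logarithms.
-/

namespace CTF

variable {L n R W : ℕ}

/-! ## Circuits as linear maps -/

/-- The basis vector `|x⟩`. -/
noncomputable def ket (x : Config R W) : Config R W → ℂ := Pi.single x 1

theorem ket_apply (x y : Config R W) : ket x y = if y = x then 1 else 0 := by
  simp [ket, Pi.single_apply]

theorem sum_smul_ket (ψ : Config R W → ℂ) : ∑ x, ψ x • ket x = ψ := by
  funext y
  simp [Finset.sum_apply, ket_apply]

/-- A gate as a linear map. -/
noncomputable def Gate.lin (V : Env L n) (g : Gate L R W) :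
    (Config R W → ℂ) →ₗ[ℂ] (Config R W → ℂ) where
  toFun ψ := g.apply V ψ
  map_add' ψ φ := by
    funext x
    cases g <;> simp only [Gate.apply, Pi.add_apply]
    all_goals first | rfl | (split_ifs <;> ring)
  map_smul' c ψ := by
    funext x
    cases g <;> simp only [Gate.apply, Pi.smul_apply, smul_eq_mul, RingHom.id_apply]
    all_goals (split_ifs <;> ring)

/-- A circuit as a linear map. -/
noncomputable def Circuit.lin (V : Env L n) : Circuit L R W →
    ((Config R W → ℂ) →ₗ[ℂ] (Config R W → ℂ))
  | [] => LinearMap.id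
  | g :: C => Circuit.lin V C ∘ₗ g.lin V

theorem Circuit.lin_eq_foldl (V : Env L n) (C : Circuit L R W) (ψ : Config R W → ℂ) :
    Circuit.lin V C ψ = C.foldl (Gate.apply V) ψ := by
  induction C generalizing ψ with
  | nil => rfl
  | cons g C ih => exact ih _

theorem Circuit.run_eq (V : Env L n) (C : Circuit L R W) :
    C.run V = Circuit.lin V C (ket 0) := by
  rw [Circuit.lin_eq_foldl, Circuit.run]
  congr 1
  funext x
  rw [ket_apply]

theorem Circuit.lin_append (V : Env L n) (C C' : Circuit L R W) (ψ : Config R W → ℂ) :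
    Circuit.lin V (C ++ C') ψ = Circuit.lin V C' (Circuit.lin V C ψ) := by
  simp [Circuit.lin_eq_foldl]

theorem Circuit.lin_cons (V : Env L n) (g : Gate L R W) (C : Circuit L R W)
    (ψ : Config R W → ℂ) :
    Circuit.lin V (g :: C) ψ = Circuit.lin V C (g.lin V ψ) := rfl

theorem Circuit.lin_nil (V : Env L n) (ψ : Config R W → ℂ) :
    Circuit.lin V [] ψ = ψ := rfl

theorem Circuit.lin_singleton (V : Env L n) (g : Gate L R W) (ψ : Config R W → ℂ) :
    Circuit.lin V [g] ψ = g.lin V ψ := rfl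

theorem Circuit.norm_lin (V : Env L n) (C : Circuit L R W) (ψ : Config R W → ℂ) :
    ∑ x, ‖Circuit.lin V C ψ x‖ ^ 2 = ∑ x, ‖ψ x‖ ^ 2 := by
  induction C generalizing ψ with
  | nil => rfl
  | cons g C ih => rw [Circuit.lin_cons, ih]; exact Gate.norm_apply V ψ g

theorem norm_ket (x : Config R W) : ∑ y, ‖ket x y‖ ^ 2 = 1 := by
  simp [ket_apply, apply_ite]

/-- Every gate is its own inverse. -/
theorem Gate.lin_lin (V : Env L n) (g : Gate L R W) (ψ : Config R W → ℂ) :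
    g.lin V (g.lin V ψ) = ψ := by
  funext x
  change g.apply V (g.apply V ψ) x = ψ x
  cases g with
  | flip c t e => simp only [Gate.apply]; rw [flipMap_invol]
  | phase c => simp only [Gate.apply]; split_ifs <;> simp
  | phaseLt a y => simp only [Gate.apply]; split_ifs <;> simp
  | phaseZero => simp only [Gate.apply]; split_ifs <;> simp
  | had c t i =>
    simp only [Gate.apply, ctrlOn_xorAt, xorAt_xorAt]
    by_cases h : ctrlOn x t c
    · have hb : (xorAt x t (BitVec.twoPow W i) t).getLsbD i = !(x t).getLsbD i := by
        simp [xorAt]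
      have h2 : ((√2 : ℝ) : ℂ) * ((√2 : ℝ) : ℂ) = 2 := by
        rw [← Complex.ofReal_mul, Real.mul_self_sqrt (by norm_num)]; norm_num
      have h0 : ((√2 : ℝ) : ℂ) ≠ 0 := by
        intro h; rw [h] at h2; norm_num at h2
      simp only [h, if_true, hb]
      cases (x t).getLsbD i
      · simp only [Bool.not_false, if_true, Bool.false_eq_true, if_false]
        field_simp
        linear_combination (-ψ x) * h2
      · simp only [Bool.not_true, if_true, Bool.false_eq_true, if_false]
        field_simp
        linear_combination (-ψ x) * h2
    · simp [h]

/-- Every gate is an involution, so reversing the list inverts the circuit. This is what allows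
`U⁻¹` and uncomputation to be written as reversed lists of gates. -/
theorem Circuit.lin_reverse_lin (V : Env L n) (C : Circuit L R W) (ψ : Config R W → ℂ) :
    Circuit.lin V C.reverse (Circuit.lin V C ψ) = ψ := by
  induction C generalizing ψ with
  | nil => rfl
  | cons g C ih =>
    rw [List.reverse_cons, Circuit.lin_append, Circuit.lin_singleton, Circuit.lin_cons, ih,
      Gate.lin_lin]

theorem Circuit.lin_lin_reverse (V : Env L n) (C : Circuit L R W) (ψ : Config R W → ℂ) :
    Circuit.lin V C (Circuit.lin V C.reverse ψ) = ψ := by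
  simpa using Circuit.lin_reverse_lin V C.reverse ψ

/-- The Hermitian inner product of state vectors. -/
noncomputable def braket (ψ φ : Config R W → ℂ) : ℂ := ∑ x, starRingEnd ℂ (ψ x) * φ x

theorem braket_ket (x : Config R W) (φ : Config R W → ℂ) : braket (ket x) φ = φ x := by
  simp [braket, ket_apply]

/-- Every gate is self-adjoint. -/
theorem Gate.braket_lin (V : Env L n) (g : Gate L R W) (ψ φ : Config R W → ℂ) :
    braket ψ (g.lin V φ) = braket (g.lin V ψ) φ := by
  change ∑ x, starRingEnd ℂ (ψ x) * g.apply V φ x = ∑ x, starRingEnd ℂ (g.apply V ψ x) * φ x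
  cases g with
  | flip c t e =>
    rw [← Equiv.sum_comp (flipMap_invol V c t e).toPerm
      fun x => starRingEnd ℂ ((Gate.flip c t e).apply V ψ x) * φ x]
    refine Finset.sum_congr rfl fun x _ => ?_
    simp only [Gate.apply, Function.Involutive.coe_toPerm, flipMap_invol V c t e x]
  | phase c =>
    refine Finset.sum_congr rfl fun x _ => ?_
    simp only [Gate.apply]; split_ifs <;> simp
  | phaseLt a y =>
    refine Finset.sum_congr rfl fun x _ => ?_
    simp only [Gate.apply]; split_ifs <;> simp
  | phaseZero =>
    refine Finset.sum_congr rfl fun x _ => ?_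
    simp only [Gate.apply]; split_ifs <;> simp
  | had c t i =>
    have hinv : Function.Involutive fun x : Config R W => xorAt x t (BitVec.twoPow W i) :=
      fun x => xorAt_xorAt x t _
    -- Flipping bit `i` exchanges the off-diagonal terms of the two sides; the diagonal of the
    -- Hadamard matrix is real and needs no reindexing.
    have h1 : ∑ x, (if ctrlOn x t c then
          starRingEnd ℂ (ψ x) * φ (xorAt x t (BitVec.twoPow W i)) / √2 else 0) =
        ∑ x, (if ctrlOn x t c then
          starRingEnd ℂ (ψ (xorAt x t (BitVec.twoPow W i))) * φ x / √2 else 0) := by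
      rw [← Equiv.sum_comp hinv.toPerm]
      refine Finset.sum_congr rfl fun x _ => ?_
      simp only [Function.Involutive.coe_toPerm, ctrlOn_xorAt, xorAt_xorAt]
    have e1 : ∀ x, starRingEnd ℂ (ψ x) * (Gate.had c t i).apply V φ x =
        (if ctrlOn x t c then
          starRingEnd ℂ (ψ x) * φ (xorAt x t (BitVec.twoPow W i)) / √2 else 0) +
        (if ctrlOn x t c then
          (if (x t).getLsbD i then -1 else 1) * starRingEnd ℂ (ψ x) * φ x / √2
          else starRingEnd ℂ (ψ x) * φ x) := by
      intro x; simp only [Gate.apply]; split_ifs <;> ring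
    have e2 : ∀ x, starRingEnd ℂ ((Gate.had c t i).apply V ψ x) * φ x =
        (if ctrlOn x t c then
          starRingEnd ℂ (ψ (xorAt x t (BitVec.twoPow W i))) * φ x / √2 else 0) +
        (if ctrlOn x t c then
          (if (x t).getLsbD i then -1 else 1) * starRingEnd ℂ (ψ x) * φ x / √2
          else starRingEnd ℂ (ψ x) * φ x) := by
      intro x; simp only [Gate.apply]
      split_ifs <;>
        (try simp only [map_add, map_div₀, map_mul, map_neg, map_one, Complex.conj_ofReal]) <;> ring
    simp only [e1, e2, Finset.sum_add_distrib, h1]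

/-- The gates are self-adjoint, so the reversed circuit is the adjoint. With `ψ = |0⟩` this turns
the amplitude of `U⁻¹ φ` at `0`, on which `phaseZero` acts, into the overlap of `φ` with `U|0⟩`. -/
theorem Circuit.braket_lin (V : Env L n) (C : Circuit L R W) (ψ φ : Config R W → ℂ) :
    braket ψ (Circuit.lin V C.reverse φ) = braket (Circuit.lin V C ψ) φ := by
  induction C generalizing ψ φ with
  | nil => rfl
  | cons g C ih =>
    rw [List.reverse_cons, Circuit.lin_append, Circuit.lin_singleton, Gate.braket_lin, ih,
      Circuit.lin_cons]

/-! ## Rotations of amplitude amplification -/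

/-- The factors by which `j` rounds of amplitude amplification multiply the amplitudes of the
marked and of the unmarked basis states, if the marked ones have total probability `P`. -/
noncomputable def ampCoef (P : ℝ) : ℕ → ℝ × ℝ
  | 0 => (1, 1)
  | j + 1 =>
    let c := -(ampCoef P j).1 * P + (ampCoef P j).2 * (1 - P)
    (2 * c + (ampCoef P j).1, 2 * c - (ampCoef P j).2)

/-- One round rotates by `2θ` in the plane spanned by the marked and the unmarked part. The
coefficients are taken relative to the initial amplitudes `sin θ` and `cos θ`, so that the recursion
involves no division and stays meaningful when one part vanishes. -/
theorem ampCoef_eq {P θ : ℝ} (h : Real.sin θ ^ 2 = P) (j : ℕ) :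
    (ampCoef P j).1 * Real.sin θ = Real.sin ((2 * j + 1) * θ) ∧
    (ampCoef P j).2 * Real.cos θ = Real.cos ((2 * j + 1) * θ) := by
  induction j with
  | zero => simp [ampCoef]
  | succ j ih =>
    obtain ⟨h1, h2⟩ := ih
    have e : (2 * ((j + 1 : ℕ) : ℝ) + 1) * θ = (2 * j + 1) * θ + 2 * θ := by push_cast; ring
    have s2 := Real.sin_sq_add_cos_sq θ
    constructor
    · rw [e, Real.sin_add, ← h1, ← h2, Real.sin_two_mul, Real.cos_two_mul]
      simp only [ampCoef, ← h]
      linear_combination (-2 * (ampCoef (Real.sin θ ^ 2) j).1 * Real.sin θ -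
        2 * (ampCoef (Real.sin θ ^ 2) j).2 * Real.sin θ) * s2
    · rw [e, Real.cos_add, ← h1, ← h2, Real.sin_two_mul, Real.cos_two_mul]
      simp only [ampCoef, ← h]
      linear_combination (-2 * (ampCoef (Real.sin θ ^ 2) j).2 * Real.cos θ) * s2

/-- Amplification preserves the total probability. -/
theorem ampCoef_norm {P : ℝ} (h0 : 0 ≤ P) (h1 : P ≤ 1) (j : ℕ) :
    (ampCoef P j).1 ^ 2 * P + (ampCoef P j).2 ^ 2 * (1 - P) = 1 := by
  have hs : Real.sin (Real.arcsin √P) ^ 2 = P := by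
    rw [Real.sin_arcsin (by linarith [Real.sqrt_nonneg P]) (Real.sqrt_le_one.mpr h1),
      Real.sq_sqrt h0]
  obtain ⟨e1, e2⟩ := ampCoef_eq hs j
  have hc : 1 - P = Real.cos (Real.arcsin √P) ^ 2 := by rw [Real.cos_sq', hs]
  rw [hc]; nth_rw 2 [← hs]
  rw [← mul_pow, ← mul_pow, e1, e2, Real.sin_sq_add_cos_sq]

end CTF

namespace CTF

variable {L n R W : ℕ}

/-! ## Amplitude amplification of a circuit -/

theorem Gate.lin_phaseZero (V : Env L n) (φ : Config R W → ℂ) :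
    (Gate.phaseZero : Gate L R W).lin V φ = φ - (2 * φ 0) • ket 0 := by
  funext x
  change (if x = 0 then -φ x else φ x) = φ x - 2 * φ 0 * ket 0 x
  rw [ket_apply]
  split_ifs with h
  · rw [h]; ring
  · ring

open Classical in
/-- The overlap of a normalized state with the state in which the amplitudes of the configurations
with property `A` are multiplied by `α`, and the others by `β`. -/
theorem braket_weighted {u : Config R W → ℂ} (hu : ∑ x, ‖u x‖ ^ 2 = 1) (A : Config R W → Prop)
    (s : ℂ) (α β : ℝ) :
    braket u (fun x => s * ((if A x then α else β : ℝ) : ℂ) * u x) =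
      s * ((α * (∑ x, if A x then ‖u x‖ ^ 2 else 0) +
        β * (1 - ∑ x, if A x then ‖u x‖ ^ 2 else 0) : ℝ) : ℂ) := by
  have h1 : α * (∑ x, if A x then ‖u x‖ ^ 2 else 0) +
        β * (1 - ∑ x, if A x then ‖u x‖ ^ 2 else 0) =
      ∑ x, (if A x then α else β) * ‖u x‖ ^ 2 := by
    rw [← hu, ← Finset.sum_sub_distrib, Finset.mul_sum, Finset.mul_sum, ← Finset.sum_add_distrib]
    refine Finset.sum_congr rfl fun x _ => ?_
    split_ifs <;> ring
  rw [h1, braket, Complex.ofReal_sum, Finset.mul_sum]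
  refine Finset.sum_congr rfl fun x _ => ?_
  have h2 : starRingEnd ℂ (u x) * u x = ((‖u x‖ ^ 2 : ℝ) : ℂ) := by
    rw [mul_comm, Complex.mul_conj, Complex.normSq_eq_norm_sq]
  rw [Complex.ofReal_mul, ← h2]
  ring

/-- The probability that a measurement of `U|0⟩` shows a score below `y`. -/
noncomputable def Inner.below (U : Inner L) (V : Env L n) (y : BitVec U.W) : ℝ :=
  ∑ x, if x U.score < y then ‖U.circ.run V x‖ ^ 2 else 0

theorem Inner.below_nonneg (U : Inner L) (V : Env L n) (y : BitVec U.W) : 0 ≤ U.below V y :=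
  Finset.sum_nonneg fun x _ => by split_ifs <;> positivity

theorem Inner.below_le_one (U : Inner L) (V : Env L n) (y : BitVec U.W) : U.below V y ≤ 1 := by
  rw [← Circuit.norm_run V U.circ]
  exact Finset.sum_le_sum fun x _ => by split_ifs <;> [rfl; positivity]

/-- The state stays in the plane spanned by the marked and the unmarked part of `u = U|0⟩`.
Conjugated by `U`, the gate `phaseZero` is `1 - 2|u⟩⟨u|`, the negative of the reflection behind
`ampCoef`; this is the origin of the sign `(-1) ^ j`. -/
theorem Inner.run_amplify (U : Inner L) (V : Env L n) (y : BitVec U.W) (j : ℕ) :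
    (U.amplify y j).run V = fun x => (-1) ^ j *
      ((if x U.score < y then (ampCoef (U.below V y) j).1
        else (ampCoef (U.below V y) j).2 : ℝ) : ℂ) * U.circ.run V x := by
  induction j with
  | zero =>
    simp [Inner.amplify, ampCoef]
  | succ j ih =>
    rw [Circuit.run_eq] at ih ⊢
    have hstep : U.amplify y (j + 1) = U.amplify y j ++
        (Gate.phaseLt U.score y :: U.circ.reverse ++ Gate.phaseZero :: U.circ) := by
      simp [Inner.amplify, List.replicate_succ']
    rw [hstep, Circuit.lin_append, ih, Circuit.lin_append, Circuit.lin_cons, Circuit.lin_cons,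
      Gate.lin_phaseZero, map_sub, map_smul, Circuit.lin_lin_reverse, ← Circuit.run_eq,
      ← braket_ket 0 (Circuit.lin V U.circ.reverse _), Circuit.braket_lin, ← Circuit.run_eq]
    set u := U.circ.run V with hu
    set P := U.below V y with hP
    set α := (ampCoef P j).1
    set β := (ampCoef P j).2
    set s : ℂ := (-1) ^ j with hs
    have hS : (Gate.phaseLt U.score y : Gate L U.R U.W).lin V (fun x => s *
        ((if x U.score < y then α else β : ℝ) : ℂ) * u x) =
        fun x => s * ((if x U.score < y then -α else β : ℝ) : ℂ) * u x := by
      funext x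
      change (if x U.score < y then -(s * ((if x U.score < y then α else β : ℝ) : ℂ) * u x)
        else s * ((if x U.score < y then α else β : ℝ) : ℂ) * u x) = _
      split_ifs <;> push_cast <;> ring
    rw [hS]
    have hB : braket u (fun x => s * ((if x U.score < y then -α else β : ℝ) : ℂ) * u x) =
        s * ((-α * P + β * (1 - P) : ℝ) : ℂ) := by
      rw [hP, Inner.below]
      convert braket_weighted (Circuit.norm_run V U.circ) (fun x => x U.score < y) s (-α) β
    rw [hB]
    funext x
    simp only [Pi.sub_apply, Pi.smul_apply, smul_eq_mul, ampCoef, pow_succ]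
    split_ifs <;> push_cast <;> ring

theorem Inner.normSq_run_amplify (U : Inner L) (V : Env L n) (y : BitVec U.W) (j : ℕ)
    (x : Config U.R U.W) :
    ‖(U.amplify y j).run V x‖ ^ 2 = (if x U.score < y then (ampCoef (U.below V y) j).1 ^ 2
        else (ampCoef (U.below V y) j).2 ^ 2) * ‖U.circ.run V x‖ ^ 2 := by
  rw [Inner.run_amplify]
  simp only [norm_mul, norm_pow, norm_neg, norm_one, one_pow, one_mul, Complex.norm_real,
    Real.norm_eq_abs, mul_pow, sq_abs]
  split_ifs <;> rfl

/-! ## Circuits that write into blank registers -/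

/-- The gate changes only registers with numbers in `[a, b)`, and it is not the reflection about
the zero state. -/
def Gate.Within (a b : ℕ) : Gate L R W → Prop
  | flip _ t _ => a ≤ t.val ∧ t.val < b
  | had _ t _ => a ≤ t.val ∧ t.val < b
  | phaseZero => False
  | _ => True

/-- The circuit changes only registers with numbers in `[a, b)`. -/
def Circuit.Within (a b : ℕ) (C : Circuit L R W) : Prop := ∀ g ∈ C, g.Within a b

theorem Gate.Within.mono {a b a' b' : ℕ} {g : Gate L R W} (h : g.Within a b) (ha : a' ≤ a)
    (hb : b ≤ b') : g.Within a' b' := by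
  cases g <;> simp only [Gate.Within] at h ⊢ <;> omega

/-- The configurations agree outside of the registers `[a, b)`. -/
def AgreeOff (a b : ℕ) (x y : Config R W) : Prop :=
  ∀ i : Fin R, i.val < a ∨ b ≤ i.val → y i = x i

theorem AgreeOff.update {a b : ℕ} {x y : Config R W} {t : Fin R} {v : BitVec W}
    (ha : a ≤ t.val) (hb : t.val < b) : AgreeOff a b x (Function.update y t v) ↔
      AgreeOff a b x y := by
  have key : ∀ i : Fin R, i.val < a ∨ b ≤ i.val → i ≠ t := by
    rintro i hi rfl; omega
  constructor
  · intro h i hi; rw [← h i hi, Function.update_of_ne (key i hi)]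
  · intro h i hi; rw [← h i hi, Function.update_of_ne (key i hi)]

theorem Gate.lin_support (V : Env L n) {a b : ℕ} {g : Gate L R W} (hg : g.Within a b)
    {x : Config R W} {ψ : Config R W → ℂ} (hψ : ∀ y, ψ y ≠ 0 → AgreeOff a b x y)
    (y : Config R W) (hy : g.lin V ψ y ≠ 0) : AgreeOff a b x y := by
  change g.apply V ψ y ≠ 0 at hy
  cases g with
  | flip c t e =>
    have h := hψ _ hy
    rw [flipMap] at h
    split_ifs at h
    · rwa [xorAt, AgreeOff.update hg.1 hg.2] at h
    · exact h
  | had c t i =>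
    by_contra hc
    have h1 : ψ y = 0 := by by_contra h; exact hc (hψ y h)
    have h2 : ψ (xorAt y t (BitVec.twoPow W i)) = 0 := by
      by_contra h; have := hψ _ h; rw [xorAt, AgreeOff.update hg.1 hg.2] at this; exact hc this
    simp [Gate.apply, h1, h2] at hy
  | phase c => refine hψ y fun h => hy ?_; simp [Gate.apply, h]
  | phaseLt c v => refine hψ y fun h => hy ?_; simp [Gate.apply, h]
  | phaseZero => refine hψ y fun h => hy ?_; simp [Gate.apply, h]

theorem Circuit.lin_support (V : Env L n) {a b : ℕ} {C : Circuit L R W} (hC : C.Within a b)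
    {x : Config R W} {ψ : Config R W → ℂ} (hψ : ∀ y, ψ y ≠ 0 → AgreeOff a b x y)
    (y : Config R W) (hy : Circuit.lin V C ψ y ≠ 0) : AgreeOff a b x y := by
  induction C generalizing ψ with
  | nil => exact hψ y hy
  | cons g C ih =>
    exact ih (fun g' hg' => hC g' (List.mem_cons_of_mem _ hg'))
      (Gate.lin_support V (hC g List.mem_cons_self) hψ) hy

theorem Circuit.lin_ket_support (V : Env L n) {a b : ℕ} {C : Circuit L R W} (hC : C.Within a b)
    {x y : Config R W} (hy : Circuit.lin V C (ket x) y ≠ 0) : AgreeOff a b x y := by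
  refine Circuit.lin_support V hC (fun z hz => ?_) y hy
  rw [ket_apply] at hz
  have : z = x := by by_contra h; simp [h] at hz
  subst this; exact fun _ _ => rfl

/-- All registers from number `a` on are blank. -/
def Blank (a : ℕ) (x : Config R W) : Prop := ∀ i : Fin R, a ≤ i.val → x i = 0

/-- When a circuit writes into blank registers, the probabilities (not only the amplitudes) of its
runs on the basis states of a superposition add up. -/
theorem Circuit.normSq_lin_of_blank (V : Env L n) {a b : ℕ} {C : Circuit L R W}
    (hC : C.Within a b) {ψ : Config R W → ℂ} (hψ : ∀ y, ψ y ≠ 0 → Blank a y) (y : Config R W) :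
    ‖Circuit.lin V C ψ y‖ ^ 2 = ∑ z, ‖ψ z‖ ^ 2 * ‖Circuit.lin V C (ket z) y‖ ^ 2 := by
  -- Registers outside `[a, b)` are left alone and those from `a` on start blank. So the final
  -- configuration `y` determines the initial one: only `y₀` contributes to the amplitude at `y`,
  -- and there is nothing to interfere with.
  set y₀ : Config R W := fun i => if i.val < a then y i else 0
  have key : ∀ z, z ≠ y₀ → ψ z = 0 ∨ Circuit.lin V C (ket z) y = 0 := by
    intro z hz
    by_contra! h
    apply hz
    funext i
    have h1 := hψ z h.1
    have h2 := Circuit.lin_ket_support V hC h.2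
    by_cases hi : i.val < a
    · simp only [y₀, hi, if_true]; exact (h2 i (Or.inl hi)).symm
    · simp only [y₀, hi, if_false]; exact h1 i (by omega)
  have e1 : Circuit.lin V C ψ y = ψ y₀ * Circuit.lin V C (ket y₀) y := by
    conv_lhs => rw [← sum_smul_ket ψ, map_sum, Finset.sum_apply]
    rw [Finset.sum_eq_single y₀]
    · simp
    · intro z _ hz; rcases key z hz with h | h <;> simp [h]
    · simp
  rw [e1, Finset.sum_eq_single y₀, norm_mul, mul_pow]
  · intro z _ hz; rcases key z hz with h | h <;> simp [h]
  · simp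

open Classical in
/-- The probability that a measurement of `ψ` gives a configuration without property `S`. -/
noncomputable def missProb (ψ : Config R W → ℂ) (S : Config R W → Prop) : ℝ :=
  ∑ y, if S y then 0 else ‖ψ y‖ ^ 2

theorem missProb_nonneg (ψ : Config R W → ℂ) (S : Config R W → Prop) : 0 ≤ missProb ψ S :=
  Finset.sum_nonneg fun y _ => by split_ifs <;> positivity

theorem missProb_mono {ψ : Config R W → ℂ} {S S' : Config R W → Prop}
    (h : ∀ y, ψ y ≠ 0 → S y → S' y) : missProb ψ S' ≤ missProb ψ S := by
  refine Finset.sum_le_sum fun y _ => ?_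
  by_cases hy : ψ y = 0
  · simp [hy]
  · split_ifs with h1 h2
    · rfl
    · positivity
    · exact absurd (h y hy ‹_›) h1
    · rfl

theorem missProb_le_norm (ψ : Config R W → ℂ) (S : Config R W → Prop) :
    missProb ψ S ≤ ∑ y, ‖ψ y‖ ^ 2 :=
  Finset.sum_le_sum fun y _ => by split_ifs <;> [positivity; rfl]

theorem missProb_lin_ket_le_one (V : Env L n) (C : Circuit L R W) (x : Config R W)
    (S : Config R W → Prop) : missProb (Circuit.lin V C (ket x)) S ≤ 1 := by
  refine (missProb_le_norm _ _).trans_eq ?_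
  rw [Circuit.norm_lin, norm_ket]

theorem missProb_eq_zero {ψ : Config R W → ℂ} {S : Config R W → Prop} :
    missProb ψ S = 0 ↔ ∀ y, ψ y ≠ 0 → S y := by
  classical
  rw [missProb, Finset.sum_eq_zero_iff_of_nonneg fun y _ => by split_ifs <;> positivity]
  refine forall_congr' fun y => ?_
  by_cases h : S y <;> simp [h]

theorem missProb_lin_of_blank (V : Env L n) {a b : ℕ} {C : Circuit L R W}
    (hC : C.Within a b) {ψ : Config R W → ℂ} (hψ : ∀ y, ψ y ≠ 0 → Blank a y)
    (S : Config R W → Prop) :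
    missProb (Circuit.lin V C ψ) S = ∑ z, ‖ψ z‖ ^ 2 * missProb (Circuit.lin V C (ket z)) S := by
  classical
  simp only [missProb, Finset.mul_sum]
  rw [Finset.sum_comm]
  refine Finset.sum_congr rfl fun y _ => ?_
  split_ifs
  · simp
  · exact Circuit.normSq_lin_of_blank V hC hψ y

/-- If the first part of a computation misses `Q` with probability at most `δ`, and the second part
misses `S` with probability at most `δ₁` from `Q`, and at most `δ₂` in any case, then the whole
computation misses `S` with probability at most `δ₁ + δ * δ₂`. -/
theorem missProb_lin_le (V : Env L n) {a b : ℕ} {C : Circuit L R W}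
    (hC : C.Within a b) {ψ : Config R W → ℂ} (hψ : ∀ y, ψ y ≠ 0 → Blank a y)
    (hnorm : ∑ y, ‖ψ y‖ ^ 2 = 1)
    {Q S : Config R W → Prop} {δ δ₁ δ₂ : ℝ} (h : missProb ψ Q ≤ δ) (hδ₁ : 0 ≤ δ₁) (hδ₂ : 0 ≤ δ₂)
    (h₁ : ∀ z, ψ z ≠ 0 → Q z → missProb (Circuit.lin V C (ket z)) S ≤ δ₁)
    (h₂ : ∀ z, ψ z ≠ 0 → ¬ Q z → missProb (Circuit.lin V C (ket z)) S ≤ δ₂) :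
    missProb (Circuit.lin V C ψ) S ≤ δ₁ + δ * δ₂ := by
  classical
  rw [missProb_lin_of_blank V hC hψ]
  calc ∑ z, ‖ψ z‖ ^ 2 * missProb (Circuit.lin V C (ket z)) S
      ≤ ∑ z, (‖ψ z‖ ^ 2 * δ₁ + (if Q z then 0 else ‖ψ z‖ ^ 2) * δ₂) := by
        refine Finset.sum_le_sum fun z _ => ?_
        by_cases hz : ψ z = 0
        · simp [hz]
        by_cases hq : Q z
        · simp only [hq, if_true, zero_mul, add_zero]
          exact mul_le_mul_of_nonneg_left (h₁ z hz hq) (by positivity)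
        · simp only [hq, if_false]
          have := mul_le_mul_of_nonneg_left (h₂ z hz hq) (by positivity : 0 ≤ ‖ψ z‖ ^ 2)
          nlinarith [mul_nonneg (by positivity : 0 ≤ ‖ψ z‖ ^ 2) hδ₁]
    _ = δ₁ + missProb ψ Q * δ₂ := by
        rw [Finset.sum_add_distrib, ← Finset.sum_mul, ← Finset.sum_mul, hnorm, one_mul, missProb]
    _ ≤ δ₁ + δ * δ₂ := by gcongr

end CTF

namespace CTF

variable {L n R W : ℕ}

/-! ## Programs over blank registers -/

/-- A program that is compiled to a circuit once the number `a` of its first blank register is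
known. It changes the registers from `a` up to `nxt a` only. -/
structure Bld (L R W : ℕ) (α : Type) where
  circ : ℕ → Circuit L R W
  out : ℕ → α
  nxt : ℕ → ℕ
  le_nxt : ∀ a, a ≤ nxt a
  within : ∀ a, nxt a ≤ R → (circ a).Within a (nxt a)

variable {α β ι : Type}

def Bld.ret (r : α) : Bld L R W α where
  circ _ := []
  out _ := r
  nxt a := a
  le_nxt _ := le_rfl
  within _ _ := fun _ h => absurd h List.not_mem_nil

def Bld.andThen (m : Bld L R W α) (k : α → Bld L R W β) : Bld L R W β where
  circ a := m.circ a ++ (k (m.out a)).circ (m.nxt a)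
  out a := (k (m.out a)).out (m.nxt a)
  nxt a := (k (m.out a)).nxt (m.nxt a)
  le_nxt a := (m.le_nxt a).trans ((k (m.out a)).le_nxt _)
  within a h g hg := by
    rcases List.mem_append.mp hg with hg | hg
    · exact (m.within a (((k (m.out a)).le_nxt _).trans h) g hg).mono le_rfl
        ((k (m.out a)).le_nxt _)
    · exact ((k (m.out a)).within _ h g hg).mono (m.le_nxt a) le_rfl

instance : Monad (Bld L R W) where
  pure := Bld.ret
  bind := Bld.andThen

/-- A configuration with the number of its first blank register. -/
structure World (R W : ℕ) where
  ptr : ℕ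
  cfg : Config R W

/-- `w ≤ w'` if `w'` results from `w` by writing into blank registers. -/
instance : Preorder (World R W) where
  le w w' := w.ptr ≤ w'.ptr ∧ ∀ i : Fin R, i.val < w.ptr → w'.cfg i = w.cfg i
  le_refl _ := ⟨le_rfl, fun _ _ => rfl⟩
  le_trans _ _ _ h h' := ⟨h.1.trans h'.1, fun i hi =>
    (h'.2 i (lt_of_lt_of_le hi h.1)).trans (h.2 i hi)⟩

/-- Run in the world `w`, the program reaches a world with property `Q`, except with probability
at most `δ`. -/
def Runs (V : Env L n) (m : Bld L R W α) (w : World R W) (Q : α → World R W → Prop) (δ : ℝ) :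
    Prop :=
  Blank w.ptr w.cfg → m.nxt w.ptr ≤ R →
    missProb (Circuit.lin V (m.circ w.ptr) (ket w.cfg))
      (fun y => Q (m.out w.ptr) ⟨m.nxt w.ptr, y⟩) ≤ δ

/-- Run in the world `w`, the program acts as a classical computation that reaches a world with
property `Q`. -/
def RunsD (V : Env L n) (m : Bld L R W α) (w : World R W) (Q : α → World R W → Prop) : Prop :=
  Blank w.ptr w.cfg → m.nxt w.ptr ≤ R →
    ∃ y, Circuit.lin V (m.circ w.ptr) (ket w.cfg) = ket y ∧ Q (m.out w.ptr) ⟨m.nxt w.ptr, y⟩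

theorem Bld.le_of_lin_ne_zero {V : Env L n} (m : Bld L R W α) {w : World R W}
    (hR : m.nxt w.ptr ≤ R) {y : Config R W}
    (hy : Circuit.lin V (m.circ w.ptr) (ket w.cfg) y ≠ 0) : w ≤ ⟨m.nxt w.ptr, y⟩ :=
  ⟨m.le_nxt _, fun i hi => Circuit.lin_ket_support V (m.within _ hR) hy i (Or.inl hi)⟩

theorem Bld.blank_of_lin_ne_zero {V : Env L n} (m : Bld L R W α) {w : World R W}
    (hw : Blank w.ptr w.cfg) (hR : m.nxt w.ptr ≤ R) {y : Config R W}
    (hy : Circuit.lin V (m.circ w.ptr) (ket w.cfg) y ≠ 0) : Blank (m.nxt w.ptr) y := by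
  intro i hi
  rw [Circuit.lin_ket_support V (m.within _ hR) hy i (Or.inr hi)]
  exact hw i ((m.le_nxt _).trans hi)

theorem Runs.imp {V : Env L n} {m : Bld L R W α} {w : World R W} {Q Q' : α → World R W → Prop}
    {δ δ' : ℝ} (h : Runs V m w Q δ) (hQ : ∀ r w', w ≤ w' → Q r w' → Q' r w') (hδ : δ ≤ δ') :
    Runs V m w Q' δ' := fun hw hR =>
  (missProb_mono fun _ hy => hQ _ _ (m.le_of_lin_ne_zero hR hy)).trans ((h hw hR).trans hδ)

theorem RunsD.imp {V : Env L n} {m : Bld L R W α} {w : World R W} {Q Q' : α → World R W → Prop}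
    (h : RunsD V m w Q) (hQ : ∀ r w', w ≤ w' → Q r w' → Q' r w') : RunsD V m w Q' := by
  intro hw hR
  obtain ⟨y, hy, hq⟩ := h hw hR
  refine ⟨y, hy, hQ _ _ (m.le_of_lin_ne_zero (V := V) hR ?_) hq⟩
  rw [hy, ket_apply]; simp

theorem RunsD.runs {V : Env L n} {m : Bld L R W α} {w : World R W} {Q : α → World R W → Prop}
    (h : RunsD V m w Q) : Runs V m w Q 0 := by
  intro hw hR
  obtain ⟨y, hy, hq⟩ := h hw hR
  rw [hy]
  refine (missProb_eq_zero.mpr fun z hz => ?_).le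
  rw [ket_apply] at hz
  have : z = y := by by_contra h; simp [h] at hz
  rwa [this]

theorem Runs.one (V : Env L n) (m : Bld L R W α) (w : World R W) (Q : α → World R W → Prop) :
    Runs V m w Q 1 := fun _ _ => missProb_lin_ket_le_one _ _ _ _

theorem RunsD.pure {V : Env L n} {r : α} {w : World R W} {Q : α → World R W → Prop} (h : Q r w) :
    RunsD V (Pure.pure r : Bld L R W α) w Q := fun _ _ => ⟨w.cfg, rfl, h⟩

theorem Runs.pure {V : Env L n} {r : α} {w : World R W} {Q : α → World R W → Prop} (h : Q r w) :
    Runs V (Pure.pure r : Bld L R W α) w Q 0 := (RunsD.pure h).runs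

theorem RunsD.bind {V : Env L n} {m : Bld L R W α} {k : α → Bld L R W β} {w : World R W}
    {Q : α → World R W → Prop} {S : β → World R W → Prop} (h : RunsD V m w Q)
    (hk : ∀ r w', w ≤ w' → Q r w' → RunsD V (k r) w' S) : RunsD V (m >>= k) w S := by
  intro hw hR
  have hR' : m.nxt w.ptr ≤ R := ((k (m.out w.ptr)).le_nxt _).trans hR
  obtain ⟨y, hy, hq⟩ := h hw hR'
  have hne : Circuit.lin V (m.circ w.ptr) (ket w.cfg) y ≠ 0 := by rw [hy, ket_apply]; simp
  obtain ⟨z, hz, hs⟩ := hk _ _ (m.le_of_lin_ne_zero hR' hne) hq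
    (m.blank_of_lin_ne_zero hw hR' hne) hR
  refine ⟨z, ?_, hs⟩
  change Circuit.lin V (m.circ w.ptr ++ (k (m.out w.ptr)).circ (m.nxt w.ptr)) _ = _
  rw [Circuit.lin_append, hy]
  exact hz

/-- Sequencing, where the second part succeeds more often from `Q₁` than from `Q₂`. -/
theorem Runs.bind₂ {V : Env L n} {m : Bld L R W α} {k : α → Bld L R W β} {w : World R W}
    {Q₁ Q₂ : α → World R W → Prop} {S : β → World R W → Prop} {δ δ₁ δ₂ : ℝ}
    (h₁ : Runs V m w Q₁ δ) (h₂ : Runs V m w Q₂ 0) (hδ₁ : 0 ≤ δ₁) (hδ₂ : 0 ≤ δ₂)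
    (hk₁ : ∀ r w', w ≤ w' → Q₁ r w' → Runs V (k r) w' S δ₁)
    (hk₂ : ∀ r w', w ≤ w' → Q₂ r w' → Runs V (k r) w' S δ₂) :
    Runs V (m >>= k) w S (δ₁ + δ * δ₂) := by
  intro hw hR
  have hR' : m.nxt w.ptr ≤ R := ((k (m.out w.ptr)).le_nxt _).trans hR
  change missProb (Circuit.lin V (m.circ w.ptr ++ (k (m.out w.ptr)).circ (m.nxt w.ptr)) _) _ ≤ _
  rw [Circuit.lin_append]
  -- The first part ends with blank registers from `m.nxt` on, and the second part writes only
  -- there. This makes the intermediate configuration behave like a classical random variable.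
  refine missProb_lin_le V ((k (m.out w.ptr)).within _ hR)
    (fun y hy => m.blank_of_lin_ne_zero hw hR' hy) ?_ (h₁ hw hR') hδ₁ hδ₂ ?_ ?_
  · rw [Circuit.norm_lin, norm_ket]
  · intro z hz hq
    exact hk₁ _ ⟨m.nxt w.ptr, z⟩ (m.le_of_lin_ne_zero hR' hz) hq
      (m.blank_of_lin_ne_zero hw hR' hz) hR
  · intro z hz _
    have h0 := missProb_eq_zero.mp (le_antisymm (h₂ hw hR') (missProb_nonneg _ _)) z hz
    exact hk₂ _ ⟨m.nxt w.ptr, z⟩ (m.le_of_lin_ne_zero hR' hz) h0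
      (m.blank_of_lin_ne_zero hw hR' hz) hR

/-- The union bound: after a failure of the first part the second one is charged with probability
one. -/
theorem Runs.bind {V : Env L n} {m : Bld L R W α} {k : α → Bld L R W β} {w : World R W}
    {Q : α → World R W → Prop} {S : β → World R W → Prop} {δ δ' : ℝ}
    (h : Runs V m w Q δ) (hδ' : 0 ≤ δ')
    (hk : ∀ r w', w ≤ w' → Q r w' → Runs V (k r) w' S δ') :
    Runs V (m >>= k) w S (δ + δ') := by
  refine (Runs.bind₂ h (Q₂ := fun _ _ => True) ?_ hδ' zero_le_one hk
    fun r w' _ _ => Runs.one V _ _ _).imp (fun _ _ _ h => h) (by linarith)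
  intro _ _
  exact (missProb_eq_zero.mpr fun _ _ => trivial).le

/-- Sequencing after a classical computation. -/
theorem RunsD.bindRuns {V : Env L n} {m : Bld L R W α} {k : α → Bld L R W β} {w : World R W}
    {Q : α → World R W → Prop} {S : β → World R W → Prop} {δ : ℝ}
    (h : RunsD V m w Q) (hδ : 0 ≤ δ)
    (hk : ∀ r w', w ≤ w' → Q r w' → Runs V (k r) w' S δ) : Runs V (m >>= k) w S δ := by
  simpa using h.runs.bind hδ hk

/-- A loop with the invariant `I`, whose argument is the list of the items still to come. -/
theorem Runs.foldlM {V : Env L n} {f : β → ι → Bld L R W β} {w₀ : World R W} {δ : ℝ} (hδ : 0 ≤ δ)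
    (I : List ι → β → World R W → Prop)
    (step : ∀ i rest b w, w₀ ≤ w → I (i :: rest) b w → Runs V (f b i) w (I rest) δ)
    (l : List ι) (b : β) (w : World R W) (hw : w₀ ≤ w) (h : I l b w) :
    Runs V (l.foldlM f b) w (I []) (l.length * δ) := by
  induction l generalizing b w with
  | nil => simpa using Runs.pure h
  | cons i l ih =>
    rw [List.foldlM_cons]
    refine ((step i l b w hw h).bind (by positivity)
      fun r w' hw' hr => ih r w' (hw.trans hw') hr).imp (fun _ _ _ h => h) ?_
    push_cast [List.length_cons]
    linarith

theorem RunsD.foldlM {V : Env L n} {f : β → ι → Bld L R W β} {w₀ : World R W}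
    (I : List ι → β → World R W → Prop)
    (step : ∀ i rest b w, w₀ ≤ w → I (i :: rest) b w → RunsD V (f b i) w (I rest))
    (l : List ι) (b : β) (w : World R W) (hw : w₀ ≤ w) (h : I l b w) :
    RunsD V (l.foldlM f b) w (I []) := by
  induction l generalizing b w with
  | nil => exact RunsD.pure h
  | cons i l ih =>
    rw [List.foldlM_cons]
    exact (step i l b w hw h).bind fun r w' hw' hr => ih r w' (hw.trans hw') hr

/-! ## The length of a program -/

/-- The program has at most `N` gates and uses at most `N` registers. -/
def Bld.Len (m : Bld L R W α) (N : ℕ) : Prop :=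
  ∀ a, (m.circ a).length ≤ N ∧ m.nxt a ≤ a + N

theorem Bld.Len.mono {m : Bld L R W α} {N N' : ℕ} (h : m.Len N) (hN : N ≤ N') : m.Len N' :=
  fun a => ⟨(h a).1.trans hN, (h a).2.trans (by omega)⟩

theorem Bld.len_pure (r : α) : (Pure.pure r : Bld L R W α).Len 0 := fun _ => ⟨le_rfl, le_rfl⟩

theorem Bld.Len.bind {m : Bld L R W α} {k : α → Bld L R W β} {N N' : ℕ} (h : m.Len N)
    (hk : ∀ r, (k r).Len N') : (m >>= k).Len (N + N') := by
  intro a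
  have h1 := h a
  have h2 := hk (m.out a) (m.nxt a)
  constructor
  · change (m.circ a ++ (k (m.out a)).circ (m.nxt a)).length ≤ _
    rw [List.length_append]; omega
  · change (k (m.out a)).nxt (m.nxt a) ≤ _
    omega

theorem Bld.len_foldlM {f : β → ι → Bld L R W β} {N : ℕ} (l : List ι)
    (h : ∀ b, ∀ i ∈ l, (f b i).Len N) (b : β) : (l.foldlM f b).Len (l.length * N) := by
  induction l generalizing b with
  | nil => simpa using Bld.len_pure b
  | cons i l ih =>
    rw [List.foldlM_cons]
    refine ((h b i List.mem_cons_self).bind fun r =>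
      ih (fun b i hi => h b i (List.mem_cons_of_mem _ hi)) r).mono ?_
    rw [List.length_cons]; ring_nf; rfl

/-! ## Computing expressions -/

variable [NeZero R]

/-- Register number `i`. -/
def rg (i : ℕ) : Fin R := Fin.ofNat R i

/-- Registers are numbered modulo `R`. This bound holds for every `i`, so that `Has.mono` needs no
assumption that the pointer is at most `R`. -/
theorem rg_val_le (i : ℕ) : (rg i : Fin R).val ≤ i := Nat.mod_le _ _

theorem rg_val {i : ℕ} (h : i < R) : (rg i : Fin R).val = i := Nat.mod_eq_of_lt h

/-- Register `r` holds the number `v`. -/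
def Has (w : World R W) (r v : ℕ) : Prop := r < w.ptr ∧ w.cfg (rg r) = BitVec.ofNat W v

theorem Has.mono {w w' : World R W} {r v : ℕ} (h : Has w r v) (hw : w ≤ w') : Has w' r v :=
  ⟨h.1.trans_le hw.1, (hw.2 _ ((rg_val_le r).trans_lt h.1)).trans h.2⟩

/-- Write the value of `e` into a new register. -/
def op (e : Expr L R W) : Bld L R W ℕ where
  circ a := [Gate.flip none (rg a) e]
  out a := a
  nxt a := a + 1
  le_nxt a := Nat.le_succ a
  within a h g hg := by
    rw [List.mem_singleton] at hg
    subst hg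
    rw [Gate.Within, rg_val (by omega)]
    omega

theorem len_op (e : Expr L R W) : (op e).Len 1 := fun _ => ⟨le_rfl, le_rfl⟩

theorem runsD_op {V : Env L n} {e : Expr L R W} {w : World R W} {v : ℕ}
    (h : e.eval V w.cfg = BitVec.ofNat W v) : RunsD V (op e) w fun r w' => Has w' r v := by
  intro hw hR
  have ha : w.ptr < R := hR
  have hz : w.cfg (rg w.ptr) = 0 := hw _ (rg_val ha).ge
  have hu : Function.update w.cfg (rg w.ptr) 0 = w.cfg := by
    rw [← hz, Function.update_eq_self]
  refine ⟨flipMap V none (rg w.ptr) e w.cfg, ?_, Nat.lt_succ_self _, ?_⟩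
  · funext y
    change ket w.cfg (flipMap V none (rg w.ptr) e y) = _
    rw [ket_apply, ket_apply]
    refine if_congr ?_ rfl rfl
    constructor
    · intro h; rw [← h, flipMap_invol]
    · intro h; rw [h, flipMap_invol]
  · change flipMap V none (rg w.ptr) e w.cfg (rg w.ptr) = _
    simp only [flipMap, ctrlOn, xorAt, hu, hz, h]
    exact (Function.update_self _ _ _).trans BitVec.zero_xor

/-- Arithmetic expressions in the contents of registers. -/
inductive Ex
  | reg (r : ℕ)
  | num (v : ℕ)
  | bin (o : BinOp) (a b : Ex)

instance : Add Ex := ⟨Ex.bin .add⟩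
instance : Mul Ex := ⟨Ex.bin .mul⟩

/-- `1` if the value of `a` is less than that of `b`, `0` otherwise. -/
def Ex.lt (a b : Ex) : Ex := .bin .lt a b

/-- `1` if the values of `a` and `b` are equal, `0` otherwise. -/
def Ex.eq (a b : Ex) : Ex := .bin .eq a b

/-- The number of nodes of an expression. -/
def Ex.size : Ex → ℕ
  | reg _ => 0
  | num _ => 1
  | bin _ a b => a.size + b.size + 1

theorem Ex.size_reg (r : ℕ) : (Ex.reg r).size = 0 := rfl
theorem Ex.size_num (v : ℕ) : (Ex.num v).size = 1 := rfl
theorem Ex.size_add (a b : Ex) : (a + b).size = a.size + b.size + 1 := rfl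
theorem Ex.size_mul (a b : Ex) : (a * b).size = a.size + b.size + 1 := rfl
theorem Ex.size_eq (a b : Ex) : (Ex.eq a b).size = a.size + b.size + 1 := rfl
theorem Ex.size_lt (a b : Ex) : (Ex.lt a b).size = a.size + b.size + 1 := rfl

/-- The program that computes an expression. -/
def comp : Ex → Bld L R W ℕ
  | .reg r => pure r
  | .num v => op (.const (BitVec.ofNat W v))
  | .bin o a b => do
      let r ← comp a
      let s ← comp b
      op (.bin o (rg r) (rg s))

theorem len_comp (e : Ex) : (comp e : Bld L R W ℕ).Len e.size := by
  induction e with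
  | reg r => exact Bld.len_pure r
  | num v => exact len_op _
  | bin o a b iha ihb =>
    exact (iha.bind fun r => ihb.bind fun s => len_op _).mono (by rw [Ex.size]; omega)

theorem len_comp_le {e : Ex} {N : ℕ} (h : e.size ≤ N) : (comp e : Bld L R W ℕ).Len N :=
  (len_comp e).mono h

/-- In the world `w`, the expression has the value `v`. -/
inductive Ev (w : World R W) : Ex → ℕ → Prop
  | reg {r v : ℕ} : Has w r v → Ev w (.reg r) v
  | num (v : ℕ) : Ev w (.num v) v
  | add {a b : Ex} {u v : ℕ} : Ev w a u → Ev w b v → Ev w (a + b) (u + v)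
  | mul {a b : Ex} {u v : ℕ} : Ev w a u → Ev w b v → Ev w (a * b) (u * v)
  | lt {a b : Ex} {u v : ℕ} : Ev w a u → Ev w b v → u < 2 ^ W → v < 2 ^ W →
      Ev w (Ex.lt a b) (if u < v then 1 else 0)
  | eq {a b : Ex} {u v : ℕ} : Ev w a u → Ev w b v → u < 2 ^ W → v < 2 ^ W →
      Ev w (Ex.eq a b) (if u = v then 1 else 0)

theorem Ev.mono {w w' : World R W} {e : Ex} {v : ℕ} (h : Ev w e v) (hw : w ≤ w') : Ev w' e v := by
  induction h with
  | reg h => exact .reg (h.mono hw)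
  | num v => exact .num v
  | add _ _ h1 h2 => exact .add h1 h2
  | mul _ _ h1 h2 => exact .mul h1 h2
  | lt _ _ hu hv h1 h2 => exact .lt h1 h2 hu hv
  | eq _ _ hu hv h1 h2 => exact .eq h1 h2 hu hv

theorem ofNat_lt_ofNat {u v : ℕ} (hu : u < 2 ^ W) (hv : v < 2 ^ W) :
    BitVec.ofNat W u < BitVec.ofNat W v ↔ u < v := by
  rw [BitVec.lt_def, BitVec.toNat_ofNat, BitVec.toNat_ofNat, Nat.mod_eq_of_lt hu,
    Nat.mod_eq_of_lt hv]

theorem ofNat_inj {u v : ℕ} (hu : u < 2 ^ W) (hv : v < 2 ^ W) :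
    BitVec.ofNat W u = BitVec.ofNat W v ↔ u = v := by
  rw [← BitVec.toNat_inj, BitVec.toNat_ofNat, BitVec.toNat_ofNat, Nat.mod_eq_of_lt hu,
    Nat.mod_eq_of_lt hv]

theorem runsD_bin {V : Env L n} {w : World R W} {o : BinOp} {a b : Ex} {u v z : ℕ}
    (ha : ∀ w', w ≤ w' → RunsD V (comp a) w' fun r w' => Has w' r u)
    (hb : ∀ w', w ≤ w' → RunsD V (comp b) w' fun r w' => Has w' r v)
    (h : o.eval (BitVec.ofNat W u) (BitVec.ofNat W v) = BitVec.ofNat W z) :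
    RunsD V (comp (.bin o a b)) w fun r w' => Has w' r z := by
  refine (ha w le_rfl).bind fun r w₁ h₁ hr => (hb w₁ h₁).bind fun s w₂ h₂ hs => runsD_op ?_
  rw [Expr.eval, (hr.mono h₂).2, hs.2, h]

/-- Registers hold numbers modulo `2 ^ W`, a quotient that addition and multiplication respect. Only
comparisons require that the values fit, hence the side conditions in `Ev.lt` and `Ev.eq` alone. -/
theorem runsD_comp {V : Env L n} {w : World R W} {e : Ex} {v : ℕ} (h : Ev w e v) :
    RunsD V (comp e) w fun r w' => Has w' r v := by
  -- The second operand is computed in a world in which the first has already been written, so the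
  -- induction must cover all later worlds.
  suffices ∀ w', w ≤ w' → RunsD V (comp e) w' fun r w' => Has w' r v from this w le_rfl
  induction h with
  | reg h => exact fun w' hw => RunsD.pure (h.mono hw)
  | num v => exact fun w' hw => runsD_op rfl
  | add _ _ h1 h2 =>
    intro w' hw
    refine runsD_bin (fun w'' h => h1 _ (hw.trans h)) (fun w'' h => h2 _ (hw.trans h)) ?_
    simp [BinOp.eval, BitVec.ofNat_add]
  | mul _ _ h1 h2 =>
    intro w' hw
    refine runsD_bin (fun w'' h => h1 _ (hw.trans h)) (fun w'' h => h2 _ (hw.trans h)) ?_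
    simp [BinOp.eval, BitVec.ofNat_mul]
  | lt _ _ hu hv h1 h2 =>
    intro w' hw
    refine runsD_bin (fun w'' h => h1 _ (hw.trans h)) (fun w'' h => h2 _ (hw.trans h)) ?_
    simp only [BinOp.eval, ofNat_lt_ofNat hu hv]
    split_ifs <;> rfl
  | eq _ _ hu hv h1 h2 =>
    intro w' hw
    refine runsD_bin (fun w'' h => h1 _ (hw.trans h)) (fun w'' h => h2 _ (hw.trans h)) ?_
    simp only [BinOp.eval, ofNat_inj hu hv]
    split_ifs <;> rfl

end CTF

namespace CTF

variable {L n R W : ℕ}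

/-! ## Uniform superpositions -/

/-- Hadamard gates on the lowest `k` qubits of a register. -/
def hadBits (k : ℕ) (t : Fin R) : Circuit L R W :=
  ((List.finRange W).take k).map (Gate.had none t)

theorem length_hadBits (k : ℕ) (t : Fin R) : (hadBits k t : Circuit L R W).length ≤ k := by
  rw [hadBits, List.length_map, List.length_take]
  exact min_le_left _ _

theorem within_hadBits {a : ℕ} (k : ℕ) {t : Fin R} (ht : t.val = a) :
    (hadBits k t : Circuit L R W).Within a (a + 1) := by
  intro g hg
  obtain ⟨i, _, rfl⟩ := List.mem_map.mp hg
  simp only [Gate.Within]; omega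

open Classical in
-- By distinctness of the list, each further gate meets a bit that is `0` throughout the current
-- support. It therefore doubles the support, and all amplitudes stay equal and positive.
theorem lin_hads (V : Env L n) {x : Config R W} {t : Fin R} (hx : x t = 0) (bs : List (Fin W))
    (hbs : bs.Nodup) : Circuit.lin V (bs.map (Gate.had none t)) (ket x) = fun y =>
      if Function.update y t 0 = x ∧ ∀ i : Fin W, (y t).getLsbD i → i ∈ bs
        then ((√2 : ℝ) : ℂ)⁻¹ ^ bs.length else 0 := by
  induction bs using List.reverseRecOn with
  | nil =>
    funext y
    simp only [List.map_nil, Circuit.lin_nil, ket_apply, List.length_nil, pow_zero,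
      List.not_mem_nil, imp_false]
    refine if_congr ⟨?_, ?_⟩ rfl rfl
    · rintro rfl
      exact ⟨by rw [← hx, Function.update_eq_self], fun i => by rw [hx]; simp⟩
    · rintro ⟨h1, h2⟩
      have : y t = 0 := by
        apply BitVec.eq_of_getLsbD_eq
        intro i hi
        simpa using h2 ⟨i, hi⟩
      rw [← h1, ← this, Function.update_eq_self]
  | append_singleton bs i ih =>
    rw [List.map_append, Circuit.lin_append, ih (List.nodup_append.mp hbs).1]
    have hi : i ∉ bs := fun h => (List.nodup_append.mp hbs).2.2 i h i (by simp) rfl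
    funext y
    have hup : Function.update (xorAt y t (BitVec.twoPow W i)) t 0 = Function.update y t 0 :=
      update_xorAt _ _ _
    have hbit : ∀ i' : Fin W, (xorAt y t (BitVec.twoPow W i) t).getLsbD i' =
        ((y t).getLsbD i' ^^ decide (i' = i)) := by
      intro i'
      simp only [xorAt, Function.update_self, BitVec.getLsbD_xor, BitVec.getLsbD_twoPow]
      simp [Fin.ext_iff, eq_comm]
    change ((if Function.update (xorAt y t (BitVec.twoPow W i)) t 0 = x ∧ _ then _ else _) +
      (if (y t).getLsbD i then -1 else 1) * (if _ then _ else _)) / ((√2 : ℝ) : ℂ) = _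
    rw [hup, List.length_append, List.length_singleton, pow_succ]
    simp only [hbit, List.mem_append, List.mem_singleton]
    by_cases h0 : Function.update y t 0 = x
    swap
    · simp only [h0, false_and, if_false, mul_zero, add_zero, zero_div]
    simp only [h0, true_and]
    -- Exactly one of `y` and its flip at bit `i` can lie in the old support: the flip if bit `i` of
    -- `y` is set, `y` itself otherwise.
    by_cases hb : (y t).getLsbD i
    · have e1 : ¬ ∀ i' : Fin W, (y t).getLsbD i' → i' ∈ bs := fun h => hi (h i hb)
      have e2 : (∀ i' : Fin W, ((y t).getLsbD i' ^^ decide (i' = i)) = true → i' ∈ bs) ↔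
          ∀ i' : Fin W, (y t).getLsbD i' = true → i' ∈ bs ∨ i' = i := by
        refine forall_congr' fun i' => ?_
        by_cases h : i' = i
        · subst h; simp [hb]
        · simp [h]
      rw [if_neg e1, if_congr e2 rfl rfl]
      split_ifs <;> simp [div_eq_mul_inv]
    · rw [Bool.not_eq_true] at hb
      have e1 : ¬ ∀ i' : Fin W, ((y t).getLsbD i' ^^ decide (i' = i)) = true → i' ∈ bs := by
        intro h; apply hi; apply h i; rw [hb]; simp
      have e2 : (∀ i' : Fin W, (y t).getLsbD i' = true → i' ∈ bs) ↔
          ∀ i' : Fin W, (y t).getLsbD i' = true → i' ∈ bs ∨ i' = i := by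
        refine forall_congr' fun i' => ?_
        by_cases h : i' = i
        · subst h; rw [hb]; simp
        · simp [h]
      rw [if_neg e1, if_congr e2 rfl rfl]
      simp only [hb, Bool.false_eq_true, if_false, zero_add, one_mul]
      split_ifs <;> simp [div_eq_mul_inv]

theorem toNat_lt_two_pow_iff {k : ℕ} (v : BitVec W) :
    v.toNat < 2 ^ k ↔ ∀ i : Fin W, v.getLsbD i → i.val < k := by
  constructor
  · intro h i hi
    by_contra hk
    rw [BitVec.getLsbD, Nat.testBit_lt_two_pow (h.trans_le (Nat.pow_le_pow_right (by norm_num)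
      (not_lt.mp hk)))] at hi
    exact absurd hi (by simp)
  · intro h
    apply Nat.lt_pow_two_of_testBit
    intro i hi
    by_contra hb
    rw [Bool.not_eq_false] at hb
    have hiW : i < W := BitVec.lt_of_getLsbD (x := v) hb
    exact absurd (h ⟨i, hiW⟩ hb) (by simp; omega)

/-- The configurations that the Hadamard gates on register `t` produce from `x`. -/
def Ranges (k : ℕ) (x : Config R W) (t : Fin R) (y : Config R W) : Prop :=
  Function.update y t 0 = x ∧ (y t).toNat < 2 ^ k

open Classical in
theorem lin_hadBits (V : Env L n) {x : Config R W} {t : Fin R} (hx : x t = 0) {k : ℕ}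
    (hk : k ≤ W) : Circuit.lin V (hadBits k t) (ket x) = fun y =>
      if Ranges k x t y then ((√2 : ℝ) : ℂ)⁻¹ ^ k else 0 := by
  rw [hadBits, lin_hads V hx _ ((List.nodup_finRange W).sublist (List.take_sublist _ _))]
  have hmem : ∀ i : Fin W, i ∈ (List.finRange W).take k ↔ i.val < k := by
    intro i
    rw [List.mem_take_iff_getElem]
    simp only [List.getElem_finRange, List.length_finRange]
    constructor
    · rintro ⟨j, hj, rfl⟩; simp; omega
    · intro h; exact ⟨i, by omega, rfl⟩
  funext y
  refine if_congr ?_ (by simp [min_eq_left hk]) rfl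
  simp only [Ranges, toNat_lt_two_pow_iff, hmem]

theorem normSq_inv_sqrt_two_pow (k : ℕ) : ‖((√2 : ℝ) : ℂ)⁻¹ ^ k‖ ^ 2 = (2 ^ k : ℝ)⁻¹ := by
  rw [norm_pow, norm_inv, Complex.norm_real, Real.norm_eq_abs, ← pow_mul, mul_comm, pow_mul,
    inv_pow, sq_abs, Real.sq_sqrt (by norm_num), inv_pow]

end CTF

namespace CTF

variable {L n R W : ℕ}

/-! ## Grover search -/

/-- One round of Grover's algorithm on the lowest `k` qubits of register `t`; the circuit `P`
computes in register `f` whether the number in register `t` is marked. -/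
def groverRound (k : ℕ) (t f : Fin R) (P : Circuit L R W) : Circuit L R W :=
  (P ++ Gate.phase f :: P.reverse) ++ ((hadBits k t).reverse ++ Gate.phase t :: hadBits k t)

theorem agreeOff_iff_update {x y : Config R W} {t : Fin R} (hx : x t = 0) :
    AgreeOff t.val (t.val + 1) x y ↔ Function.update y t 0 = x := by
  constructor
  · intro h
    funext i
    by_cases hi : i = t
    · subst hi; simp [hx]
    · rw [Function.update_of_ne hi]
      exact h i (by have : i.val ≠ t.val := fun h => hi (Fin.ext h); omega)
  · rintro rfl i hi
    rw [Function.update_of_ne]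
    rintro rfl; omega

theorem Gate.lin_phase_ket (V : Env L n) (c : Fin R) (z : Config R W) :
    (Gate.phase c : Gate L R W).lin V (ket z) = (if z c = 0 then (1 : ℂ) else -1) • ket z := by
  funext y
  change (if y c = 0 then ket z y else -ket z y) = (if z c = 0 then (1 : ℂ) else -1) * ket z y
  rw [ket_apply]
  by_cases h : y = z
  · subst h; split_ifs <;> simp
  · simp [h]

open Classical in
-- Compute, change the sign, uncompute. On the support `P` takes basis states to basis states, so
-- the reversed circuit restores them and only the sign is left; linearity does the rest.
theorem lin_oracle (V : Env L n) {k : ℕ} {x : Config R W} {t f : Fin R} {P : Circuit L R W}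
    {A : Config R W → Prop}
    (hP : ∀ z, Ranges k x t z → ∃ z', Circuit.lin V P (ket z) = ket z' ∧ (z' f = 0 ↔ ¬ A z))
    {φ : Config R W → ℂ} (hφ : ∀ y, φ y ≠ 0 → Ranges k x t y) :
    Circuit.lin V (P ++ Gate.phase f :: P.reverse) φ = fun y => (if A y then -1 else 1) * φ y := by
  have h1 : ∀ z, Ranges k x t z → Circuit.lin V (P ++ Gate.phase f :: P.reverse) (ket z) =
      (if A z then (-1 : ℂ) else 1) • ket z := by
    intro z hz
    obtain ⟨z', h1, h2⟩ := hP z hz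
    rw [Circuit.lin_append, Circuit.lin_cons, h1, Gate.lin_phase_ket, map_smul, ← h1,
      Circuit.lin_reverse_lin, if_congr h2 rfl rfl]
    split_ifs <;> rfl
  conv_lhs => rw [← sum_smul_ket φ, map_sum]
  conv_rhs => rw [← sum_smul_ket (fun y => (if A y then -1 else 1) * φ y)]
  refine Finset.sum_congr rfl fun z _ => ?_
  by_cases hz : φ z = 0
  · simp [hz]
  · rw [map_smul, h1 z (hφ z hz), smul_smul, mul_comm]

/-- Among the configurations that agree with `x` off register `t`, only `x` itself has that register
blank. There the gate `phase t` is `2|x⟩⟨x| - 1`, and conjugation by the Hadamard gates makes it the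
reflection about the uniform state. -/
theorem lin_diffuser (V : Env L n) {k : ℕ} {x : Config R W} {t : Fin R} (hx : x t = 0)
    {φ : Config R W → ℂ} (hφ : ∀ y, φ y ≠ 0 → Function.update y t 0 = x) :
    Circuit.lin V ((hadBits k t).reverse ++ Gate.phase t :: hadBits k t) φ =
      (2 * braket (Circuit.lin V (hadBits k t) (ket x)) φ) •
        Circuit.lin V (hadBits k t) (ket x) - φ := by
  have hw : Circuit.Within t.val (t.val + 1) (hadBits k t : Circuit L R W).reverse := fun g hg =>
    within_hadBits k rfl g (List.mem_reverse.mp hg)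
  set χ := Circuit.lin V (hadBits k t).reverse φ with hχ
  have hsupp : ∀ y, χ y ≠ 0 → Function.update y t 0 = x := fun y hy =>
    (agreeOff_iff_update hx).mp (Circuit.lin_support V hw
      (fun z hz => (agreeOff_iff_update hx).mpr (hφ z hz)) y hy)
  have hph : (Gate.phase t : Gate L R W).lin V χ = (2 * χ x) • ket x - χ := by
    funext y
    change (if y t = 0 then χ y else -χ y) = 2 * χ x * ket x y - χ y
    rw [ket_apply]
    by_cases h : y = x
    · subst h; simp only [hx, if_true]; ring
    · rw [if_neg h]
      by_cases hy : y t = 0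
      · have : χ y = 0 := by
          by_contra h'
          apply h
          have := hsupp y h'
          rwa [← hy, Function.update_eq_self] at this
        simp [this]
      · rw [if_neg hy]; ring
  rw [Circuit.lin_append, Circuit.lin_cons, ← hχ, hph, map_sub, map_smul, hχ,
    Circuit.lin_lin_reverse, ← Circuit.braket_lin, braket_ket]

open Classical in
-- The recursion of `Inner.run_amplify`, with the uniform state in place of `U|0⟩`. No sign `(-1) ^
-- j` appears, since `phase t` negates the nonzero values instead of zero.
theorem lin_groverRounds (V : Env L n) {k : ℕ} (hk : k ≤ W) {x : Config R W} {t f : Fin R}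
    (hx : x t = 0) {P : Circuit L R W} {A : Config R W → Prop}
    (hP : ∀ z, Ranges k x t z → ∃ z', Circuit.lin V P (ket z) = ket z' ∧ (z' f = 0 ↔ ¬ A z))
    {u : Config R W → ℂ} (hu : u = Circuit.lin V (hadBits k t) (ket x)) {p : ℝ}
    (hp : p = ∑ y, if A y then ‖u y‖ ^ 2 else 0) (j : ℕ) :
    Circuit.lin V (hadBits k t ++ (List.replicate j (groverRound k t f P)).flatten) (ket x) =
      fun y => ((if A y then (ampCoef p j).1 else (ampCoef p j).2 : ℝ) : ℂ) * u y := by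
  have hun : ∑ y, ‖u y‖ ^ 2 = 1 := by rw [hu, Circuit.norm_lin, norm_ket]
  have hus : ∀ y, u y ≠ 0 → Ranges k x t y := by
    intro y hy
    rw [hu, lin_hadBits V hx hk] at hy
    by_contra h
    exact hy (if_neg h)
  induction j with
  | zero =>
    funext y
    simp [ampCoef, hu]
  | succ j ih =>
    rw [List.replicate_succ', List.flatten_append, ← List.append_assoc, Circuit.lin_append, ih,
      List.flatten_singleton, groverRound, Circuit.lin_append, lin_oracle V hP, lin_diffuser V hx,
      ← hu]
    · have e : (fun y => (if A y then -1 else 1) *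
          (((if A y then (ampCoef p j).1 else (ampCoef p j).2 : ℝ) : ℂ) * u y)) =
          fun y => 1 * ((if A y then -(ampCoef p j).1 else (ampCoef p j).2 : ℝ) : ℂ) * u y := by
        funext y; split_ifs <;> push_cast <;> ring
      rw [e, braket_weighted hun, ← hp]
      funext y
      simp only [Pi.sub_apply, Pi.smul_apply, smul_eq_mul, ampCoef]
      split_ifs <;> push_cast <;> ring
    · intro y hy
      exact (hus y fun h => hy (by simp [h])).1
    · intro y hy
      exact hus y fun h => hy (by simp [h])

open Classical in
/-- The fraction of marked numbers. -/
noncomputable def markFrac (k : ℕ) (S : ℕ → Prop) : ℝ :=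
  ((Finset.range (2 ^ k)).filter S).card * (2 ^ k : ℝ)⁻¹

open Classical in
theorem sum_marked (V : Env L n) {k : ℕ} (hk : k ≤ W) {x : Config R W} {t : Fin R} (hx : x t = 0)
    (S : ℕ → Prop) :
    (∑ y, if S (y t).toNat then ‖Circuit.lin V (hadBits k t) (ket x) y‖ ^ 2 else 0) =
      markFrac k S := by
  have e : ∀ y : Config R W,
      (if S (y t).toNat then ‖Circuit.lin V (hadBits k t) (ket x) y‖ ^ 2 else 0) =
      if Ranges k x t y ∧ S (y t).toNat then (2 ^ k : ℝ)⁻¹ else 0 := by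
    intro y
    rw [lin_hadBits V hx hk, ← normSq_inv_sqrt_two_pow]
    beta_reduce
    by_cases h1 : S (y t).toNat <;>
      by_cases h2 : Ranges k x t y
    · rw [if_pos h1, if_pos h2, if_pos ⟨h2, h1⟩]
    · rw [if_pos h1, if_neg h2, if_neg fun h => h2 h.1]; simp
    · rw [if_neg h1, if_neg fun h => h1 h.2]
    · rw [if_neg h1, if_neg fun h => h1 h.2]
  simp only [e]
  rw [← Finset.sum_filter, Finset.sum_const, nsmul_eq_mul, markFrac]
  congr 2
  have hW : 2 ^ k ≤ 2 ^ W := Nat.pow_le_pow_right (by norm_num) hk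
  refine Finset.card_bij' (fun y _ => (y t).toNat)
    (fun i _ => Function.update x t (BitVec.ofNat W i)) ?_ ?_ ?_ ?_
  · intro y hy
    simp only [Finset.mem_filter, Finset.mem_univ, true_and, Finset.mem_range] at hy ⊢
    exact ⟨hy.1.2, hy.2⟩
  · intro i hi
    simp only [Finset.mem_filter, Finset.mem_univ, true_and, Finset.mem_range] at hi ⊢
    have : (BitVec.ofNat W i).toNat = i := by
      rw [BitVec.toNat_ofNat, Nat.mod_eq_of_lt (hi.1.trans_le hW)]
    refine ⟨⟨?_, ?_⟩, ?_⟩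
    · rw [Function.update_idem, ← hx, Function.update_eq_self]
    · rw [Function.update_self, this]; exact hi.1
    · rw [Function.update_self, this]; exact hi.2
  · intro y hy
    simp only [Finset.mem_filter, Finset.mem_univ, true_and] at hy
    rw [← hy.1.1, Function.update_idem, BitVec.ofNat_toNat, BitVec.setWidth_eq,
      Function.update_eq_self]
  · intro i hi
    simp only [Finset.mem_filter, Finset.mem_range] at hi
    rw [Function.update_self, BitVec.toNat_ofNat, Nat.mod_eq_of_lt (hi.1.trans_le hW)]

theorem markFrac_nonneg (k : ℕ) (S : ℕ → Prop) : 0 ≤ markFrac k S := by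
  rw [markFrac]; positivity

theorem markFrac_le_one (k : ℕ) (S : ℕ → Prop) : markFrac k S ≤ 1 := by
  classical
  rw [markFrac, ← div_eq_mul_inv, div_le_one (by positivity)]
  have := Finset.card_filter_le (Finset.range (2 ^ k)) S
  rw [Finset.card_range] at this
  exact_mod_cast this

theorem le_markFrac {k : ℕ} {S : ℕ → Prop} {i : ℕ} (hi : i < 2 ^ k) (h : S i) :
    (2 ^ k : ℝ)⁻¹ ≤ markFrac k S := by
  classical
  rw [markFrac]
  have : 1 ≤ ((Finset.range (2 ^ k)).filter S).card :=
    Finset.card_pos.mpr ⟨i, by simp [hi, h]⟩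
  have h1 : (1 : ℝ) ≤ ((Finset.range (2 ^ k)).filter S).card := by exact_mod_cast this
  nlinarith [show (0 : ℝ) < (2 ^ k : ℝ)⁻¹ by positivity]

/-- The probability that `j` rounds of Grover's algorithm end with an unmarked number. -/
noncomputable def groverMiss (k : ℕ) (S : ℕ → Prop) (j : ℕ) : ℝ :=
  (ampCoef (markFrac k S) j).2 ^ 2 * (1 - markFrac k S)

theorem groverMiss_nonneg (k : ℕ) (S : ℕ → Prop) (j : ℕ) : 0 ≤ groverMiss k S j :=
  mul_nonneg (sq_nonneg _) (by linarith [markFrac_le_one k S])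

theorem groverMiss_le_one (k : ℕ) (S : ℕ → Prop) (j : ℕ) : groverMiss k S j ≤ 1 := by
  have h := ampCoef_norm (markFrac_nonneg k S) (markFrac_le_one k S) j
  have := mul_nonneg (sq_nonneg (ampCoef (markFrac k S) j).1) (markFrac_nonneg k S)
  rw [groverMiss]; linarith

variable [NeZero R]

/-- Put a number into a new register by `j` rounds of Grover's algorithm, and check it. -/
def sample (k : ℕ) (pred : ℕ → Bld L R W ℕ) (j : ℕ) : Bld L R W (ℕ × ℕ) where
  -- Every Grover round uncomputes its flag. The predicate is run once more at the end to record
  -- whether the number obtained is marked.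
  circ a := (hadBits k (rg a) ++ (List.replicate j (groverRound k (rg a)
    (rg ((pred a).out (a + 1))) ((pred a).circ (a + 1)))).flatten) ++ (pred a).circ (a + 1)
  out a := (a, (pred a).out (a + 1))
  nxt a := (pred a).nxt (a + 1)
  le_nxt a := (Nat.le_succ a).trans ((pred a).le_nxt _)
  within a hR := by
    have hle : a + 1 ≤ (pred a).nxt (a + 1) := (pred a).le_nxt _
    have ha : a < R := lt_of_lt_of_le hle hR
    have h1 : ∀ g ∈ (hadBits k (rg a) : Circuit L R W), g.Within a ((pred a).nxt (a + 1)) :=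
      fun g hg => (within_hadBits k (rg_val ha) g hg).mono le_rfl hle
    have h2 : ∀ g ∈ (pred a).circ (a + 1), g.Within a ((pred a).nxt (a + 1)) :=
      fun g hg => ((pred a).within _ hR g hg).mono (Nat.le_succ a) le_rfl
    intro g hg
    simp only [List.mem_append, List.mem_flatten, List.mem_replicate, groverRound]
      at hg
    rcases hg with (hg | ⟨l, ⟨_, rfl⟩, hg⟩) | hg
    · exact h1 g hg
    · simp only [List.mem_append, List.mem_cons, List.mem_reverse] at hg
      rcases hg with (hg | rfl | hg) | (hg | rfl | hg)
      · exact h2 g hg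
      · trivial
      · exact h2 g hg
      · exact h1 g hg
      · trivial
      · exact h1 g hg
    · exact h2 g hg

theorem len_sample {k N : ℕ} {pred : ℕ → Bld L R W ℕ} (h : ∀ i, (pred i).Len N) (j : ℕ) :
    (sample k pred j).Len (1 + k + N + j * (2 * N + 2 * k + 2)) := by
  intro a
  have h1 := h a (a + 1)
  have h2 := length_hadBits (L := L) (W := W) k (rg a : Fin R)
  constructor
  · simp only [sample, List.length_append, List.length_flatten, List.map_replicate,
      List.sum_replicate, groverRound, List.length_cons, List.length_reverse, smul_eq_mul]
    have : j * (((pred a).circ (a + 1)).length + (((pred a).circ (a + 1)).length + 1) +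
        ((hadBits k (rg a) : Circuit L R W).length +
          ((hadBits k (rg a) : Circuit L R W).length + 1))) ≤ j * (2 * N + 2 * k + 2) :=
      Nat.mul_le_mul_left _ (by omega)
    omega
  · change (pred a).nxt (a + 1) ≤ _
    have := Nat.zero_le (j * (2 * N + 2 * k + 2))
    omega

open Classical in
/-- `pred` decides, in the world `w` and later, whether a number is marked. -/
def Decides (V : Env L n) (k : ℕ) (pred : ℕ → Bld L R W ℕ) (S : ℕ → Prop) (w : World R W) : Prop :=
  ∀ i < 2 ^ k, ∀ r w', w ≤ w' → Has w' r i →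
    RunsD V (pred r) w' fun f w'' => Has w'' f (if S i then 1 else 0)

theorem Decides.mono {V : Env L n} {k : ℕ} {pred : ℕ → Bld L R W ℕ} {S : ℕ → Prop}
    {w w' : World R W} (h : Decides V k pred S w) (hw : w ≤ w') : Decides V k pred S w' :=
  fun i hi r w'' hw' => h i hi r w'' (hw.trans hw')

open Classical in
-- Two postconditions of the same program: the flag is right with certainty, and a marked number
-- comes out except with probability `groverMiss`. The search uses the pair through `Runs.bind₂`:
-- errors of attempts multiply because a failed attempt is recognized as such.
theorem runs_sample {V : Env L n} {k : ℕ} (hk : k ≤ W) (hW : 0 < W) {pred : ℕ → Bld L R W ℕ}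
    {S : ℕ → Prop} {w : World R W} (h : Decides V k pred S w) (j : ℕ) :
    Runs V (sample k pred j) w (fun r w' => ∃ i < 2 ^ k, Has w' r.1 i ∧
      Has w' r.2 (if S i then 1 else 0)) 0 ∧
    Runs V (sample k pred j) w (fun r w' => ∃ i < 2 ^ k, S i ∧ Has w' r.1 i ∧ Has w' r.2 1)
      (groverMiss k S j) := by
  set a := w.ptr with ha
  set x := w.cfg with hxdef
  set t : Fin R := rg a with ht
  set P := (pred a).circ (a + 1) with hP
  set f : Fin R := rg ((pred a).out (a + 1)) with hf
  -- Each configuration in the superposition is a later world in which register `a` holds a number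
  -- below `2 ^ k`, so `Decides` makes the compiled predicate a classical map on it.
  have main : Blank a x → (pred a).nxt (a + 1) ≤ R → ∀ z, Ranges k x t z →
      ∃ z', Circuit.lin V P (ket z) = ket z' ∧
        Has ⟨(pred a).nxt (a + 1), z'⟩ a (z t).toNat ∧
        Has ⟨(pred a).nxt (a + 1), z'⟩ ((pred a).out (a + 1))
          (if S (z t).toNat then 1 else 0) := by
    intro hb hR z hz
    have hle : a + 1 ≤ (pred a).nxt (a + 1) := (pred a).le_nxt _
    have haR : a < R := lt_of_lt_of_le hle hR
    have htv : t.val = a := rg_val haR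
    have hne : ∀ i : Fin R, i ≠ t → z i = x i := fun i hi => by
      rw [← hz.1, Function.update_of_ne hi]
    have hle' : w ≤ ⟨a + 1, z⟩ := ⟨Nat.le_succ _, fun i hi => hne i (by
      rintro rfl; omega)⟩
    have hHas : Has (⟨a + 1, z⟩ : World R W) a (z t).toNat :=
      ⟨Nat.lt_succ_self _, by rw [BitVec.ofNat_toNat, BitVec.setWidth_eq]⟩
    have hbz : Blank (a + 1) z := fun i hi => by
      rw [hne i (by rintro rfl; omega)]; exact hb i (by omega)
    obtain ⟨z', h1, h2⟩ := h _ hz.2 a ⟨a + 1, z⟩ hle' hHas hbz hR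
    refine ⟨z', h1, hHas.mono ((pred a).le_of_lin_ne_zero (V := V) (w := ⟨a + 1, z⟩) hR ?_), h2⟩
    rw [h1, ket_apply]; simp
  -- Pulls a postcondition `Q` back through the last, deterministic run of the predicate to a
  -- property `A` of the state after the Grover rounds.
  have base : Blank a x → (pred a).nxt (a + 1) ≤ R → ∀ {Q A : Config R W → Prop} {δ : ℝ},
      missProb (fun y => (((if S (y t).toNat then (ampCoef (markFrac k S) j).1
        else (ampCoef (markFrac k S) j).2 : ℝ) : ℂ) * Circuit.lin V (hadBits k t) (ket x) y)) A
        ≤ δ →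
      (∀ z z', Ranges k x t z → Circuit.lin V P (ket z) = ket z' → A z → Q z') →
      missProb (Circuit.lin V ((sample k pred j).circ a) (ket x)) Q ≤ δ := by
    intro hb hR Q A δ hδ hQ
    have haR : a < R := lt_of_lt_of_le ((pred a).le_nxt (a + 1)) hR
    have htv : t.val = a := rg_val haR
    have hx : x t = 0 := hb t htv.ge
    have e := lin_groverRounds V hk hx (P := P) (f := f) (A := fun z => S (z t).toNat)
      (fun z hz => by
        obtain ⟨z', h1, _, h2⟩ := main hb hR z hz
        refine ⟨z', h1, ?_⟩
        rw [show z' f = _ from h2.2]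
        have h1W : 1 < 2 ^ W := Nat.one_lt_two_pow (by omega)
        change BitVec.ofNat W _ = BitVec.ofNat W 0 ↔ _
        split_ifs with hs
        · rw [ofNat_inj h1W (by omega)]; simp [hs]
        · simp [hs]) rfl (sum_marked V hk hx S).symm j
    change missProb (Circuit.lin V ((hadBits k t ++ (List.replicate j (groverRound k t f
      P)).flatten) ++ P) (ket x)) Q ≤ δ
    have hnorm := Circuit.norm_lin V (hadBits k t ++ (List.replicate j (groverRound k t f
      P)).flatten) (ket x)
    rw [norm_ket, e] at hnorm
    rw [Circuit.lin_append, e]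
    have hsupp : ∀ y, (((if S (y t).toNat then (ampCoef (markFrac k S) j).1
        else (ampCoef (markFrac k S) j).2 : ℝ) : ℂ) * Circuit.lin V (hadBits k t) (ket x) y) ≠ 0 →
        Ranges k x t y := by
      intro y hy
      by_contra hr
      apply hy
      rw [lin_hadBits V hx hk]
      simp only
      rw [if_neg hr, mul_zero]
    refine (missProb_lin_le V ((pred a).within (a + 1) hR) (fun y hy => ?_) hnorm
      (Q := A) hδ le_rfl zero_le_one (fun z hz hA => ?_)
      fun z _ _ => missProb_lin_ket_le_one _ _ _ _).trans (by linarith)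
    · intro i hi
      rw [← hb i (by omega), ← (hsupp y hy).1, Function.update_of_ne]
      rintro rfl; omega
    · obtain ⟨z', h1, _⟩ := main hb hR z (hsupp z hz)
      have hq := hQ z z' (hsupp z hz) h1 hA
      change missProb (Circuit.lin V P (ket z)) Q ≤ 0
      rw [h1]
      refine (missProb_eq_zero.mpr fun y hy => ?_).le
      rw [ket_apply] at hy
      have : y = z' := by by_contra h; simp [h] at hy
      rwa [this]
  constructor
  · intro hb hR
    refine base hb hR (A := fun _ => True) (missProb_eq_zero.mpr fun _ _ => trivial).le ?_
    intro z z' hz hz' _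
    obtain ⟨z'', h1, h2, h3⟩ := main hb hR z hz
    have : z' = z'' := by
      by_contra hne
      have := congrFun (hz'.symm.trans h1) z'
      rw [ket_apply, ket_apply] at this
      simp [hne] at this
    subst this
    exact ⟨_, hz.2, h2, h3⟩
  · intro hb hR
    have hx : x t = 0 := hb t (rg_val (lt_of_lt_of_le ((pred a).le_nxt (a + 1)) hR)).ge
    refine base hb hR (A := fun z => S (z t).toNat) ?_ ?_
    · rw [missProb, groverMiss, ← sum_marked V hk hx S]
      have hn : ∑ y, ‖Circuit.lin V (hadBits k t) (ket x) y‖ ^ 2 = 1 := by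
        rw [Circuit.norm_lin, norm_ket]
      rw [← hn, ← Finset.sum_sub_distrib, Finset.mul_sum]
      refine Finset.sum_le_sum fun y _ => ?_
      split_ifs with hs
      · simp
      · rw [norm_mul, mul_pow, Complex.norm_real, Real.norm_eq_abs, sq_abs, sub_zero]
    · intro z z' hz hz' hs
      obtain ⟨z'', h1, h2, h3⟩ := main hb hR z hz
      have : z' = z'' := by
        by_contra hne
        have := congrFun (hz'.symm.trans h1) z'
        rw [ket_apply, ket_apply] at this
        simp [hne] at this
      subst this
      rw [if_pos hs] at h3
      exact ⟨_, hz.2, hs, h2, h3⟩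

end CTF

namespace CTF

variable {L n R W : ℕ} {α β ι : Type}

/-! ## Bounded-error search with an unknown number of marked items -/

/-- Take the first power of three with `3 ^ i * θ > 3π/4`; the power before it works, since tripling
cannot jump over an interval whose ends have ratio three. Powers of three are used because they are
odd, hence of the form `2 j + 1`. -/
theorem exists_pow_three_mul {θ : ℝ} (h0 : 0 < θ) (h1 : θ ≤ Real.pi / 2) :
    ∃ i : ℕ, Real.pi / 4 < 3 ^ i * θ ∧ 3 ^ i * θ ≤ 3 * Real.pi / 4 := by
  have hpi := Real.pi_pos
  have hex : ∃ i : ℕ, 3 * Real.pi / 4 < 3 ^ i * θ := by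
    obtain ⟨i, hi⟩ := pow_unbounded_of_one_lt (3 * Real.pi / 4 / θ) (by norm_num : (1 : ℝ) < 3)
    exact ⟨i, by rwa [div_lt_iff₀ h0] at hi⟩
  classical
  have hfind := Nat.find_spec hex
  have hpos : Nat.find hex ≠ 0 := by
    intro h
    rw [h] at hfind
    linarith
  obtain ⟨i, hi⟩ := Nat.exists_eq_succ_of_ne_zero hpos
  refine ⟨i, ?_, not_lt.mp (Nat.find_min hex (by omega))⟩
  rw [hi, pow_succ] at hfind
  linarith

/-- The numbers of Grover rounds `(3 ^ i - 1) / 2`, for `i < I`, each `r` times. -/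
def schedule (I r : ℕ) : List ℕ :=
  (List.range I).flatMap fun i => List.replicate r ((3 ^ i - 1) / 2)

theorem length_schedule (I r : ℕ) : (schedule I r).length = I * r := by
  simp [schedule, List.length_flatMap]

theorem sum_schedule_le (I r : ℕ) : (schedule I r).sum ≤ 3 ^ I * r := by
  induction I with
  | zero => simp [schedule]
  | succ I ih =>
    have : schedule (I + 1) r = schedule I r ++ List.replicate r ((3 ^ I - 1) / 2) := by
      simp [schedule, List.range_succ]
    rw [this, List.sum_append, List.sum_replicate, smul_eq_mul]
    have h : (3 ^ I - 1) / 2 ≤ 3 ^ I := (Nat.div_le_self _ _).trans (Nat.sub_le _ _)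
    calc _ ≤ 3 ^ I * r + r * 3 ^ I := Nat.add_le_add ih (Nat.mul_le_mul_left _ h)
      _ ≤ 3 ^ (I + 1) * r := by rw [pow_succ]; nlinarith [Nat.zero_le (3 ^ I * r)]

/-- After `(3 ^ i - 1) / 2` rounds the angle is `3 ^ i * θ`. Some `i` brings it between `π/4` and
`3π/4`, where `cos² ≤ 1/2`, whatever the unknown number of solutions is. -/
theorem groverMiss_pow_three {m : ℕ} {S : ℕ → Prop} (hS : ∃ i < 2 ^ (2 * m), S i) {I : ℕ}
    (hI : 3 * 2 ^ m ≤ 3 ^ I) : ∃ i < I, groverMiss (2 * m) S ((3 ^ i - 1) / 2) ≤ 1 / 2 := by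
  obtain ⟨i₀, hi₀, hSi⟩ := hS
  set p := markFrac (2 * m) S
  have hp0 : (2 ^ (2 * m) : ℝ)⁻¹ ≤ p := le_markFrac hi₀ hSi
  have hppos : 0 < p := lt_of_lt_of_le (by positivity) hp0
  have hp1 : p ≤ 1 := markFrac_le_one _ _
  set θ := Real.arcsin √p
  have hsin : Real.sin θ = √p :=
    Real.sin_arcsin (by linarith [Real.sqrt_nonneg p]) (Real.sqrt_le_one.mpr hp1)
  have hθ0 : 0 < θ := Real.arcsin_pos.mpr (Real.sqrt_pos.mpr hppos)
  -- A single marked number already gives `sin θ ≥ 2 ^ (-m)`. This limits the stages that have to be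
  -- tried.
  have hθm : (2 ^ m : ℝ)⁻¹ ≤ θ := by
    refine le_trans ?_ (Real.sin_le hθ0.le)
    rw [hsin]
    apply Real.le_sqrt_of_sq_le
    rwa [inv_pow, ← pow_mul, mul_comm]
  obtain ⟨i, h1, h2⟩ := exists_pow_three_mul hθ0 (Real.arcsin_le_pi_div_two _)
  refine ⟨i, ?_, ?_⟩
  · have h3 : (3 : ℝ) ^ i < 3 * 2 ^ m := by
      have h2m : (0 : ℝ) < 2 ^ m := by positivity
      have h4 : (3 : ℝ) ^ i * (2 ^ m)⁻¹ ≤ 3 ^ i * θ := by gcongr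
      have h5 : (3 : ℝ) ^ i * (2 ^ m)⁻¹ < 3 := by linarith [Real.pi_lt_four]
      rwa [← div_eq_mul_inv, div_lt_iff₀ h2m] at h5
    have h4 : 3 ^ i < 3 ^ I := lt_of_lt_of_le (by exact_mod_cast h3) hI
    exact (Nat.pow_lt_pow_iff_right (by norm_num)).mp h4
  · have hodd : 2 * ((3 ^ i - 1) / 2) + 1 = 3 ^ i := by
      have : Odd (3 ^ i) := Odd.pow (by decide)
      obtain ⟨c, hc⟩ := this
      omega
    have hs2 : Real.sin θ ^ 2 = p := by rw [hsin, Real.sq_sqrt hppos.le]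
    have hcos : 1 - p = Real.cos θ ^ 2 := by rw [Real.cos_sq', hs2]
    have he := (ampCoef_eq hs2 ((3 ^ i - 1) / 2)).2
    have hcast : (2 * (((3 ^ i - 1) / 2 : ℕ) : ℝ) + 1) = 3 ^ i := by exact_mod_cast hodd
    rw [hcast] at he
    rw [groverMiss, hcos, ← mul_pow, he, Real.cos_sq]
    have := Real.cos_nonpos_of_pi_div_two_le_of_le (x := 2 * (3 ^ i * θ)) (by linarith)
      (by linarith)
    linarith

/-- Only the `r` attempts of the good stage are estimated; the factors of all others are at most
one. -/
theorem prod_groverMiss_schedule {m r I : ℕ} {S : ℕ → Prop} (hS : ∃ i < 2 ^ (2 * m), S i)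
    (hI : 3 * 2 ^ m ≤ 3 ^ I) :
    ((schedule I r).map (groverMiss (2 * m) S)).prod ≤ (1 / 2) ^ r := by
  obtain ⟨i, hi, h⟩ := groverMiss_pow_three hS hI
  have hprod : ∀ l : List ℕ, 0 ≤ (l.map (groverMiss (2 * m) S)).prod ∧
      (l.map (groverMiss (2 * m) S)).prod ≤ 1 := by
    intro l
    induction l with
    | nil => simp
    | cons j l ih =>
      rw [List.map_cons, List.prod_cons]
      exact ⟨mul_nonneg (groverMiss_nonneg _ _ _) ih.1,
        mul_le_one₀ (groverMiss_le_one _ _ _) ih.1 ih.2⟩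
  obtain ⟨l₁, l₂, hl⟩ := List.append_of_mem (List.mem_range.mpr hi)
  rw [schedule, hl, List.flatMap_append, List.flatMap_cons, List.map_append, List.map_append,
    List.prod_append, List.prod_append, List.map_replicate, List.prod_replicate]
  set A := ((List.flatMap (fun i => List.replicate r ((3 ^ i - 1) / 2)) l₁).map
    (groverMiss (2 * m) S)).prod
  set B := ((List.flatMap (fun i => List.replicate r ((3 ^ i - 1) / 2)) l₂).map
    (groverMiss (2 * m) S)).prod
  have hA : 0 ≤ A ∧ A ≤ 1 := hprod _
  have hB : 0 ≤ B ∧ B ≤ 1 := hprod _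
  have hq : groverMiss (2 * m) S ((3 ^ i - 1) / 2) ^ r ≤ (1 / 2) ^ r :=
    pow_le_pow_left₀ (groverMiss_nonneg _ _ _) h r
  have hq0 : 0 ≤ groverMiss (2 * m) S ((3 ^ i - 1) / 2) ^ r :=
    pow_nonneg (groverMiss_nonneg _ _ _) r
  calc A * (groverMiss (2 * m) S ((3 ^ i - 1) / 2) ^ r * B)
      ≤ 1 * (groverMiss (2 * m) S ((3 ^ i - 1) / 2) ^ r * 1) := by
        apply mul_le_mul hA.2 (mul_le_mul_of_nonneg_left hB.2 hq0)
          (mul_nonneg hq0 hB.1) zero_le_one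
    _ ≤ (1 / 2) ^ r := by linarith

theorem Bld.len_foldlM_sum {f : β → ι → Bld L R W β} {N : ι → ℕ} (l : List ι)
    (h : ∀ b i, (f b i).Len (N i)) (b : β) : (l.foldlM f b).Len (l.map N).sum := by
  induction l generalizing b with
  | nil => exact Bld.len_pure b
  | cons i l ih =>
    rw [List.foldlM_cons, List.map_cons, List.sum_cons]
    exact (h b i).bind fun r => ih r

variable [NeZero R]

/-- One attempt of a search: the first marked number that is sampled is kept. -/
def searchStep (k : ℕ) (pred : ℕ → Bld L R W ℕ) (st : ℕ × ℕ) (j : ℕ) : Bld L R W (ℕ × ℕ) := do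
  let s ← sample k pred j
  let f ← comp (.reg st.1 + Ex.eq (.reg st.1) (.num 0) * .reg s.2)
  let i ← comp (.reg st.2 + Ex.eq (.reg st.1) (.num 0) * .reg s.2 * .reg s.1)
  pure (f, i)

/-- Search for a marked number below `2 ^ k`: a flag that tells whether one was found, and the
number. -/
def search (k : ℕ) (pred : ℕ → Bld L R W ℕ) (js : List ℕ) : Bld L R W (ℕ × ℕ) := do
  let f ← comp (.num 0)
  let i ← comp (.num 0)
  js.foldlM (searchStep k pred) (f, i)

theorem len_search {k N : ℕ} {pred : ℕ → Bld L R W ℕ} (h : ∀ i, (pred i).Len N) (js : List ℕ) :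
    (search k pred js).Len (2 + js.length * (10 + k + N) + js.sum * (2 * N + 2 * k + 2)) := by
  have h1 : ∀ st j, (searchStep k pred st j).Len (10 + k + N + j * (2 * N + 2 * k + 2)) := by
    intro st j
    have h2 : (searchStep k pred st j).Len (1 + k + N + j * (2 * N + 2 * k + 2) + (4 + (5 + 0))) :=
      (len_sample h j).bind fun s => (len_comp_le le_rfl).bind fun f =>
        (len_comp_le le_rfl).bind fun i => Bld.len_pure _
    exact h2.mono (by omega)
  refine ((len_comp _).bind fun f => (len_comp _).bind fun i =>
    Bld.len_foldlM_sum js h1 (f, i)).mono ?_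
  have : (js.map fun j => 10 + k + N + j * (2 * N + 2 * k + 2)).sum =
      js.length * (10 + k + N) + js.sum * (2 * N + 2 * k + 2) := by
    rw [List.sum_map_add, List.sum_map_mul_right, List.map_id', List.map_const', List.sum_replicate,
      smul_eq_mul]
  rw [this]
  simp only [Ex.size]
  omega

/-- Nothing has been found yet. -/
def Idle (st : ℕ × ℕ) (w : World R W) : Prop := Has w st.1 0 ∧ Has w st.2 0

/-- A marked number has been found. -/
def FoundAt (k : ℕ) (S : ℕ → Prop) (st : ℕ × ℕ) (w : World R W) : Prop :=
  ∃ i < 2 ^ k, S i ∧ Has w st.1 1 ∧ Has w st.2 i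

theorem runsD_keep {V : Env L n} {w : World R W} {st s : ℕ × ℕ} {v u fl i : ℕ}
    (hv : v < 2 ^ W) (h1 : Has w st.1 v) (h2 : Has w st.2 u) (h3 : Has w s.2 fl)
    (h4 : Has w s.1 i) :
    RunsD V (do
      let f ← comp (.reg st.1 + Ex.eq (.reg st.1) (.num 0) * .reg s.2)
      let i ← comp (.reg st.2 + Ex.eq (.reg st.1) (.num 0) * .reg s.2 * .reg s.1)
      pure (f, i)) w fun r w' => Has w' r.1 (v + (if v = 0 then 1 else 0) * fl) ∧
        Has w' r.2 (u + (if v = 0 then 1 else 0) * fl * i) := by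
  have h0 : 0 < 2 ^ W := by positivity
  refine (runsD_comp (.add (.reg h1) (.mul (.eq (.reg h1) (.num 0) hv h0) (.reg h3)))).bind
    fun f w₁ hw₁ hf => ?_
  refine (runsD_comp (Ev.mono (.add (.reg h2) (.mul (.mul (.eq (.reg h1) (.num 0) hv h0)
    (.reg h3)) (.reg h4))) hw₁)).bind fun i w₂ hw₂ hi => ?_
  exact RunsD.pure ⟨hf.mono hw₂, hi⟩

theorem runs_searchStep_found {V : Env L n} {k : ℕ} (hk : k ≤ W) (hW : 0 < W)
    {pred : ℕ → Bld L R W ℕ} {S : ℕ → Prop} {w : World R W} (h : Decides V k pred S w) (j : ℕ)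
    {st : ℕ × ℕ} (hst : FoundAt k S st w) :
    Runs V (searchStep k pred st j) w (FoundAt k S) 0 := by
  obtain ⟨i, hi, hS, h1, h2⟩ := hst
  have h1W : 1 < 2 ^ W := Nat.one_lt_two_pow (by omega)
  refine ((runs_sample hk hW h j).1.bind le_rfl fun s w' hw' hs => ?_).imp (fun _ _ _ h => h)
    (add_zero 0).le
  obtain ⟨i', -, h3, h4⟩ := hs
  refine ((runsD_keep h1W (h1.mono hw') (h2.mono hw') h4 h3).imp fun r w'' _ hr => ?_).runs
  exact ⟨i, hi, hS, by simpa using hr.1, by simpa using hr.2⟩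

theorem runs_searchStep_idle {V : Env L n} {k : ℕ} (hk : k ≤ W) (hW : 0 < W)
    {pred : ℕ → Bld L R W ℕ} {S : ℕ → Prop} {w : World R W} (h : Decides V k pred S w) (j : ℕ)
    {st : ℕ × ℕ} (hst : Idle st w) :
    Runs V (searchStep k pred st j) w (FoundAt k S) (groverMiss k S j) ∧
    Runs V (searchStep k pred st j) w (fun r w' => FoundAt k S r w' ∨ Idle r w') 0 := by
  have h0W : 0 < 2 ^ W := by positivity
  constructor
  · refine ((runs_sample hk hW h j).2.bind le_rfl fun s w' hw' hs => ?_).imp (fun _ _ _ h => h)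
      (add_zero _).le
    obtain ⟨i, hi, hS, h3, h4⟩ := hs
    refine ((runsD_keep h0W (hst.1.mono hw') (hst.2.mono hw') h4 h3).imp fun r w'' _ hr => ?_).runs
    exact ⟨i, hi, hS, by simpa using hr.1, by simpa using hr.2⟩
  · refine ((runs_sample hk hW h j).1.bind le_rfl fun s w' hw' hs => ?_).imp (fun _ _ _ h => h)
      (add_zero _).le
    obtain ⟨i, hi, h3, h4⟩ := hs
    refine ((runsD_keep h0W (hst.1.mono hw') (hst.2.mono hw') h4 h3).imp fun r w'' _ hr => ?_).runs
    by_cases hS : S i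
    · exact Or.inl ⟨i, hi, hS, by simpa [hS] using hr.1, by simpa [hS] using hr.2⟩
    · exact Or.inr ⟨by simpa [hS] using hr.1, by simpa [hS] using hr.2⟩

theorem runs_searchLoop_found {V : Env L n} {k : ℕ} (hk : k ≤ W) (hW : 0 < W)
    {pred : ℕ → Bld L R W ℕ} {S : ℕ → Prop} {w : World R W} (h : Decides V k pred S w)
    (js : List ℕ) {st : ℕ × ℕ} (hst : FoundAt k S st w) :
    Runs V (js.foldlM (searchStep k pred) st) w (FoundAt k S) 0 := by
  refine (Runs.foldlM (w₀ := w) le_rfl (fun _ => FoundAt k S) (fun j rest st w' hw' hst' =>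
    runs_searchStep_found hk hW (h.mono hw') j hst') js st w le_rfl hst).imp (fun _ _ _ h => h) ?_
  simp

/-- A step from the idle state leads with certainty to success or back to the idle state, and
success is permanent. So failure probabilities of successive attempts multiply instead of adding up.
-/
theorem runs_searchLoop_idle {V : Env L n} {k : ℕ} (hk : k ≤ W) (hW : 0 < W)
    {pred : ℕ → Bld L R W ℕ} {S : ℕ → Prop} {w : World R W} (h : Decides V k pred S w)
    (js : List ℕ) {st : ℕ × ℕ} (hst : Idle st w) :
    Runs V (js.foldlM (searchStep k pred) st) w (FoundAt k S)
      (js.map (groverMiss k S)).prod := by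
  induction js generalizing st w with
  | nil => simpa using Runs.one V _ w _
  | cons j js ih =>
    have hnn : 0 ≤ (js.map (groverMiss k S)).prod :=
      List.prod_nonneg fun x hx => by
        obtain ⟨j, -, rfl⟩ := List.mem_map.mp hx; exact groverMiss_nonneg _ _ _
    obtain ⟨h1, h2⟩ := runs_searchStep_idle hk hW h j hst
    rw [List.foldlM_cons, List.map_cons, List.prod_cons]
    refine (Runs.bind₂ h1 h2 le_rfl hnn (fun r w' hw' hr =>
      runs_searchLoop_found hk hW (h.mono hw') js hr) fun r w' hw' hr => ?_).imp
      (fun _ _ _ h => h) (zero_add _).le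
    rcases hr with hr | hr
    · exact (runs_searchLoop_found hk hW (h.mono hw') js hr).imp (fun _ _ _ h => h) hnn
    · exact ih (h.mono hw') hr

/-- The search finds a marked number, if there is one. -/
theorem runs_search {V : Env L n} {m r I : ℕ} (hm : 2 * m ≤ W) (hW : 0 < W)
    (hI : 3 * 2 ^ m ≤ 3 ^ I) {pred : ℕ → Bld L R W ℕ} {S : ℕ → Prop} {w : World R W}
    (h : Decides V (2 * m) pred S w) :
    Runs V (search (2 * m) pred (schedule I r)) w (fun st w' =>
      FoundAt (2 * m) S st w' ∨ (∀ i < 2 ^ (2 * m), ¬ S i) ∧ Idle st w') ((1 / 2) ^ r) := by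
  refine (runsD_comp (.num 0)).bindRuns (by positivity) fun f w₁ hw₁ hf =>
    (runsD_comp (.num 0)).bindRuns (by positivity) fun i w₂ hw₂ hi => ?_
  have hidle : Idle (f, i) w₂ := ⟨hf.mono hw₂, hi⟩
  have hdec := h.mono (hw₁.trans hw₂)
  -- Without a marked number the flag is never raised, so the search answers correctly with error
  -- zero; errors are one-sided.
  by_cases hS : ∃ i < 2 ^ (2 * m), S i
  · exact (runs_searchLoop_idle hm hW hdec (schedule I r) hidle).imp
      (fun _ _ _ h => Or.inl h) (prod_groverMiss_schedule hS hI)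
  · push Not at hS
    refine (Runs.foldlM (w₀ := w₂) le_rfl (fun _ => Idle) (fun j rest st w' hw' hst' => ?_)
      (schedule I r) (f, i) w₂ le_rfl hidle).imp (fun _ _ _ h => Or.inr ⟨hS, h⟩)
      (by rw [mul_zero]; positivity)
    refine (runs_searchStep_idle hm hW (hdec.mono hw') j hst').2.imp (fun r w'' _ hr => ?_) le_rfl
    rcases hr with ⟨i, hi, hs, _⟩ | hr
    · exact absurd hs (hS i hi)
    · exact hr

end CTF

namespace CTF

variable {L n : ℕ}

/-! ## Keys -/

theorem digit_lt (o : Option (Fin n)) : digit o < n + 1 := by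
  cases o with
  | none => simp [digit]
  | some j => simp [digit]

theorem digit_injective : Function.Injective (digit (n := n)) := by
  rintro (_ | a) (_ | b) h <;> simp [digit] at h ⊢
  exact Fin.ext h

theorem code_eq (t : Track L n) :
    code t = (finFunctionFinEquiv fun l => (⟨digit (t l), digit_lt _⟩ : Fin (n + 1))).val := by
  rw [finFunctionFinEquiv_apply]; rfl

theorem code_lt (t : Track L n) : code t < (n + 1) ^ L := by
  rw [code_eq]; exact Fin.isLt _

theorem code_injective : Function.Injective (code (L := L) (n := n)) := by
  intro t t' h
  rw [code_eq, code_eq, Fin.val_inj, EmbeddingLike.apply_eq_iff_eq] at h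
  funext l
  exact digit_injective (Fin.mk.inj (congrFun h l))

/-- The code is the remainder of the key modulo `(n + 1) ^ L`. The tie-break thus makes the key a
name for the track vector. -/
theorem hits_eq_of_key_eq {D : Detector L} {c c' : Cand L n D.w} (h : key D c = key D c') :
    c.hits = c'.hits := by
  apply code_injective
  have h1 := congrArg (· % (n + 1) ^ L) h
  simpa [key, Nat.add_mod, Nat.mod_eq_of_lt (code_lt _)] using h1

/-! ## Overlaps -/

theorem shared_comm (t t' : Track L n) : shared t t' = shared t' t := by
  rw [shared, shared]
  congr 1
  ext l
  simp only [Finset.mem_filter, Finset.mem_univ, true_and]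
  constructor <;> rintro ⟨h1, h2⟩ <;> exact ⟨h2 ▸ h1, h2.symm⟩

theorem Overlap.symm {f : ℚ} {t t' : Track L n} (h : Overlap f t t') : Overlap f t' t := by
  rwa [Overlap, min_comm, shared_comm]

theorem rOf_le_numHits {f : ℚ} (hf : f ≤ 1) (t : Track L n) : rOf f t ≤ numHits t := by
  rw [rOf, Nat.ceil_le]
  exact mul_le_of_le_one_left (by positivity) hf

theorem overlap_self {f : ℚ} (hf : f ≤ 1) (t : Track L n) : Overlap f t t := by
  rw [Overlap, min_self]
  refine (rOf_le_numHits hf t).trans (le_of_eq ?_)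
  simp [numHits, shared]

/-! ## Cleaning -/

theorem pairwise_sortCands (D : Detector L) (cs : List (Cand L n D.w)) :
    (sortCands D cs).Pairwise fun a b => key D a ≤ key D b := by
  have : Std.Total fun a b : Cand L n D.w => key D a ≤ key D b := ⟨fun a b => le_total _ _⟩
  have : IsTrans (Cand L n D.w) fun a b => key D a ≤ key D b :=
    ⟨fun a b c => le_trans⟩
  exact List.pairwise_insertionSort _ _

theorem mem_sortCands {D : Detector L} {cs : List (Cand L n D.w)} {c : Cand L n D.w} :
    c ∈ sortCands D cs ↔ c ∈ cs := List.mem_insertionSort _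

/-- One step of the cleaning. -/
def cleanStep {w : ℕ} (f : ℚ) (acc : List (Cand L n w)) (c : Cand L n w) : List (Cand L n w) :=
  if ∃ c' ∈ acc, Overlap f c.hits c'.hits then acc else acc ++ [c]

theorem clean_eq (D : Detector L) (f : ℚ) (cs : List (Cand L n D.w)) :
    clean D f cs = (sortCands D cs).foldl (cleanStep f) [] := rfl

/-- By `h`, a kept track that blocks a selected candidate is selected itself, so deleting the
unselected tracks from the accumulator does not change what happens to selected candidates. `hacc`
records that the accumulator precedes the rest of the list in quality. -/
theorem clean_filter (D : Detector L) (f : ℚ) (sel : Track L n → Prop) [DecidablePred sel]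
    (l : List (Cand L n D.w)) (hl : l.Pairwise fun a b => key D a ≤ key D b)
    (acc : List (Cand L n D.w)) (hacc : ∀ a ∈ acc, ∀ c ∈ l, key D a ≤ key D c)
    (h : ∀ c ∈ acc ++ l, ∀ c' ∈ acc ++ l, key D c < key D c' →
      Overlap f c.hits c'.hits → sel c'.hits → sel c.hits) :
    (l.foldl (cleanStep f) acc).filter (fun c => sel c.hits) =
      (l.filter fun c => sel c.hits).foldl (cleanStep f) (acc.filter fun c => sel c.hits) := by
  induction l generalizing acc with
  | nil => rfl
  | cons c l ih =>
    have key_step : ∀ acc', (∀ a ∈ acc', a ∈ acc ∨ a = c) →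
        (l.foldl (cleanStep f) acc').filter (fun c => sel c.hits) =
        (l.filter fun c => sel c.hits).foldl (cleanStep f)
          (acc'.filter fun c => sel c.hits) := by
      intro acc' hacc'
      have hmem : ∀ a ∈ acc' ++ l, a ∈ acc ++ c :: l := by
        intro a ha
        rcases List.mem_append.mp ha with ha | ha
        · rcases hacc' a ha with h | h
          · exact List.mem_append_left _ h
          · subst h; simp
        · simp [ha]
      refine ih (List.pairwise_cons.mp hl).2 acc' ?_ fun a ha b hb => h a (hmem a ha) b (hmem b hb)
      intro a ha b hb
      rcases hacc' a ha with h | rfl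
      · exact hacc a h b (List.mem_cons_of_mem _ hb)
      · exact (List.pairwise_cons.mp hl).1 b hb
    rw [List.foldl_cons, key_step]
    swap
    · intro a ha
      rw [cleanStep] at ha
      split_ifs at ha
      · exact Or.inl ha
      · simpa using ha
    by_cases hs : sel c.hits
    · rw [List.filter_cons_of_pos (by simpa using hs), List.foldl_cons]
      congr 1
      have hiff : (∃ c' ∈ acc, Overlap f c.hits c'.hits) ↔
          ∃ c' ∈ acc.filter (fun c => sel c.hits), Overlap f c.hits c'.hits := by
        constructor
        · rintro ⟨c', hc', ho⟩
          refine ⟨c', ?_, ho⟩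
          rw [List.mem_filter]
          refine ⟨hc', ?_⟩
          rw [decide_eq_true_eq]
          -- The hypothesis `h` speaks of strictly better candidates; for equal keys the two tracks
          -- coincide, and there is nothing to show.
          rcases (hacc c' hc' c List.mem_cons_self).lt_or_eq with hlt | heq
          · exact h c' (List.mem_append_left _ hc') c (by simp) hlt ho.symm hs
          · rw [hits_eq_of_key_eq heq]; exact hs
        · rintro ⟨c', hc', ho⟩
          exact ⟨c', (List.mem_filter.mp hc').1, ho⟩
      rw [cleanStep, cleanStep, if_congr hiff rfl rfl]
      split_ifs
      · rfl
      · rw [List.filter_append, List.filter_cons_of_pos (by simpa using hs), List.filter_nil]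
    · rw [List.filter_cons_of_neg (by simpa using hs)]
      congr 1
      rw [cleanStep]
      split_ifs
      · rfl
      · rw [List.filter_append, List.filter_cons_of_neg (by simpa using hs), List.filter_nil,
          List.append_nil]

/-- Only the hits are compared, because candidates with equal keys may come in either order. The
lists of keys are sorted permutations of each other, hence equal, and keys determine hits. -/
theorem sortCands_filter (D : Detector L) (cs : List (Cand L n D.w)) (p : Cand L n D.w → Bool) :
    ((sortCands D cs).filter p).map Cand.hits = (sortCands D (cs.filter p)).map Cand.hits := by
  have h1 : ((sortCands D cs).filter p).Perm (sortCands D (cs.filter p)) :=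
    ((List.perm_insertionSort _ _).filter _).trans (List.perm_insertionSort _ _).symm
  have hk : ((sortCands D cs).filter p).map (key D) = (sortCands D (cs.filter p)).map (key D) := by
    refine List.Perm.eq_of_pairwise (le := (· ≤ ·)) (fun a b _ _ => le_antisymm) ?_ ?_ (h1.map _)
    · rw [List.pairwise_map]
      exact (pairwise_sortCands D cs).filter _
    · rw [List.pairwise_map]
      exact pairwise_sortCands D _
  have hh : ∀ l₁ l₂ : List (Cand L n D.w), l₁.map (key D) = l₂.map (key D) →
      l₁.map Cand.hits = l₂.map Cand.hits := by
    intro l₁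
    induction l₁ with
    | nil => intro l₂ h; cases l₂ with
      | nil => rfl
      | cons => simp at h
    | cons a l₁ ih => intro l₂ h; cases l₂ with
      | nil => simp at h
      | cons b l₂ =>
        simp only [List.map_cons, List.cons.injEq] at h ⊢
        exact ⟨hits_eq_of_key_eq h.1, ih l₂ h.2⟩
  exact hh _ _ hk

theorem foldl_cleanStep_congr {w : ℕ} (f : ℚ) (l₁ l₂ : List (Cand L n w))
    (h : l₁.map Cand.hits = l₂.map Cand.hits) (a₁ a₂ : List (Cand L n w))
    (ha : a₁.map Cand.hits = a₂.map Cand.hits) :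
    (l₁.foldl (cleanStep f) a₁).map Cand.hits = (l₂.foldl (cleanStep f) a₂).map Cand.hits := by
  induction l₁ generalizing l₂ a₁ a₂ with
  | nil => cases l₂ with
    | nil => exact ha
    | cons => simp at h
  | cons c l₁ ih => cases l₂ with
    | nil => simp at h
    | cons c' l₂ =>
      simp only [List.map_cons, List.cons.injEq] at h
      rw [List.foldl_cons, List.foldl_cons]
      refine ih l₂ h.2 _ _ ?_
      have hiff : (∃ b ∈ a₁, Overlap f c.hits b.hits) ↔ ∃ b ∈ a₂, Overlap f c'.hits b.hits := by
        rw [← h.1]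
        have e : ∀ a : List (Cand L n w), (∃ b ∈ a, Overlap f c.hits b.hits) ↔
            ∃ t ∈ a.map Cand.hits, Overlap f c.hits t := by
          intro a; simp
        rw [e, e, ha]
      rw [cleanStep, cleanStep, if_congr hiff rfl rfl]
      split_ifs
      · exact ha
      · simp [ha, h.1]

/-- If selection respects cleaning, then the order of the two stages does not matter. -/
theorem ctfOutput_eq_recoOutput (D : Detector L) (E : Event L n D.w) (hL : 3 ≤ L) (lam : ℕ)
    (f : ℚ) (h : SelectionConsistent D E hL lam f) :
    ctfOutput D E hL lam f = recoOutput D E hL lam f := by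
  rw [ctfOutput, recoOutput, clean_eq, clean_eq,
    clean_filter D f (Selected D E) _ (pairwise_sortCands D _) [] (by simp), marked]
  · refine foldl_cleanStep_congr f _ _ ?_ _ _ rfl
    exact sortCands_filter D _ fun c => decide (Selected D E c.hits)
  · intro c hc c' hc'
    rw [List.nil_append, mem_sortCands] at hc hc'
    exact h c hc c' hc'

/-- The tracks that cleaning adds to `acc` are found one after another as the best candidates that
do not overlap the tracks before. -/
theorem foldl_cleanStep_spec (D : Detector L) {f : ℚ} (hf : f ≤ 1) (l : List (Cand L n D.w))
    (hl : l.Pairwise fun a b => key D a ≤ key D b) (acc : List (Cand L n D.w)) :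
    ∃ g, l.foldl (cleanStep f) acc = acc ++ g ∧
      (∀ c ∈ l, ∃ c' ∈ acc ++ g, Overlap f c.hits c'.hits) ∧
      ∀ (i : ℕ) (hi : i < g.length), g[i] ∈ l ∧
        (∀ c' ∈ acc ++ g.take i, ¬ Overlap f g[i].hits c'.hits) ∧
        ∀ c ∈ l, (∀ c' ∈ acc ++ g.take i, ¬ Overlap f c.hits c'.hits) → key D g[i] ≤ key D c := by
  induction l generalizing acc with
  | nil => exact ⟨[], by simp⟩
  | cons c l ih =>
    rw [List.pairwise_cons] at hl
    rw [List.foldl_cons, cleanStep]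
    split_ifs with ho
    · obtain ⟨g, h1, h2, h3⟩ := ih hl.2 acc
      refine ⟨g, h1, ?_, ?_⟩
      · intro a ha
        rcases List.mem_cons.mp ha with rfl | ha
        · obtain ⟨c', hc', hov⟩ := ho
          exact ⟨c', List.mem_append_left _ hc', hov⟩
        · exact h2 a ha
      · intro i hi
        obtain ⟨m1, m2, m3⟩ := h3 i hi
        refine ⟨List.mem_cons_of_mem _ m1, m2, fun a ha hna => ?_⟩
        rcases List.mem_cons.mp ha with rfl | ha
        · obtain ⟨c', hc', hov⟩ := ho
          exact absurd hov (hna c' (List.mem_append_left _ hc'))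
        · exact m3 a ha hna
    · obtain ⟨g, h1, h2, h3⟩ := ih hl.2 (acc ++ [c])
      refine ⟨c :: g, by simpa using h1, ?_, ?_⟩
      · intro a ha
        rcases List.mem_cons.mp ha with rfl | ha
        · exact ⟨a, by simp, overlap_self hf _⟩
        · simpa using h2 a ha
      · intro i hi
        cases i with
        | zero =>
          simp only [List.getElem_cons_zero, List.take_zero, List.append_nil]
          refine ⟨List.mem_cons_self, fun c' hc' hov => ho ⟨c', hc', hov⟩, fun a ha _ => ?_⟩
          rcases List.mem_cons.mp ha with rfl | ha
          · exact le_rfl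
          · exact hl.1 a ha
        | succ i =>
          simp only [List.getElem_cons_succ, List.take_succ_cons]
          obtain ⟨m1, m2, m3⟩ := h3 i (by simpa using hi)
          rw [List.append_assoc, List.singleton_append] at m2 m3
          refine ⟨List.mem_cons_of_mem _ m1, m2, fun a ha hna => ?_⟩
          rcases List.mem_cons.mp ha with rfl | ha
          · exact absurd (overlap_self hf _) (hna a (by simp))
          · exact m3 a ha hna

variable {D : Detector L} {E : Event L n D.w} {hL : 3 ≤ L} {lam : ℕ} {f : ℚ}

theorem mem_valid {ts : List (Track L n)} {c : Cand L n D.w} :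
    c ∈ valid D E hL lam f ts ↔ c ∈ marked D E hL lam ∧ ∀ t ∈ ts, ¬ Overlap f c.hits t := by
  simp [valid]

/-- The next track of the output is the best valid candidate. -/
theorem recoOutput_next (hf : f ≤ 1) {i : ℕ} (hi : i < (recoOutput D E hL lam f).length) :
    ∃ c ∈ valid D E hL lam f ((recoOutput D E hL lam f).take i),
      c.hits = (recoOutput D E hL lam f)[i] ∧
      ∀ c' ∈ valid D E hL lam f ((recoOutput D E hL lam f).take i), key D c ≤ key D c' := by
  obtain ⟨g, h1, -, h3⟩ := foldl_cleanStep_spec D hf _ (pairwise_sortCands D (marked D E hL lam)) []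
  rw [List.nil_append] at h1
  have hreco : recoOutput D E hL lam f = g.map Cand.hits := by rw [recoOutput, clean_eq, h1]
  simp only [hreco] at hi ⊢
  rw [List.length_map] at hi
  obtain ⟨m1, m2, m3⟩ := h3 i hi
  rw [List.nil_append] at m2 m3
  rw [← List.map_take]
  refine ⟨g[i], ?_, by simp, fun c' hc' => ?_⟩
  · rw [mem_valid]
    refine ⟨mem_sortCands.mp m1, fun t ht => ?_⟩
    obtain ⟨c', hc', rfl⟩ := List.mem_map.mp ht
    exact m2 c' hc'
  · rw [mem_valid] at hc'
    exact m3 c' (mem_sortCands.mpr hc'.1) fun a ha => hc'.2 _ (List.mem_map_of_mem ha)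

/-- A candidate is rejected only because of a kept track that it overlaps, and a kept one overlaps
itself. This is what ends the main loop after exactly the right number of rounds. -/
theorem valid_recoOutput (hf : f ≤ 1) : valid D E hL lam f (recoOutput D E hL lam f) = [] := by
  obtain ⟨g, h1, h2, -⟩ := foldl_cleanStep_spec D hf _ (pairwise_sortCands D (marked D E hL lam)) []
  rw [List.nil_append] at h1 h2
  have hreco : recoOutput D E hL lam f = g.map Cand.hits := by rw [recoOutput, clean_eq, h1]
  rw [List.eq_nil_iff_forall_not_mem]
  intro c hc
  rw [mem_valid, hreco] at hc
  obtain ⟨c', hc', ho⟩ := h2 c (mem_sortCands.mpr hc.1)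
  exact hc.2 _ (List.mem_map_of_mem hc') ho

theorem nodup_recoOutput (hf : f ≤ 1) : (recoOutput D E hL lam f).Nodup := by
  rw [List.Nodup, List.pairwise_iff_getElem]
  intro i j hi hj hij h
  obtain ⟨c, hc, hch, -⟩ := recoOutput_next hf hj
  rw [mem_valid] at hc
  refine hc.2 _ (List.mem_take_iff_getElem.mpr ⟨i, by simpa using ⟨hij, hi⟩, rfl⟩) ?_
  rw [hch, h]
  exact overlap_self hf _

/-- Shows that the fuel of `reconstruct` is never exhausted. -/
theorem length_recoOutput_le (hf : f ≤ 1) : (recoOutput D E hL lam f).length ≤ (n + 1) ^ L := by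
  refine (nodup_recoOutput hf).length_le_card.trans (le_of_eq ?_)
  simp

end CTF

namespace CTF

variable {L n : ℕ}

/-! ## The search tree -/

open Ordnode in
-- Membership in the tree is studied through `All`, since this is the form in which rebalancing is
-- known to preserve the contents.
theorem all_insertWith_aux (x : ℕ) (P : ℕ → Prop) {t : Ordnode ℕ} {o₁ : WithBot ℕ}
    {o₂ : WithTop ℕ} (h : Valid' o₁ t o₂) (hl : Bounded nil o₁ x) (hr : Bounded nil x o₂) :
    All P (insertWith (fun _ => x) x t) ↔ P x ∧ All P t := by
  induction t generalizing o₁ o₂ with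
  | nil =>
    refine (all_singleton (P := P) (x := x)).trans ?_
    simp [All]
  | node sz l y r ihl ihr =>
    rw [insertWith, cmpLE]
    split_ifs with h_1 h_2 <;> dsimp only
    · obtain rfl : x = y := le_antisymm h_1 h_2
      simp only [All]; tauto
    · have hlt : x < y := lt_of_le_not_ge h_1 h_2
      obtain ⟨vl, e⟩ := insertWith.valid_aux (fun _ => x) x (fun _ _ => ⟨le_rfl, le_rfl⟩) h.left hl
        hlt
      rw [all_balanceL vl.3 h.3.2.2 vl.2 h.2.2.2 (Or.inl ⟨_, e, h.3.1⟩), ihl h.left hl hlt]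
      simp only [All]; tauto
    · have hlt : y < x := not_le.mp h_1
      obtain ⟨vr, e⟩ := insertWith.valid_aux (fun _ => x) x (fun _ _ => ⟨le_rfl, le_rfl⟩) h.right
        hlt hr
      rw [all_balanceR h.3.2.1 vr.3 h.2.2.1 vr.2 (Or.inr ⟨_, e, h.3.1⟩), ihr h.right hlt hr]
      simp only [All]; tauto

theorem all_insert (x : ℕ) (P : ℕ → Prop) {t : Ordnode ℕ} (h : t.Valid) :
    Ordnode.All P (Ordnode.insert x t) ↔ P x ∧ Ordnode.All P t := by
  rw [Ordnode.insert_eq_insertWith]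
  exact all_insertWith_aux x P h trivial trivial

theorem size_insert_le (x : ℕ) {t : Ordnode ℕ} (h : t.Valid) :
    (Ordnode.insert x t).size ≤ t.size + 1 := by
  rw [Ordnode.insert_eq_insertWith]
  exact (Ordnode.raised_iff.mp (Ordnode.insertWith.valid_aux (fun _ => x) x
    (fun _ _ => ⟨le_rfl, le_rfl⟩) h trivial trivial).2).2

/-- Membership is defined by descent. In an ordered tree the subtree that the descent leaves aside
cannot contain `k`, so that descent and occurrence agree. -/
theorem not_all_ne_iff_mem {k : ℕ} {t : Ordnode ℕ} {o₁ : WithBot ℕ} {o₂ : WithTop ℕ}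
    (h : Ordnode.Valid' o₁ t o₂) : ¬ Ordnode.All (· ≠ k) t ↔ k ∈ t := by
  induction t generalizing o₁ o₂ with
  | nil =>
    change ¬ True ↔ (false = true)
    simp
  | node sz l y r ihl ihr =>
    have e : k ∈ Ordnode.node sz l y r ↔ (match cmpLE k y with
      | Ordering.lt => k ∈ l
      | Ordering.eq => True
      | Ordering.gt => k ∈ r) := by
      change (Ordnode.mem k (Ordnode.node sz l y r) = true) ↔ _
      rw [Ordnode.mem]
      cases cmpLE k y
      · rfl
      · simp
      · rfl
    rw [e, cmpLE]
    have hl := Ordnode.Bounded.mem_lt (o := o₁) (x := y) h.left.1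
    have hr := Ordnode.Bounded.mem_gt (o := o₂) (x := y) h.right.1
    split_ifs with h_1 h_2 <;> dsimp only
    · obtain rfl : k = y := le_antisymm h_1 h_2
      simp [Ordnode.All]
    · rw [← ihl h.left]
      have h1 : Ordnode.All (· ≠ k) r := Ordnode.All.imp (fun a ha => by
        have : y < a := ha
        omega) hr
      simp only [Ordnode.All]
      have : y ≠ k := by omega
      tauto
    · rw [← ihr h.right]
      have h1 : Ordnode.All (· ≠ k) l := Ordnode.All.imp (fun a ha => by omega) hl
      simp only [Ordnode.All]
      have : y ≠ k := by omega
      tauto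

theorem mem_insert_iff {k x : ℕ} {t : Ordnode ℕ} (h : t.Valid) :
    k ∈ Ordnode.insert x t ↔ k = x ∨ k ∈ t := by
  rw [← not_all_ne_iff_mem (Ordnode.insert.valid x h), all_insert x _ h,
    ← not_all_ne_iff_mem h]
  by_cases hk : k = x
  · simp [hk]
  · simp [hk, Ne.symm hk]

theorem foldl_insert_spec (ks : List ℕ) {T : Ordnode ℕ} (h : T.Valid) :
    (ks.foldl (fun T k => Ordnode.insert k T) T).Valid ∧
    (∀ k, k ∈ ks.foldl (fun T k => Ordnode.insert k T) T ↔ k ∈ ks ∨ k ∈ T) ∧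
    (ks.foldl (fun T k => Ordnode.insert k T) T).size ≤ T.size + ks.length := by
  induction ks generalizing T with
  | nil => exact ⟨h, by simp, le_rfl⟩
  | cons x ks ih =>
    obtain ⟨h1, h2, h3⟩ := ih (Ordnode.insert.valid x h)
    refine ⟨h1, fun k => ?_, ?_⟩
    · rw [List.foldl_cons, h2, mem_insert_iff h, List.mem_cons]; tauto
    · rw [List.foldl_cons, List.length_cons]
      have := size_insert_le x h
      omega

theorem treeOf_spec (f : ℚ) (ts : List (Track L n)) {N : ℕ}
    (hN : ∀ t : Track L n, (insertKeys f t).length ≤ N) :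
    (treeOf f ts).Valid ∧ (∀ k, k ∈ treeOf f ts ↔ ∃ t ∈ ts, k ∈ insertKeys f t) ∧
    (treeOf f ts).size ≤ ts.length * N := by
  induction ts using List.reverseRecOn with
  | nil =>
    refine ⟨Ordnode.valid_nil, fun k => ?_, le_of_eq (by simp [treeOf])⟩
    simp only [treeOf, List.foldl_nil, List.not_mem_nil, false_and, exists_false, iff_false]
    exact Bool.false_ne_true
  | append_singleton ts t ih =>
    obtain ⟨h1, h2, h3⟩ := ih
    have e : treeOf f (ts ++ [t]) = insertTrack f (treeOf f ts) t := by simp [treeOf]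
    obtain ⟨g1, g2, g3⟩ := foldl_insert_spec (insertKeys f t) h1
    rw [e, insertTrack]
    refine ⟨g1, fun k => ?_, ?_⟩
    · rw [g2, h2]
      simp only [List.mem_append, List.mem_singleton]
      constructor
      · rintro (h | ⟨t', ht', h⟩)
        · exact ⟨t, Or.inr rfl, h⟩
        · exact ⟨t', Or.inl ht', h⟩
      · rintro ⟨t', ht' | rfl, h⟩
        · exact Or.inr ⟨t', ht', h⟩
        · exact Or.inl h
    · have := hN t
      rw [List.length_append, List.length_singleton, add_mul, one_mul]
      omega

/-- The depth of a tree. -/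
def treeDepth : Ordnode ℕ → ℕ
  | .nil => 0
  | .node _ l _ r => max (treeDepth l) (treeDepth r) + 1

/-- Balance with ratio three means that `size + 1` of a child is at most `3/4` of that of its
parent, including the exceptional case of at most one node in both children. -/
theorem four_pow_depth_le {t : Ordnode ℕ} (hs : t.Sized) (hb : t.Balanced) :
    4 ^ treeDepth t ≤ 3 ^ treeDepth t * (t.size + 1) := by
  induction t with
  | nil => simp [treeDepth]
  | node sz l y r ihl ihr =>
    have h1 := ihl hs.2.1 hb.2.1
    have h2 := ihr hs.2.2 hb.2.2
    have hsz : sz = l.size + r.size + 1 := hs.1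
    have hbal : l.size + r.size ≤ 1 ∨ l.size ≤ 3 * r.size ∧ r.size ≤ 3 * l.size := hb.1
    have key : ∀ d s : ℕ, 4 ^ d ≤ 3 ^ d * (s + 1) → 4 * (s + 1) ≤ 3 * (sz + 1) →
        4 ^ (d + 1) ≤ 3 ^ (d + 1) * (sz + 1) := by
      intro d s h h'
      calc 4 ^ (d + 1) = 4 ^ d * 4 := pow_succ _ _
        _ ≤ 3 ^ d * (s + 1) * 4 := Nat.mul_le_mul_right _ h
        _ = 3 ^ d * (4 * (s + 1)) := by ring
        _ ≤ 3 ^ d * (3 * (sz + 1)) := Nat.mul_le_mul_left _ h'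
        _ = 3 ^ (d + 1) * (sz + 1) := by ring
    change 4 ^ (max (treeDepth l) (treeDepth r) + 1) ≤
      3 ^ (max (treeDepth l) (treeDepth r) + 1) * (sz + 1)
    rcases le_total (treeDepth l) (treeDepth r) with h | h
    · rw [max_eq_right h]; exact key _ _ h2 (by omega)
    · rw [max_eq_left h]; exact key _ _ h1 (by omega)

theorem treeDepth_le {t : Ordnode ℕ} (h : t.Valid) {c : ℕ} (hc : t.size + 1 ≤ 2 ^ c) :
    treeDepth t ≤ 3 * c := by
  by_contra! hlt
  have h1 := four_pow_depth_le h.2 h.3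
  set d := treeDepth t
  have h2 : 4 ^ d ≤ 3 ^ d * 2 ^ c := h1.trans (Nat.mul_le_mul_left _ hc)
  -- The factor three in the bound comes from `2 * 27 ≤ 64`: three levels reduce `size + 1` at least
  -- by half.
  have h3 : 2 ^ c * 3 ^ (3 * c) ≤ 4 ^ (3 * c) := by
    rw [pow_mul, pow_mul, ← mul_pow]
    exact Nat.pow_le_pow_left (by norm_num) c
  obtain ⟨e, he⟩ := Nat.exists_eq_add_of_lt hlt
  have h4 : 3 ^ (e + 1) < 4 ^ (e + 1) := Nat.pow_lt_pow_left (by norm_num) (by omega)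
  have h5 : 3 ^ d * 2 ^ c < 4 ^ d := by
    rw [he, show 3 * c + e + 1 = 3 * c + (e + 1) by ring, pow_add 3, pow_add 4]
    calc 3 ^ (3 * c) * 3 ^ (e + 1) * 2 ^ c = (2 ^ c * 3 ^ (3 * c)) * 3 ^ (e + 1) := by ring
      _ ≤ 4 ^ (3 * c) * 3 ^ (e + 1) := Nat.mul_le_mul_right _ h3
      _ < 4 ^ (3 * c) * 4 ^ (e + 1) := Nat.mul_lt_mul_of_pos_left h4 (by positivity)
  omega

/-! ## Looking up a key in the memory of the tree -/

/-- Cells are numbered as in a heap: the ancestors of cell `a` are the quotients `a / 2 ^ e`. A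
subtree with root in cell `q` fills only cells that have `q` among them. -/
theorem treeCell_of_not_desc {a : ℕ} (t : Ordnode ℕ) {q : ℕ} (h : ∀ e, a / 2 ^ e ≠ q) :
    treeCell a t q = 0 := by
  induction t generalizing q with
  | nil => rfl
  | node sz l k r ihl ihr =>
    have h0 : a ≠ q := by simpa using h 0
    rw [treeCell, if_neg h0, ihl, ihr]
    · intro e he
      apply h (e + 1)
      rw [pow_succ, ← Nat.div_div_eq_div_mul, he]; omega
    · intro e he
      apply h (e + 1)
      rw [pow_succ, ← Nat.div_div_eq_div_mul, he]; omega

/-- The sum in `treeCell` is a case distinction in disguise: a cell lies below at most one of the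
two children. -/
theorem treeCell_child {a q b : ℕ} (hq : 0 < q) (hb : b ≤ 1) {e : ℕ} (he : a / 2 ^ e = 2 * q + b)
    {sz k : ℕ} {l r : Ordnode ℕ} :
    treeCell a (.node sz l k r) q =
      if b = 0 then treeCell a l (2 * q) else treeCell a r (2 * q + 1) := by
  have hne : a ≠ q := by
    have := Nat.div_le_self a (2 ^ e)
    omega
  have hother : ∀ b' ≤ 1, b' ≠ b → ∀ e', a / 2 ^ e' ≠ 2 * q + b' := by
    intro b' hb' hbb e' he'
    -- Numbers at least halve from a cell to a proper ancestor, whereas `2 * q` and `2 * q + 1`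
    -- differ by less than a factor two. So siblings are never both ancestors of `a`.
    have aux : ∀ e₁ e₂ c₁ c₂, a / 2 ^ e₁ = c₁ → a / 2 ^ e₂ = c₂ → e₁ < e₂ → 2 * c₂ ≤ c₁ := by
      intro e₁ e₂ c₁ c₂ h₁ h₂ hlt
      have h3 : a / 2 ^ e₂ = a / 2 ^ e₁ / 2 ^ (e₂ - e₁) := by
        rw [Nat.div_div_eq_div_mul, ← pow_add]
        congr 2; omega
      have h4 : 2 ^ 1 ≤ 2 ^ (e₂ - e₁) := Nat.pow_le_pow_right (by norm_num) (by omega)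
      have h5 : c₁ / 2 ^ (e₂ - e₁) ≤ c₁ / 2 ^ 1 := Nat.div_le_div_left h4 (by norm_num)
      rw [← h₂, h3, h₁]
      omega
    rcases lt_trichotomy e e' with h | h | h
    · have := aux e e' _ _ he he' h; omega
    · subst h; omega
    · have := aux e' e _ _ he' he h; omega
  rw [treeCell, if_neg hne]
  split_ifs with h0
  · rw [treeCell_of_not_desc r (hother 1 le_rfl (by omega)), add_zero]
  · have hz := treeCell_of_not_desc (a := a) l (q := 2 * q)
      (by simpa using hother 0 (by omega) (by omega))
    rw [hz, zero_add]

/-- One step of the descent in the search tree: the cell, and a flag that tells whether the key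
was met. -/
def probeStep (T : Ordnode ℕ) (k : ℕ) (s : ℕ × ℕ) : ℕ × ℕ :=
  let v := treeCell s.1 T 1
  (2 * s.1 + (if k + 1 < v then 0 else 1), if s.2 + (if v = k + 1 then 1 else 0) = 0 then 0 else 1)

theorem probeStep_iterate_flag (T : Ordnode ℕ) (k d : ℕ) {s : ℕ × ℕ} (hs : s.2 = 1) :
    ((probeStep T k)^[d] s).2 = 1 := by
  induction d generalizing s with
  | zero => exact hs
  | succ d ih =>
    rw [Function.iterate_succ_apply]
    exact ih (by simp [probeStep, hs])

theorem probeStep_iterate_addr (T : Ordnode ℕ) (k d : ℕ) :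
    ((probeStep T k)^[d] (1, 0)).1 < 2 ^ (d + 1) := by
  induction d with
  | zero => simp
  | succ d ih =>
    rw [Function.iterate_succ_apply']
    have : (probeStep T k ((probeStep T k)^[d] (1, 0))).1 ≤
        2 * ((probeStep T k)^[d] (1, 0)).1 + 1 := by
      simp only [probeStep]
      split_ifs <;> omega
    rw [pow_succ]
    omega

/-- The invariant `hsub` says that the memory at and below cell `q` is that of the subtree `t`. The
number of steps is fixed in advance, as a circuit requires; steps beyond the hit or beyond a leaf
must not alter the flag. -/
theorem probeStep_descent (T : Ordnode ℕ) (k d : ℕ) (t : Ordnode ℕ) (q : ℕ) (hq : 0 < q)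
    (hsub : ∀ a e, a / 2 ^ e = q → treeCell a T 1 = treeCell a t q) (hd : treeDepth t ≤ d) :
    ((probeStep T k)^[d] (q, 0)).2 = if k ∈ t then 1 else 0 := by
  induction d generalizing t q with
  | zero =>
    cases t with
    | nil =>
      change 0 = if false = true then 1 else 0
      simp
    | node => simp [treeDepth] at hd
  | succ d ih =>
    rw [Function.iterate_succ_apply]
    have hv := hsub q 0 (by simp)
    cases t with
    | nil =>
      -- Below an empty cell all cells are empty. The descent goes on to the right, and the content
      -- `0` never equals `k + 1`.
      have hv0 : treeCell q T 1 = 0 := hv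
      have e : probeStep T k (q, 0) = (2 * q + 1, 0) := by simp [probeStep, hv0]
      rw [e, ih .nil (2 * q + 1) (by omega) _ (by simp [treeDepth])]
      intro a e he
      rw [hsub a (e + 1) (by rw [pow_succ, ← Nat.div_div_eq_div_mul, he]; omega)]
      rfl
    | node sz l y r =>
      have hvy : treeCell q T 1 = y + 1 := by rw [hv, treeCell, if_pos rfl]
      have hd' : treeDepth l ≤ d ∧ treeDepth r ≤ d := by
        simp only [treeDepth] at hd; omega
      have hm : k ∈ Ordnode.node sz l y r ↔ (match cmpLE k y with
          | Ordering.lt => k ∈ l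
          | Ordering.eq => True
          | Ordering.gt => k ∈ r) := by
        change (Ordnode.mem k (Ordnode.node sz l y r) = true) ↔ _
        rw [Ordnode.mem]
        cases cmpLE k y
        · rfl
        · simp
        · rfl
      have child : ∀ b ≤ 1, ∀ a e, a / 2 ^ e = 2 * q + b → treeCell a T 1 =
          if b = 0 then treeCell a l (2 * q) else treeCell a r (2 * q + 1) := by
        intro b hb a e he
        rw [hsub a (e + 1) (by rw [pow_succ, ← Nat.div_div_eq_div_mul, he]; omega),
          treeCell_child hq hb he]
      rcases lt_trichotomy k y with hlt | heq | hgt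
      · have e : probeStep T k (q, 0) = (2 * q, 0) := by
          simp [probeStep, hvy, hlt, hlt.ne']
        rw [e, ih l (2 * q) (by omega) (fun a e he => by simpa using child 0 (by omega) a e he)
          hd'.1]
        have hc : cmpLE k y = Ordering.lt := by simp [cmpLE, hlt.le, hlt]
        rw [hc] at hm
        exact if_congr hm.symm rfl rfl
      · subst heq
        rw [probeStep_iterate_flag _ _ _ (by simp [probeStep, hvy])]
        have hc : cmpLE k k = Ordering.eq := by simp [cmpLE]
        rw [hc] at hm
        rw [if_pos (hm.mpr trivial)]
      · have e : probeStep T k (q, 0) = (2 * q + 1, 0) := by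
          simp [probeStep, hvy, hgt.ne, hgt.le]
        rw [e, ih r (2 * q + 1) (by omega)
          (fun a e he => by simpa using child 1 le_rfl a e he) hd'.2]
        have hc : cmpLE k y = Ordering.gt := by simp [cmpLE, hgt]
        rw [hc] at hm
        exact if_congr hm.symm rfl rfl

theorem probeStep_spec (T : Ordnode ℕ) (k : ℕ) {d : ℕ} (hd : treeDepth T ≤ d) :
    ((probeStep T k)^[d] (1, 0)).2 = if k ∈ T then 1 else 0 :=
  probeStep_descent T k d T 1 one_pos (fun _ _ _ => rfl) hd

end CTF

namespace CTF

variable {L n : ℕ}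

/-! ## Tuples and overlaps -/

/-- The tuple of the hits of a track in the layers `S`. -/
def restrict (t : Track L n) (S : Finset (Fin L)) : Track L n := fun l =>
  if l ∈ S then t l else none

theorem mem_tuples {t u : Track L n} {m : ℕ} :
    u ∈ tuples t m ↔ ∃ S : Finset (Fin L), S.card = m ∧ (∀ l ∈ S, (t l).isSome) ∧
      u = restrict t S := by
  rw [tuples, List.mem_map]
  constructor
  · rintro ⟨l, hl, rfl⟩
    rw [List.mem_sublistsLen] at hl
    have hnd : l.Nodup := ((List.nodup_finRange L).filter _).sublist hl.1
    refine ⟨l.toFinset, by rw [List.toFinset_card_of_nodup hnd, hl.2], fun i hi => ?_, ?_⟩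
    · have := hl.1.subset (List.mem_toFinset.mp hi)
      simpa using this
    · funext i
      simp [restrict]
  · rintro ⟨S, hS, hdom, rfl⟩
    refine ⟨(List.finRange L).filter (· ∈ S), ?_, ?_⟩
    · rw [List.mem_sublistsLen]
      constructor
      · have : (List.finRange L).filter (fun i => decide (i ∈ S)) =
            ((List.finRange L).filter fun l => (t l).isSome).filter (fun i => decide (i ∈ S)) := by
          rw [List.filter_filter]
          refine List.filter_congr fun i _ => ?_
          by_cases h : i ∈ S
          · simp [h, hdom i h]
          · simp [h]
        rw [this]
        exact List.filter_sublist
      · rw [← hS, ← List.toFinset_card_of_nodup ((List.nodup_finRange L).filter _)]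
        congr 1
        ext i; simp
    · funext i
      simp [restrict]

/-- A tuple reveals its set of layers, since all entries in that set are hits. Equal tuples thus
exhibit `S.card` common hits. -/
theorem restrict_eq_restrict {t t' : Track L n} {S S' : Finset (Fin L)}
    (hS : ∀ l ∈ S, (t l).isSome) (hS' : ∀ l ∈ S', (t' l).isSome)
    (h : restrict t S = restrict t' S') : S = S' ∧ S.card ≤ shared t t' := by
  have hdom : ∀ {t : Track L n} {S : Finset (Fin L)} (_ : ∀ l ∈ S, (t l).isSome) (l : Fin L),
      l ∈ S ↔ (restrict t S l).isSome := by
    intro t S hS l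
    by_cases hl : l ∈ S
    · simp [restrict, hl, hS l hl]
    · simp [restrict, hl]
  have hSS : S = S' := by
    ext l; rw [hdom hS, hdom hS', h]
  subst hSS
  refine ⟨rfl, Finset.card_le_card fun l hl => ?_⟩
  simp only [Finset.mem_filter, Finset.mem_univ, true_and]
  refine ⟨hS l hl, ?_⟩
  have := congrFun h l
  simpa [restrict, hl] using this

theorem exists_restrict_eq {t t' : Track L n} {m : ℕ} (h : m ≤ shared t t') :
    ∃ S : Finset (Fin L), S.card = m ∧ (∀ l ∈ S, (t l).isSome) ∧ (∀ l ∈ S, (t' l).isSome) ∧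
      restrict t S = restrict t' S := by
  obtain ⟨S, hS, hc⟩ := Finset.exists_subset_card_eq h
  have key : ∀ l ∈ S, (t l).isSome ∧ t l = t' l := fun l hl => by
    simpa using hS hl
  refine ⟨S, hc, fun l hl => (key l hl).1, fun l hl => (key l hl).2 ▸ (key l hl).1, ?_⟩
  funext l
  by_cases hl : l ∈ S
  · simp [restrict, hl, (key l hl).2]
  · simp [restrict, hl]

/-- A mixed radix representation with the digits `i`, `j` and the code; `j ≤ L` makes `j` a proper
digit to the base `L + 1`. -/
theorem tupleKey_inj {i j i' j' : ℕ} {t t' : Track L n} (hj : j ≤ L) (hj' : j' ≤ L)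
    (h : tupleKey i j t = tupleKey i' j' t') : i = i' ∧ j = j' ∧ t = t' := by
  have hp : 0 < (n + 1) ^ L := by positivity
  have h1 : i * (L + 1) + j = i' * (L + 1) + j' := by
    have := congrArg (· / (n + 1) ^ L) h
    simpa [tupleKey, Nat.add_div_of_dvd_right, Nat.div_eq_of_lt (code_lt _), hp.ne', mul_comm,
      Nat.mul_add_div hp] using this
  have h2 : code t = code t' := by
    rw [tupleKey, tupleKey, h1] at h
    omega
  have h3 : i = i' := by
    have := congrArg (· / (L + 1)) h1
    simpa [mul_comm _ (L + 1), Nat.mul_add_div, Nat.div_eq_of_lt (Nat.lt_succ_of_le hj),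
      Nat.div_eq_of_lt (Nat.lt_succ_of_le hj')] using this
  subst h3
  exact ⟨rfl, by omega, code_injective h2⟩

theorem numHits_le (t : Track L n) : numHits t ≤ L := by
  refine (Finset.card_filter_le _ _).trans ?_
  simp

theorem rOf_le_ceil {f : ℚ} (hf0 : 0 < f) (t : Track L n) : rOf f t ≤ ⌈f * L⌉₊ := by
  apply Nat.ceil_mono
  have : (numHits t : ℚ) ≤ L := by exact_mod_cast numHits_le t
  gcongr

theorem ceil_le {f : ℚ} (hf : f ≤ 1) : ⌈f * (L : ℚ)⌉₊ ≤ L := by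
  rw [Nat.ceil_le]
  exact mul_le_of_le_one_left (by positivity) hf

theorem mem_insertKeys {f : ℚ} {t : Track L n} {k : ℕ} :
    k ∈ insertKeys f t ↔ ∃ S : Finset (Fin L), 1 ≤ S.card ∧ S.card ≤ rOf f t ∧
      (∀ l ∈ S, (t l).isSome) ∧ k = tupleKey S.card (rOf f t) (restrict t S) := by
  simp only [insertKeys, List.mem_flatMap, List.mem_range'_1, List.mem_map, mem_tuples]
  constructor
  · rintro ⟨m, hm, u, ⟨S, rfl, h1, rfl⟩, rfl⟩
    exact ⟨S, hm.1, by omega, h1, rfl⟩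
  · rintro ⟨S, h1, h2, h3, rfl⟩
    exact ⟨S.card, ⟨h1, by omega⟩, _, ⟨S, rfl, h3, rfl⟩, rfl⟩

theorem mem_probeKeys {f : ℚ} (hf0 : 0 < f) {t : Track L n} {k : ℕ} :
    k ∈ probeKeys f t ↔ ∃ S : Finset (Fin L), (∀ l ∈ S, (t l).isSome) ∧ ∃ j,
      k = tupleKey S.card j (restrict t S) ∧ (1 ≤ S.card ∧ S.card = j ∧ S.card ≤ rOf f t ∨
        S.card = rOf f t ∧ rOf f t ≤ j ∧ j ≤ ⌈f * L⌉₊) := by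
  have hr := rOf_le_ceil hf0 t
  simp only [probeKeys, List.mem_append, List.mem_flatMap, List.mem_range'_1, List.mem_map,
    mem_tuples]
  constructor
  · rintro (⟨m, hm, u, ⟨S, rfl, h1, rfl⟩, rfl⟩ | ⟨m, hm, u, ⟨S, h0, h1, rfl⟩, rfl⟩)
    · exact ⟨S, h1, _, rfl, Or.inl ⟨hm.1, rfl, by omega⟩⟩
    · exact ⟨S, h1, m, by rw [h0], Or.inr ⟨h0, hm.1, by omega⟩⟩
  · rintro ⟨S, h1, j, rfl, ⟨h2, rfl, h3⟩ | ⟨h2, h3, h4⟩⟩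
    · exact Or.inl ⟨S.card, ⟨h2, by omega⟩, _, ⟨S, rfl, h1, rfl⟩, rfl⟩
    · exact Or.inr ⟨j, ⟨h3, by omega⟩, _, ⟨S, h2, h1, rfl⟩, by rw [h2]⟩

/-- Two tracks overlap iff one of the tuples looked up for the first was inserted with the
second. -/
theorem overlap_iff_probe {f : ℚ} (hf0 : 0 < f) (hf1 : f ≤ 1) {t t' : Track L n}
    (ht : 1 ≤ rOf f t) (ht' : 1 ≤ rOf f t') :
    Overlap f t t' ↔ ∃ k ∈ probeKeys f t, k ∈ insertKeys f t' := by
  have hr := rOf_le_ceil hf0 t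
  have hr' := rOf_le_ceil hf0 t'
  have hcl := ceil_le (L := L) hf1
  constructor
  · intro h
    obtain ⟨S, hc, h1, h2, h3⟩ := exists_restrict_eq h
    refine ⟨tupleKey S.card (rOf f t') (restrict t S), ?_, ?_⟩
    · rw [mem_probeKeys hf0]
      refine ⟨S, h1, _, rfl, ?_⟩
      -- The shared tuple is stored under its size and `r'`. If `r ≤ r'` it is an `r`-tuple in the
      -- tree of index `(r, r')`, found by the second list of probes; otherwise it is an `r'`-tuple
      -- in the tree of index `(r', r')`, found by the first.
      rcases le_total (rOf f t) (rOf f t') with h | h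
      · rw [min_eq_left h] at hc; exact Or.inr ⟨hc, h, hr'⟩
      · rw [min_eq_right h] at hc; exact Or.inl ⟨by omega, hc, by omega⟩
    · rw [mem_insertKeys]
      refine ⟨S, ?_, ?_, h2, by rw [h3]⟩
      · rw [hc]; omega
      · rw [hc]; omega
  · rintro ⟨k, hk, hk'⟩
    rw [mem_probeKeys hf0] at hk
    rw [mem_insertKeys] at hk'
    obtain ⟨S, h1, j, rfl, hj⟩ := hk
    obtain ⟨S', h2, h3, h4, h5⟩ := hk'
    obtain ⟨e1, e2, e3⟩ := tupleKey_inj (by omega) (by omega) h5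
    obtain ⟨rfl, hle⟩ := restrict_eq_restrict h1 h4 e3
    rw [Overlap]
    refine le_trans ?_ hle
    omega

/-- A shorter list of tuples would do for the lookup. -/
theorem overlap_iff_lookup {f : ℚ} (hf0 : 0 < f) (hf1 : f ≤ 1) {t t' : Track L n}
    (ht : 1 ≤ rOf f t) (ht' : 1 ≤ rOf f t') :
    Overlap f t t' ↔ ∃ S : Finset (Fin L), (∀ l ∈ S, (t l).isSome) ∧ ∃ j ≤ L,
      S.card = min (rOf f t) j ∧ tupleKey S.card j (restrict t S) ∈ insertKeys f t' := by
  have hr' := rOf_le_ceil hf0 t'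
  have hcl := ceil_le (L := L) hf1
  constructor
  · intro h
    obtain ⟨S, hc, h1, h2, h3⟩ := exists_restrict_eq h
    refine ⟨S, h1, rOf f t', by omega, hc, ?_⟩
    rw [mem_insertKeys]
    refine ⟨S, ?_, ?_, h2, by rw [h3]⟩
    · rw [hc]; omega
    · rw [hc]; omega
  · rintro ⟨S, h1, j, hj, hc, hk⟩
    rw [mem_insertKeys] at hk
    obtain ⟨S', h2, h3, h4, h5⟩ := hk
    obtain ⟨e1, e2, e3⟩ := tupleKey_inj (by omega) (by omega) h5
    obtain ⟨rfl, hle⟩ := restrict_eq_restrict h1 h4 e3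
    rw [Overlap]
    refine le_trans ?_ hle
    omega

theorem length_tuples_le (t : Track L n) (m : ℕ) : (tuples t m).length ≤ 2 ^ L := by
  rw [tuples, List.length_map, List.length_sublistsLen]
  refine (Nat.choose_le_two_pow _ _).trans (Nat.pow_le_pow_right (by norm_num) ?_)
  refine (List.length_filter_le _ _).trans ?_
  simp

theorem length_flatMap_le {α β : Type} (l : List α) (g : α → List β) {N : ℕ}
    (h : ∀ a ∈ l, (g a).length ≤ N) : (l.flatMap g).length ≤ l.length * N := by
  rw [List.length_flatMap]
  refine (List.sum_le_card_nsmul _ N ?_).trans ?_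
  · intro x hx
    obtain ⟨a, ha, rfl⟩ := List.mem_map.mp hx
    exact h a ha
  · simp

theorem length_insertKeys_le {f : ℚ} (hf : f ≤ 1) (t : Track L n) :
    (insertKeys f t).length ≤ L * 2 ^ L := by
  refine (length_flatMap_le _ _ (N := 2 ^ L) fun m _ => ?_).trans ?_
  · rw [List.length_map]; exact length_tuples_le t m
  · rw [List.length_range']
    exact Nat.mul_le_mul_right _ ((rOf_le_numHits hf t).trans (numHits_le t))

theorem length_probeKeys_le {f : ℚ} (hf : f ≤ 1) (t : Track L n) :
    (probeKeys f t).length ≤ (2 * L + 1) * 2 ^ L := by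
  rw [probeKeys, List.length_append]
  have h1 : ((List.range' 1 (rOf f t)).flatMap fun m =>
      (tuples t m).map (tupleKey m m)).length ≤ L * 2 ^ L := by
    refine (length_flatMap_le _ _ (N := 2 ^ L) fun m _ => ?_).trans ?_
    · rw [List.length_map]; exact length_tuples_le t m
    · rw [List.length_range']
      exact Nat.mul_le_mul_right _ ((rOf_le_numHits hf t).trans (numHits_le t))
  have h2 : ((List.range' (rOf f t) (⌈f * L⌉₊ + 1 - rOf f t)).flatMap fun m =>
      (tuples t (rOf f t)).map (tupleKey (rOf f t) m)).length ≤ (L + 1) * 2 ^ L := by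
    refine (length_flatMap_le _ _ (N := 2 ^ L) fun m _ => ?_).trans ?_
    · rw [List.length_map]; exact length_tuples_le t _
    · rw [List.length_range']
      refine Nat.mul_le_mul_right _ ?_
      have := ceil_le (L := L) hf
      omega
  nlinarith [h1, h2]

end CTF

namespace CTF

variable {L n : ℕ}

/-! ## Track finding -/

/-- The continuation of a candidate by the hit `j` of layer `l`, if its `χ²` is below the cut. -/
def hitExt (D : Detector L) (E : Event L n D.w) (l : Fin L) (c : Cand L n D.w) (j : Fin n) :
    Option (Cand L n D.w) :=
  (E l j).bind fun h =>
    if D.chi2 l (D.predict l c.state) h < D.chi0 then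
      some (Cand.mk (Function.update c.hits l (some j)) (D.kalman l (D.predict l c.state) h)
        (c.chi + (D.chi2 l (D.predict l c.state) h).toNat) c.ghosts)
    else none

/-- The continuation of a candidate by a ghost hit. -/
def ghostExt (D : Detector L) (l : Fin L) (c : Cand L n D.w) : Cand L n D.w :=
  Cand.mk c.hits (D.ghost l (D.predict l c.state)) c.chi (c.ghosts + 1)

/-- The candidate is not dropped. -/
def Passes (D : Detector L) (c : Cand L n D.w) : Prop :=
  c.ghosts ≤ D.maxGhosts ∧ c.chi ≤ D.maxChi

instance (D : Detector L) (c : Cand L n D.w) : Decidable (Passes D c) := by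
  unfold Passes; infer_instance

/-- The continuations of candidates to layer `l`, before the best ones are chosen. -/
def pool (D : Detector L) (E : Event L n D.w) (l : Fin L) (cs : List (Cand L n D.w)) :
    List (Cand L n D.w) :=
  (cs.flatMap (extend D E l)).filter fun c => Passes D c

/-- The candidate has been extended to the layers below `k` only, and its numbers are bounded. -/
structure Fresh (k : ℕ) {w : ℕ} (c : Cand L n w) : Prop where
  hits : ∀ l : Fin L, k ≤ l.val → c.hits l = none
  ghosts : c.ghosts ≤ k
  chi : c.chi ≤ k * 2 ^ w

/-- The invariant of track finding. -/
structure LayerInv (lam k : ℕ) {w : ℕ} (cs : List (Cand L n w)) : Prop where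
  length : cs.length ≤ lam
  nodup : (cs.map Cand.hits).Nodup
  fresh : ∀ c ∈ cs, Fresh k c

/-- The invariant of track finding, for the candidates of the seed `(j0, j1, j2)`. -/
structure ListInv (lam : ℕ) (k : ℕ) (j0 j1 j2 : Fin n) {w : ℕ} (h3 : 3 ≤ L)
    (cs : List (Cand L n w)) : Prop extends LayerInv lam k cs where
  hit0 : ∀ c ∈ cs, c.hits ⟨0, by omega⟩ = some j0
  hit1 : ∀ c ∈ cs, c.hits ⟨1, by omega⟩ = some j1
  hit2 : ∀ c ∈ cs, c.hits ⟨2, by omega⟩ = some j2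
  three_le : 3 ≤ k

variable {D : Detector L} {E : Event L n D.w} {hL : 3 ≤ L} {lam : ℕ}

theorem findStep_eq (cs : List (Cand L n D.w)) (l : Fin L) :
    findStep D E lam cs l = (sortCands D (pool D E l cs)).take lam := rfl

theorem extend_eq (l : Fin L) (c : Cand L n D.w) :
    extend D E l c = if ((List.finRange n).filterMap (hitExt D E l c)).isEmpty
      then [ghostExt D l c] else (List.finRange n).filterMap (hitExt D E l c) := rfl

theorem mem_extend {l : Fin L} {c c' : Cand L n D.w} :
    c' ∈ extend D E l c ↔ (∃ j, hitExt D E l c j = some c') ∨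
      (∀ j, hitExt D E l c j = none) ∧ c' = ghostExt D l c := by
  have hemp : ((List.finRange n).filterMap (hitExt D E l c)).isEmpty ↔
      ∀ j, hitExt D E l c j = none := by
    simp [List.isEmpty_iff]
  rw [extend_eq]
  split_ifs with h
  · rw [hemp] at h
    simp [h]
  · rw [hemp] at h
    simp [h]

theorem hitExt_eq_some {l : Fin L} {c c' : Cand L n D.w} {j : Fin n} :
    hitExt D E l c j = some c' ↔ ∃ h, E l j = some h ∧
      D.chi2 l (D.predict l c.state) h < D.chi0 ∧
      c' = Cand.mk (Function.update c.hits l (some j)) (D.kalman l (D.predict l c.state) h)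
        (c.chi + (D.chi2 l (D.predict l c.state) h).toNat) c.ghosts := by
  rw [hitExt]
  cases E l j with
  | none => simp
  | some h =>
    simp only [Option.bind_some, Option.some.injEq, exists_eq_left']
    split_ifs with hc
    · simp [hc, eq_comm]
    · simp [hc]

theorem Fresh.extend {l : Fin L} {c c' : Cand L n D.w} (h : Fresh l.val c)
    (hc' : c' ∈ extend D E l c) : Fresh (l.val + 1) c' := by
  rcases mem_extend.mp hc' with ⟨j, hj⟩ | ⟨-, rfl⟩
  · obtain ⟨x, -, -, rfl⟩ := hitExt_eq_some.mp hj
    refine ⟨fun l' hl' => ?_, h.ghosts.trans (Nat.le_succ _), ?_⟩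
    · have : l' ≠ l := by rintro rfl; omega
      simp only [Function.update_of_ne this]
      exact h.hits l' (by omega)
    · have h1 := h.chi
      have h2 := (D.chi2 l (D.predict l c.state) x).isLt
      simp only [add_mul, one_mul]
      omega
  · refine ⟨fun l' hl' => h.hits l' (by omega), Nat.succ_le_succ h.ghosts, ?_⟩
    exact h.chi.trans (Nat.mul_le_mul_right _ (Nat.le_succ _))

theorem update_hits_of_mem_extend {l : Fin L} {c c' : Cand L n D.w} (h : c.hits l = none)
    (hc' : c' ∈ extend D E l c) : Function.update c'.hits l none = c.hits := by
  rcases mem_extend.mp hc' with ⟨j, hj⟩ | ⟨-, rfl⟩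
  · obtain ⟨x, -, -, rfl⟩ := hitExt_eq_some.mp hj
    simp only [Function.update_idem]
    rw [← h, Function.update_eq_self]
  · rw [ghostExt]
    simp only
    rw [← h, Function.update_eq_self]

theorem nodup_hits_extend (l : Fin L) (c : Cand L n D.w) :
    ((extend D E l c).map Cand.hits).Nodup := by
  rw [extend_eq]
  split_ifs
  · simp
  · rw [List.Nodup, List.pairwise_map]
    refine List.Pairwise.filterMap (R := (· ≠ ·)) _ ?_ (List.nodup_finRange n)
    intro a b hab c₁ h₁ c₂ h₂ heq
    obtain ⟨x, -, -, rfl⟩ := hitExt_eq_some.mp h₁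
    obtain ⟨y, -, -, rfl⟩ := hitExt_eq_some.mp h₂
    have := congrFun heq l
    simp only [Function.update_self, Option.some.injEq] at this
    exact hab this

/-- Blanking the entry `l` recovers the parent, so children of different parents differ; children of
one parent differ in the entry `l`. Distinct tracks have distinct keys, which bisection needs in
order to single out one candidate. -/
theorem nodup_hits_pool {l : Fin L} {cs : List (Cand L n D.w)} (hcs : (cs.map Cand.hits).Nodup)
    (hfresh : ∀ c ∈ cs, Fresh l.val c) : ((pool D E l cs).map Cand.hits).Nodup := by
  refine List.Nodup.sublist (List.filter_sublist.map _) ?_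
  rw [List.map_flatMap, List.nodup_flatMap]
  refine ⟨fun c _ => nodup_hits_extend l c, ?_⟩
  rw [List.Nodup, List.pairwise_map] at hcs
  refine List.Pairwise.imp_of_mem ?_ hcs
  intro c₁ c₂ h₁ h₂ hne t ht₁ ht₂
  obtain ⟨a, ha, rfl⟩ := List.mem_map.mp ht₁
  obtain ⟨b, hb, hab⟩ := List.mem_map.mp ht₂
  apply hne
  rw [← update_hits_of_mem_extend ((hfresh c₁ h₁).hits l le_rfl) ha,
    ← update_hits_of_mem_extend ((hfresh c₂ h₂).hits l le_rfl) hb, hab]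

theorem nodup_key_of_nodup_hits {cs : List (Cand L n D.w)} (h : (cs.map Cand.hits).Nodup) :
    (cs.map (key D)).Nodup := by
  rw [List.Nodup, List.pairwise_map] at h ⊢
  exact h.imp fun hne heq => hne (hits_eq_of_key_eq heq)

theorem pairwise_lt_sortCands {cs : List (Cand L n D.w)} (h : (cs.map (key D)).Nodup) :
    (sortCands D cs).Pairwise fun a b => key D a < key D b := by
  have h1 : ((sortCands D cs).map (key D)).Nodup :=
    ((List.perm_insertionSort _ cs).map _).nodup_iff.mpr h
  rw [List.Nodup, List.pairwise_map] at h1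
  exact ((pairwise_sortCands D cs).and h1).imp fun h => lt_of_le_of_ne h.1 h.2

theorem foldl_drop_finRange {β : Type} (g : β → Fin L → β) (P : ℕ → β → Prop)
    (step : ∀ (l : Fin L) (b : β), P l.val b → P (l.val + 1) (g b l)) {k : ℕ} (hk : k ≤ L) (b : β)
    (h : P k b) : P L (((List.finRange L).drop k).foldl g b) := by
  induction hd : L - k generalizing k b with
  | zero =>
    have : k = L := by omega
    subst this
    rw [List.drop_eq_nil_of_le (by simp)]
    exact h
  | succ d ih =>
    have hlt : k < L := by omega
    rw [List.drop_eq_getElem_cons (by simpa using hlt), List.foldl_cons]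
    refine ih (k := k + 1) (by omega) _ ?_ (by omega)
    have := step ⟨k, hlt⟩ b h
    simpa using this

/-- The candidates of the seed `(j0, j1, j2)`. -/
def seedCands (D : Detector L) (E : Event L n D.w) (hL : 3 ≤ L) (lam : ℕ) (j0 j1 j2 : Fin n) :
    List (Cand L n D.w) :=
  ((List.finRange L).drop 3).foldl (findStep D E lam) (seed D E hL j0 j1 j2).toList

theorem findStep_nil (l : Fin L) : findStep D E lam [] l = [] := by
  simp [findStep_eq, pool, sortCands]

/-- A bad triplet contributes the empty list, which `findStep` preserves. The candidates can
therefore be indexed by all triplets, as in the superposition. -/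
theorem mem_found {c : Cand L n D.w} :
    c ∈ found D E hL lam ↔ ∃ j0 j1 j2, c ∈ seedCands D E hL lam j0 j1 j2 := by
  have hnil : ∀ ls : List (Fin L), ls.foldl (findStep D E lam) [] = [] := by
    intro ls
    induction ls with
    | nil => rfl
    | cons l ls ih => rw [List.foldl_cons, findStep_nil, ih]
  simp only [found, seeds, List.mem_flatMap, List.mem_finRange, true_and, List.mem_filterMap]
  constructor
  · rintro ⟨s, ⟨j0, j1, j2, hs⟩, hc⟩
    exact ⟨j0, j1, j2, by rw [seedCands, hs]; exact hc⟩
  · rintro ⟨j0, j1, j2, hc⟩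
    rw [seedCands] at hc
    cases hs : seed D E hL j0 j1 j2 with
    | none => rw [hs, Option.toList_none, hnil] at hc; exact absurd hc List.not_mem_nil
    | some s => exact ⟨s, ⟨j0, j1, j2, hs⟩, by rw [hs] at hc; exact hc⟩

theorem mem_pool {l : Fin L} {cs : List (Cand L n D.w)} {c : Cand L n D.w} :
    c ∈ pool D E l cs ↔ (∃ c₀ ∈ cs, c ∈ extend D E l c₀) ∧ Passes D c := by
  simp [pool]

theorem LayerInv.findStep {l : Fin L} {cs : List (Cand L n D.w)} (h : LayerInv lam l.val cs) :
    LayerInv lam (l.val + 1) (findStep D E lam cs l) := by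
  rw [findStep_eq]
  refine ⟨by rw [List.length_take]; exact min_le_left _ _, ?_, fun c hc => ?_⟩
  · refine List.Nodup.sublist ((List.take_sublist _ _).map _) ?_
    exact ((List.perm_insertionSort _ _).map _).nodup_iff.mpr (nodup_hits_pool h.nodup h.fresh)
  · obtain ⟨c₀, h₀, hc₀⟩ := (mem_pool.mp (mem_sortCands.mp (List.mem_of_mem_take hc))).1
    exact (h.fresh c₀ h₀).extend hc₀

theorem ListInv.findStep {l : Fin L} {j0 j1 j2 : Fin n} {cs : List (Cand L n D.w)}
    (h : ListInv lam l.val j0 j1 j2 hL cs) :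
    ListInv lam (l.val + 1) j0 j1 j2 hL (findStep D E lam cs l) := by
  have hmem : ∀ c ∈ CTF.findStep D E lam cs l, ∃ c₀ ∈ cs, c ∈ extend D E l c₀ :=
    fun c hc => (mem_pool.mp (mem_sortCands.mp (List.mem_of_mem_take hc))).1
  have hhit : ∀ (i : Fin L) (j : Fin n), i.val < 3 → (∀ c ∈ cs, c.hits i = some j) →
      ∀ c ∈ CTF.findStep D E lam cs l, c.hits i = some j := by
    intro i j hi hj c hc
    obtain ⟨c₀, h₀, hc₀⟩ := hmem c hc
    rw [← hj c₀ h₀, ← update_hits_of_mem_extend ((h.fresh c₀ h₀).hits l le_rfl) hc₀,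
      Function.update_of_ne]
    have := h.three_le
    rintro rfl; omega
  exact ⟨h.toLayerInv.findStep, hhit _ _ (by simp) h.hit0,
    hhit _ _ (by simp) h.hit1, hhit _ _ (by simp) h.hit2, h.three_le.trans (Nat.le_succ _)⟩

theorem seed_eq_some {j0 j1 j2 : Fin n} {s : Cand L n D.w} :
    seed D E hL j0 j1 j2 = some s ↔ ∃ h0 h1 h2, E ⟨0, by omega⟩ j0 = some h0 ∧
      E ⟨1, by omega⟩ j1 = some h1 ∧ E ⟨2, by omega⟩ j2 = some h2 ∧ D.seedGood h0 h1 h2 ∧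
      s = Cand.mk (fun l => if l.val = 0 then some j0 else if l.val = 1 then some j1
          else if l.val = 2 then some j2 else none)
        (D.initState h0 h1 h2) (D.initChi h0 h1 h2).toNat 0 := by
  rw [seed]
  constructor
  · intro h
    obtain ⟨h0, e0, h⟩ := Option.bind_eq_some_iff.mp h
    obtain ⟨h1, e1, h⟩ := Option.bind_eq_some_iff.mp h
    obtain ⟨h2, e2, h⟩ := Option.bind_eq_some_iff.mp h
    by_cases hg : D.seedGood h0 h1 h2
    · rw [if_pos hg, Option.some.injEq] at h
      exact ⟨h0, h1, h2, e0, e1, e2, hg, h.symm⟩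
    · rw [if_neg hg] at h
      exact absurd h (by simp)
  · rintro ⟨h0, h1, h2, e0, e1, e2, hg, rfl⟩
    rw [e0, Option.bind_some, e1, Option.bind_some, e2, Option.bind_some, if_pos hg]

theorem layerInv_seed (hlam : 1 ≤ lam) (j0 j1 j2 : Fin n) :
    LayerInv lam 3 (seed D E hL j0 j1 j2).toList := by
  cases hs : seed D E hL j0 j1 j2 with
  | none => constructor <;> simp
  | some s =>
    obtain ⟨h0, h1, h2, -, -, -, -, rfl⟩ := seed_eq_some.mp hs
    have hb := (D.initChi h0 h1 h2).isLt
    constructor <;> simp [hlam]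
    refine ⟨fun l hl => ?_, Nat.zero_le _, ?_⟩
    · have e0 : l.val ≠ 0 := by omega
      have e1 : l.val ≠ 1 := by omega
      have e2 : l.val ≠ 2 := by omega
      simp [e0, e1, e2]
    · simp only; omega

theorem listInv_seed (hlam : 1 ≤ lam) (j0 j1 j2 : Fin n) :
    ListInv lam 3 j0 j1 j2 hL (seed D E hL j0 j1 j2).toList := by
  refine ⟨layerInv_seed hlam j0 j1 j2, ?_, ?_, ?_, le_rfl⟩ <;>
  · intro c hc
    rw [Option.mem_toList, seed_eq_some] at hc
    obtain ⟨h0, h1, h2, -, -, -, -, rfl⟩ := hc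
    simp

theorem listInv_seedCands (hlam : 1 ≤ lam) (j0 j1 j2 : Fin n) :
    ListInv lam L j0 j1 j2 hL (seedCands D E hL lam j0 j1 j2) :=
  foldl_drop_finRange _ (fun k cs => ListInv lam k j0 j1 j2 hL cs) (fun _ _ h => h.findStep) hL _
    (listInv_seed hlam j0 j1 j2)

theorem one_le_rOf {f : ℚ} (hf : 0 < f) {t : Track L n} {l : Fin L} (h : (t l).isSome) :
    1 ≤ rOf f t := by
  rw [rOf, Nat.one_le_ceil_iff]
  have : 0 < numHits t := Finset.card_pos.mpr ⟨l, by simp [h]⟩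
  have : (0 : ℚ) < numHits t := by exact_mod_cast this
  positivity

/-- Seed hits are never removed. Without a hit, a track would overlap everything while inserting no
tuple, and the tree would not see it. -/
theorem one_le_rOf_of_mem_found {f : ℚ} (hf : 0 < f) (hlam : 1 ≤ lam) {c : Cand L n D.w}
    (hc : c ∈ found D E hL lam) : 1 ≤ rOf f c.hits := by
  obtain ⟨j0, j1, j2, hc⟩ := mem_found.mp hc
  exact one_le_rOf hf (l := ⟨0, by omega⟩)
    (by rw [(listInv_seedCands hlam j0 j1 j2).hit0 c hc]; rfl)

/-- A bound for all keys. -/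
theorem key_lt {c : Cand L n D.w} {k : ℕ} (hg : c.ghosts ≤ k) (hc : c.chi ≤ k * 2 ^ D.w) :
    key D c < (2 ^ D.w * k + 2 ^ D.w * (k * 2 ^ D.w) + 1) * (n + 1) ^ L := by
  have h1 : penalty D c ≤ 2 ^ D.w * k + 2 ^ D.w * (k * 2 ^ D.w) :=
    Nat.add_le_add (Nat.mul_le_mul D.unit.isLt.le hg) (Nat.mul_le_mul D.omega.isLt.le hc)
  have h2 := code_lt c.hits
  calc key D c < penalty D c * (n + 1) ^ L + (n + 1) ^ L := Nat.add_lt_add_left h2 _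
    _ = (penalty D c + 1) * (n + 1) ^ L := by ring
    _ ≤ _ := Nat.mul_le_mul_right _ (by omega)

end CTF

namespace CTF

variable {L n R W : ℕ}

/-! ## Candidates in registers -/

/-- The value of a hit register. -/
def hval {w : ℕ} : Option (BitVec w) → ℕ
  | none => 0
  | some m => m.toNat + 1

theorem hval_le {w : ℕ} (o : Option (BitVec w)) : hval o ≤ 2 ^ w := by
  cases o with
  | none => exact Nat.zero_le _
  | some m => exact m.isLt

theorem toWord_ofNat {w : ℕ} (hw : w < W) (v : BitVec w) :
    toWord w (BitVec.ofNat W v.toNat) = v := by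
  rw [toWord, BitVec.toNat_ofNat, Nat.mod_eq_of_lt, BitVec.ofNat_toNat, BitVec.setWidth_eq]
  exact v.isLt.trans (Nat.pow_lt_pow_right (by norm_num) hw)

theorem toHit_ofNat {w : ℕ} (hw : w < W) (o : Option (BitVec w)) :
    toHit w (BitVec.ofNat W (hval o)) = o := by
  rw [toHit, BitVec.toNat_ofNat,
    Nat.mod_eq_of_lt ((hval_le o).trans_lt (Nat.pow_lt_pow_right (by norm_num) hw))]
  cases o with
  | none => rfl
  | some m => simp [hval]

theorem hitWord_ofNat {w : ℕ} (hw : w < W) (o : Option (BitVec w)) :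
    hitWord w (BitVec.ofNat W (hval o)) = o.getD 0 := by
  rw [hitWord, toHit_ofNat hw]

/-- Hit number `j` of layer `l`, for any number `j`. -/
def hitAt {w : ℕ} (E : Event L n w) (l : Fin L) (j : ℕ) : Option (BitVec w) :=
  if h : j < n then E l ⟨j, h⟩ else none

/-- The components of a candidate. -/
inductive Fld (L : ℕ)
  | ok | st | chi | gh
  | trk (l : Fin L)

/-- All components. -/
def Fld.all (L : ℕ) : List (Fld L) := [ok, st, chi, gh] ++ (List.finRange L).map trk

theorem Fld.mem_all (x : Fld L) : x ∈ Fld.all L := by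
  cases x <;> simp [Fld.all]

theorem Fld.length_all : (Fld.all L).length = L + 4 := by
  simp [Fld.all]

/-- The registers of a candidate. -/
abbrev Slot (L : ℕ) := Fld L → ℕ

def fval {w : ℕ} : Fld L → Cand L n w → ℕ
  | .ok, _ => 1
  | .st, c => c.state.toNat
  | .chi, c => c.chi
  | .gh, c => c.ghosts
  | .trk l, c => digit (c.hits l)

/-- The value of a component; all components of no candidate are `0`. -/
def oval {w : ℕ} (o : Option (Cand L n w)) (x : Fld L) : ℕ := o.elim 0 (fval x)

section Prog

variable [NeZero R]

theorem runsD_loadHit {V : Env L n} {w : World R W} {l : Fin L} {r j : ℕ} (h : Has w r j)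
    (hj : j < 2 ^ W) :
    RunsD V (op (.loadHit l (rg r))) w fun s w' => Has w' s (hval (hitAt V.E l j)) := by
  refine runsD_op ?_
  rw [Expr.eval, h.2, hitAt]
  have : (BitVec.ofNat W j).toNat = j := by rw [BitVec.toNat_ofNat, Nat.mod_eq_of_lt hj]
  simp only [this]
  split_ifs with hjn
  · cases V.E l ⟨j, hjn⟩ <;> rfl
  · rfl

theorem runsD_predict {V : Env L n} {w : World R W} (hw : V.D.w < W) {l : Fin L} {r : ℕ}
    {p : BitVec V.D.w} (h : Has w r p.toNat) :
    RunsD V (op (.predict l (rg r))) w fun s w' => Has w' s (V.D.predict l p).toNat := by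
  refine runsD_op ?_
  rw [Expr.eval, h.2, toWord_ofNat hw]; rfl

theorem runsD_ghost {V : Env L n} {w : World R W} (hw : V.D.w < W) {l : Fin L} {r : ℕ}
    {p : BitVec V.D.w} (h : Has w r p.toNat) :
    RunsD V (op (.ghost l (rg r))) w fun s w' => Has w' s (V.D.ghost l p).toNat := by
  refine runsD_op ?_
  rw [Expr.eval, h.2, toWord_ofNat hw]; rfl

theorem runsD_chi2 {V : Env L n} {w : World R W} (hw : V.D.w < W) {l : Fin L} {r s : ℕ}
    {p : BitVec V.D.w} {m : Option (BitVec V.D.w)} (h : Has w r p.toNat) (hs : Has w s (hval m)) :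
    RunsD V (op (.chi2 l (rg r) (rg s))) w fun s w' =>
      Has w' s (V.D.chi2 l p (m.getD 0)).toNat := by
  refine runsD_op ?_
  rw [Expr.eval, h.2, hs.2, toWord_ofNat hw, hitWord_ofNat hw]; rfl

theorem runsD_kalman {V : Env L n} {w : World R W} (hw : V.D.w < W) {l : Fin L} {r s : ℕ}
    {p : BitVec V.D.w} {m : Option (BitVec V.D.w)} (h : Has w r p.toNat) (hs : Has w s (hval m)) :
    RunsD V (op (.kalman l (rg r) (rg s))) w fun s w' =>
      Has w' s (V.D.kalman l p (m.getD 0)).toNat := by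
  refine runsD_op ?_
  rw [Expr.eval, h.2, hs.2, toWord_ofNat hw, hitWord_ofNat hw]; rfl

theorem runsD_initState {V : Env L n} {w : World R W} (hw : V.D.w < W) {r s t : ℕ}
    {m₀ m₁ m₂ : Option (BitVec V.D.w)} (h₀ : Has w r (hval m₀)) (h₁ : Has w s (hval m₁))
    (h₂ : Has w t (hval m₂)) :
    RunsD V (op (.initState (rg r) (rg s) (rg t))) w fun s w' =>
      Has w' s (V.D.initState (m₀.getD 0) (m₁.getD 0) (m₂.getD 0)).toNat := by
  refine runsD_op ?_
  rw [Expr.eval, h₀.2, h₁.2, h₂.2, hitWord_ofNat hw, hitWord_ofNat hw, hitWord_ofNat hw]; rfl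

theorem runsD_initChi {V : Env L n} {w : World R W} (hw : V.D.w < W) {r s t : ℕ}
    {m₀ m₁ m₂ : Option (BitVec V.D.w)} (h₀ : Has w r (hval m₀)) (h₁ : Has w s (hval m₁))
    (h₂ : Has w t (hval m₂)) :
    RunsD V (op (.initChi (rg r) (rg s) (rg t))) w fun s w' =>
      Has w' s (V.D.initChi (m₀.getD 0) (m₁.getD 0) (m₂.getD 0)).toNat := by
  refine runsD_op ?_
  rw [Expr.eval, h₀.2, h₁.2, h₂.2, hitWord_ofNat hw, hitWord_ofNat hw, hitWord_ofNat hw]; rfl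

theorem runsD_seedGood {V : Env L n} {w : World R W} (hw : V.D.w < W) {r s t : ℕ}
    {m₀ m₁ m₂ : Option (BitVec V.D.w)} (h₀ : Has w r (hval m₀)) (h₁ : Has w s (hval m₁))
    (h₂ : Has w t (hval m₂)) :
    RunsD V (op (.seedGood (rg r) (rg s) (rg t))) w fun s w' =>
      Has w' s (if V.D.seedGood (m₀.getD 0) (m₁.getD 0) (m₂.getD 0) then 1 else 0) := by
  refine runsD_op ?_
  rw [Expr.eval, h₀.2, h₁.2, h₂.2, hitWord_ofNat hw, hitWord_ofNat hw, hitWord_ofNat hw]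
  split_ifs <;> rfl

theorem runsD_selected {V : Env L n} {w : World R W} (hw : V.D.w < W) {t : Fin L → ℕ}
    {m : Fin L → Option (BitVec V.D.w)} (h : ∀ l, Has w (t l) (hval (m l))) :
    RunsD V (op (.selected fun l => rg (t l))) w fun s w' =>
      Has w' s (if V.D.threshold ≤ V.D.refit m then 1 else 0) := by
  refine runsD_op ?_
  have : (fun l => toHit V.D.w (w.cfg (rg (t l)))) = m := by
    funext l
    rw [(h l).2, toHit_ofNat hw]
  rw [Expr.eval, this]
  split_ifs <;> rfl

/-- Compute one number for every component. -/
noncomputable def tabulate (e : Fld L → Ex) : Bld L R W (Slot L) :=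
  open Classical in
  (Fld.all L).foldlM (fun g x => do
    let r ← comp (e x)
    pure (Function.update g x r)) fun _ => 0

theorem len_tabulate {e : Fld L → Ex} {N : ℕ} (h : ∀ x, (e x).size ≤ N) :
    (tabulate e : Bld L R W (Slot L)).Len ((L + 4) * N) := by
  classical
  refine (Bld.len_foldlM (N := N) _ (fun g x _ => ?_) _).mono (by rw [Fld.length_all])
  exact ((len_comp_le (h x)).bind fun r => Bld.len_pure _).mono le_rfl

theorem runsD_tabulate {V : Env L n} {w : World R W} {e : Fld L → Ex} {v : Fld L → ℕ}
    (h : ∀ x, Ev w (e x) (v x)) :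
    RunsD V (tabulate e) w fun s w' => ∀ x, Has w' (s x) (v x) := by
  classical
  refine (RunsD.foldlM (w₀ := w) (fun rest g w' => ∀ x, x ∉ rest → Has w' (g x) (v x)) ?_ _ _ w
    le_rfl fun x hx => absurd (Fld.mem_all x) hx).imp fun s w' _ hs x => hs x List.not_mem_nil
  intro x rest g w' hw' hg
  refine (runsD_comp ((h x).mono hw')).bind fun r w'' hw'' hr => RunsD.pure fun y hy => ?_
  by_cases hyx : y = x
  · subst hyx
    rwa [Function.update_self]
  · rw [Function.update_of_ne hyx]
    exact (hg y (by simp [hyx, hy])).mono hw''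

/-- The registers `s` hold the candidate `o`. -/
def Rep {w : ℕ} (wd : World R W) (s : Slot L) (o : Option (Cand L n w)) : Prop :=
  ∀ x, Has wd (s x) (oval o x)

theorem Rep.mono {w : ℕ} {wd wd' : World R W} {s : Slot L} {o : Option (Cand L n w)}
    (h : Rep wd s o) (hw : wd ≤ wd') : Rep wd' s o := fun x => (h x).mono hw

/-- The sum of expressions. -/
def sumEx {ι : Type} (e : ι → Ex) : List ι → Ex
  | [] => .num 0
  | i :: l => e i + sumEx e l

theorem size_sumEx {ι : Type} {e : ι → Ex} {N : ℕ} (h : ∀ i, (e i).size ≤ N) (l : List ι) :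
    (sumEx e l).size ≤ l.length * (N + 1) + 1 := by
  induction l with
  | nil => simp [sumEx, Ex.size]
  | cons i l ih =>
    rw [sumEx, Ex.size_add, List.length_cons, add_mul]
    have := h i
    omega

theorem Ev.sum {ι : Type} {w : World R W} {e : ι → Ex} {v : ι → ℕ} {l : List ι}
    (h : ∀ i ∈ l, Ev w (e i) (v i)) : Ev w (sumEx e l) (l.map v).sum := by
  induction l with
  | nil => exact .num 0
  | cons i l ih =>
    rw [List.map_cons, List.sum_cons]
    exact .add (h i List.mem_cons_self) (ih fun j hj => h j (List.mem_cons_of_mem _ hj))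

theorem Ev.cast {w : World R W} {e : Ex} {u v : ℕ} (h : Ev w e u) (huv : u = v) : Ev w e v :=
  huv ▸ h

/-- Choose one of `N` registers. -/
def muxEx (sel : ℕ → Ex) (N : ℕ) (r : ℕ → ℕ) : Ex :=
  sumEx (fun q => sel q * .reg (r q)) (List.range N)

theorem size_muxEx {sel : ℕ → Ex} {M : ℕ} (h : ∀ q, (sel q).size ≤ M) (N : ℕ) (r : ℕ → ℕ) :
    (muxEx sel N r).size ≤ N * (M + 2) + 1 := by
  refine (size_sumEx (N := M + 1) (fun q => ?_) _).trans (by rw [List.length_range])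
  rw [Ex.size_mul, Ex.size_reg]
  have := h q
  omega

/-- The selectors are one-hot, so the sum of products picks one value; a number outside the range
yields `0`, the representation of no candidate. -/
theorem Ev.mux {w : World R W} {sel : ℕ → Ex} {N : ℕ} {r v : ℕ → ℕ} {q : ℕ}
    (hsel : ∀ i < N, Ev w (sel i) (if i = q then 1 else 0)) (h : ∀ i < N, Has w (r i) (v i)) :
    Ev w (muxEx sel N r) (if q < N then v q else 0) := by
  refine (Ev.sum (v := fun i => (if i = q then 1 else 0) * v i) fun i hi => ?_).cast ?_
  · rw [List.mem_range] at hi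
    exact .mul (hsel i hi) (.reg (h i hi))
  · have : ((List.range N).map fun i => (if i = q then 1 else 0) * v i).sum =
        ∑ i ∈ Finset.range N, (if i = q then 1 else 0) * v i := rfl
    rw [this]
    simp [ite_mul]

/-- The key of a candidate. -/
def keyEx (D : Detector L) (n : ℕ) (s : Slot L) : Ex :=
  (.num D.unit.toNat * .reg (s .gh) + .num D.omega.toNat * .reg (s .chi)) * .num ((n + 1) ^ L) +
    sumEx (fun l => .reg (s (.trk l)) * .num ((n + 1) ^ (l : ℕ))) (List.finRange L)

theorem size_keyEx (D : Detector L) (n : ℕ) (s : Slot L) : (keyEx D n s).size ≤ 3 * L + 9 := by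
  have h1 := size_sumEx (e := fun l : Fin L => Ex.reg (s (.trk l)) * .num ((n + 1) ^ (l : ℕ)))
    (N := 2) (fun l => le_rfl) (List.finRange L)
  rw [List.length_finRange] at h1
  simp only [keyEx, Ex.size_add, Ex.size_mul, Ex.size_num, Ex.size_reg]
  omega

theorem Ev.key {D : Detector L} {w : World R W} {s : Slot L} {o : Option (Cand L n D.w)}
    (h : Rep w s o) : Ev w (keyEx D n s) (o.elim 0 (CTF.key D)) := by
  refine (Ev.add (.mul (.add (.mul (.num _) (.reg (h .gh))) (.mul (.num _) (.reg (h .chi))))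
    (.num _)) (Ev.sum fun l _ => .mul (.reg (h (.trk l))) (.num _))).cast ?_
  cases o with
  | none => simp [oval]
  | some c =>
    simp only [oval, Option.elim, fval, CTF.key, penalty, code]
    rw [Fin.sum_univ_def]

end Prog

end CTF

namespace CTF

variable {L n R W : ℕ}

/-! ## The best members of a family -/

/-- The parameters of the searches: numbers below `4 ^ m` are searched, in `I` stages with `r`
attempts each, and keys are below `2 ^ kb`. -/
structure Par where
  m : ℕ
  I : ℕ
  r : ℕ
  kb : ℕ

/-- The parameters fit to registers of `W` qubits. -/
structure Par.Fits (P : Par) (W : ℕ) : Prop where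
  m_le : 2 * P.m ≤ W
  kb_lt : P.kb < W
  stages : 3 * 2 ^ P.m ≤ 3 ^ P.I

theorem Par.Fits.lt {P : Par} (hP : P.Fits W) {a : ℕ} (h : a ≤ 2 ^ P.kb) : a < 2 ^ W :=
  h.trans_lt (Nat.pow_lt_pow_right (by norm_num) hP.kb_lt)

theorem Par.Fits.pos {P : Par} (hP : P.Fits W) : 0 < W := Nat.zero_lt_of_lt hP.kb_lt

theorem Par.Fits.idx_lt {P : Par} (hP : P.Fits W) {a : ℕ} (h : a < 2 ^ (2 * P.m)) : a < 2 ^ W :=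
  h.trans_le (Nat.pow_le_pow_right (by norm_num) hP.m_le)

/-- The error probability of a search. -/
noncomputable def Par.err (P : Par) : ℝ := (1 / 2) ^ P.r

theorem Par.err_nonneg (P : Par) : 0 ≤ P.err := by unfold Par.err; positivity

/-- The length of a search for a predicate of length `N`. -/
def Par.len (P : Par) (N : ℕ) : ℕ :=
  2 + P.I * P.r * (10 + 2 * P.m + N) + 3 ^ P.I * P.r * (2 * N + 2 * (2 * P.m) + 2)

section Prog

variable [NeZero R]

/-- A search with the given parameters. -/
def Par.search (P : Par) (pred : ℕ → Bld L R W ℕ) : Bld L R W (ℕ × ℕ) :=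
  CTF.search (2 * P.m) pred (schedule P.I P.r)

theorem Par.len_search (P : Par) {pred : ℕ → Bld L R W ℕ} {N : ℕ} (h : ∀ i, (pred i).Len N) :
    (P.search pred).Len (P.len N) := by
  refine (CTF.len_search h _).mono ?_
  rw [length_schedule, Par.len]
  have := Nat.mul_le_mul_right (2 * N + 2 * (2 * P.m) + 2) (sum_schedule_le P.I P.r)
  omega

theorem Par.runs_search {V : Env L n} {P : Par} (hP : P.Fits W) {pred : ℕ → Bld L R W ℕ}
    {S : ℕ → Prop} {w : World R W} (h : Decides V (2 * P.m) pred S w) :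
    Runs V (P.search pred) w (fun st w' =>
      FoundAt (2 * P.m) S st w' ∨ (∀ i < 2 ^ (2 * P.m), ¬ S i) ∧ Idle st w') P.err :=
  CTF.runs_search hP.m_le hP.pos hP.stages h

/-- The program `cand` computes the members of the list `pl` by number, where `fam i` is member
number `i`, if there is one. -/
structure Family (V : Env L n) (P : Par) (cand : ℕ → Bld L R W (Slot L))
    (pl : List (Cand L n V.D.w)) (fam : ℕ → Option (Cand L n V.D.w)) (w : World R W) : Prop where
  runs : ∀ i < 2 ^ (2 * P.m), ∀ r w', w ≤ w' → Has w' r i →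
    RunsD V (cand r) w' fun s w'' => Rep w'' s (fam i)
  mem : ∀ c, c ∈ pl ↔ ∃ i < 2 ^ (2 * P.m), fam i = some c
  key_lt : ∀ c ∈ pl, key V.D c < 2 ^ P.kb
  nodup : (pl.map (key V.D)).Nodup

theorem Family.mono {V : Env L n} {P : Par} {cand : ℕ → Bld L R W (Slot L)}
    {pl : List (Cand L n V.D.w)} {fam : ℕ → Option (Cand L n V.D.w)} {w w' : World R W}
    (h : Family V P cand pl fam w) (hw : w ≤ w') : Family V P cand pl fam w' :=
  ⟨fun i hi r w'' hw'' => h.runs i hi r w'' (hw.trans hw''), h.mem, h.key_lt, h.nodup⟩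

/-- Test whether a member has a key in a given range. -/
def keyIn (D : Detector L) (n : ℕ) (cand : ℕ → Bld L R W (Slot L)) (lo hi i : ℕ) :
    Bld L R W ℕ := do
  let s ← cand i
  comp (.reg (s .ok) * Ex.lt (keyEx D n s) (.reg hi) *
    Ex.eq (Ex.lt (keyEx D n s) (.reg lo)) (.num 0))

theorem len_keyIn (D : Detector L) {cand : ℕ → Bld L R W (Slot L)} {N : ℕ}
    (h : ∀ i, (cand i).Len N) (lo hi i : ℕ) :
    (keyIn D n cand lo hi i).Len (N + (6 * L + 24)) := by
  refine (h i).bind fun s => len_comp_le ?_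
  have := size_keyEx D n s
  simp only [Ex.size_mul, Ex.size_lt, Ex.size_eq, Ex.size_num, Ex.size_reg]
  omega

variable {V : Env L n} {P : Par} {cand : ℕ → Bld L R W (Slot L)} {pl : List (Cand L n V.D.w)}
  {fam : ℕ → Option (Cand L n V.D.w)} {w : World R W}

theorem Family.decides (hP : P.Fits W) (h : Family V P cand pl fam w) {rlo rhi lo hi : ℕ}
    (hlo : Has w rlo lo) (hhi : Has w rhi hi) (hlo' : lo ≤ 2 ^ P.kb) (hhi' : hi ≤ 2 ^ P.kb) :
    Decides V (2 * P.m) (keyIn V.D n cand rlo rhi)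
      (fun i => ∃ c, fam i = some c ∧ lo ≤ key V.D c ∧ key V.D c < hi) w := by
  intro i hi₀ r w' hw' hr
  refine (h.runs i hi₀ r w' hw' hr).bind fun s w'' hw'' hs => ?_
  have hk : (fam i).elim 0 (key V.D) ≤ 2 ^ P.kb := by
    cases hf : fam i with
    | none => exact Nat.zero_le _
    | some c => exact (h.key_lt c ((h.mem c).mpr ⟨i, hi₀, hf⟩)).le
  have hle := hw'.trans hw''
  have h1 : (1 : ℕ) < 2 ^ W := Nat.one_lt_two_pow (by have := hP.pos; omega)
  refine runsD_comp ((Ev.mul (.mul (.reg (hs .ok)) (.lt (Ev.key hs) (.reg (hhi.mono hle))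
    (hP.lt hk) (hP.lt hhi'))) (.eq (.lt (Ev.key hs) (.reg (hlo.mono hle)) (hP.lt hk) (hP.lt hlo'))
    (.num 0) (by split_ifs <;> omega) (by omega))).cast ?_)
  cases hf : fam i with
  | none => simp [oval, hf]
  | some c =>
    have hiff : (∃ c', fam i = some c' ∧ lo ≤ key V.D c' ∧ key V.D c' < hi) ↔
        ¬ key V.D c < lo ∧ key V.D c < hi := by simp [hf]
    simp only [oval, Option.elim, fval, hiff]
    by_cases ha : key V.D c < lo <;> by_cases hb : key V.D c < hi <;> simp [ha, hb]

/-- Binary search for the least key that is at least `lo`. -/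
def bisect (P : Par) (D : Detector L) (n : ℕ) (cand : ℕ → Bld L R W (Slot L)) (lo : ℕ) :
    ℕ → ℕ → Bld L R W ℕ
  | 0, v => pure v
  | b + 1, v => do
      let hi ← comp (.reg v + .num (2 ^ b))
      let st ← P.search (keyIn D n cand lo hi)
      let v' ← comp (.reg v + Ex.eq (.reg st.1) (.num 0) * .num (2 ^ b))
      bisect P D n cand lo b v'

theorem len_bisect (P : Par) (D : Detector L) {cand : ℕ → Bld L R W (Slot L)} {N : ℕ}
    (h : ∀ i, (cand i).Len N) (lo b v : ℕ) :
    (bisect P D n cand lo b v).Len (b * (P.len (N + (6 * L + 24)) + 7)) := by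
  induction b generalizing v with
  | zero => exact (Bld.len_pure v).mono (Nat.zero_le _)
  | succ b ih =>
    refine ((len_comp_le (N := 2) le_rfl).bind fun hi =>
      (P.len_search (len_keyIn D h lo hi)).bind fun st =>
      (len_comp_le (N := 5) le_rfl).bind fun v' => ih v').mono ?_
    rw [add_mul b 1, one_mul]
    omega

/-- The key `v` is a lower bound for the keys that are at least `lo`, and there is such a key
below `u`, or there is none at all and `u` is the upper bound for all keys. -/
def Brackets (P : Par) (D : Detector L) (pl : List (Cand L n D.w)) (lo v u : ℕ) : Prop :=
  (∀ c ∈ pl, lo ≤ key D c → v ≤ key D c) ∧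
    ((∃ c ∈ pl, lo ≤ key D c ∧ key D c < u) ∨ (∀ c ∈ pl, key D c < lo) ∧ u = 2 ^ P.kb) ∧
    u ≤ 2 ^ P.kb

/-- Each step asks, by one search, for a member with key in `[lo, v + 2 ^ b)`, which halves the
interval that contains the least key from `lo` on. If there is no such key, the lower end climbs
until the upper end is `2 ^ kb`. The `b` searches contribute one error each. -/
theorem Family.runs_bisect (hP : P.Fits W) (h : Family V P cand pl fam w) {rlo lo : ℕ}
    (hlo : Has w rlo lo) (hlo' : lo ≤ 2 ^ P.kb) (b : ℕ) {rv v : ℕ} (hv : Has w rv v)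
    (hb : Brackets P V.D pl lo v (v + 2 ^ b)) :
    Runs V (bisect P V.D n cand rlo b rv) w
      (fun r w' => ∃ v', Has w' r v' ∧ Brackets P V.D pl lo v' (v' + 1)) (b * P.err) := by
  induction b generalizing rv v w with
  | zero => exact (Runs.pure ⟨v, hv, hb⟩).imp (fun _ _ _ h => h) (by simp)
  | succ b ih =>
    have he := P.err_nonneg
    have hpos := Nat.two_pow_pos b
    have hpow : (2 : ℕ) ^ (b + 1) = 2 ^ b + 2 ^ b := by ring
    have h1 : (1 : ℕ) < 2 ^ W := Nat.one_lt_two_pow (by have := hP.pos; omega)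
    obtain ⟨hb1, hb2, hb3⟩ := hb
    refine (RunsD.bindRuns (runsD_comp (.add (.reg hv) (.num _))) (δ := P.err + b * P.err)
      (by positivity) fun rhi w₁ hw₁ hhi => ?_).imp (fun _ _ _ h => h) (by push_cast; linarith)
    refine (Par.runs_search hP ((h.mono hw₁).decides hP (hlo.mono hw₁) hhi hlo' (by omega))).bind
      (by positivity) fun st w₂ hw₂ hst => ?_
    have hle := hw₁.trans hw₂
    -- A key in the lower half: the lower end stays, and the member found is the new witness for the
    -- upper end.
    rcases hst with ⟨i, hi, ⟨c, hc, hc1, hc2⟩, hs, -⟩ | ⟨hno, hs, -⟩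
    · refine RunsD.bindRuns (runsD_comp (.add (.reg (hv.mono hle)) (.mul (.eq (.reg hs) (.num 0) h1
        (by omega)) (.num _)))) (by positivity) fun rv' w₃ hw₃ hv' => ?_
      refine ih (h.mono (hle.trans hw₃)) (hlo.mono (hle.trans hw₃)) (v := v) (by simpa using hv') ?_
      exact ⟨hb1, Or.inl ⟨c, (h.mem c).mpr ⟨i, hi, hc⟩, hc1, hc2⟩, by omega⟩
    -- No key in the lower half: the lower end moves up by `2 ^ b`, and the upper end with its
    -- witness is unchanged.
    · refine RunsD.bindRuns (runsD_comp (.add (.reg (hv.mono hle)) (.mul (.eq (.reg hs) (.num 0)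
        (by omega) (by omega)) (.num _)))) (by positivity) fun rv' w₃ hw₃ hv' => ?_
      refine ih (h.mono (hle.trans hw₃)) (hlo.mono (hle.trans hw₃)) (v := v + 2 ^ b)
        (by simpa using hv') ?_
      rw [show v + 2 ^ b + 2 ^ b = v + 2 ^ (b + 1) by omega]
      refine ⟨fun c hc hcl => ?_, hb2, hb3⟩
      by_contra hlt
      obtain ⟨i, hi, hci⟩ := (h.mem c).mp hc
      exact hno i hi ⟨c, hci, hcl, by omega⟩

/-- Find the member with the least key that is at least `lo`, and the next value of `lo`. -/
noncomputable def next (P : Par) (D : Detector L) (n : ℕ) (cand : ℕ → Bld L R W (Slot L))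
    (lo : ℕ) : Bld L R W (Slot L × ℕ) := do
  let z ← comp (.num 0)
  let v ← bisect P D n cand lo P.kb z
  let hi ← comp (.reg v + .num 1)
  let st ← P.search (keyIn D n cand lo hi)
  let s ← cand st.2
  let s' ← tabulate fun x => .reg st.1 * .reg (s x)
  pure (s', hi)

/-- The length of `next`. -/
def Par.nextLen (P : Par) (L N : ℕ) : ℕ :=
  3 + P.kb * (P.len (N + (6 * L + 24)) + 7) + P.len (N + (6 * L + 24)) + N + (L + 4)

theorem len_next (P : Par) (D : Detector L) {cand : ℕ → Bld L R W (Slot L)} {N : ℕ}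
    (h : ∀ i, (cand i).Len N) (lo : ℕ) :
    (next P D n cand lo).Len (P.nextLen L N) := by
  refine ((len_comp_le (N := 1) le_rfl).bind fun z => (len_bisect P D h lo P.kb z).bind fun v =>
    (len_comp_le (N := 2) le_rfl).bind fun hi => (P.len_search (len_keyIn D h lo hi)).bind fun st =>
    (h st.2).bind fun s => (len_tabulate (N := 1) fun x => le_rfl).bind fun s' =>
    Bld.len_pure _).mono ?_
  rw [Par.nextLen]
  omega

/-- The members with key at least `lo` are those from number `d` on. -/
def Splits (D : Detector L) (pl : List (Cand L n D.w)) (d lo : ℕ) : Prop :=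
  ∀ c ∈ pl, lo ≤ key D c ↔ c ∈ (sortCands D pl).drop d

/-- In a strictly sorted list, the member with the least key from `lo` on is the head of the
remaining part. -/
theorem Splits.drop_eq {D : Detector L} {pl : List (Cand L n D.w)} {d lo : ℕ}
    (hn : (pl.map (key D)).Nodup) (h : Splits D pl d lo) {c : Cand L n D.w} (hc : c ∈ pl)
    (hlo : lo ≤ key D c) (hmin : ∀ c' ∈ pl, lo ≤ key D c' → key D c ≤ key D c') :
    (sortCands D pl).drop d = c :: (sortCands D pl).drop (d + 1) := by
  have hs := pairwise_lt_sortCands hn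
  have hmem := (h c hc).mp hlo
  have hsd := hs.drop (i := d)
  have hd1 : (sortCands D pl).drop (d + 1) = ((sortCands D pl).drop d).tail := by
    rw [List.tail_drop]
  rw [hd1]
  cases hd : (sortCands D pl).drop d with
  | nil => rw [hd] at hmem; exact absurd hmem List.not_mem_nil
  | cons c' rest =>
    rw [hd] at hmem hsd
    rw [List.tail_cons]
    rcases List.mem_cons.mp hmem with rfl | hr
    · rfl
    · have hc' : c' ∈ pl := mem_sortCands.mp (List.mem_of_mem_drop (i := d) (by rw [hd]; simp))
      have := hmin c' hc' ((h c' hc').mpr (by rw [hd]; simp))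
      exact absurd (List.rel_of_pairwise_cons hsd hr) (by omega)

theorem Splits.succ {D : Detector L} {pl : List (Cand L n D.w)} {d lo : ℕ}
    (hn : (pl.map (key D)).Nodup) (h : Splits D pl d lo) {c : Cand L n D.w} (hc : c ∈ pl)
    (hlo : lo ≤ key D c) (hmin : ∀ c' ∈ pl, lo ≤ key D c' → key D c ≤ key D c') :
    Splits D pl (d + 1) (key D c + 1) := by
  have hd := h.drop_eq hn hc hlo hmin
  have hsd := (pairwise_lt_sortCands hn).drop (i := d)
  rw [hd] at hsd
  intro c' hc'
  constructor
  · intro hlt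
    have := (h c' hc').mp (by omega)
    rw [hd] at this
    rcases List.mem_cons.mp this with rfl | hr
    · omega
    · exact hr
  · intro hr
    exact List.rel_of_pairwise_cons hsd hr

/-- Bisection yields the least key `v` only. One more search in `[lo, v + 1)` finds its owner, and
`v + 1` is the bound for the next call; hence `kb + 1` searches. -/
theorem Family.runs_next (hP : P.Fits W) (h : Family V P cand pl fam w) {rlo lo d : ℕ}
    (hlo : Has w rlo lo) (hlo' : lo ≤ 2 ^ P.kb) (hd : Splits V.D pl d lo) :
    Runs V (next P V.D n cand rlo) w (fun a w' => Rep w' a.1 (sortCands V.D pl)[d]? ∧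
      ∃ lo', Has w' a.2 lo' ∧ lo' ≤ 2 ^ P.kb ∧ Splits V.D pl (d + 1) lo')
      ((P.kb + 1) * P.err) := by
  have he := P.err_nonneg
  refine RunsD.bindRuns (runsD_comp (.num 0)) (by positivity) fun rz w₁ hw₁ hz => ?_
  refine ((h.mono hw₁).runs_bisect hP (hlo.mono hw₁) hlo' P.kb hz ?_).bind he
    (fun rv w₂ hw₂ hv => ?_)
    |>.imp (fun _ _ _ h => h) (by linarith)
  · refine ⟨fun c _ _ => Nat.zero_le _, ?_, by omega⟩
    by_cases hex : ∃ c ∈ pl, lo ≤ key V.D c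
    · obtain ⟨c, hc, hcl⟩ := hex
      exact Or.inl ⟨c, hc, hcl, by have := h.key_lt c hc; omega⟩
    · push Not at hex
      exact Or.inr ⟨hex, by omega⟩
  obtain ⟨v, hv, hb1, hb2, hb3⟩ := hv
  refine RunsD.bindRuns (runsD_comp (.add (.reg hv) (.num 1))) he fun rhi w₃ hw₃ hhi => ?_
  have hle := hw₁.trans (hw₂.trans hw₃)
  refine ((Par.runs_search hP ((h.mono hle).decides hP (hlo.mono hle) hhi hlo' hb3)).bind
    le_rfl fun st w₄ hw₄ hst => ?_).imp (fun _ _ _ h => h) (add_zero _).le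
  have key_of : ∀ c ∈ pl, lo ≤ key V.D c → key V.D c < v + 1 →
      ∀ c' ∈ pl, lo ≤ key V.D c' → key V.D c ≤ key V.D c' := by
    intro c hc h1 h2 c' hc' h3
    have := hb1 c' hc' h3
    omega
  have hle4 := hle.trans hw₄
  -- Both outcomes of the search are treated alike: the program computes whichever member the index
  -- register names and multiplies all its components by the flag, which erases it if nothing was
  -- found.
  suffices ∃ i fl, i < 2 ^ (2 * P.m) ∧ Has w₄ st.2 i ∧ Has w₄ st.1 fl ∧
      (∀ x, fl * oval (fam i) x = oval (sortCands V.D pl)[d]? x) ∧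
      Splits V.D pl (d + 1) (v + 1) by
    obtain ⟨i, fl, hi, h2, h1, hval, hsp⟩ := this
    refine RunsD.runs (RunsD.bind (h.runs i hi _ _ hle4 h2) fun s w₅ hw₅ hs => ?_)
    refine RunsD.bind (runsD_tabulate fun x => .mul (.reg (h1.mono hw₅)) (.reg (hs x)))
      fun s' w₆ hw₆ hs' => RunsD.pure ⟨fun x => ?_, v + 1, hhi.mono (hw₄.trans (hw₅.trans hw₆)),
        hb3, hsp⟩
    have := hs' x
    rwa [hval x] at this
  rcases hst with ⟨i, hi, ⟨c, hc, hc1, hc2⟩, h1, h2⟩ | ⟨hno, h1, h2⟩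
  · have hcm := (h.mem c).mpr ⟨i, hi, hc⟩
    have hmin := key_of c hcm hc1 hc2
    have hdr := hd.drop_eq h.nodup hcm hc1 hmin
    refine ⟨i, 1, hi, h2, h1, fun x => ?_, ?_⟩
    · have : (sortCands V.D pl)[d]? = some c := by
        rw [← List.head?_drop, hdr, List.head?_cons]
      rw [this, hc, one_mul]
    · have := hd.succ h.nodup hcm hc1 hmin
      have hv1 := hb1 c hcm hc1
      rwa [show key V.D c + 1 = v + 1 by omega] at this
  -- A failed search leaves only the second alternative of `Brackets`: all members are used up, and
  -- the new bound is `2 ^ kb`, above every key.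
  · rcases hb2 with ⟨c, hc, hc1, hc2⟩ | ⟨hlt, hkb⟩
    · obtain ⟨i, hi, hci⟩ := (h.mem c).mp hc
      exact absurd ⟨c, hci, hc1, hc2⟩ (hno i hi)
    · have hnil : (sortCands V.D pl).drop d = [] := by
        rw [List.eq_nil_iff_forall_not_mem]
        intro c hc
        have hcm : c ∈ pl := mem_sortCands.mp (List.mem_of_mem_drop hc)
        have := (hd c hcm).mpr hc
        have := hlt c hcm
        omega
      refine ⟨0, 0, by positivity, h2, h1, fun x => ?_, fun c hc => ⟨fun hk => ?_, fun hc' => ?_⟩⟩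
      · rw [← List.head?_drop, hnil]
        simp [oval]
      · have := h.key_lt c hc
        omega
      · rw [← List.tail_drop, hnil] at hc'
        exact absurd hc' List.not_mem_nil

/-- Find the `N` members with the least keys. -/
noncomputable def picks (P : Par) (D : Detector L) (n : ℕ) (cand : ℕ → Bld L R W (Slot L)) :
    ℕ → Bld L R W ((ℕ → Slot L) × ℕ)
  | 0 => do
      let lo ← comp (.num 0)
      pure (fun _ _ => 0, lo)
  | N + 1 => do
      let a ← picks P D n cand N
      let b ← next P D n cand a.2
      pure (Function.update a.1 N b.1, b.2)

theorem len_picks (P : Par) (D : Detector L) {cand : ℕ → Bld L R W (Slot L)} {M : ℕ}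
    (h : ∀ i, (cand i).Len M) (N : ℕ) :
    (picks P D n cand N).Len (1 + N * P.nextLen L M) := by
  induction N with
  | zero => exact ((len_comp_le (N := 1) le_rfl).bind fun _ => Bld.len_pure _).mono (by simp)
  | succ N ih =>
    refine (ih.bind fun a => (len_next P D h a.2).bind fun b => Bld.len_pure _).mono ?_
    rw [add_mul]
    omega

theorem Family.runs_picks (hP : P.Fits W) (h : Family V P cand pl fam w) (N : ℕ) :
    Runs V (picks P V.D n cand N) w (fun a w' =>
      (∀ q < N, Rep w' (a.1 q) (sortCands V.D pl)[q]?) ∧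
      ∃ lo, Has w' a.2 lo ∧ lo ≤ 2 ^ P.kb ∧ Splits V.D pl N lo) (N * ((P.kb + 1) * P.err)) := by
  have he := P.err_nonneg
  induction N with
  | zero =>
    refine (RunsD.bind (runsD_comp (.num 0)) fun lo w₁ hw₁ hlo => RunsD.pure
      ⟨fun q hq => absurd hq (Nat.not_lt_zero _), 0, hlo, Nat.zero_le _, fun c hc => ?_⟩).runs.imp
      (fun _ _ _ h => h) (by simp)
    simp [mem_sortCands, hc]
  | succ N ih =>
    refine (ih.bind (δ' := (P.kb + 1) * P.err) (by positivity) fun a w₁ hw₁ ha => ?_).imp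
      (fun _ _ _ h => h) (by push_cast; linarith)
    obtain ⟨ha, lo, hlo, hlo', hsp⟩ := ha
    refine (((h.mono hw₁).runs_next hP hlo hlo' hsp).bind le_rfl fun b w₂ hw₂ hb =>
      Runs.pure ⟨fun q hq => ?_, hb.2⟩).imp (fun _ _ _ h => h) (by simp)
    by_cases hqN : q = N
    · subst hqN
      simp only [Function.update_self]
      exact hb.1
    · simp only [Function.update_of_ne hqN]
      exact (ha q (by omega)).mono hw₂

end Prog

end CTF

namespace CTF

variable {L n R W : ℕ}

/-! ## One layer of track finding -/

/-- No hit of layer `l` continues a track with the predicted state `p`. -/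
def NoHit (D : Detector L) (E : Event L n D.w) (l : Fin L) (p : BitVec D.w) : Prop :=
  ∀ j m, hitAt E l j = some m → ¬ D.chi2 l p m < D.chi0

theorem noHit_iff {D : Detector L} {E : Event L n D.w} {l : Fin L} {c : Cand L n D.w} :
    NoHit D E l (D.predict l c.state) ↔ ∀ j, hitExt D E l c j = none := by
  constructor
  · intro h j
    by_contra hne
    obtain ⟨c', hc'⟩ := Option.ne_none_iff_exists'.mp hne
    obtain ⟨m, hm, hlt, -⟩ := hitExt_eq_some.mp hc'
    exact h j.val m (by simp [hitAt, hm]) hlt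
  · intro h j m hm hlt
    rw [hitAt] at hm
    split_ifs at hm with hj
    have := h ⟨j, hj⟩
    rw [hitExt, hm] at this
    simp [hlt] at this

open Classical in
/-- The continuation number `j` of a candidate: by hit number `j`, or by a ghost for `j = n`. -/
noncomputable def extAt (D : Detector L) (E : Event L n D.w) (l : Fin L) (c : Cand L n D.w)
    (j : ℕ) : Option (Cand L n D.w) :=
  if h : j < n then hitExt D E l c ⟨j, h⟩
  else if j = n ∧ NoHit D E l (D.predict l c.state) then some (ghostExt D l c) else none

theorem mem_extend_iff_extAt {D : Detector L} {E : Event L n D.w} {l : Fin L}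
    {c c' : Cand L n D.w} {b : ℕ} (hb : n < 2 ^ b) :
    c' ∈ extend D E l c ↔ ∃ j < 2 ^ b, extAt D E l c j = some c' := by
  rw [mem_extend, ← noHit_iff]
  constructor
  · rintro (⟨j, hj⟩ | ⟨hno, rfl⟩)
    · exact ⟨j, j.isLt.trans hb, by rw [extAt, dif_pos j.isLt]; exact hj⟩
    · exact ⟨n, hb, by rw [extAt, dif_neg (lt_irrefl n), if_pos ⟨rfl, hno⟩]⟩
  · rintro ⟨j, -, hj⟩
    rw [extAt] at hj
    split_ifs at hj with h1 h2
    · exact Or.inl ⟨_, hj⟩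
    · exact Or.inr ⟨h2.2, (Option.some.inj hj).symm⟩

/-- The continuation number `i` of a list of candidates: continuation `i % 2 ^ b` of candidate
`i / 2 ^ b`, if it is not dropped. -/
noncomputable def famOf (D : Detector L) (E : Event L n D.w) (l : Fin L)
    (cs : List (Cand L n D.w)) (b i : ℕ) : Option (Cand L n D.w) :=
  cs[i / 2 ^ b]?.bind fun c => (extAt D E l c (i % 2 ^ b)).filter fun c => Passes D c

/-- Continuation `j` of candidate `q` has the number `2 ^ b * q + j`. The numbering covers the pool
but has gaps where hits are missing or cut. -/
theorem mem_pool_iff_famOf {D : Detector L} {E : Event L n D.w} {l : Fin L}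
    {cs : List (Cand L n D.w)} {c : Cand L n D.w} {b k N : ℕ} (hb : n < 2 ^ b)
    (hcs : cs.length ≤ N) (hk : N * 2 ^ b ≤ 2 ^ k) :
    c ∈ pool D E l cs ↔ ∃ i < 2 ^ k, famOf D E l cs b i = some c := by
  have hpos := Nat.two_pow_pos b
  rw [mem_pool]
  constructor
  · rintro ⟨⟨c₀, h₀, hc⟩, hp⟩
    obtain ⟨q, hq, rfl⟩ := List.mem_iff_getElem.mp h₀
    obtain ⟨j, hj, hext⟩ := (mem_extend_iff_extAt hb).mp hc
    refine ⟨2 ^ b * q + j, ?_, ?_⟩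
    · calc 2 ^ b * q + j < 2 ^ b * (q + 1) := by rw [mul_add]; omega
        _ ≤ 2 ^ b * N := Nat.mul_le_mul_left _ (by omega)
        _ ≤ 2 ^ k := by rwa [mul_comm]
    · rw [famOf, Nat.mul_add_div hpos, Nat.div_eq_of_lt hj, Nat.mul_add_mod, Nat.mod_eq_of_lt hj,
        add_zero, List.getElem?_eq_getElem hq, Option.bind_some, hext]
      simp [hp]
  · rintro ⟨i, -, hi⟩
    rw [famOf] at hi
    obtain ⟨c₀, h₀, hi⟩ := Option.bind_eq_some_iff.mp hi
    rw [Option.filter_eq_some_iff] at hi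
    exact ⟨⟨c₀, List.mem_of_getElem? h₀, (mem_extend_iff_extAt hb).mpr
      ⟨_, Nat.mod_lt _ hpos, hi.1⟩⟩, by simpa using hi.2⟩

/-- The state of a candidate. -/
def stOf {w : ℕ} (o : Option (Cand L n w)) : BitVec w := o.elim 0 Cand.state

theorem oval_st {w : ℕ} (o : Option (Cand L n w)) : oval o .st = (stOf o).toNat := by
  cases o <;> simp [oval, stOf, fval]

/-- A bound for the total `χ²` that is equivalent to the cut and fits in a register. -/
def Detector.chiCut (D : Detector L) : ℕ := min D.maxChi (L * 2 ^ D.w)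

/-- A bound for the number of ghosts that is equivalent to the cut and fits in a register. -/
def Detector.ghostCut (D : Detector L) : ℕ := min D.maxGhosts L

/-- The parameters fit to the event and the detector: numbers up to `n` have `b` digits, and `N`
candidates can be continued at a time. -/
structure Par.Suits (P : Par) (D : Detector L) (n N b W : ℕ) : Prop extends P.Fits W where
  keys : (2 ^ D.w * L + 2 ^ D.w * (L * 2 ^ D.w) + 1) * (n + 1) ^ L ≤ 2 ^ P.kb
  lt_b : n < 2 ^ b
  idx : N * 2 ^ b ≤ 2 ^ (2 * P.m)
  one_le : 1 ≤ N
  w_lt : D.w < W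
  layers : 3 ≤ L

theorem Par.Suits.sum_le {P : Par} {D : Detector L} {N b : ℕ} (h : P.Suits D n N b W) :
    L * 2 ^ D.w + 1 ≤ 2 ^ P.kb := by
  refine le_trans ?_ ((Nat.le_mul_of_pos_right _ (by positivity)).trans h.keys)
  rw [mul_comm L]
  omega

theorem Par.Suits.n_le {P : Par} {D : Detector L} {N b : ℕ} (h : P.Suits D n N b W) :
    n + 1 ≤ 2 ^ P.kb := by
  refine le_trans ?_ ((Nat.le_mul_of_pos_left _ (by positivity)).trans h.keys)
  have := h.layers
  exact Nat.le_self_pow (by omega) _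

theorem Par.Suits.layers_le {P : Par} {D : Detector L} {N b : ℕ} (h : P.Suits D n N b W) :
    L + 1 ≤ 2 ^ P.kb :=
  le_trans (Nat.succ_le_succ (Nat.le_mul_of_pos_right _ (by positivity))) h.sum_le

section Prog

variable [NeZero R]

/-- Test whether hit number `i` continues a track with the predicted state in register `p`. -/
def goodHit (D : Detector L) (l : Fin L) (p i : ℕ) : Bld L R W ℕ := do
  let h ← op (.loadHit l (rg i))
  let c ← op (.chi2 l (rg p) (rg h))
  comp (Ex.lt (.num 0) (.reg h) * Ex.lt (.reg c) (.num D.chi0.toNat))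

theorem len_goodHit (D : Detector L) (l : Fin L) (p i : ℕ) :
    (goodHit D l p i : Bld L R W ℕ).Len 7 :=
  (len_op _).bind fun _ => (len_op _).bind fun _ => len_comp_le (N := 5) le_rfl

theorem decides_goodHit {V : Env L n} {P : Par} (hP : P.Fits W) (hw : V.D.w < W) {w : World R W}
    {l : Fin L} {rp : ℕ} {p : BitVec V.D.w} (hp : Has w rp p.toNat) :
    Decides V (2 * P.m) (goodHit V.D l rp)
      (fun i => ∃ m, hitAt V.E l i = some m ∧ V.D.chi2 l p m < V.D.chi0) w := by
  intro i hi r w' hw' hr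
  have hpow : 2 ^ V.D.w < 2 ^ W := Nat.pow_lt_pow_right (by norm_num) hw
  refine (runsD_loadHit hr (hP.idx_lt hi)).bind fun h w₁ hw₁ hh => ?_
  refine (runsD_chi2 hw (hp.mono (hw'.trans hw₁)) hh).bind fun c w₂ hw₂ hc => ?_
  refine runsD_comp ((Ev.mul (.lt (.num 0) (.reg (hh.mono hw₂)) (by positivity)
    ((hval_le _).trans_lt hpow)) (.lt (.reg hc) (.num _) ((BitVec.isLt _).trans hpow)
    ((BitVec.isLt _).trans hpow))).cast ?_)
  cases hm : hitAt V.E l i with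
  | none => simp [hval, hm]
  | some m => simp [hval, hm, BitVec.lt_def]

/-- For each of `N` candidates, compute whether it is continued by a ghost. -/
def ghostFlags (P : Par) (D : Detector L) (l : Fin L) (g : ℕ → Slot L) : ℕ → Bld L R W (ℕ → ℕ)
  | 0 => pure fun _ => 0
  | N + 1 => do
      let ga ← ghostFlags P D l g N
      let p ← op (.predict l (rg (g N .st)))
      let st ← P.search (goodHit D l p)
      let a ← comp (Ex.eq (.reg st.1) (.num 0))
      pure (Function.update ga N a)

theorem len_ghostFlags (P : Par) (D : Detector L) (l : Fin L) (g : ℕ → Slot L) (N : ℕ) :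
    (ghostFlags P D l g N : Bld L R W _).Len (N * (P.len 7 + 3)) := by
  induction N with
  | zero => exact (Bld.len_pure _).mono (Nat.zero_le _)
  | succ N ih =>
    refine (ih.bind fun ga => (len_op _).bind fun p => (P.len_search (len_goodHit D l p)).bind
      fun st => (len_comp_le (N := 2) le_rfl).bind fun a => Bld.len_pure _).mono ?_
    rw [add_mul N 1, one_mul]
    omega

open Classical in
-- Whether a candidate goes on with a ghost depends on all hits of the layer and takes a search of
-- its own. It is settled beforehand, so that the predicate in the later searches is a classical
-- computation, as `Decides` demands.
theorem runs_ghostFlags {V : Env L n} {P : Par} {N b : ℕ} (hP : P.Suits V.D n N b W)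
    {w : World R W} {l : Fin L} {g : ℕ → Slot L} {o : ℕ → Option (Cand L n V.D.w)} (M : ℕ)
    (hg : ∀ q < M, Rep w (g q) (o q)) :
    Runs V (ghostFlags P V.D l g M) w (fun ga w' => ∀ q < M, Has w' (ga q)
      (if NoHit V.D V.E l (V.D.predict l (stOf (o q))) then 1 else 0)) (M * P.err) := by
  have he := P.err_nonneg
  have hn : n < 2 ^ (2 * P.m) := hP.lt_b.trans_le
    (le_trans (Nat.le_mul_of_pos_left _ hP.one_le) hP.idx)
  have h1 : (1 : ℕ) < 2 ^ W := Nat.one_lt_two_pow (by have := hP.pos; omega)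
  induction M with
  | zero =>
    rw [Nat.cast_zero, zero_mul]
    exact Runs.pure fun q hq => absurd hq (Nat.not_lt_zero _)
  | succ M ih =>
    refine ((ih fun q hq => hg q (by omega)).bind (δ' := P.err) he fun ga w₁ hw₁ hga => ?_).imp
      (fun _ _ _ h => h) (by push_cast; linarith)
    have hst := hg M (by omega) .st
    rw [oval_st] at hst
    refine RunsD.bindRuns (runsD_predict hP.w_lt (hst.mono hw₁)) he fun p w₂ hw₂ hp => ?_
    refine ((Par.runs_search hP.toFits (decides_goodHit hP.toFits hP.w_lt hp)).bind le_rfl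
      fun st w₃ hw₃ hs => ?_).imp (fun _ _ _ h => h) (add_zero _).le
    suffices hfl : ∃ fl, Has w₃ st.1 fl ∧ fl < 2 ^ W ∧ (if fl = 0 then 1 else 0) =
        (if NoHit V.D V.E l (V.D.predict l (stOf (o M))) then 1 else 0) by
      obtain ⟨fl, h2, h3, h4⟩ := hfl
      refine RunsD.runs (RunsD.bind (runsD_comp (.eq (.reg h2) (.num 0) h3 (by omega)))
        fun a w₄ hw₄ ha => RunsD.pure fun q hq => ?_)
      by_cases hqM : q = M
      · subst hqM
        rw [Function.update_self, ← h4]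
        exact ha
      · rw [Function.update_of_ne hqM]
        exact (hga q (by omega)).mono (hw₂.trans (hw₃.trans hw₄))
    rcases hs with ⟨i, hi, ⟨m, hm, hlt⟩, hs, -⟩ | ⟨hno, hs, -⟩
    · refine ⟨1, hs, h1, ?_⟩
      have : ¬ NoHit V.D V.E l (V.D.predict l (stOf (o M))) := fun h => h i m hm hlt
      simp [this]
    · refine ⟨0, hs, by omega, ?_⟩
      have : NoHit V.D V.E l (V.D.predict l (stOf (o M))) := by
        intro j m hm hlt
        refine hno j (lt_trans ?_ hn) ⟨m, hm, hlt⟩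
        by_contra hj
        simp [hitAt, hj] at hm
      simp [this]

/-- The values of the components of the continuation by a hit `m` with the label `j`. -/
def hitVal (D : Detector L) (l : Fin L) (o : Option (Cand L n D.w)) (m : Option (BitVec D.w))
    (j : ℕ) : Fld L → ℕ
  | .ok => 1
  | .st => (D.kalman l (D.predict l (stOf o)) (m.getD 0)).toNat
  | .chi => oval o .chi + (D.chi2 l (D.predict l (stOf o)) (m.getD 0)).toNat
  | .gh => oval o .gh
  | .trk l' => if l' = l then j + 1 else oval o (.trk l')

/-- The values of the components of the continuation by a ghost. -/
def ghostVal (D : Detector L) (l : Fin L) (o : Option (Cand L n D.w)) : Fld L → ℕ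
  | .ok => 1
  | .st => (D.ghost l (D.predict l (stOf o))).toNat
  | .chi => oval o .chi
  | .gh => oval o .gh + 1
  | .trk l' => oval o (.trk l')

open Classical in
-- The continuation written without branches: each case is weighted by the product of its tests, and
-- at most one weight is nonzero, since a hit needs `j < n` and the ghost `j = n`.
theorem oval_filter_extAt (D : Detector L) (E : Event L n D.w) (l : Fin L) (c : Cand L n D.w)
    (j : ℕ) (x : Fld L) :
    oval ((extAt D E l c j).filter fun c => Passes D c) x =
      (if 0 < hval (hitAt E l j) then 1 else 0) *
        (if (D.chi2 l (D.predict l c.state) ((hitAt E l j).getD 0)).toNat < D.chi0.toNat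
          then 1 else 0) *
        (if c.chi + (D.chi2 l (D.predict l c.state) ((hitAt E l j).getD 0)).toNat ≤ D.maxChi
          then 1 else 0) *
        (if c.ghosts ≤ D.maxGhosts then 1 else 0) * hitVal D l (some c) (hitAt E l j) j x +
      (if NoHit D E l (D.predict l c.state) then 1 else 0) * (if j = n then 1 else 0) *
        (if c.chi ≤ D.maxChi then 1 else 0) * (if c.ghosts + 1 ≤ D.maxGhosts then 1 else 0) *
        ghostVal D l (some c) x := by
  by_cases hj : j < n
  · have hjn : j ≠ n := hj.ne
    rw [extAt, dif_pos hj, hitExt, hitAt, dif_pos hj]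
    simp only [hjn, if_false, mul_zero, zero_mul, add_zero]
    cases E l ⟨j, hj⟩ with
    | none => simp [hval, oval]
    | some m =>
      simp only [Option.bind_some, Option.getD_some, hval, Nat.succ_pos, if_true, one_mul,
        BitVec.lt_def]
      by_cases h1 : (D.chi2 l (D.predict l c.state) m).toNat < D.chi0.toNat
      · by_cases h2 : c.chi + (D.chi2 l (D.predict l c.state) m).toNat ≤ D.maxChi
        · by_cases h3 : c.ghosts ≤ D.maxGhosts
          · simp only [h1, h2, h3, if_true, one_mul, Passes, and_self, decide_true,
              Option.filter_some]
            cases x with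
            | trk l' =>
              by_cases hl : l' = l
              · subst hl; simp [oval, fval, hitVal, digit]
              · simp [oval, fval, hitVal, hl]
            | _ => simp [oval, fval, hitVal, stOf]
          · simp [h1, h3, Passes, oval, Option.filter_some]
        · simp [h1, h2, Passes, oval, Option.filter_some]
      · simp [h1, oval]
  · have hm : hitAt E l j = none := by simp [hitAt, hj]
    rw [extAt, dif_neg hj, hm]
    simp only [hval, lt_irrefl, if_false, zero_mul, zero_add]
    by_cases h1 : j = n
    · by_cases h2 : NoHit D E l (D.predict l c.state)
      · by_cases h3 : c.chi ≤ D.maxChi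
        · by_cases h4 : c.ghosts + 1 ≤ D.maxGhosts
          · simp only [h1, h2, h3, h4, if_true, one_mul, Passes, and_self, decide_true,
              Option.filter_some, ghostExt]
            cases x <;> simp [oval, fval, ghostVal, stOf]
          · simp [h1, h2, h4, Passes, oval, ghostExt, Option.filter_some]
        · simp [h1, h2, h3, Passes, oval, ghostExt, Option.filter_some]
      · simp [h1, h2, oval]
    · simp [h1, oval]

/-- The components of the continuation by a hit. -/
def hitFld (l : Fin L) (s : Slot L) (j k c : ℕ) : Fld L → Ex
  | .ok => .num 1
  | .st => .reg k
  | .chi => .reg (s .chi) + .reg c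
  | .gh => .reg (s .gh)
  | .trk l' => if l' = l then .reg j + .num 1 else .reg (s (.trk l'))

/-- The components of the continuation by a ghost. -/
def ghostFld (s : Slot L) (k : ℕ) : Fld L → Ex
  | .ok => .num 1
  | .st => .reg k
  | .chi => .reg (s .chi)
  | .gh => .reg (s .gh) + .num 1
  | .trk l' => .reg (s (.trk l'))

/-- The continuation number `i` of `N` candidates. -/
noncomputable def extCand (D : Detector L) (n : ℕ) (l : Fin L) (N b : ℕ) (g : ℕ → Slot L)
    (ga : ℕ → ℕ) (i : ℕ) : Bld L R W (Slot L) := do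
  let mask ← comp (.num (2 ^ b - 1))
  let j ← op (.bin .and (rg i) (rg mask))
  let s ← tabulate fun x =>
    muxEx (fun q => Ex.eq (.num (2 ^ b * q) + .reg j) (.reg i)) N fun q => g q x
  let a ← comp (muxEx (fun q => Ex.eq (.num (2 ^ b * q) + .reg j) (.reg i)) N ga)
  let h ← op (.loadHit l (rg j))
  let p ← op (.predict l (rg (s .st)))
  let c ← op (.chi2 l (rg p) (rg h))
  let k ← op (.kalman l (rg p) (rg h))
  let gs ← op (.ghost l (rg p))
  let fh ← comp (.reg (s .ok) * Ex.lt (.num 0) (.reg h) * Ex.lt (.reg c) (.num D.chi0.toNat) *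
    Ex.lt (.reg (s .chi) + .reg c) (.num (D.chiCut + 1)) *
    Ex.lt (.reg (s .gh)) (.num (D.ghostCut + 1)))
  let fg ← comp (.reg (s .ok) * .reg a * Ex.eq (.reg j) (.num n) *
    Ex.lt (.reg (s .chi)) (.num (D.chiCut + 1)) *
    Ex.lt (.reg (s .gh) + .num 1) (.num (D.ghostCut + 1)))
  tabulate fun x => .reg fh * hitFld l s j k c x + .reg fg * ghostFld s gs x

/-- The length of `extCand`. -/
def extLen (L N : ℕ) : ℕ := (L + 5) * (N * 5 + 1) + (L + 4) * 7 + 40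

theorem len_extCand (D : Detector L) (l : Fin L) (N b : ℕ) (g : ℕ → Slot L) (ga : ℕ → ℕ) (i : ℕ) :
    (extCand D n l N b g ga i : Bld L R W _).Len (extLen L N) := by
  have hsz : ∀ j (r : ℕ → ℕ),
      (muxEx (fun q => Ex.eq (.num (2 ^ b * q) + .reg j) (.reg i)) N r).size ≤ N * 5 + 1 :=
    fun j r => size_muxEx (M := 3) (fun q => le_rfl) N r
  refine ((len_comp_le (N := 1) le_rfl).bind fun mask => (len_op _).bind fun j =>
    (len_tabulate fun x => hsz j _).bind fun s => (len_comp_le (hsz j _)).bind fun a =>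
    (len_op _).bind fun h => (len_op _).bind fun p => (len_op _).bind fun c =>
    (len_op _).bind fun k => (len_op _).bind fun gs => (len_comp_le (N := 13) le_rfl).bind fun fh =>
    (len_comp_le (N := 12) le_rfl).bind fun fg =>
    len_tabulate (N := 7) fun x => ?_).mono ?_
  · simp only [Ex.size_add, Ex.size_mul, Ex.size_reg]
    have h1 : (hitFld l s j k c x).size ≤ 2 := by
      cases x <;> simp only [hitFld] <;> (try split_ifs) <;>
        simp [Ex.size_add, Ex.size_num, Ex.size_reg]
    have h2 : (ghostFld s gs x).size ≤ 2 := by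
      cases x <;> simp [ghostFld, Ex.size_add, Ex.size_num, Ex.size_reg]
    omega
  · rw [extLen, show (L + 5) * (N * 5 + 1) = (L + 4) * (N * 5 + 1) + (N * 5 + 1) by ring]
    omega

theorem runsD_and {V : Env L n} {w : World R W} {r s i b : ℕ} (hr : Has w r i)
    (hs : Has w s (2 ^ b - 1)) :
    RunsD V (op (.bin .and (rg r) (rg s))) w fun j w' => Has w' j (i % 2 ^ b) := by
  refine runsD_op ?_
  rw [Expr.eval, hr.2, hs.2, BinOp.eval, ← BitVec.ofNat_and, Nat.and_two_pow_sub_one_eq_mod]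

/-- The program computes the continuation by a hit and the one by a ghost in any case, and adds them
with the weights of `oval_filter_extAt`. Most of the proof checks that the numbers to be compared
fit into a register. -/
theorem family_extCand {V : Env L n} {P : Par} {N b : ℕ} (hP : P.Suits V.D n N b W)
    {w : World R W} {l : Fin L} {g : ℕ → Slot L} {ga : ℕ → ℕ} {cs : List (Cand L n V.D.w)}
    (hcs : cs.length ≤ N) (hnd : (cs.map Cand.hits).Nodup) (hfresh : ∀ c ∈ cs, Fresh l.val c)
    (hg : ∀ q < N, Rep w (g q) cs[q]?)
    (hga : open Classical in ∀ q < N, Has w (ga q)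
      (if NoHit V.D V.E l (V.D.predict l (stOf cs[q]?)) then 1 else 0)) :
    Family V P (extCand V.D n l N b g ga) (pool V.D V.E l cs) (famOf V.D V.E l cs b) w := by
  classical
  refine ⟨?_, fun c => mem_pool_iff_famOf hP.lt_b hcs hP.idx, ?_,
    nodup_key_of_nodup_hits (nodup_hits_pool hnd hfresh)⟩
  swap
  · intro c hc
    obtain ⟨⟨c₀, h₀, hc⟩, -⟩ := mem_pool.mp hc
    have hf := (hfresh c₀ h₀).extend hc
    have hl : l.val + 1 ≤ L := l.isLt
    exact (key_lt (hf.ghosts.trans hl) (hf.chi.trans (Nat.mul_le_mul_right _ hl))).trans_le hP.keys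
  intro i hi r w' hw' hr
  have hiW := hP.toFits.idx_lt hi
  have hpow : 2 ^ V.D.w < 2 ^ W := Nat.pow_lt_pow_right (by norm_num) hP.w_lt
  have hpb := Nat.two_pow_pos b
  set j := i % 2 ^ b with hj
  have hji : j ≤ i := Nat.mod_le _ _
  refine RunsD.bind (runsD_comp (.num _)) fun rm w₁ hw₁ hm => ?_
  refine RunsD.bind (runsD_and (hr.mono hw₁) hm) fun rj w₂ hw₂ hrj => ?_
  -- There is no division among the word operations. The quotient `i / 2 ^ b` is recognized by
  -- comparing `2 ^ b * q + j` with `i` for each of the `N` values of `q`.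
  have hsel : ∀ w₃, w₂ ≤ w₃ → ∀ q < N,
      Ev w₃ (Ex.eq (.num (2 ^ b * q) + .reg rj) (.reg r)) (if q = i / 2 ^ b then 1 else 0) := by
    intro w₃ hw₃ q hq
    have hlt : 2 ^ b * q + j < 2 ^ W := by
      refine hP.toFits.idx_lt (lt_of_lt_of_le ?_ hP.idx)
      have := Nat.mod_lt i hpb
      calc 2 ^ b * q + j < 2 ^ b * (q + 1) := by rw [mul_add]; omega
        _ ≤ 2 ^ b * N := Nat.mul_le_mul_left _ (by omega)
        _ = N * 2 ^ b := mul_comm _ _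
    refine (Ev.eq (.add (.num _) (.reg (hrj.mono hw₃))) (.reg (hr.mono (hw₁.trans (hw₂.trans hw₃))))
      hlt hiW).cast (if_congr ?_ rfl rfl)
    have hdm := Nat.div_add_mod i (2 ^ b)
    constructor
    · intro h
      have : 2 ^ b * q = 2 ^ b * (i / 2 ^ b) := by omega
      exact Nat.eq_of_mul_eq_mul_left hpb this
    · rintro rfl
      exact hdm
  set o := cs[i / 2 ^ b]? with ho
  have hout : ¬ i / 2 ^ b < N → o = none := fun h => List.getElem?_eq_none (by omega)
  refine RunsD.bind (runsD_tabulate (v := oval o) fun x => (Ev.mux (hsel w₂ le_rfl) fun q hq =>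
    (hg q hq x).mono (hw'.trans (hw₁.trans hw₂))).cast ?_) fun s w₃ hw₃ hs => ?_
  · split_ifs with h
    · rfl
    · rw [hout h]; rfl
  refine RunsD.bind (runsD_comp (Ev.mux (hsel w₃ hw₃) fun q hq =>
    (hga q hq).mono (hw'.trans (hw₁.trans (hw₂.trans hw₃))))) fun a w₄ hw₄ ha => ?_
  refine RunsD.bind (runsD_loadHit (hrj.mono (hw₃.trans hw₄)) (hji.trans_lt hiW))
    fun h w₅ hw₅ hh => ?_
  have hst := hs .st
  rw [oval_st] at hst
  refine RunsD.bind (runsD_predict hP.w_lt (hst.mono (hw₄.trans hw₅))) fun p w₆ hw₆ hp => ?_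
  set pv := V.D.predict l (stOf o)
  set m := hitAt V.E l j with hmj
  refine RunsD.bind (runsD_chi2 hP.w_lt hp (hh.mono hw₆)) fun c w₇ hw₇ hc => ?_
  refine RunsD.bind (runsD_kalman hP.w_lt (hp.mono hw₇) (hh.mono (hw₆.trans hw₇)))
    fun k w₈ hw₈ hk => ?_
  refine RunsD.bind (runsD_ghost hP.w_lt (hp.mono (hw₇.trans hw₈))) fun gs w₉ hw₉ hgs => ?_
  have hsum := hP.sum_le
  have hlay := hP.layers_le
  have hl : l.val + 1 ≤ L := l.isLt
  have hl2 : (l.val + 1) * 2 ^ V.D.w ≤ L * 2 ^ V.D.w := Nat.mul_le_mul_right _ hl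
  -- One more `χ²`, which is below `2 ^ w`, keeps the total within `L * 2 ^ w`; an empty slot counts
  -- as zero.
  have hchi : oval o .chi + 2 ^ V.D.w ≤ L * 2 ^ V.D.w := by
    rw [add_mul] at hl2
    cases hoc : o with
    | none => simp only [oval, Option.elim]; omega
    | some c₀ =>
      have := (hfresh c₀ (List.mem_of_getElem? (ho ▸ hoc))).chi
      simp only [oval, Option.elim, fval]; omega
  have hgh : oval o .gh + 1 ≤ L := by
    cases hoc : o with
    | none => simp only [oval, Option.elim]; omega
    | some c₀ =>
      have := (hfresh c₀ (List.mem_of_getElem? (ho ▸ hoc))).ghosts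
      simp only [oval, Option.elim, fval]; omega
  have hcc : V.D.chiCut + 1 < 2 ^ W :=
    hP.toFits.lt (le_trans (Nat.succ_le_succ (min_le_right _ _)) hsum)
  have hgc : V.D.ghostCut + 1 < 2 ^ W :=
    hP.toFits.lt (le_trans (Nat.succ_le_succ (min_le_right _ _)) hlay)
  have hcv := (V.D.chi2 l pv (m.getD 0)).isLt
  have hcW : oval o .chi + (V.D.chi2 l pv (m.getD 0)).toNat < 2 ^ W :=
    hP.toFits.lt (by omega)
  have hle39 := hw₄.trans (hw₅.trans (hw₆.trans (hw₇.trans (hw₈.trans hw₉))))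
  have hs9 : ∀ x, Has w₉ (s x) (oval o x) := fun x => (hs x).mono hle39
  have hc9 := hc.mono (hw₈.trans hw₉)
  have hj9 := hrj.mono (hw₃.trans hle39)
  refine RunsD.bind (runsD_comp (.mul (.mul (.mul (.mul (.reg (hs9 .ok))
    (.lt (.num 0) (.reg (hh.mono (hw₆.trans (hw₇.trans (hw₈.trans hw₉))))) (by positivity)
      ((hval_le _).trans_lt hpow)))
    (.lt (.reg hc9) (.num _) (hcv.trans hpow) ((BitVec.isLt _).trans hpow)))
    (.lt (.add (.reg (hs9 .chi)) (.reg hc9)) (.num _) hcW hcc))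
    (.lt (.reg (hs9 .gh)) (.num _) (hP.toFits.lt (by omega)) hgc))) fun fh w₁₀ hw₁₀ hfh => ?_
  refine RunsD.bind (runsD_comp (Ev.mono (.mul (.mul (.mul (.mul (.reg (hs9 .ok))
    (.reg (ha.mono (hw₅.trans (hw₆.trans (hw₇.trans (hw₈.trans hw₉)))))))
    (.eq (.reg hj9) (.num n) (hji.trans_lt hiW) (hP.toFits.lt (by have := hP.n_le; omega))))
    (.lt (.reg (hs9 .chi)) (.num _) (hP.toFits.lt (by omega)) hcc))
    (.lt (.add (.reg (hs9 .gh)) (.num 1)) (.num _) (hP.toFits.lt (by omega)) hgc)) hw₁₀))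
    fun fg w₁₁ hw₁₁ hfg => ?_
  have hle911 := hw₁₀.trans hw₁₁
  have hev1 : ∀ x, Ev w₁₁ (hitFld l s rj k c x) (hitVal V.D l o m j x) := by
    intro x
    refine Ev.mono ?_ hle911
    cases x with
    | ok => exact .num 1
    | st => exact .reg (hk.mono hw₉)
    | chi => exact .add (.reg (hs9 .chi)) (.reg hc9)
    | gh => exact .reg (hs9 .gh)
    | trk l' =>
      simp only [hitFld, hitVal]
      split_ifs
      · exact .add (.reg hj9) (.num 1)
      · exact .reg (hs9 (.trk l'))
  have hev2 : ∀ x, Ev w₁₁ (ghostFld s gs x) (ghostVal V.D l o x) := by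
    intro x
    refine Ev.mono ?_ hle911
    cases x with
    | ok => exact .num 1
    | st => exact .reg hgs
    | chi => exact .reg (hs9 .chi)
    | gh => exact .add (.reg (hs9 .gh)) (.num 1)
    | trk l' => exact .reg (hs9 (.trk l'))
  refine runsD_tabulate fun x => (Ev.add (.mul (.reg (hfh.mono hw₁₁)) (hev1 x))
    (.mul (.reg hfg) (hev2 x))).cast ?_
  have hfam : famOf V.D V.E l cs b i =
      o.bind fun c => (extAt V.D V.E l c j).filter fun c => Passes V.D c := rfl
  rw [hfam]
  cases hoc : o with
  | none => simp [oval]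
  | some c₀ =>
    have hN : i / 2 ^ b < N := by
      by_contra h
      rw [hout h] at hoc
      exact absurd hoc (by simp)
    -- The cuts may be arbitrarily large numbers. Truncated at the largest value that can occur,
    -- they fit into a register and decide the same.
    have hchiC : ∀ a, a ≤ L * 2 ^ V.D.w → (a < V.D.chiCut + 1 ↔ a ≤ V.D.maxChi) := by
      intro a ha
      rw [Nat.lt_succ_iff, Detector.chiCut, le_min_iff]
      exact and_iff_left ha
    have hghC : ∀ a, a ≤ L → (a < V.D.ghostCut + 1 ↔ a ≤ V.D.maxGhosts) := by
      intro a ha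
      rw [Nat.lt_succ_iff, Detector.ghostCut, le_min_iff]
      exact and_iff_left ha
    have hc1 : c₀.chi + 2 ^ V.D.w ≤ L * 2 ^ V.D.w := by simpa [hoc, oval, fval] using hchi
    have hg1 : c₀.ghosts + 1 ≤ L := by simpa [hoc, oval, fval] using hgh
    have e0 : pv = V.D.predict l c₀.state := by simp only [pv, hoc, stOf, Option.elim]
    rw [e0] at hcv
    rw [Option.bind_some, oval_filter_extAt, e0]
    simp only [oval, Option.elim, fval, hchiC _ (show c₀.chi + (V.D.chi2 l (V.D.predict l c₀.state)
      (m.getD 0)).toNat ≤ _ by omega), hchiC _ (show c₀.chi ≤ _ by omega),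
      hghC _ (show c₀.ghosts ≤ _ by omega), hghC _ hg1, if_pos hN, one_mul]
    rfl

/-- Continue `N` candidates to layer `l`. -/
noncomputable def layer (P : Par) (D : Detector L) (n N b : ℕ) (g : ℕ → Slot L) (l : Fin L) :
    Bld L R W (ℕ → Slot L) := do
  let ga ← ghostFlags P D l g N
  let a ← picks P D n (extCand D n l N b g ga) N
  pure a.1

/-- The length of `layer`. -/
def Par.layerLen (P : Par) (L N : ℕ) : ℕ :=
  N * (P.len 7 + 3) + (1 + N * P.nextLen L (extLen L N))

theorem len_layer (P : Par) (D : Detector L) (N b : ℕ) (g : ℕ → Slot L) (l : Fin L) :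
    (layer P D n N b g l : Bld L R W _).Len (P.layerLen L N) :=
  ((len_ghostFlags P D l g N).bind fun ga => (len_picks P D (len_extCand D l N b g ga) N).bind
    fun _ => Bld.len_pure _).mono (by rw [Par.layerLen, add_zero])

/-- For each of the `N` slots there is one search for the ghost flag and `kb + 1` searches for the
next candidate, which makes `kb + 2`. -/
theorem runs_layer {V : Env L n} {P : Par} {N b : ℕ} (hP : P.Suits V.D n N b W)
    {w : World R W} {l : Fin L} {g : ℕ → Slot L} {cs : List (Cand L n V.D.w)}
    (hcs : cs.length ≤ N) (hnd : (cs.map Cand.hits).Nodup) (hfresh : ∀ c ∈ cs, Fresh l.val c)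
    (hg : ∀ q < N, Rep w (g q) cs[q]?) :
    Runs V (layer P V.D n N b g l) w
      (fun a w' => ∀ q < N, Rep w' (a q) (findStep V.D V.E N cs l)[q]?)
      (N * ((P.kb + 2) * P.err)) := by
  have he := P.err_nonneg
  refine ((runs_ghostFlags hP N hg).bind (δ' := N * ((P.kb + 1) * P.err)) (by positivity)
    fun ga w₁ hw₁ hga => ?_).imp (fun _ _ _ h => h) (by linarith)
  refine (((family_extCand hP hcs hnd hfresh (fun q hq => (hg q hq).mono hw₁) hga).runs_picks
    hP.toFits N).bind le_rfl fun a w₂ hw₂ ha => Runs.pure fun q hq => ?_).imp (fun _ _ _ h => h)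
    (add_zero _).le
  rw [findStep_eq, List.getElem?_take_of_lt hq]
  exact ha.1 q hq

end Prog

end CTF

namespace CTF

variable {L n R W : ℕ}

/-! ## Looking up the tuples of a track -/

/-- At most one summand of `treeCell` is nonzero, so a cell holds at most one key plus one. The
content therefore fits into a register at every address. -/
theorem treeCell_le {B : ℕ} {t : Ordnode ℕ} (h : Ordnode.All (· < B) t) (a q : ℕ) (hq : 0 < q) :
    treeCell a t q ≤ B := by
  induction t generalizing q with
  | nil => exact Nat.zero_le _
  | node sz l k r ihl ihr =>
    by_cases hd : ∃ e b, b ≤ 1 ∧ a / 2 ^ e = 2 * q + b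
    · obtain ⟨e, b, hb, he⟩ := hd
      rw [treeCell_child hq hb he]
      split_ifs
      · exact ihl h.1 _ (by omega)
      · exact ihr h.2.2 _ (by omega)
    · push Not at hd
      rw [treeCell, treeCell_of_not_desc l
          (fun e he => hd e 0 (by omega) he : ∀ e, a / 2 ^ e ≠ 2 * q),
        treeCell_of_not_desc r fun e he => hd e 1 le_rfl he]
      split_ifs
      · exact h.2.1
      · exact Nat.zero_le _

theorem all_treeOf {f : ℚ} {P : ℕ → Prop} (hP : ∀ t : Track L n, ∀ k ∈ insertKeys f t, P k)
    (ts : List (Track L n)) : Ordnode.All P (treeOf f ts) := by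
  have hfold : ∀ (ks : List ℕ) {T : Ordnode ℕ}, T.Valid → Ordnode.All P T → (∀ k ∈ ks, P k) →
      Ordnode.All P (ks.foldl (fun T k => Ordnode.insert k T) T) := by
    intro ks
    induction ks with
    | nil => exact fun _ h _ => h
    | cons x ks ih =>
      intro T hv h hks
      exact ih (Ordnode.insert.valid x hv)
        ((all_insert x P hv).mpr ⟨hks x List.mem_cons_self, h⟩)
        fun k hk => hks k (List.mem_cons_of_mem _ hk)
  have : (treeOf f ts).Valid ∧ Ordnode.All P (treeOf f ts) := by
    induction ts using List.reverseRecOn with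
    | nil => exact ⟨Ordnode.valid_nil, trivial⟩
    | append_singleton ts t ih =>
      have e : treeOf f (ts ++ [t]) = insertTrack f (treeOf f ts) t := by simp [treeOf]
      rw [e, insertTrack]
      exact ⟨(foldl_insert_spec (insertKeys f t) ih.1).1, hfold _ ih.1 ih.2 (hP t)⟩
  exact this.2

theorem tupleKey_lt {i j : ℕ} (hi : i ≤ L) (hj : j ≤ L) (t : Track L n) :
    tupleKey i j t < (L + 1) ^ 2 * (n + 1) ^ L := by
  have h1 := code_lt t
  have h2 : i * (L + 1) + j + 1 ≤ (L + 1) ^ 2 := by nlinarith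
  calc tupleKey i j t < (i * (L + 1) + j) * (n + 1) ^ L + (n + 1) ^ L := Nat.add_lt_add_left h1 _
    _ = (i * (L + 1) + j + 1) * (n + 1) ^ L := by ring
    _ ≤ _ := Nat.mul_le_mul_right _ h2

theorem code_restrict (t : Track L n) (S : Finset (Fin L)) :
    code (restrict t S) = (((List.finRange L).filter fun l => l ∈ S).map
      fun l => digit (t l) * (n + 1) ^ (l : ℕ)).sum := by
  have : code (restrict t S) = ∑ l ∈ Finset.univ.filter (· ∈ S),
      digit (t l) * (n + 1) ^ (l : ℕ) := by
    rw [code, Finset.sum_filter]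
    refine Finset.sum_congr rfl fun l _ => ?_
    by_cases hl : l ∈ S <;> simp [restrict, hl, digit]
  rw [this]
  have hnd : ((List.finRange L).filter fun l => decide (l ∈ S)).Nodup :=
    (List.nodup_finRange L).filter _
  rw [← List.sum_toFinset _ hnd]
  refine Finset.sum_congr ?_ fun _ _ => rfl
  ext l; simp

theorem digit_pos_iff {o : Option (Fin n)} : 0 < digit o ↔ o.isSome := by
  cases o <;> simp [digit]

theorem ite_ite_eq_zero (p : Prop) [Decidable p] :
    (if (if p then 1 else 0) = 0 then 1 else 0 : ℕ) = if p then 0 else 1 := by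
  by_cases h : p <;> simp [h]

theorem ite_mul_ite_mul_ite {p q r : Prop} [Decidable p] [Decidable q] [Decidable r]
    {_ : Decidable (q ∧ r ∧ p)} :
    ((if p then 1 else 0) * (if q then 1 else 0) * if r then 1 else 0 : ℕ) =
      if q ∧ r ∧ p then 1 else 0 := by
  by_cases hp : p <;> by_cases hq : q <;> by_cases hr : r <;> simp [hp, hq, hr]

section Prog

variable [NeZero R]

/-- `d` steps down the search tree on the way to the key in register `k`. -/
def lookup (k : ℕ) : ℕ → Bld L R W (ℕ × ℕ)
  | 0 => do
      let a ← comp (.num 1)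
      let fl ← comp (.num 0)
      pure (a, fl)
  | d + 1 => do
      let st ← lookup k d
      let v ← op (.loadTree (rg st.1))
      let a ← comp (.num 2 * .reg st.1 + Ex.eq (Ex.lt (.reg k + .num 1) (.reg v)) (.num 0))
      let fl ← comp (Ex.eq (Ex.eq (.reg st.2 + Ex.eq (.reg v) (.reg k + .num 1)) (.num 0)) (.num 0))
      pure (a, fl)

theorem len_lookup (k d : ℕ) : (lookup k d : Bld L R W _).Len (2 + d * 17) := by
  induction d with
  | zero =>
    exact ((len_comp_le (N := 1) le_rfl).bind fun a => (len_comp_le (N := 1) le_rfl).bind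
      fun fl => Bld.len_pure (a, fl)).mono (by omega)
  | succ d ih =>
    refine (ih.bind fun st => (len_op _).bind fun v => (len_comp_le (N := 8) le_rfl).bind fun a =>
      (len_comp_le (N := 8) le_rfl).bind fun fl => Bld.len_pure _).mono ?_
    omega

theorem runsD_lookup {V : Env L n} {P : Par} (hP : P.Fits W) {w : World R W} {rk k : ℕ}
    (hk : Has w rk k) (hk' : k + 1 ≤ 2 ^ P.kb) (hT : Ordnode.All (· < 2 ^ P.kb) V.T) {d : ℕ}
    (hd : d + 1 ≤ P.kb) :
    RunsD V (lookup rk d) w fun st w' => Has w' st.1 ((probeStep V.T k)^[d] (1, 0)).1 ∧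
      Has w' st.2 ((probeStep V.T k)^[d] (1, 0)).2 ∧ ((probeStep V.T k)^[d] (1, 0)).2 ≤ 1 := by
  have h1 : (1 : ℕ) < 2 ^ W := Nat.one_lt_two_pow (by have := hP.pos; omega)
  induction d with
  | zero =>
    exact RunsD.bind (runsD_comp (.num 1)) fun a w₁ hw₁ ha => RunsD.bind (runsD_comp (.num 0))
      fun fl w₂ hw₂ hfl => RunsD.pure ⟨ha.mono hw₂, hfl, Nat.zero_le _⟩
  | succ d ih =>
    refine RunsD.bind (ih (by omega)) fun st w₁ hw₁ hst => ?_
    obtain ⟨ha, hf, hf1⟩ := hst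
    rw [Function.iterate_succ_apply']
    have haddr := probeStep_iterate_addr V.T k d
    set s := (probeStep V.T k)^[d] (1, 0)
    have haW : s.1 < 2 ^ W := haddr.trans
      (Nat.pow_lt_pow_right (by norm_num) (by have := hP.kb_lt; omega))
    have hvW := hP.lt (treeCell_le hT s.1 1 one_pos)
    refine RunsD.bind (runsD_op (v := treeCell s.1 V.T 1) ?_) fun v w₂ hw₂ hv => ?_
    · rw [Expr.eval, ha.2, BitVec.toNat_ofNat, Nat.mod_eq_of_lt haW]
    have hk2 := hk.mono (hw₁.trans hw₂)
    have hkW := hP.lt hk'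
    refine RunsD.bind (runsD_comp (.add (.mul (.num 2) (.reg (ha.mono hw₂)))
      (.eq (.lt (.add (.reg hk2) (.num 1)) (.reg hv) hkW hvW) (.num 0)
        (by split_ifs <;> omega) (by omega)))) fun a w₃ hw₃ ha' => ?_
    refine RunsD.bind (runsD_comp (Ev.mono (.eq (.eq (.add (.reg (hf.mono hw₂))
      (.eq (.reg hv) (.add (.reg hk2) (.num 1)) hvW hkW)) (.num 0) ?_ (by omega)) (.num 0)
      (by split_ifs <;> omega) (by omega)) hw₃)) fun fl w₄ hw₄ hfl => RunsD.pure ⟨?_, ?_, ?_⟩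
    · have : (2 : ℕ) < 2 ^ W := by
        have hkb := hP.kb_lt
        calc 2 < 2 ^ 2 := by norm_num
          _ ≤ 2 ^ W := Nat.pow_le_pow_right (by norm_num) (by omega)
      split_ifs <;> omega
    · rw [ite_ite_eq_zero] at ha'
      exact ha'.mono hw₄
    · rw [ite_ite_eq_zero] at hfl
      exact hfl
    · simp only [probeStep]
      split_ifs <;> omega

/-- The number of hits in the layers `ls`. -/
def countEx (s : Slot L) (ls : List (Fin L)) : Ex :=
  sumEx (fun l => Ex.lt (.num 0) (.reg (s (.trk l)))) ls

theorem size_countEx (s : Slot L) (ls : List (Fin L)) :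
    (countEx s ls).size ≤ ls.length * 3 + 1 :=
  size_sumEx (N := 2) (fun _ => le_rfl) _

/-- The registers `s` hold the track `t`. -/
def TrkRep (w : World R W) (s : Slot L) (t : Track L n) : Prop :=
  ∀ l, Has w (s (.trk l)) (digit (t l))

theorem TrkRep.mono {w w' : World R W} {s : Slot L} {t : Track L n} (h : TrkRep w s t)
    (hw : w ≤ w') : TrkRep w' s t := fun l => (h l).mono hw

theorem Ev.count {P : Par} (hP : P.Fits W) {wd : World R W} {s : Slot L}
    {t : Track L n} (h : TrkRep wd s t) (hn : n + 1 ≤ 2 ^ P.kb) (ls : List (Fin L))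
    (hls : ls.Nodup) : Ev wd (countEx s ls) (ls.toFinset.filter fun l => (t l).isSome).card := by
  refine (Ev.sum (v := fun l => if (t l).isSome then 1 else 0) fun l _ => ?_).cast ?_
  · refine (Ev.lt (.num 0) (.reg (h l)) (by positivity) (hP.lt ?_)).cast ?_
    · have := digit_lt (t l)
      change digit (t l) ≤ _
      omega
    · simp only [digit_pos_iff]
  · rw [Finset.card_filter, List.sum_toFinset _ hls]

/-- Test whether the tuple of the hits in the layers `S` is in the tree `𝒯_{|S|, j}` and conflicts
with a track. -/
noncomputable def probeOne (f : ℚ) (n Dp : ℕ) (s : Slot L) (nh : ℕ)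
    (Sj : Finset (Fin L) × ℕ) : Bld L R W ℕ := do
  let k ← comp (.num ((Sj.1.card * (L + 1) + Sj.2) * (n + 1) ^ L) +
    sumEx (fun l => .reg (s (.trk l)) * .num ((n + 1) ^ (l : ℕ)))
      ((List.finRange L).filter fun l => l ∈ Sj.1))
  let st ← lookup k Dp
  -- The circuit never computes `⌈f N⌉`. The last factor runs over the numbers of hits `M` for which
  -- the size condition holds, a list that is known when the circuit is built.
  comp (.reg st.2 *
    Ex.eq (countEx s ((List.finRange L).filter fun l => l ∈ Sj.1)) (.num Sj.1.card) *
    sumEx (fun M => Ex.eq (.reg nh) (.num M))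
      ((List.range (L + 1)).filter fun M => Sj.1.card = min ⌈f * M⌉₊ Sj.2))

/-- What `probeOne` tests. -/
def ProbeHit (f : ℚ) (T : Ordnode ℕ) (t : Track L n) (Sj : Finset (Fin L) × ℕ) : Prop :=
  (∀ l ∈ Sj.1, (t l).isSome) ∧ Sj.1.card = min (rOf f t) Sj.2 ∧
    tupleKey Sj.1.card Sj.2 (restrict t Sj.1) ∈ T

theorem len_probeOne (f : ℚ) (Dp : ℕ) (s : Slot L) (nh : ℕ) (Sj : Finset (Fin L) × ℕ) :
    (probeOne f n Dp s nh Sj : Bld L R W _).Len (9 * L + 17 + Dp * 17) := by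
  have hl1 : ((List.finRange L).filter fun l => l ∈ Sj.1).length ≤ L :=
    (List.length_filter_le _ _).trans (by simp)
  have hl2 : ((List.range (L + 1)).filter fun M : ℕ =>
      Sj.1.card = min ⌈f * M⌉₊ Sj.2).length ≤ L + 1 :=
    (List.length_filter_le _ _).trans (by simp)
  refine ((len_comp_le (N := 3 * L + 3) ?_).bind fun k => (len_lookup k Dp).bind fun st =>
    len_comp_le (N := 6 * L + 12) ?_).mono (by omega)
  · have := size_sumEx (e := fun l : Fin L => Ex.reg (s (.trk l)) * .num ((n + 1) ^ (l : ℕ)))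
      (N := 2) (fun _ => le_rfl) ((List.finRange L).filter fun l => l ∈ Sj.1)
    rw [Ex.size_add, Ex.size_num]
    omega
  · have h1 := size_countEx s ((List.finRange L).filter fun l => l ∈ Sj.1)
    have h2 := size_sumEx (e := fun M => Ex.eq (.reg nh) (.num M)) (N := 2) (fun _ => le_rfl)
      ((List.range (L + 1)).filter fun M : ℕ => Sj.1.card = min ⌈f * M⌉₊ Sj.2)
    simp only [Ex.size_mul, Ex.size_eq, Ex.size_num, Ex.size_reg]
    omega

open Classical in
theorem runsD_probeOne {V : Env L n} {P : Par} {N b : ℕ} (hP : P.Suits V.D n N b W)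
    (hkb : (L + 1) ^ 2 * (n + 1) ^ L ≤ 2 ^ P.kb) {Dp : ℕ} (hDp : Dp + 1 ≤ P.kb)
    (hT : Ordnode.All (· < 2 ^ P.kb) V.T) (hdep : treeDepth V.T ≤ Dp) {f : ℚ} {w : World R W}
    {s : Slot L} {t : Track L n} (hs : TrkRep w s t) {nh : ℕ}
    (hnh : Has w nh (numHits t)) {Sj : Finset (Fin L) × ℕ} (hj : Sj.2 ≤ L) :
    RunsD V (probeOne f n Dp s nh Sj) w fun r w' =>
      Has w' r (if ProbeHit f V.T t Sj then 1 else 0) := by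
  have hcard : Sj.1.card ≤ L := (Finset.card_le_univ _).trans (by simp)
  have hfin : ((List.finRange L).filter fun l => decide (l ∈ Sj.1)).toFinset = Sj.1 := by
    ext l; simp
  have hL := hP.layers_le
  refine RunsD.bind (runsD_comp ((Ev.add (.num _) (Ev.sum (v := fun l => digit (t l) *
    (n + 1) ^ (l : ℕ)) fun l _ => .mul (.reg (hs l)) (.num _))).cast
    (v := tupleKey Sj.1.card Sj.2 (restrict t Sj.1)) ?_)) fun k w₁ hw₁ hk => ?_
  · rw [tupleKey, code_restrict]
  have hklt := (tupleKey_lt hcard hj (restrict t Sj.1)).trans_le hkb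
  refine RunsD.bind (runsD_lookup hP.toFits hk hklt hT hDp) fun st w₂ hw₂ hst => ?_
  have hle := hw₁.trans hw₂
  have hst2 := hst.2.1
  rw [probeStep_spec V.T _ hdep] at hst2
  have hcount : (Sj.1.filter fun l => (t l).isSome).card ≤ L :=
    (Finset.card_le_card (Finset.filter_subset _ _)).trans hcard
  have hev := Ev.count hP.toFits (hs.mono hle) hP.n_le
    ((List.finRange L).filter fun l => l ∈ Sj.1) ((List.nodup_finRange L).filter _)
  rw [hfin] at hev
  have hnL := numHits_le t
  refine runsD_comp ((Ev.mul (.mul (.reg hst2) (.eq hev (.num _) (hP.toFits.lt (by omega))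
    (hP.toFits.lt (by omega)))) (Ev.sum (v := fun M => if numHits t = M then 1 else 0)
      fun M hM => .eq (.reg (hnh.mono hle)) (.num M) (hP.toFits.lt (by omega)) ?_)).cast ?_)
  · have := (List.mem_filter.mp hM).1
    rw [List.mem_range] at this
    exact hP.toFits.lt (by omega)
  have h1 : ((Sj.1.filter fun l => (t l).isSome).card = Sj.1.card) ↔
      ∀ l ∈ Sj.1, (t l).isSome := by
    rw [Finset.card_filter_eq_iff]
  have h2 : (((List.range (L + 1)).filter fun M : ℕ =>
      decide (Sj.1.card = min ⌈f * M⌉₊ Sj.2)).map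
      fun M => if numHits t = M then 1 else 0).sum =
      if Sj.1.card = min (rOf f t) Sj.2 then 1 else 0 := by
    have hnd : ((List.range (L + 1)).filter fun M : ℕ =>
        decide (Sj.1.card = min ⌈f * M⌉₊ Sj.2)).Nodup := List.nodup_range.filter _
    rw [← List.sum_toFinset _ hnd, Finset.sum_ite_eq]
    refine if_congr ?_ rfl rfl
    simp only [List.mem_toFinset, List.mem_filter, List.mem_range, decide_eq_true_eq, rOf]
    exact and_iff_right (by omega)
  rw [h2]
  simp only [h1, ProbeHit]
  exact ite_mul_ite_mul_ite

/-- Test a list of tuples. -/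
noncomputable def probeAll (f : ℚ) (n Dp : ℕ) (s : Slot L) (nh : ℕ) :
    List (Finset (Fin L) × ℕ) → Bld L R W ℕ
  | [] => comp (.num 0)
  | Sj :: l => do
      let a ← probeAll f n Dp s nh l
      let r ← probeOne f n Dp s nh Sj
      comp (Ex.eq (Ex.eq (.reg a + .reg r) (.num 0)) (.num 0))

theorem len_probeAll (f : ℚ) (Dp : ℕ) (s : Slot L) (nh : ℕ) (l : List (Finset (Fin L) × ℕ)) :
    (probeAll f n Dp s nh l : Bld L R W _).Len (1 + l.length * (9 * L + 22 + Dp * 17)) := by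
  induction l with
  | nil => exact (len_comp_le (N := 1) le_rfl).mono (by simp)
  | cons Sj l ih =>
    refine (ih.bind fun a => (len_probeOne f Dp s nh Sj).bind fun r =>
      len_comp_le (N := 5) le_rfl).mono ?_
    rw [List.length_cons, add_mul]
    omega

open Classical in
theorem runsD_probeAll {V : Env L n} {P : Par} {N b : ℕ} (hP : P.Suits V.D n N b W)
    (hkb : (L + 1) ^ 2 * (n + 1) ^ L ≤ 2 ^ P.kb) {Dp : ℕ} (hDp : Dp + 1 ≤ P.kb)
    (hT : Ordnode.All (· < 2 ^ P.kb) V.T) (hdep : treeDepth V.T ≤ Dp) {f : ℚ} {w : World R W}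
    {s : Slot L} {t : Track L n} (hs : TrkRep w s t) {nh : ℕ}
    (hnh : Has w nh (numHits t)) (l : List (Finset (Fin L) × ℕ)) (hl : ∀ Sj ∈ l, Sj.2 ≤ L) :
    RunsD V (probeAll f n Dp s nh l) w fun r w' =>
      Has w' r (if ∃ Sj ∈ l, ProbeHit f V.T t Sj then 1 else 0) := by
  have h2 : (2 : ℕ) < 2 ^ W := hP.toFits.lt (by have := hP.layers_le; have := hP.layers; omega)
  induction l with
  | nil => exact runsD_comp (Ev.cast (.num 0) (by simp))
  | cons Sj l ih =>
    refine RunsD.bind (ih fun x hx => hl x (List.mem_cons_of_mem _ hx)) fun a w₁ hw₁ ha => ?_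
    refine RunsD.bind (runsD_probeOne hP hkb hDp hT hdep (hs.mono hw₁) (hnh.mono hw₁)
      (hl Sj List.mem_cons_self)) fun r w₂ hw₂ hr => ?_
    refine runsD_comp ((Ev.eq (.eq (.add (.reg (ha.mono hw₂)) (.reg hr)) (.num 0)
      (by split_ifs <;> omega) (by omega)) (.num 0) (by split_ifs <;> omega) (by omega)).cast ?_)
    by_cases a1 : ProbeHit f V.T t Sj <;>
      by_cases a2 : ∃ Sj ∈ l, ProbeHit f V.T t Sj <;> simp [a1, a2]

end Prog

/-- All sets of layers with all numbers of hits. -/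
noncomputable def allProbes (L : ℕ) : List (Finset (Fin L) × ℕ) :=
  (Finset.univ : Finset (Finset (Fin L))).toList ×ˢ List.range (L + 1)

theorem mem_allProbes {Sj : Finset (Fin L) × ℕ} : Sj ∈ allProbes L ↔ Sj.2 ≤ L := by
  rw [allProbes, List.mem_product]
  simp

theorem length_allProbes : (allProbes L).length = 2 ^ L * (L + 1) := by
  simp [allProbes, List.length_product]

/-- The circuit tries all sets of layers with all indices `j`, a list that does not depend on the
track. The conditions in `ProbeHit` discard the probes that are irrelevant to the track at hand. -/
theorem exists_probeHit_iff {f : ℚ} (hf0 : 0 < f) (hf1 : f ≤ 1) {t : Track L n}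
    {ts : List (Track L n)} (ht : 1 ≤ rOf f t) (hts : ∀ t' ∈ ts, 1 ≤ rOf f t') :
    (∃ Sj ∈ allProbes L, ProbeHit f (treeOf f ts) t Sj) ↔ ∃ t' ∈ ts, Overlap f t t' := by
  have hmem := (treeOf_spec f ts (N := L * 2 ^ L) fun t => length_insertKeys_le hf1 t).2.1
  constructor
  · rintro ⟨⟨S, j⟩, hj, h1, h2, h3⟩
    obtain ⟨t', ht', hk⟩ := (hmem _).mp h3
    exact ⟨t', ht', (overlap_iff_lookup hf0 hf1 ht (hts t' ht')).mpr
      ⟨S, h1, j, mem_allProbes.mp hj, h2, hk⟩⟩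
  · rintro ⟨t', ht', ho⟩
    obtain ⟨S, h1, j, hj, h2, hk⟩ := (overlap_iff_lookup hf0 hf1 ht (hts t' ht')).mp ho
    exact ⟨(S, j), mem_allProbes.mpr hj, h1, h2, (hmem _).mpr ⟨t', ht', hk⟩⟩

end CTF

namespace CTF

variable {L n R W : ℕ}

/-! ## The whole program -/

/-- The track of a candidate, without hits if there is none. -/
def hitsOf {w : ℕ} (o : Option (Cand L n w)) : Track L n := o.elim (fun _ => none) Cand.hits

/-- The seed with the hits number `j0`, `j1`, `j2`, for any numbers. -/
def seedAt (D : Detector L) (E : Event L n D.w) (hL : 3 ≤ L) (j0 j1 j2 : ℕ) :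
    Option (Cand L n D.w) :=
  if h : j0 < n ∧ j1 < n ∧ j2 < n then seed D E hL ⟨j0, h.1⟩ ⟨j1, h.2.1⟩ ⟨j2, h.2.2⟩ else none

/-- The candidates found for the seed with the hits number `j0`, `j1`, `j2`. -/
def candsAt (D : Detector L) (E : Event L n D.w) (hL : 3 ≤ L) (lam j0 j1 j2 : ℕ) :
    List (Cand L n D.w) :=
  ((List.finRange L).drop 3).foldl (findStep D E lam) (seedAt D E hL j0 j1 j2).toList

theorem layerInv_seedAt {D : Detector L} {E : Event L n D.w} {hL : 3 ≤ L} {lam : ℕ}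
    (hlam : 1 ≤ lam) (j0 j1 j2 : ℕ) : LayerInv lam 3 (seedAt D E hL j0 j1 j2).toList := by
  rw [seedAt]
  split_ifs
  · exact layerInv_seed hlam _ _ _
  · constructor <;> simp

open Classical in
/-- The value of the score register for a candidate. -/
noncomputable def scoreVal (W : ℕ) (V : Env L n) (f : ℚ) : Option (Cand L n V.D.w) → ℕ
  | none => 2 ^ W - 1
  | some c => if Selected V.D V.E c.hits ∧ ¬ ∃ Sj ∈ allProbes L, ProbeHit f V.T c.hits Sj
      then key V.D c else 2 ^ W - 1

section Prog

variable [NeZero R]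

theorem Has.mod {w : World R W} {r v : ℕ} (h : Has w r v) : Has w r (v % 2 ^ W) := by
  refine ⟨h.1, h.2.trans ?_⟩
  apply BitVec.eq_of_toNat_eq
  simp

theorem Rep.trkRep {w : ℕ} {wd : World R W} {s : Slot L} {o : Option (Cand L n w)}
    (h : Rep wd s o) : TrkRep wd s (hitsOf o) := by
  intro l
  have := h (.trk l)
  cases o <;> exact this

/-- Load the hits of a track. -/
def hitRegs (s : Slot L) : Bld L R W (Fin L → ℕ) :=
  (List.finRange L).foldlM (fun g l => do
    -- Adding `2 ^ W - 1` subtracts one modulo `2 ^ W`. The digit `j + 1` becomes the label `j`, and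
    -- the digit `0` of a ghost becomes an address beyond `n`, where no hit is loaded.
    let a ← comp (.reg (s (.trk l)) + .num (2 ^ W - 1))
    let h ← op (.loadHit l (rg a))
    pure (Function.update g l h)) fun _ => 0

theorem len_hitRegs (s : Slot L) : (hitRegs s : Bld L R W _).Len (L * 3) := by
  refine (Bld.len_foldlM (N := 3) _ (fun g l _ => ?_) _).mono (by simp)
  exact ((len_comp_le (N := 2) le_rfl).bind fun a => (len_op _).bind fun h =>
    Bld.len_pure _).mono le_rfl

theorem runsD_hitRegs {V : Env L n} {w : World R W} {s : Slot L} {t : Track L n}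
    (hn : n < 2 ^ W) (h : TrkRep w s t) :
    RunsD V (hitRegs s) w fun r w' => ∀ l, Has w' (r l) (hval ((t l).bind (V.E l))) := by
  refine (RunsD.foldlM (w₀ := w) (fun rest g w' => ∀ l, l ∉ rest →
    Has w' (g l) (hval ((t l).bind (V.E l)))) ?_ _ _ w le_rfl
    fun l hl => absurd (List.mem_finRange l) hl).imp fun s w' _ hs l => hs l List.not_mem_nil
  intro l rest g w₁ hw₁ hg
  refine RunsD.bind (runsD_comp (.add (.reg ((h l).mono hw₁)) (.num _))) fun a w₂ hw₂ ha => ?_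
  have hpos := Nat.two_pow_pos W
  refine RunsD.bind (runsD_loadHit ha.mod (Nat.mod_lt _ hpos)) fun r w₃ hw₃ hr => RunsD.pure
    fun l' hl' => ?_
  have hval_eq : hitAt V.E l ((digit (t l) + (2 ^ W - 1)) % 2 ^ W) = (t l).bind (V.E l) := by
    cases htl : t l with
    | none =>
      rw [digit, zero_add, Nat.mod_eq_of_lt (by omega), hitAt, dif_neg (by omega)]
      rfl
    | some j =>
      have hj := j.isLt
      rw [digit, show j.val + 1 + (2 ^ W - 1) = j.val + 2 ^ W by omega, Nat.add_mod_right,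
        Nat.mod_eq_of_lt (by omega), hitAt, dif_pos hj]
      rfl
  rw [hval_eq] at hr
  by_cases hll : l' = l
  · subst hll
    rwa [Function.update_self]
  · rw [Function.update_of_ne hll]
    exact (hg l' (by simp [hll, hl'])).mono (hw₂.trans hw₃)

/-- Choose the candidate with the number in register `q`, and compute its score. -/
noncomputable def finish (D : Detector L) (n : ℕ) (f : ℚ) (N Dp q : ℕ) (g : ℕ → Slot L) :
    Bld L R W (Slot L × ℕ) := do
  let s ← tabulate fun x => muxEx (fun i => Ex.eq (.num i) (.reg q)) N fun i => g i x
  let t ← hitRegs s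
  let sel ← op (.selected fun l => rg (t l))
  let nh ← comp (countEx s (List.finRange L))
  let ov ← probeAll f n Dp s nh (allProbes L)
  let gd ← comp (.reg (s .ok) * .reg sel * Ex.eq (.reg ov) (.num 0))
  let sc ← comp (.reg gd * keyEx D n s + Ex.eq (.reg gd) (.num 0) * .num (2 ^ W - 1))
  pure (s, sc)

/-- The length of `finish`. -/
def finishLen (L N Dp : ℕ) : ℕ :=
  (L + 4) * (N * 4 + 1) + 9 * L + 30 + 2 ^ L * (L + 1) * (9 * L + 22 + Dp * 17)

theorem len_finish (D : Detector L) (f : ℚ) (N Dp q : ℕ) (g : ℕ → Slot L) :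
    (finish D n f N Dp q g : Bld L R W _).Len (finishLen L N Dp) := by
  refine ((len_tabulate (N := N * 4 + 1) fun x => size_muxEx (M := 2) (fun _ => le_rfl) _ _).bind
    fun s => (len_hitRegs s).bind fun t => (len_op _).bind fun sel =>
    (len_comp_le (size_countEx s _)).bind fun nh =>
    (len_probeAll f Dp s nh (allProbes L)).bind fun ov =>
    (len_comp_le (N := 4) le_rfl).bind fun gd =>
    (len_comp_le (N := 3 * L + 15) ?_).bind fun sc => Bld.len_pure _).mono ?_
  · have := size_keyEx D n s
    simp only [Ex.size_add, Ex.size_mul, Ex.size_eq, Ex.size_num, Ex.size_reg]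
    omega
  · rw [finishLen, length_allProbes, List.length_finRange]
    omega

theorem runsD_finish {V : Env L n} {P : Par} {N b : ℕ} (hP : P.Suits V.D n N b W)
    (hkb : (L + 1) ^ 2 * (n + 1) ^ L ≤ 2 ^ P.kb) {Dp : ℕ} (hDp : Dp + 1 ≤ P.kb)
    (hT : Ordnode.All (· < 2 ^ P.kb) V.T) (hdep : treeDepth V.T ≤ Dp) {f : ℚ} {w : World R W}
    {g : ℕ → Slot L} {cs : List (Cand L n V.D.w)} (hcs : LayerInv N L cs)
    (hg : ∀ q < N, Rep w (g q) cs[q]?) {rq q : ℕ} (hq : Has w rq q) (hqW : q < 2 ^ W) :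
    RunsD V (finish V.D n f N Dp rq g) w fun a w' =>
      Rep w' a.1 cs[q]? ∧ Has w' a.2 (scoreVal W V f cs[q]?) := by
  classical
  have h1 : (1 : ℕ) < 2 ^ W := Nat.one_lt_two_pow (by have := hP.pos; omega)
  have hN : N ≤ 2 ^ W := (Nat.le_mul_of_pos_right N (Nat.two_pow_pos b)).trans
    (hP.idx.trans (Nat.pow_le_pow_right (by norm_num) hP.m_le))
  set o := cs[q]? with ho
  refine RunsD.bind (runsD_tabulate (v := oval o) fun x => (Ev.mux (q := q) (fun i hi =>
    .eq (.num i) (.reg hq) (hi.trans_le hN) hqW) fun i hi => hg i hi x).cast ?_)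
    fun s w₁ hw₁ hs => ?_
  · split_ifs with h
    · rfl
    · rw [ho, List.getElem?_eq_none (by have := hcs.length; omega)]; rfl
  have hs : Rep w₁ s o := hs
  have hnW : n < 2 ^ W := hP.toFits.lt (by have := hP.n_le; omega)
  refine RunsD.bind (runsD_hitRegs hnW hs.trkRep) fun t w₂ hw₂ ht => ?_
  refine RunsD.bind (runsD_selected hP.w_lt ht) fun sel w₃ hw₃ hsel => ?_
  have hev := Ev.count hP.toFits (hs.mono (hw₂.trans hw₃)).trkRep hP.n_le (List.finRange L)
    (List.nodup_finRange L)
  have hcount : ((List.finRange L).toFinset.filter fun l => (hitsOf o l).isSome).card =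
      numHits (hitsOf o) := by
    rw [numHits]
    congr 1
    ext l; simp
  rw [hcount] at hev
  refine RunsD.bind (runsD_comp hev) fun nh w₄ hw₄ hnh => ?_
  refine RunsD.bind (runsD_probeAll hP hkb hDp hT hdep
    (hs.mono (hw₂.trans (hw₃.trans hw₄))).trkRep hnh (allProbes L) fun Sj h => mem_allProbes.mp h)
    fun ov w₅ hw₅ hov => ?_
  refine RunsD.bind (runsD_comp (.mul (.mul (.reg ((hs.mono
    (hw₂.trans (hw₃.trans (hw₄.trans hw₅)))) .ok)) (.reg (hsel.mono (hw₄.trans hw₅))))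
    (.eq (.reg hov) (.num 0) (by split_ifs <;> omega) (by omega)))) fun gd w₆ hw₆ hgd => ?_
  have hs6 := hs.mono (hw₂.trans (hw₃.trans (hw₄.trans (hw₅.trans hw₆))))
  have hok : oval o .ok ≤ 1 := by cases o <;> simp [oval, fval]
  refine RunsD.bind (runsD_comp (.add (.mul (.reg hgd) (Ev.key hs6)) (.mul (.eq (.reg hgd) (.num 0)
    ?_ (by omega)) (.num _)))) fun sc w₇ hw₇ hsc => RunsD.pure ⟨hs6.mono hw₇, ?_⟩
  · split_ifs <;> simp <;> omega
  · convert hsc using 1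
    clear_value o
    cases o with
    | none => simp [scoreVal, oval]
    | some c =>
      simp only [scoreVal, oval, Option.elim, fval, one_mul, hitsOf, Selected]
      by_cases a1 : V.D.threshold ≤ V.D.refit fun l => (c.hits l).bind (V.E l) <;>
        by_cases a2 : ∃ Sj ∈ allProbes L, ProbeHit f V.T c.hits Sj <;> simp [a1, a2]

/-- The components of a seed. -/
def seedFld (r0 r1 r2 st ch : ℕ) : Fld L → Ex
  | .ok => .num 1
  | .st => .reg st
  | .chi => .reg ch
  | .gh => .num 0
  | .trk l => if l.val = 0 then .reg r0 + .num 1 else if l.val = 1 then .reg r1 + .num 1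
      else if l.val = 2 then .reg r2 + .num 1 else .num 0

/-- The seed with the hits in the registers `r0`, `r1`, `r2`. -/
noncomputable def seedSlot (hL : 3 ≤ L) (r0 r1 r2 : ℕ) : Bld L R W (Slot L) := do
  let h0 ← op (.loadHit ⟨0, by omega⟩ (rg r0))
  let h1 ← op (.loadHit ⟨1, by omega⟩ (rg r1))
  let h2 ← op (.loadHit ⟨2, by omega⟩ (rg r2))
  let sg ← op (.seedGood (rg h0) (rg h1) (rg h2))
  let st ← op (.initState (rg h0) (rg h1) (rg h2))
  let ch ← op (.initChi (rg h0) (rg h1) (rg h2))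
  let fl ← comp (.reg sg * Ex.lt (.num 0) (.reg h0) * Ex.lt (.num 0) (.reg h1) *
    Ex.lt (.num 0) (.reg h2))
  tabulate fun x => .reg fl * seedFld r0 r1 r2 st ch x

theorem len_seedSlot (hL : 3 ≤ L) (r0 r1 r2 : ℕ) :
    (seedSlot hL r0 r1 r2 : Bld L R W _).Len (15 + (L + 4) * 3) := by
  refine ((len_op _).bind fun h0 => (len_op _).bind fun h1 => (len_op _).bind fun h2 =>
    (len_op _).bind fun sg => (len_op _).bind fun st => (len_op _).bind fun ch =>
    (len_comp_le (N := 9) le_rfl).bind fun fl => len_tabulate (N := 3) fun x => ?_).mono (by omega)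
  rw [Ex.size_mul, Ex.size_reg]
  have : (seedFld r0 r1 r2 st ch x).size ≤ 2 := by
    cases x <;> simp only [seedFld] <;> (try split_ifs) <;>
      simp [Ex.size_add, Ex.size_num, Ex.size_reg]
  omega

theorem runsD_seedSlot {V : Env L n} (hL : 3 ≤ L) (hw : V.D.w < W) {w : World R W}
    {r0 r1 r2 j0 j1 j2 : ℕ} (h0 : Has w r0 j0) (h1 : Has w r1 j1) (h2 : Has w r2 j2)
    (hj0 : j0 < 2 ^ W) (hj1 : j1 < 2 ^ W) (hj2 : j2 < 2 ^ W) :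
    RunsD V (seedSlot hL r0 r1 r2) w fun s w' => Rep w' s (seedAt V.D V.E hL j0 j1 j2) := by
  have hpow : 2 ^ V.D.w < 2 ^ W := Nat.pow_lt_pow_right (by norm_num) hw
  refine RunsD.bind (runsD_loadHit h0 hj0) fun s0 w₁ hw₁ hs0 => ?_
  refine RunsD.bind (runsD_loadHit (h1.mono hw₁) hj1) fun s1 w₂ hw₂ hs1 => ?_
  refine RunsD.bind (runsD_loadHit (h2.mono (hw₁.trans hw₂)) hj2) fun s2 w₃ hw₃ hs2 => ?_
  have hs0 := hs0.mono (hw₂.trans hw₃)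
  have hs1 := hs1.mono hw₃
  refine RunsD.bind (runsD_seedGood hw hs0 hs1 hs2) fun sg w₄ hw₄ hsg => ?_
  refine RunsD.bind (runsD_initState hw (hs0.mono hw₄) (hs1.mono hw₄) (hs2.mono hw₄))
    fun st w₅ hw₅ hst => ?_
  have h35 := hw₄.trans hw₅
  refine RunsD.bind (runsD_initChi hw (hs0.mono h35) (hs1.mono h35) (hs2.mono h35))
    fun ch w₆ hw₆ hch => ?_
  have h36 := h35.trans hw₆
  refine RunsD.bind (runsD_comp (.mul (.mul (.mul (.reg (hsg.mono (hw₅.trans hw₆)))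
    (.lt (.num 0) (.reg (hs0.mono h36)) (by positivity) ((hval_le _).trans_lt hpow)))
    (.lt (.num 0) (.reg (hs1.mono h36)) (by positivity) ((hval_le _).trans_lt hpow)))
    (.lt (.num 0) (.reg (hs2.mono h36)) (by positivity) ((hval_le _).trans_lt hpow))))
    fun fl w₇ hw₇ hfl => ?_
  set m0 := hitAt V.E ⟨0, by omega⟩ j0 with hm0
  set m1 := hitAt V.E ⟨1, by omega⟩ j1 with hm1
  set m2 := hitAt V.E ⟨2, by omega⟩ j2 with hm2
  have h07 := hw₁.trans (hw₂.trans (hw₃.trans (h36.trans hw₇)))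
  let v : Fld L → ℕ
    | .ok => 1
    | .st => (V.D.initState (m0.getD 0) (m1.getD 0) (m2.getD 0)).toNat
    | .chi => (V.D.initChi (m0.getD 0) (m1.getD 0) (m2.getD 0)).toNat
    | .gh => 0
    | .trk l => if l.val = 0 then j0 + 1 else if l.val = 1 then j1 + 1
      else if l.val = 2 then j2 + 1 else 0
  have hv : ∀ x, Ev w₇ (seedFld r0 r1 r2 st ch x) (v x) := by
    intro x
    cases x with
    | ok => exact .num 1
    | st => exact .reg (hst.mono (hw₆.trans hw₇))
    | chi => exact .reg (hch.mono hw₇)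
    | gh => exact .num 0
    | trk l =>
      simp only [seedFld, v]
      split_ifs
      · exact .add (.reg (h0.mono h07)) (.num 1)
      · exact .add (.reg (h1.mono h07)) (.num 1)
      · exact .add (.reg (h2.mono h07)) (.num 1)
      · exact .num 0
  refine runsD_tabulate fun x => (Ev.mul (.reg hfl) (hv x)).cast ?_
  by_cases hlt : j0 < n ∧ j1 < n ∧ j2 < n
  · obtain ⟨a0, a1, a2⟩ := hlt
    have e0 : m0 = V.E ⟨0, by omega⟩ ⟨j0, a0⟩ := dif_pos a0
    have e1 : m1 = V.E ⟨1, by omega⟩ ⟨j1, a1⟩ := dif_pos a1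
    have e2 : m2 = V.E ⟨2, by omega⟩ ⟨j2, a2⟩ := dif_pos a2
    rw [seedAt, dif_pos ⟨a0, a1, a2⟩, seed, ← e0, ← e1, ← e2]
    clear_value m0 m1 m2
    cases m0 with
    | none => simp [hval, oval]
    | some x0 =>
      cases m1 with
      | none => simp [hval, oval]
      | some x1 =>
        cases m2 with
        | none => simp [hval, oval]
        | some x2 =>
          by_cases hg : V.D.seedGood x0 x1 x2
          · simp only [hval, Option.getD_some, Nat.succ_pos, if_true, one_mul, Option.bind_some, hg]
            cases x with
            | trk l =>
              simp only [v, oval, Option.elim, fval]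
              split_ifs <;> simp [digit]
            | _ => simp [v, oval, fval]
          · simp [hg, oval]
  · rw [seedAt, dif_neg hlt]
    rw [not_and_or, not_and_or] at hlt
    rcases hlt with h | h | h
    · simp [hm0, hitAt, h, hval, oval]
    · simp [hm1, hitAt, h, hval, oval]
    · simp [hm2, hitAt, h, hval, oval]

theorem runs_layers {V : Env L n} {P : Par} {N b : ℕ} (hP : P.Suits V.D n N b W) {k : ℕ}
    (hk : k ≤ L) {w : World R W} {g : ℕ → Slot L} {cs : List (Cand L n V.D.w)}
    (hcs : LayerInv N k cs) (hg : ∀ q < N, Rep w (g q) cs[q]?) :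
    Runs V (((List.finRange L).drop k).foldlM (layer P V.D n N b) g) w (fun g' w' => ∀ q < N,
      Rep w' (g' q) (((List.finRange L).drop k).foldl (findStep V.D V.E N) cs)[q]?)
      ((L - k : ℕ) * (N * ((P.kb + 2) * P.err))) := by
  have he := P.err_nonneg
  induction hd : L - k generalizing k w g cs with
  | zero =>
    rw [List.drop_eq_nil_of_le (by simp; omega), Nat.cast_zero, zero_mul]
    exact Runs.pure hg
  | succ d ih =>
    have hlt : k < L := by omega
    rw [List.drop_eq_getElem_cons (by simpa using hlt), List.foldlM_cons, List.foldl_cons]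
    have hl : (List.finRange L)[k]'(by simpa using hlt) = ⟨k, hlt⟩ := by simp
    rw [hl]
    refine ((runs_layer hP (l := ⟨k, hlt⟩) hcs.length hcs.nodup hcs.fresh hg).bind
      (δ' := d * (N * ((P.kb + 2) * P.err))) (by positivity) fun g' w' hw' hg' => ?_).imp
      (fun _ _ _ h => h) (by push_cast; linarith)
    exact ih (k := k + 1) (by omega) (LayerInv.findStep (l := ⟨k, hlt⟩) hcs) hg' (by omega)

/-- Seeding, finding, cleaning and selection, for the seed in the registers `0`, `1`, `2` and the
number of a candidate in register `3`. -/
noncomputable def body (P : Par) (D : Detector L) (n : ℕ) (hL : 3 ≤ L) (f : ℚ) (N b Dp : ℕ) :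
    Bld L R W (Slot L × ℕ) := do
  let s ← seedSlot hL 0 1 2
  let z ← comp (.num 0)
  let g ← ((List.finRange L).drop 3).foldlM (layer P D n N b) fun q =>
    if q = 0 then s else fun _ => z
  finish D n f N Dp 3 g

/-- The length of `body`. -/
def Par.bodyLen (P : Par) (L N Dp : ℕ) : ℕ :=
  (16 + (L + 4) * 3) + L * P.layerLen L N + finishLen L N Dp

theorem len_body (P : Par) (D : Detector L) (hL : 3 ≤ L) (f : ℚ) (N b Dp : ℕ) :
    (body P D n hL f N b Dp : Bld L R W _).Len (P.bodyLen L N Dp) := by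
  refine ((len_seedSlot hL 0 1 2).bind fun s => (len_comp_le (N := 1) le_rfl).bind fun z =>
    (Bld.len_foldlM (N := P.layerLen L N) _ (fun g l _ => len_layer P D N b g l) _).bind fun g =>
    len_finish D f N Dp 3 g).mono ?_
  have : ((List.finRange L).drop 3).length * P.layerLen L N ≤ L * P.layerLen L N :=
    Nat.mul_le_mul_right _ (by simp)
  rw [Par.bodyLen]
  omega

/-- The error probability of `body`. -/
noncomputable def Par.bodyErr (P : Par) (L N : ℕ) : ℝ := L * (N * ((P.kb + 2) * P.err))

theorem runs_body {V : Env L n} {P : Par} {N b : ℕ} (hP : P.Suits V.D n N b W)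
    (hkb : (L + 1) ^ 2 * (n + 1) ^ L ≤ 2 ^ P.kb) {Dp : ℕ} (hDp : Dp + 1 ≤ P.kb)
    (hT : Ordnode.All (· < 2 ^ P.kb) V.T) (hdep : treeDepth V.T ≤ Dp) (hL : 3 ≤ L) {f : ℚ}
    {w : World R W} {j0 j1 j2 q : ℕ} (h0 : Has w 0 j0) (h1 : Has w 1 j1) (h2 : Has w 2 j2)
    (h3 : Has w 3 q) (hj0 : j0 < 2 ^ W) (hj1 : j1 < 2 ^ W) (hj2 : j2 < 2 ^ W) (hq : q < 2 ^ W) :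
    Runs V (body P V.D n hL f N b Dp) w (fun a w' =>
      Rep w' a.1 (candsAt V.D V.E hL N j0 j1 j2)[q]? ∧
      Has w' a.2 (scoreVal W V f (candsAt V.D V.E hL N j0 j1 j2)[q]?)) (P.bodyErr L N) := by
  have he := P.err_nonneg
  have hL3 : ((L - 3 : ℕ) : ℝ) ≤ L := by exact_mod_cast Nat.sub_le _ _
  have hinv := layerInv_seedAt (D := V.D) (E := V.E) (hL := hL) hP.one_le j0 j1 j2
  have hfin : LayerInv N L (candsAt V.D V.E hL N j0 j1 j2) :=
    foldl_drop_finRange _ (fun k cs => LayerInv N k cs) (fun _ _ h => h.findStep) hL _ hinv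
  refine (RunsD.bindRuns (runsD_seedSlot hL hP.w_lt h0 h1 h2 hj0 hj1 hj2)
    (δ := (L - 3 : ℕ) * (N * ((P.kb + 2) * P.err))) (by positivity) fun s w₁ hw₁ hs => ?_).imp
    (fun _ _ _ h => h) (by
      rw [Par.bodyErr]
      exact mul_le_mul_of_nonneg_right hL3 (by positivity))
  refine RunsD.bindRuns (runsD_comp (.num 0)) (by positivity) fun z w₂ hw₂ hz => ?_
  refine ((runs_layers hP hL hinv fun q hq => ?_).bind le_rfl fun g w₃ hw₃ hg =>
    (runsD_finish hP hkb hDp hT hdep hfin hg (h3.mono (hw₁.trans (hw₂.trans hw₃))) hq).runs).imp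
    (fun _ _ _ h => h) (add_zero _).le
  -- At first only slot `0` is occupied. All other slots refer to one register with content `0`,
  -- which represents no candidate in every component.
  split_ifs with h
  · subst h
    have : (seedAt V.D V.E hL j0 j1 j2).toList[0]? = seedAt V.D V.E hL j0 j1 j2 := by
      cases seedAt V.D V.E hL j0 j1 j2 <;> rfl
    rw [this]
    exact hs.mono hw₂
  · have : (seedAt V.D V.E hL j0 j1 j2).toList[q]? = none := by
      refine List.getElem?_eq_none ?_
      cases seedAt V.D V.E hL j0 j1 j2 with
      | none => simp
      | some c => rw [Option.toList_some, List.length_singleton]; omega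
    rw [this]
    exact fun x => hz

end Prog

end CTF

namespace CTF

variable {L n R W : ℕ}

/-! ## The circuit -/

theorem measure_apply (V : Env L n) (C : Circuit L R W) (A : Set (Config R W)) :
    (C.measure V).toOuterMeasure A = ENNReal.ofReal (missProb (C.run V) fun x => x ∉ A) := by
  classical
  rw [PMF.toOuterMeasure_apply_fintype, missProb,
    ENNReal.ofReal_sum_of_nonneg fun x _ => by split_ifs <;> positivity]
  refine Finset.sum_congr rfl fun x _ => ?_
  by_cases hx : x ∈ A
  · rw [Set.indicator_of_mem hx, if_neg (not_not.mpr hx)]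
    rfl
  · rw [Set.indicator_of_notMem hx, if_pos hx, ENNReal.ofReal_zero]

theorem missProb_add_compl (ψ : Config R W → ℂ) (S : Config R W → Prop) :
    missProb ψ S + missProb ψ (fun x => ¬ S x) = ∑ x, ‖ψ x‖ ^ 2 := by
  classical
  rw [missProb, missProb, ← Finset.sum_add_distrib]
  refine Finset.sum_congr rfl fun x _ => ?_
  by_cases h : S x <;> simp [h]

theorem decode_eq_some {U : Inner L} {x : Config U.R U.W} {t : Track L n} :
    U.decode n x = some t ↔ ∀ l, (x (U.trk l)).toNat = digit (t l) := by
  rw [Inner.decode]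
  constructor
  · intro h l
    split_ifs at h with h0
    rw [← Option.some.inj h]
    simp only
    split_ifs with h1
    · rw [h1, digit]
    · rw [digit]; simp only; omega
  · intro h
    have h0 : ∀ l, (x (U.trk l)).toNat ≤ n := fun l => by
      have := digit_lt (t l)
      rw [h l]; omega
    rw [dif_pos h0, Option.some.injEq]
    funext l
    have hl := h l
    cases htl : t l with
    | none =>
      rw [htl, digit] at hl
      rw [dif_pos hl]
    | some j =>
      rw [htl, digit] at hl
      rw [dif_neg (by omega), Option.some.injEq]
      apply Fin.ext
      simp only; omega

section Prog

variable [NeZero R]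

/-- Hadamard gates on the lowest `ks i` qubits of register `i`, for `i < d`. -/
def hads (ks : ℕ → ℕ) : ℕ → Circuit L R W
  | 0 => []
  | d + 1 => hads ks d ++ hadBits (ks d) (rg d)

theorem length_hads (ks : ℕ → ℕ) (d : ℕ) :
    (hads ks d : Circuit L R W).length ≤ ∑ i ∈ Finset.range d, ks i := by
  induction d with
  | zero => simp [hads]
  | succ d ih =>
    rw [hads, List.length_append, Finset.sum_range_succ]
    exact Nat.add_le_add ih (length_hadBits _ _)

/-- The configurations that the Hadamard gates produce. -/
def Input (ks : ℕ → ℕ) (d : ℕ) (y : Config R W) : Prop :=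
  Blank d y ∧ ∀ i < d, (y (rg i)).toNat < 2 ^ ks i

open Classical in
-- Each register is prepared while it is blank, so the probabilities of the registers multiply: the
-- inputs are uniformly distributed.
theorem normSq_hads (V : Env L n) {ks : ℕ → ℕ} {d : ℕ} (hd : d ≤ R) (hks : ∀ i < d, ks i ≤ W)
    (y : Config R W) : ‖Circuit.lin V (hads ks d) (ket 0) y‖ ^ 2 =
      if Input ks d y then ∏ i ∈ Finset.range d, ((2 : ℝ) ^ ks i)⁻¹ else 0 := by
  induction d generalizing y with
  | zero =>
    rw [hads, Circuit.lin_nil, ket_apply]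
    have : Input ks 0 y ↔ y = 0 := by
      constructor
      · intro h; funext i; exact h.1 i (Nat.zero_le _)
      · rintro rfl; exact ⟨fun _ _ => rfl, fun i hi => absurd hi (Nat.not_lt_zero _)⟩
    simp only [this]
    by_cases h : y = 0 <;> simp [h]
  | succ d ih =>
    have ih := ih (by omega) fun i hi => hks i (by omega)
    have hdR : (rg d : Fin R).val = d := rg_val (by omega)
    rw [hads, Circuit.lin_append, Circuit.normSq_lin_of_blank V (within_hadBits _ hdR) ?_]
    -- The only configuration from which `y` can arise is `y` with register `d` blanked.
    · rw [Finset.sum_eq_single (Function.update y (rg d) 0)]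
      · rw [ih]
        by_cases hin : Input ks d (Function.update y (rg d) 0)
        · have h0 : Function.update y (rg d) 0 (rg d) = 0 := Function.update_self _ _ _
          rw [if_pos hin, lin_hadBits V h0 (hks d (by omega))]
          have hiff : Ranges (ks d) (Function.update y (rg d) 0) (rg d) y ↔ Input ks (d + 1) y := by
            constructor
            · intro h
              refine ⟨fun i hi => ?_, fun i hi => ?_⟩
              · have := hin.1 i (by omega)
                rwa [Function.update_of_ne] at this
                rintro rfl; omega
              · rcases Nat.lt_succ_iff_lt_or_eq.mp hi with h' | rfl
                · have := hin.2 i h'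
                  rwa [Function.update_of_ne] at this
                  intro he
                  have := congrArg Fin.val he
                  rw [hdR, rg_val (by omega)] at this
                  omega
                · exact h.2
            · intro h
              exact ⟨rfl, h.2 d (by omega)⟩
          simp only [hiff]
          split_ifs
          · rw [normSq_inv_sqrt_two_pow, Finset.prod_range_succ]
          · simp
        · rw [if_neg hin, zero_mul, if_neg]
          intro h
          apply hin
          refine ⟨fun i hi => ?_, fun i hi => ?_⟩
          · by_cases he : i = rg d
            · rw [he, Function.update_self]
            · rw [Function.update_of_ne he]
              refine h.1 i ?_
              have : i.val ≠ d := fun h => he (Fin.ext (h.trans hdR.symm))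
              omega
          · rw [Function.update_of_ne]
            · exact h.2 i (by omega)
            · intro he
              have := congrArg Fin.val he
              rw [hdR, rg_val (by omega)] at this
              omega
      · intro z _ hz
        by_cases hin : Input ks d z
        · rw [lin_hadBits V (hin.1 _ hdR.ge) (hks d (by omega))]
          simp only
          rw [if_neg fun h => hz h.1.symm]
          simp
        · rw [ih, if_neg hin, zero_mul]
      · simp
    · intro z hz
      by_contra hb
      have := ih z
      rw [if_neg fun h => hb h.1] at this
      exact hz (by simpa using this)

/-- The circuit that performs seeding, finding, cleaning and selection in superposition. -/
noncomputable def innerCirc (R W : ℕ) [NeZero R] (P : Par) (D : Detector L) (n : ℕ) (hL : 3 ≤ L)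
    (f : ℚ) (N b Dp kq : ℕ) : Circuit L R W :=
  hads (fun i => if i = 3 then kq else 2 * P.m) 4 ++ (body P D n hL f N b Dp).circ 4

/-- The circuit together with its output registers. -/
noncomputable def inner (R W : ℕ) [NeZero R] (P : Par) (D : Detector L) (n : ℕ) (hL : 3 ≤ L)
    (f : ℚ) (N b Dp kq : ℕ) : Inner L where
  R := R
  W := W
  circ := innerCirc R W P D n hL f N b Dp kq
  trk l := rg (((body P D n hL f N b Dp : Bld L R W _).out 4).1 (.trk l))
  score := rg ((body P D n hL f N b Dp : Bld L R W _).out 4).2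

/-- The probability of each input of the program. -/
noncomputable def Par.prob (P : Par) (kq : ℕ) : ℝ := ((2 : ℝ) ^ (6 * P.m + kq))⁻¹

/-- What the program needs. -/
structure Ready (P : Par) (V : Env L n) (R W N b Dp kq : ℕ) : Prop extends
    P.Suits V.D n N b W where
  tuples : (L + 1) ^ 2 * (n + 1) ^ L ≤ 2 ^ P.kb
  depth_le : Dp + 1 ≤ P.kb
  tree : Ordnode.All (· < 2 ^ P.kb) V.T
  depth : treeDepth V.T ≤ Dp
  regs : 4 + P.bodyLen L N Dp ≤ R
  kq_le : kq ≤ W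
  slots : N ≤ 2 ^ kq

/-- The candidate for an input. -/
def candOf (V : Env L n) (hL : 3 ≤ L) (N : ℕ) (z : Config R W) : Option (Cand L n V.D.w) :=
  (candsAt V.D V.E hL N (z (rg 0)).toNat (z (rg 1)).toNat (z (rg 2)).toNat)[(z (rg 3)).toNat]?

/-- The inputs of the program. -/
def IsInput (P : Par) (kq : ℕ) (z : Config R W) : Prop :=
  Input (fun i => if i = 3 then kq else 2 * P.m) 4 z

/-- The track registers and the score register show the candidate `o`. -/
def Outcome (V : Env L n) (P : Par) (hL : 3 ≤ L) (f : ℚ) (N b Dp : ℕ)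
    (o : Option (Cand L n V.D.w)) (y : Config R W) : Prop :=
  (∀ l, (y (rg (((body P V.D n hL f N b Dp : Bld L R W _).out 4).1 (.trk l)))).toNat =
    digit (hitsOf o l)) ∧
  (y (rg ((body P V.D n hL f N b Dp : Bld L R W _).out 4).2)).toNat = scoreVal W V f o

theorem mem_found_of_candsAt {D : Detector L} {E : Event L n D.w} {hL : 3 ≤ L} {N j0 j1 j2 : ℕ}
    {c : Cand L n D.w} (h : c ∈ candsAt D E hL N j0 j1 j2) :
    ∃ h0 h1 h2, c ∈ seedCands D E hL N ⟨j0, h0⟩ ⟨j1, h1⟩ ⟨j2, h2⟩ := by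
  rw [candsAt, seedAt] at h
  split_ifs at h with hlt
  · exact ⟨hlt.1, hlt.2.1, hlt.2.2, h⟩
  · have hnil : ∀ ls : List (Fin L), ls.foldl (findStep D E N) [] = [] := by
      intro ls
      induction ls with
      | nil => rfl
      | cons l ls ih => rw [List.foldl_cons, findStep_nil, ih]
    rw [Option.toList_none, hnil] at h
    exact absurd h List.not_mem_nil

theorem Ready.key_lt {R : ℕ} {P : Par} {V : Env L n} {N b Dp kq : ℕ} (h : Ready P V R W N b Dp kq)
    {hL : 3 ≤ L} {j0 j1 j2 : ℕ} {c : Cand L n V.D.w} (hc : c ∈ candsAt V.D V.E hL N j0 j1 j2) :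
    key V.D c < 2 ^ W - 1 := by
  obtain ⟨h0, h1, h2, hc⟩ := mem_found_of_candsAt hc
  have hf := (listInv_seedCands h.one_le _ _ _).fresh c hc
  have h3 := (CTF.key_lt hf.ghosts hf.chi).trans_le h.keys
  have h4 : 2 ^ (P.kb + 1) ≤ 2 ^ W := Nat.pow_le_pow_right (by norm_num) h.kb_lt
  have h5 : 2 ≤ 2 ^ P.kb := by
    have := h.layers_le
    have := h.layers
    omega
  rw [pow_succ] at h4
  omega

theorem scoreVal_lt {R : ℕ} {P : Par} {V : Env L n} {N b Dp kq : ℕ} (h : Ready P V R W N b Dp kq)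
    {hL : 3 ≤ L} {f : ℚ} {j0 j1 j2 q : ℕ} :
    scoreVal W V f (candsAt V.D V.E hL N j0 j1 j2)[q]? < 2 ^ W := by
  have hpos := Nat.two_pow_pos W
  cases ho : (candsAt V.D V.E hL N j0 j1 j2)[q]? with
  | none => simp only [scoreVal]; omega
  | some c =>
    have := h.key_lt (List.mem_of_getElem? ho)
    simp only [scoreVal]
    split_ifs <;> omega

theorem Ready.nxt_le {P : Par} {V : Env L n} {N b Dp kq : ℕ} (h : Ready P V R W N b Dp kq)
    (hL : 3 ≤ L) (f : ℚ) : (body P V.D n hL f N b Dp : Bld L R W _).nxt 4 ≤ R :=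
  le_trans (len_body P V.D hL f N b Dp 4).2 h.regs

set_option maxHeartbeats 1000000 in
-- Unfolding the postcondition of `body` is expensive.
theorem Ready.missProb_le {P : Par} {V : Env L n} {N b Dp kq : ℕ} (h : Ready P V R W N b Dp kq)
    (hL : 3 ≤ L) (f : ℚ) {z : Config R W} (hz : IsInput P kq z) :
    missProb (Circuit.lin V ((body P V.D n hL f N b Dp).circ 4) (ket z))
      (Outcome V P hL f N b Dp (candOf V hL N z)) ≤ P.bodyErr L N := by
  have hhas : ∀ i < 4, Has (⟨4, z⟩ : World R W) i (z (rg i)).toNat := fun i hi => ⟨hi, by simp⟩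
  have hlt : ∀ i, (z (rg i)).toNat < 2 ^ W := fun i => BitVec.isLt _
  refine le_trans (missProb_mono fun y _ hy => ?_)
    (runs_body h.toSuits h.tuples h.depth_le h.tree h.depth hL (f := f) (w := ⟨4, z⟩)
      (hhas 0 (by omega)) (hhas 1 (by omega)) (hhas 2 (by omega)) (hhas 3 (by omega))
      (hlt 0) (hlt 1) (hlt 2) (hlt 3) hz.1 ?_)
  · obtain ⟨h1, h2⟩ := hy
    refine ⟨fun l => ?_, ?_⟩
    · have := (h1.trkRep l).2
      simp only at this
      rw [this, BitVec.toNat_ofNat, Nat.mod_eq_of_lt]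
      · rfl
      · have h3 := digit_lt (hitsOf (candOf V hL N z) l)
        exact h.toFits.lt (by have := h.n_le; exact le_trans h3.le this)
    · have := h2.2
      simp only at this
      rw [this, BitVec.toNat_ofNat, Nat.mod_eq_of_lt (scoreVal_lt h)]
      rfl
  · exact h.nxt_le hL f

theorem Ready.four_le {R : ℕ} {P : Par} {V : Env L n} {N b Dp kq : ℕ}
    (h : Ready P V R W N b Dp kq) : 4 ≤ R := le_trans (Nat.le_add_right _ _) h.regs

open Classical in
/-- The probability of an event is the mean over the inputs. -/
theorem Ready.missProb_run {P : Par} {V : Env L n} {N b Dp kq : ℕ}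
    (h : Ready P V R W N b Dp kq) (hL : 3 ≤ L) (f : ℚ) (S : Config R W → Prop) :
    missProb ((innerCirc R W P V.D n hL f N b Dp kq).run V) S =
      ∑ z : Config R W, (if IsInput P kq z then P.prob kq else 0) *
        missProb (Circuit.lin V ((body P V.D n hL f N b Dp).circ 4) (ket z)) S := by
  have hks : ∀ i < 4, (fun i => if i = 3 then kq else 2 * P.m) i ≤ W := by
    intro i _
    have := h.kq_le
    have := h.m_le
    simp only
    split_ifs <;> assumption
  have hnorm : ∀ z : Config R W, ‖Circuit.lin V (hads (fun i => if i = 3 then kq else 2 * P.m) 4)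
      (ket 0) z‖ ^ 2 = if IsInput P kq z then P.prob kq else 0 := by
    intro z
    rw [normSq_hads V h.four_le hks]
    refine if_congr Iff.rfl ?_ rfl
    simp only [Finset.prod_range_succ, Finset.prod_range_zero, Par.prob]
    norm_num
    rw [← mul_inv, ← mul_inv, ← mul_inv, ← pow_add, ← pow_add, ← pow_add]
    congr 2
    ring
  have hrun : (innerCirc R W P V.D n hL f N b Dp kq).run V =
      Circuit.lin V ((body P V.D n hL f N b Dp).circ 4)
        (Circuit.lin V (hads (fun i => if i = 3 then kq else 2 * P.m) 4)
        (ket (0 : Config R W))) := by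
    rw [Circuit.run_eq, innerCirc, Circuit.lin_append]
  rw [hrun, missProb_lin_of_blank V ((body P V.D n hL f N b Dp).within 4
    (((len_body P V.D hL f N b Dp 4).2).trans h.regs))]
  · exact Finset.sum_congr rfl fun z _ => by rw [hnorm]
  · intro y hy
    by_contra hb
    have := hnorm y
    rw [if_neg fun h => hb h.1] at this
    exact hy (by simpa using this)

theorem Par.prob_pos (P : Par) (kq : ℕ) : 0 < P.prob kq := by unfold Par.prob; positivity

theorem Par.bodyErr_nonneg (P : Par) (L N : ℕ) : 0 ≤ P.bodyErr L N := by
  have := P.err_nonneg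
  unfold Par.bodyErr
  positivity

open Classical in
-- Apply `Ready.missProb_run` to the event that never happens: it is missed with probability one, on
-- average as well as for each input.
theorem Ready.sum_prob {P : Par} {V : Env L n} {N b Dp kq : ℕ}
    (h : Ready P V R W N b Dp kq) (hL : 3 ≤ L) :
    ∑ z : Config R W, (if IsInput P kq z then P.prob kq else 0) = 1 := by
  have := h.missProb_run hL 1 fun _ => False
  have hone : ∀ ψ : Config R W → ℂ, missProb ψ (fun _ => False) = ∑ x, ‖ψ x‖ ^ 2 := by
    intro ψ; simp [missProb]
  have h2 : missProb ((innerCirc R W P V.D n hL 1 N b Dp kq).run V) (fun _ => False) = 1 := by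
    rw [← Circuit.norm_run V (innerCirc R W P V.D n hL 1 N b Dp kq)]
    exact hone _
  rw [h2] at this
  simp only [hone, Circuit.norm_lin, norm_ket, mul_one] at this
  exact this.symm

open Classical in
/-- An event has about the probability of the inputs for which it is the ideal outcome. -/
theorem Ready.missProb_le_sum {P : Par} {V : Env L n} {N b Dp kq : ℕ}
    (h : Ready P V R W N b Dp kq) (hL : 3 ≤ L) (f : ℚ) (S : Config R W → Prop)
    (Z : Config R W → Prop) (hS : ∀ z y, IsInput P kq z → ¬ Z z →
      Outcome V P hL f N b Dp (candOf V hL N z) y → S y) :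
    missProb ((innerCirc R W P V.D n hL f N b Dp kq).run V) S ≤
      (∑ z : Config R W, if IsInput P kq z ∧ Z z then P.prob kq else 0) + P.bodyErr L N := by
  have hp := P.prob_pos kq
  have he := P.bodyErr_nonneg L N
  rw [h.missProb_run hL f S]
  have hsum := h.sum_prob hL
  calc _ ≤ ∑ z : Config R W, ((if IsInput P kq z ∧ Z z then P.prob kq else 0) +
        (if IsInput P kq z then P.prob kq else 0) * P.bodyErr L N) := by
        refine Finset.sum_le_sum fun z _ => ?_
        by_cases hz : IsInput P kq z
        · by_cases hZ : Z z
          · simp only [hz, hZ, and_self, if_true]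
            have := missProb_lin_ket_le_one V ((body P V.D n hL f N b Dp).circ 4) z S
            nlinarith
          · simp only [hz, hZ, and_false, if_false, if_true, zero_add]
            exact mul_le_mul_of_nonneg_left ((missProb_mono fun y _ hy => hS z y hz hZ hy).trans
              (h.missProb_le hL f hz)) hp.le
        · simp [hz]
    _ = _ := by rw [Finset.sum_add_distrib, ← Finset.sum_mul, hsum, one_mul]

end Prog

end CTF

/-! ### The distribution of the measured candidates -/

namespace CTF

variable {L n R W : ℕ}

section Prog

variable [NeZero R]

/-- Register contents of an input. -/
def mkInput {R : ℕ} (j0 j1 j2 q : ℕ) : Config R W := fun i =>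
  BitVec.ofNat W (if i.val = 0 then j0 else if i.val = 1 then j1 else if i.val = 2 then j2
    else if i.val = 3 then q else 0)

/-- The first three digits of a track are its seed, so they determine three of the four input
registers. -/
theorem candOf_eq {V : Env L n} {hL : 3 ≤ L} {N : ℕ} {z : Config R W} {c : Cand L n V.D.w}
    (hN : 1 ≤ N) (h : candOf V hL N z = some c) :
    digit (c.hits ⟨0, by omega⟩) = (z (rg 0)).toNat + 1 ∧
    digit (c.hits ⟨1, by omega⟩) = (z (rg 1)).toNat + 1 ∧
    digit (c.hits ⟨2, by omega⟩) = (z (rg 2)).toNat + 1 := by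
  obtain ⟨h0, h1, h2, hc⟩ := mem_found_of_candsAt (List.mem_of_getElem? h)
  have hi := listInv_seedCands (D := V.D) (E := V.E) (hL := hL) hN ⟨_, h0⟩ ⟨_, h1⟩ ⟨_, h2⟩
  rw [hi.hit0 c hc, hi.hit1 c hc, hi.hit2 c hc]
  exact ⟨rfl, rfl, rfl⟩

/-- Every candidate belongs to exactly one input. -/
theorem Ready.existsUnique_input {P : Par} {V : Env L n} {N b Dp kq : ℕ}
    (h : Ready P V R W N b Dp kq) {hL : 3 ≤ L} {c : Cand L n V.D.w}
    (hc : c ∈ found V.D V.E hL N) :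
    ∃ z : Config R W, IsInput P kq z ∧ candOf V hL N z = some c ∧
      ∀ z' c', IsInput P kq z' → candOf V hL N z' = some c' → c'.hits = c.hits → z' = z := by
  have h4 := h.four_le
  obtain ⟨j0, j1, j2, hc⟩ := mem_found.mp hc
  have hi := listInv_seedCands (D := V.D) (E := V.E) (hL := hL) h.one_le j0 j1 j2
  obtain ⟨q, hq, hqc⟩ := List.getElem_of_mem hc
  have hqN : q < N := lt_of_lt_of_le hq hi.length
  have hn : n ≤ 2 ^ (2 * P.m) :=
    h.lt_b.le.trans ((Nat.le_mul_of_pos_left _ h.one_le).trans h.idx)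
  have hm : 2 ^ (2 * P.m) ≤ 2 ^ W := Nat.pow_le_pow_right (by norm_num) h.m_le
  have hk : 2 ^ kq ≤ 2 ^ W := Nat.pow_le_pow_right (by norm_num) h.kq_le
  have hs := h.slots
  have r0 : (rg 0 : Fin R).val = 0 := rg_val (by omega)
  have r1 : (rg 1 : Fin R).val = 1 := rg_val (by omega)
  have r2 : (rg 2 : Fin R).val = 2 := rg_val (by omega)
  have r3 : (rg 3 : Fin R).val = 3 := rg_val (by omega)
  have e0 : ((mkInput j0 j1 j2 q : Config R W) (rg 0)).toNat = j0 := by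
    simp only [mkInput, r0, BitVec.toNat_ofNat]
    exact Nat.mod_eq_of_lt (by simp; omega)
  have e1 : ((mkInput j0 j1 j2 q : Config R W) (rg 1)).toNat = j1 := by
    simp only [mkInput, r1, BitVec.toNat_ofNat]
    exact Nat.mod_eq_of_lt (by simp; omega)
  have e2 : ((mkInput j0 j1 j2 q : Config R W) (rg 2)).toNat = j2 := by
    simp only [mkInput, r2, BitVec.toNat_ofNat]
    exact Nat.mod_eq_of_lt (by simp; omega)
  have e3 : ((mkInput j0 j1 j2 q : Config R W) (rg 3)).toNat = q := by
    simp only [mkInput, r3, BitVec.toNat_ofNat]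
    exact Nat.mod_eq_of_lt (by simp; omega)
  have hcands : candsAt V.D V.E hL N j0 j1 j2 = seedCands V.D V.E hL N j0 j1 j2 := by
    rw [candsAt, seedCands, seedAt, dif_pos ⟨j0.2, j1.2, j2.2⟩]
  have hcand : candOf V hL N (mkInput j0 j1 j2 q : Config R W) = some c := by
    rw [candOf, e0, e1, e2, e3, hcands, List.getElem?_eq_getElem hq, hqc]
  refine ⟨mkInput j0 j1 j2 q, ⟨fun i hi => ?_, fun i hi => ?_⟩, hcand, ?_⟩
  · simp only [mkInput]
    rw [if_neg (by omega), if_neg (by omega), if_neg (by omega), if_neg (by omega)]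
    rfl
  · have : i = 0 ∨ i = 1 ∨ i = 2 ∨ i = 3 := by omega
    rcases this with rfl | rfl | rfl | rfl
    · simp only [e0]; simp; omega
    · simp only [e1]; simp; omega
    · simp only [e2]; simp; omega
    · simp only [e3]; simp; omega
  · intro z' c' hz' hc' he
    have d := candOf_eq h.one_le hcand
    have d' := candOf_eq h.one_le hc'
    rw [he, d.1, d.2.1, d.2.2, e0, e1, e2] at d'
    obtain ⟨d0, d1, d2⟩ := d'
    rw [candOf, ← Nat.succ_inj.mp d0, ← Nat.succ_inj.mp d1, ← Nat.succ_inj.mp d2, hcands] at hc'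
    obtain ⟨hq', hqc'⟩ := List.getElem?_eq_some_iff.mp hc'
    -- The candidates of one seed have distinct tracks, so the track also determines the slot.
    have d3 : (z' (rg 3)).toNat = q := by
      refine (hi.nodup.getElem_inj_iff (hi := by simpa using hq') (hj := by simpa using hq)).mp ?_
      simp [hqc', hqc, he]
    funext i
    apply BitVec.eq_of_toNat_eq
    by_cases hi4 : 4 ≤ i.val
    · rw [hz'.1 i hi4]
      simp only [mkInput]
      rw [if_neg (by omega), if_neg (by omega), if_neg (by omega), if_neg (by omega)]
      rfl
    · have : i = rg 0 ∨ i = rg 1 ∨ i = rg 2 ∨ i = rg 3 := by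
        simp only [Fin.ext_iff, r0, r1, r2, r3]; omega
      rcases this with rfl | rfl | rfl | rfl
      · rw [e0]; omega
      · rw [e1]; omega
      · rw [e2]; omega
      · rw [e3, d3]

open Classical in
theorem sum_prob_unique (P : Par) (kq : ℕ) (Z : Config R W → Prop) {z : Config R W}
    (hz : IsInput P kq z) (hZ : Z z) (hu : ∀ z', IsInput P kq z' → Z z' → z' = z) :
    (∑ z : Config R W, if IsInput P kq z ∧ Z z then P.prob kq else 0) = P.prob kq := by
  rw [Finset.sum_eq_single z, if_pos ⟨hz, hZ⟩]
  · intro z' _ hne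
    exact if_neg fun h' => hne (hu z' h'.1 h'.2)
  · simp

open Classical in
theorem Ready.sum_prob_compl {P : Par} {V : Env L n} {N b Dp kq : ℕ}
    (h : Ready P V R W N b Dp kq) (hL : 3 ≤ L) {Z Z' : Config R W → Prop}
    (hZ : ∀ z, Z' z ↔ ¬ Z z) :
    (∑ z : Config R W, if IsInput P kq z ∧ Z' z then P.prob kq else 0) =
      1 - ∑ z : Config R W, if IsInput P kq z ∧ Z z then P.prob kq else 0 := by
  rw [← h.sum_prob hL, eq_sub_iff_add_eq, ← Finset.sum_add_distrib]
  refine Finset.sum_congr rfl fun z _ => ?_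
  simp only [hZ]
  by_cases ha : IsInput P kq z <;> by_cases hb : Z z <;> simp [ha, hb]

/-- The lookup in the tree is exact, since all tracks involved have `r ≥ 1`. So the score is finite
precisely for valid candidates. -/
theorem scoreVal_eq {V : Env L n} {f : ℚ} (hf0 : 0 < f) (hf1 : f ≤ 1) {ts : List (Track L n)}
    (hT : V.T = treeOf f ts) (hts : ∀ t ∈ ts, 1 ≤ rOf f t) {hL : 3 ≤ L} {N : ℕ} (hN : 1 ≤ N)
    {c : Cand L n V.D.w} (hc : c ∈ found V.D V.E hL N) :
    (c ∈ valid V.D V.E hL N f ts → scoreVal W V f (some c) = key V.D c) ∧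
    (c ∉ valid V.D V.E hL N f ts → scoreVal W V f (some c) = 2 ^ W - 1) := by
  have hiff : (Selected V.D V.E c.hits ∧ ¬ ∃ Sj ∈ allProbes L, ProbeHit f V.T c.hits Sj) ↔
      c ∈ valid V.D V.E hL N f ts := by
    rw [hT, exists_probeHit_iff hf0 hf1 (one_le_rOf_of_mem_found hf0 hN hc) hts, mem_valid, marked,
      List.mem_filter]
    simp only [hc, true_and, decide_eq_true_eq]
    push Not
    rfl
  constructor
  · intro h; rw [scoreVal, if_pos (hiff.mpr h)]
  · intro h; rw [scoreVal, if_neg fun h' => h (hiff.mp h')]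

theorem candOf_mem {V : Env L n} {hL : 3 ≤ L} {N : ℕ} {z : Config R W} {c : Cand L n V.D.w}
    (h : candOf V hL N z = some c) : c ∈ found V.D V.E hL N := by
  obtain ⟨h0, h1, h2, hc⟩ := mem_found_of_candsAt (List.mem_of_getElem? h)
  exact mem_found.mpr ⟨_, _, _, hc⟩

theorem one_sub_missProb {R : ℕ} (V : Env L n) (C : Circuit L R W) (S : Config R W → Prop) :
    missProb (C.run V) (fun x => ¬ S x) = 1 - missProb (C.run V) S := by
  rw [← Circuit.norm_run V C, ← missProb_add_compl _ S]
  ring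

theorem lt_infty_iff {U : Inner L} {v : BitVec U.W} : v < U.infty ↔ v.toNat < 2 ^ U.W - 1 := by
  rw [BitVec.lt_def, Inner.infty, BitVec.toNat_allOnes]

theorem mem_shows {U : Inner L} {D : Detector L} {c : Cand L n D.w} {y : Config U.R U.W}
    {t : Track L n} {v : ℕ} (hdec : U.decode n y = some t) (hsc : (y U.score).toNat = v)
    (hc : key D c < 2 ^ U.W - 1) : y ∈ U.shows D c ↔ t = c.hits ∧ v = key D c := by
  change (U.decode n y = some c.hits ∧ (y U.score).toNat = key D c ∧ y U.score < U.infty) ↔ _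
  rw [hdec, lt_infty_iff, hsc, Option.some.injEq]
  constructor
  · rintro ⟨h1, h2, -⟩; exact ⟨h1, h2⟩
  · rintro ⟨h1, h2⟩; exact ⟨h1, h2, h2 ▸ hc⟩

open Classical in
/-- What a measurement of the circuit yields. -/
theorem Ready.performs {P : Par} {D : Detector L} {E : Event L n D.w} {N b Dp kq : ℕ} {f : ℚ}
    (hf0 : 0 < f) (hf1 : f ≤ 1) {ts : List (Track L n)} (hts : ∀ t ∈ ts, 1 ≤ rOf f t)
    (h : Ready P ⟨D, E, treeOf f ts⟩ R W N b Dp kq) (hL : 3 ≤ L) {ε : ℝ}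
    (hε : P.bodyErr L N ≤ ε * P.prob kq) (hε0 : 0 ≤ ε) :
    (inner R W P D n hL f N b Dp kq).Performs D E hL N f ts (P.prob kq) ε := by
  set V : Env L n := ⟨D, E, treeOf f ts⟩ with hV
  set U := inner R W P D n hL f N b Dp kq with hU
  have hsv := fun {c : Cand L n D.w} (hc : c ∈ found D E hL N) =>
    scoreVal_eq (V := V) (W := W) hf0 hf1 rfl hts h.one_le hc
  have hfound : ∀ c ∈ valid D E hL N f ts, c ∈ found D E hL N := fun c hc =>
    (List.mem_filter.mp (mem_valid.mp hc).1).1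
  have hp := P.prob_pos kq
  have hkey : ∀ c ∈ found D E hL N, key D c < 2 ^ W - 1 := by
    intro c hc
    obtain ⟨z, -, hz, -⟩ := h.existsUnique_input hc
    exact h.key_lt (List.mem_of_getElem? hz)
  -- For found candidates validity depends on the hits alone. An ideal outcome thus shows `c` iff
  -- its candidate has the hits and the key of `c`.
  have hshow : ∀ (o : Option (Cand L n D.w)) (y : Config R W),
      (∀ c, o = some c → c ∈ found D E hL N) →
      Outcome V P hL f N b Dp o y → ∀ c ∈ valid D E hL N f ts,
      (y ∈ U.shows D c ↔ ∃ c', o = some c' ∧ c'.hits = c.hits ∧ key D c' = key D c) := by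
    intro o y ho hy c hc
    have hdec : U.decode n y = some (hitsOf o) := decode_eq_some.mpr hy.1
    have hsc : (y U.score).toNat = scoreVal W V f o := hy.2
    have hcf := hkey c (hfound c hc)
    have hmem : y ∈ U.shows D c ↔ hitsOf o = c.hits ∧ scoreVal W V f o = key D c :=
      mem_shows (U := U) hdec hsc hcf
    rw [hmem]
    cases o with
    | none =>
      simp only [scoreVal, reduceCtorEq, false_and, exists_false, iff_false, not_and]
      omega
    | some c' =>
      have hc' := hsv (ho c' rfl)
      simp only [Option.some.injEq, exists_eq_left']
      by_cases hv : c' ∈ valid D E hL N f ts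
      · rw [hc'.1 hv]; rfl
      · rw [hc'.2 hv]
        constructor
        · rintro ⟨-, h2⟩; omega
        · rintro ⟨h1, h2⟩
          refine absurd ?_ hv
          rw [mem_valid, marked, List.mem_filter] at hc ⊢
          rw [h1]
          exact ⟨⟨ho c' rfl, hc.1.2⟩, hc.2⟩
  have hcm : ∀ (z : Config R W) c, candOf V hL N z = some c → c ∈ found D E hL N :=
    fun z c hz => candOf_mem hz
  refine ⟨fun c hc => ?_, ?_⟩
  · obtain ⟨z, hz, hzc, hu⟩ := h.existsUnique_input (hfound c hc)
    rw [measure_apply]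
    constructor
    · apply ENNReal.ofReal_le_ofReal
      -- The lower bound comes from the complement: `c` fails to be shown at most with the
      -- probability of the other inputs, `1 - p`, plus the error.
      have h1 := h.missProb_le_sum hL f (fun x => x ∈ U.shows D c)
        (fun z => ¬ ∃ c', candOf V hL N z = some c' ∧ c'.hits = c.hits ∧ key D c' = key D c)
        fun z y hz hZ hy => (hshow _ y (hcm z) hy c hc).mpr (not_not.mp hZ)
      have h2 : missProb (U.circ.run V) (fun x => x ∉ U.shows D c) =
          1 - missProb ((innerCirc R W P D n hL f N b Dp kq).run V) (fun x => x ∈ U.shows D c) :=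
        one_sub_missProb (R := R) (W := W) V _ _
      rw [h2]
      have h3 := sum_prob_unique P kq
        (fun z => ∃ c', candOf V hL N z = some c' ∧ c'.hits = c.hits ∧ key D c' = key D c) hz
        ⟨c, hzc, rfl, rfl⟩ fun z' hz' ⟨c', h1, h2, _⟩ => hu z' c' hz' h1 h2
      rw [h.sum_prob_compl hL (Z := fun z => ∃ c', candOf V hL N z = some c' ∧
        c'.hits = c.hits ∧ key D c' = key D c) fun z => Iff.rfl, h3] at h1
      have h1' : missProb ((innerCirc R W P D n hL f N b Dp kq).run V)
        (fun x => x ∈ U.shows D c) ≤ 1 - P.prob kq + P.bodyErr L N := h1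
      linarith
    · apply ENNReal.ofReal_le_ofReal
      have h1 := h.missProb_le_sum hL f (fun x => x ∉ U.shows D c)
        (fun z => ∃ c', candOf V hL N z = some c' ∧ c'.hits = c.hits ∧ key D c' = key D c)
        fun z y hz hZ hy h' => hZ ((hshow _ y (hcm z) hy c hc).mp h')
      have h3 := sum_prob_unique P kq
        (fun z => ∃ c', candOf V hL N z = some c' ∧ c'.hits = c.hits ∧ key D c' = key D c) hz
        ⟨c, hzc, rfl, rfl⟩ fun z' hz' ⟨c', h1, h2, _⟩ => hu z' c' hz' h1 h2
      refine h1.trans ?_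
      linarith
  · rw [measure_apply]
    apply ENNReal.ofReal_le_ofReal
    have hp1 : P.prob kq ≤ 1 := inv_le_one_of_one_le₀ (one_le_pow₀ (by norm_num))
    -- No ideal outcome has a finite score without showing a valid candidate. What is left is the
    -- error of the program, at most `ε * p ≤ ε`.
    have h1 := h.missProb_le_sum hL f
      (fun x => x ∉ {x | x U.score < U.infty ∧ ∀ c ∈ valid D E hL N f ts, x ∉ U.shows D c})
      (fun z => False) fun z y hz _ hy h' => ?_
    · refine h1.trans ?_
      simp only [and_false, if_false, Finset.sum_const_zero, zero_add]
      nlinarith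
    · obtain ⟨h2, h3⟩ := h'
      have hsc : (y (inner R W P D n hL f N b Dp kq).score).toNat =
        scoreVal W V f (candOf V hL N z) := hy.2
      have h2 := (lt_infty_iff (U := U) (v := (y : Config U.R U.W) U.score)).mp h2
      have h2 : scoreVal W V f (candOf V hL N z) < 2 ^ W - 1 := by
        rw [← hsc]; exact h2
      cases ho : candOf V hL N z with
      | none => rw [ho] at h2; simp only [scoreVal] at h2; omega
      | some c =>
        by_cases hv : c ∈ valid D E hL N f ts
        · exact h3 c hv ((hshow _ y (hcm z) hy c hv).mpr ⟨c, ho, rfl, rfl⟩)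
        · rw [ho, (hsv (hcm z c ho)).2 hv] at h2; omega

end Prog

end CTF

namespace CTF

variable {L n R W : ℕ}

/-! ## Quantum minimum finding -/

/-- The estimate `|sin ((2j+1)θ)| ≤ (2j+1) |sin θ|`, obtained from the recursion so that `P = 0`
needs no separate treatment. It limits how much amplification can favour wrong samples with a low
score. -/
theorem abs_ampCoef_le {P : ℝ} (h0 : 0 ≤ P) (h1 : P ≤ 1) (j : ℕ) :
    |(ampCoef P j).1| ≤ 2 * j + 1 := by
  induction j with
  | zero => simp [ampCoef]
  | succ j ih =>
    have hn := ampCoef_norm h0 h1 j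
    set A := (ampCoef P j).1
    set B := (ampCoef P j).2
    have hB : |B * (1 - P)| ≤ 1 := by
      rw [← sq_le_one_iff_abs_le_one]
      nlinarith [mul_nonneg (sq_nonneg A) h0, mul_nonneg (sq_nonneg B) (sub_nonneg.mpr h1),
        mul_nonneg (mul_nonneg (sq_nonneg B) (sub_nonneg.mpr h1)) h0]
    have hA : |A * (1 - 2 * P)| ≤ |A| := by
      rw [abs_mul]
      exact mul_le_of_le_one_right (abs_nonneg _) (abs_le.mpr ⟨by linarith, by linarith⟩)
    have e : (ampCoef P (j + 1)).1 = A * (1 - 2 * P) + 2 * (B * (1 - P)) := by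
      simp only [ampCoef]; ring
    rw [e]
    refine (abs_add_le _ _).trans ?_
    rw [abs_mul 2, abs_two]
    push_cast
    linarith

/-- The mean probability of success of amplitude amplification with a random number of rounds. -/
theorem sum_ampCoef_ge {P : ℝ} (h0 : 0 < P) (h1 : P ≤ 3 / 4) {M : ℕ} (hM : 1 / √P ≤ M) :
    (M : ℝ) / 4 ≤ ∑ j ∈ Finset.range M, (ampCoef P j).1 ^ 2 * P := by
  set θ := Real.arcsin √P
  have hsq : √P ≤ 1 := Real.sqrt_le_one.mpr (by linarith)
  have hsin : Real.sin θ = √P := Real.sin_arcsin (by linarith [Real.sqrt_nonneg P]) hsq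
  have hs2 : Real.sin θ ^ 2 = P := by rw [hsin, Real.sq_sqrt h0.le]
  have hpos : 0 < √P := Real.sqrt_pos.mpr h0
  -- This is the purpose of `P ≤ 3/4`: with `cos θ ≥ 1/2`, the denominator `sin (2θ) = 2 sin θ cos
  -- θ` below is at least `√P`.
  have hcos : 1 / 2 ≤ Real.cos θ := by
    refine abs_le_of_sq_le_sq' (a := 1 / 2) ?_ (Real.cos_arcsin_nonneg _) |>.2
    rw [Real.cos_sq', hs2]; linarith
  have hs : √P ≤ Real.sin (2 * θ) := by
    rw [Real.sin_two_mul, hsin]; nlinarith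
  have hterm : ∀ j : ℕ, (ampCoef P j).1 ^ 2 * P = 1 / 2 - Real.cos ((4 * j + 2) * θ) / 2 := by
    intro j
    have h := (ampCoef_eq hs2 j).1
    have : (ampCoef P j).1 ^ 2 * P = Real.sin ((2 * j + 1) * θ) ^ 2 := by
      rw [← h, mul_pow, hs2]
    rw [this, Real.sin_sq_eq_half_sub]
    ring_nf
  -- Multiplied by `2 sin (2θ)`, the sum of cosines telescopes. It is therefore bounded
  -- independently of `M`.
  have htel : ∀ M : ℕ, (∑ j ∈ Finset.range M, Real.cos ((4 * j + 2) * θ)) *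
      (2 * Real.sin (2 * θ)) = Real.sin (4 * M * θ) := by
    intro M
    induction M with
    | zero => simp
    | succ M ih =>
      rw [Finset.sum_range_succ, add_mul, ih]
      have e1 : 4 * ((M + 1 : ℕ) : ℝ) * θ = (4 * M + 2) * θ + 2 * θ := by push_cast; ring
      have e2 : 4 * (M : ℝ) * θ = (4 * M + 2) * θ - 2 * θ := by ring
      rw [e1, e2, Real.sin_add, Real.sin_sub]
      ring
  simp only [hterm]
  rw [Finset.sum_sub_distrib, Finset.sum_const, Finset.card_range, nsmul_eq_mul, ← Finset.sum_div]
  have hle : (∑ j ∈ Finset.range M, Real.cos ((4 * j + 2) * θ)) ≤ 1 / (2 * √P) := by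
    have h3 : (∑ j ∈ Finset.range M, Real.cos ((4 * j + 2) * θ)) * (2 * Real.sin (2 * θ)) ≤ 1 :=
      (htel M).trans_le (Real.sin_le_one _)
    rcases le_or_gt (∑ j ∈ Finset.range M, Real.cos ((4 * j + 2) * θ)) 0 with h | h
    · exact h.trans (by positivity)
    · rw [le_div_iff₀ (by positivity)]
      refine le_trans ?_ h3
      gcongr
  have : 1 / (2 * √P) = (1 / √P) / 2 := by field_simp
  linarith

theorem sum_range_two_mul_add_one (M : ℕ) :
    ∑ j ∈ Finset.range M, (2 * (j : ℝ) + 1) = (M : ℝ) ^ 2 := by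
  induction M with
  | zero => simp
  | succ M ih => rw [Finset.sum_range_succ, ih]; push_cast; ring

/-- A bound for the expected number of calls until a search succeeds that has reached the range
`a` for the number of rounds, if the success probability without amplification is `P`. -/
noncomputable def searchCost (P a : ℝ) : ℝ := if 1 / √P ≤ a then 20 * a else 36 / √P - 10 * a

theorem searchCost_nonneg {P a : ℝ} (hP : 0 < P) (ha : 0 ≤ a) : 0 ≤ searchCost P a := by
  have : 0 < √P := Real.sqrt_pos.mpr hP
  rw [searchCost]
  split_ifs with h
  · positivity
  · push Not at h
    have e : 36 / √P = 36 * (1 / √P) := by ring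
    rw [e]; linarith

theorem searchCost_one_le {P : ℝ} (hP : 0 < P) (hP1 : P ≤ 1) : searchCost P 1 ≤ 36 / √P := by
  have hs : 0 < √P := Real.sqrt_pos.mpr hP
  have h1 : 1 ≤ 1 / √P := by
    rw [le_div_iff₀ hs, one_mul]; exact Real.sqrt_le_one.mpr hP1
  have e : 36 / √P = 36 * (1 / √P) := by ring
  rw [searchCost, e]
  split_ifs <;> linarith

/-- `S` is the sum of the success probabilities for `0, …, M - 1` rounds. -/
theorem searchCost_step {P a : ℝ} (hP : 0 < P) (ha : 1 ≤ a) {M S : ℝ}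
    (hM0 : 0 < M) (hM : M ≤ 2 * a) (hS0 : 0 ≤ S)
    (hS : 1 / √P ≤ a → M / 4 ≤ S) :
    M ^ 2 + (M - S) * searchCost P (6 / 5 * a) ≤ M * searchCost P a := by
  have hs : 0 < √P := Real.sqrt_pos.mpr hP
  have e : 36 / √P = 36 * (1 / √P) := by ring
  rw [searchCost, searchCost, e]
  set X := 1 / √P
  -- Once the range is large enough, a quarter of the choices succeeds on average, and `2a + (3/4) *
  -- 24a = 20a`: the coefficient `20` reproduces itself although the range grows by `6/5`.
  by_cases h : X ≤ a
  · rw [if_pos h, if_pos (by linarith)]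
    have := hS h
    nlinarith
  · push Not at h
    rw [if_neg (not_le.mpr h)]
    have hkey : ∀ F : ℝ, 0 ≤ F → 2 * a + F ≤ 36 * X - 10 * a →
        M ^ 2 + (M - S) * F ≤ M * (36 * X - 10 * a) := by
      intro F hF h'
      nlinarith [mul_nonneg hS0 hF]
    -- Before that, success is not counted at all. If the next range is large enough, `2a + 24a ≤
    -- 36X - 10a` because `a ≤ X`; otherwise `2a + 36X - 12a = 36X - 10a` exactly. This fixes the
    -- constants `36` and `10`.
    split_ifs with h2
    · exact hkey _ (by linarith) (by linarith)
    · push Not at h2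
      exact hkey _ (by linarith) (by linarith)

/-- Cumulated masses. -/
theorem sum_mul_inv_sqrt_ge {m : ℕ → ℝ} (hm : ∀ r, 0 ≤ m r) {t : ℕ} (ht : 0 < m t)
    (ht0 : ∀ r < t, m r = 0) {y : ℕ} (hy : t < y) :
    2 * (√(∑ r ∈ Finset.range y, m r) - √(m t)) ≤
      ∑ r ∈ Finset.range y, if r = t then 0 else m r / √(∑ i ∈ Finset.range r, m i) := by
  induction y, hy using Nat.le_induction with
  | base =>
    have h0 : ∑ r ∈ Finset.range t, m r = 0 :=
      Finset.sum_eq_zero fun r hr => ht0 r (Finset.mem_range.mp hr)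
    rw [Finset.sum_range_succ, h0, zero_add, sub_self, mul_zero]
    refine Finset.sum_nonneg fun r _ => ?_
    have := hm r
    split_ifs <;> positivity
  | succ y hy ih =>
    rw [Finset.sum_range_succ, Finset.sum_range_succ, if_neg (by omega)]
    have hQ : m t ≤ ∑ r ∈ Finset.range y, m r :=
      Finset.single_le_sum (fun r _ => hm r) (Finset.mem_range.mpr (by omega))
    set Q := ∑ r ∈ Finset.range y, m r
    have hQ0 : 0 < Q := lt_of_lt_of_le ht hQ
    have hs : 0 < √Q := Real.sqrt_pos.mpr hQ0
    have hmy := hm y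
    -- Concavity of the square root; the left sides telescope.
    have h2 : 2 * (√(Q + m y) - √Q) ≤ m y / √Q := by
      rw [le_div_iff₀ hs]
      have e1 := Real.sq_sqrt hQ0.le
      have e2 := Real.sq_sqrt (add_nonneg hQ0.le hmy)
      nlinarith [sq_nonneg (√(Q + m y) - √Q)]
    linarith

end CTF

/-! ### A round of quantum minimum finding and the masses of the scores -/

namespace CTF

variable {L n R W : ℕ}

/-- The state after a round of quantum minimum finding, with `j` rounds of amplification and the
sample `x`. -/
def qmfNext (V : Env L n) (U : Inner L) (s : QMF U) (j : ℕ) (x : Config U.R U.W) : QMF U :=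
  if x U.score < s.y then
    QMF.mk (some x) (x U.score) 0 (s.calls + (2 * j + 1))
      (s.time + (U.amplify s.y j).cost V.D.opCost + U.R * U.W + U.W + 1)
  else QMF.mk s.best s.y (s.fails + 1) (s.calls + (2 * j + 1))
      (s.time + (U.amplify s.y j).cost V.D.opCost + U.R * U.W + U.W + 1)

/-- The number of choices for the number of rounds of amplification. -/
def rangeSize (B s : ℕ) : ℕ := min (⌈((6 : ℚ) / 5) ^ s⌉₊ - 1) B + 1

instance (B s : ℕ) : Nonempty (Fin (rangeSize B s)) := by
  unfold rangeSize; infer_instance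

theorem qmfRound_eq (V : Env L n) (U : Inner L) (B : ℕ) (s : QMF U) :
    qmfRound V U B s = (PMF.uniformOfFintype (Fin (rangeSize B s.fails))).bind fun j =>
      ((U.amplify s.y j).measure V).bind fun x => PMF.pure (qmfNext V U s j x) := rfl

theorem tsum_bind_mul {α β : Type*} (p : PMF α) (q : α → PMF β) (F : β → ENNReal) :
    ∑' b, p.bind q b * F b = ∑' a, p a * ∑' b, q a b * F b := by
  simp only [PMF.bind_apply, ← ENNReal.tsum_mul_right, ← ENNReal.tsum_mul_left]
  rw [ENNReal.tsum_comm]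
  simp only [mul_assoc]

theorem tsum_pure_mul {α : Type*} (a : α) (F : α → ENNReal) : ∑' b, PMF.pure a b * F b = F a := by
  rw [tsum_eq_single a]
  · simp
  · intro b hb; simp [hb]

theorem tsum_measure_mul_le {U : Inner L} (V : Env L n) (C : Circuit L U.R U.W)
    {F : Config U.R U.W → ENNReal} {g : Config U.R U.W → ℝ} (hg : ∀ x, 0 ≤ g x)
    (h : ∀ x, F x ≤ ENNReal.ofReal (g x)) :
    ∑' x, C.measure V x * F x ≤ ENNReal.ofReal (∑ x, ‖C.run V x‖ ^ 2 * g x) := by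
  rw [tsum_fintype, ENNReal.ofReal_sum_of_nonneg fun x _ => mul_nonneg (by positivity) (hg x)]
  refine Finset.sum_le_sum fun x _ => ?_
  rw [ENNReal.ofReal_mul (by positivity)]
  exact mul_le_mul_right (h x) _

/-- Reduces an expectation over one round to a finite real sum over the number of amplifications and
the sample. The bounds on whole runs follow by induction, with `F` the failure probability of the
remaining rounds. -/
theorem tsum_qmfRound_le (V : Env L n) (U : Inner L) (B : ℕ) (s : QMF U) {F : QMF U → ENNReal}
    {g : ℕ → Config U.R U.W → ℝ} (hg : ∀ j x, 0 ≤ g j x)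
    (h : ∀ j ≤ B, ∀ x, F (qmfNext V U s j x) ≤ ENNReal.ofReal (g j x)) {b : ℝ}
    (hb : ∑ j ∈ Finset.range (rangeSize B s.fails),
      ∑ x, ‖(U.amplify s.y j).run V x‖ ^ 2 * g j x ≤ rangeSize B s.fails * b) :
    ∑' s', qmfRound V U B s s' * F s' ≤ ENNReal.ofReal b := by
  have hpos : (0 : ℝ) < rangeSize B s.fails := by
    rw [rangeSize]; positivity
  rw [qmfRound_eq, tsum_bind_mul, tsum_fintype]
  simp only [tsum_bind_mul, tsum_pure_mul, PMF.uniformOfFintype_apply, Fintype.card_fin]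
  have hj : ∀ j : Fin (rangeSize B s.fails), j.val ≤ B := fun j =>
    Nat.lt_succ_iff.mp (lt_of_lt_of_le j.2 (Nat.succ_le_succ (min_le_right _ _)))
  calc _ ≤ ∑ j : Fin (rangeSize B s.fails), ((rangeSize B s.fails : ℕ) : ENNReal)⁻¹ *
        ENNReal.ofReal (∑ x, ‖(U.amplify s.y j).run V x‖ ^ 2 * g j x) :=
        Finset.sum_le_sum fun j _ => mul_le_mul_right
          (tsum_measure_mul_le V _ (hg j) (h j (hj j))) _
    _ = ENNReal.ofReal ((rangeSize B s.fails : ℝ)⁻¹ * ∑ j ∈ Finset.range (rangeSize B s.fails),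
        ∑ x, ‖(U.amplify s.y j).run V x‖ ^ 2 * g j x) := by
        rw [← Finset.mul_sum, ENNReal.ofReal_mul (by positivity), ENNReal.ofReal_inv_of_pos hpos,
          ENNReal.ofReal_natCast, ← ENNReal.ofReal_sum_of_nonneg, Finset.sum_range]
        exact fun j _ => Finset.sum_nonneg fun x _ => mul_nonneg (by positivity) (hg _ x)
    _ ≤ ENNReal.ofReal b := by
        apply ENNReal.ofReal_le_ofReal
        rwa [inv_mul_le_iff₀ hpos]

open Classical in
/-- The probability that a measurement of `U|0⟩` yields a good sample with score `r`. -/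
noncomputable def Inner.mass (U : Inner L) (V : Env L n) (Good : Config U.R U.W → Prop) (r : ℕ) :
    ℝ := ∑ x, if Good x ∧ (x U.score).toNat = r then ‖U.circ.run V x‖ ^ 2 else 0

/-- The probability that a measurement of `U|0⟩` yields a good sample with score below `r`. -/
noncomputable def Inner.cum (U : Inner L) (V : Env L n) (Good : Config U.R U.W → Prop) (r : ℕ) :
    ℝ := ∑ i ∈ Finset.range r, U.mass V Good i

open Classical in
/-- A measurement of `U|0⟩` yields a good sample or the score `+∞`, except with probability `e`;
`t` is the least score of a good sample, or `+∞`. -/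
structure Sampler (U : Inner L) (V : Env L n) (Good : Config U.R U.W → Prop) (t : ℕ) (p e : ℝ) :
    Prop where
  pos : 0 < p
  err_nonneg : 0 ≤ e
  lt_infty : ∀ x, Good x → x U.score < U.infty
  le_score : ∀ x, Good x → t ≤ (x U.score).toNat
  le_infty : t ≤ U.infty.toNat
  le_mass : t < U.infty.toNat → p ≤ U.mass V Good t
  junk : (∑ x, if x U.score < U.infty ∧ ¬ Good x then ‖U.circ.run V x‖ ^ 2 else 0) ≤ e
  below_le : U.below V U.infty ≤ 3 / 4

variable {U : Inner L} {V : Env L n} {Good : Config U.R U.W → Prop} {t : ℕ} {p e : ℝ}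

theorem Inner.mass_nonneg (U : Inner L) (V : Env L n) (Good : Config U.R U.W → Prop) (r : ℕ) :
    0 ≤ U.mass V Good r :=
  Finset.sum_nonneg fun x _ => by split_ifs <;> positivity

open Classical in
theorem Inner.sum_good (U : Inner L) (V : Env L n) (Good : Config U.R U.W → Prop) (y : BitVec U.W)
    (F : ℕ → ℝ) :
    (∑ x, if Good x ∧ x U.score < y then ‖U.circ.run V x‖ ^ 2 * F (x U.score).toNat else 0) =
      ∑ r ∈ Finset.range y.toNat, U.mass V Good r * F r := by
  simp only [Inner.mass, Finset.sum_mul]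
  rw [Finset.sum_comm]
  refine Finset.sum_congr rfl fun x _ => ?_
  by_cases hx : Good x
  · simp only [hx, true_and, ite_mul, zero_mul]
    rw [Finset.sum_ite_eq]
    simp only [Finset.mem_range, BitVec.lt_def]
  · simp [hx]

theorem Inner.cum_le_below (U : Inner L) (V : Env L n) (Good : Config U.R U.W → Prop)
    (y : BitVec U.W) : U.cum V Good y.toNat ≤ U.below V y := by
  have := U.sum_good V Good y fun _ => 1
  simp only [mul_one] at this
  rw [Inner.cum, ← this, Inner.below]
  refine Finset.sum_le_sum fun x _ => ?_
  by_cases hx : Good x <;> by_cases hy : x U.score < y <;> simp [hx, hy]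

theorem Inner.below_mono (U : Inner L) (V : Env L n) {y y' : BitVec U.W} (h : y ≤ y') :
    U.below V y ≤ U.below V y' := by
  refine Finset.sum_le_sum fun x _ => ?_
  by_cases h1 : x U.score < y
  · rw [if_pos h1, if_pos (by rw [BitVec.lt_def] at *; rw [BitVec.le_def] at h; omega)]
  · rw [if_neg h1]; split_ifs <;> positivity

theorem le_inf (y : BitVec U.W) : y ≤ U.infty := by
  rw [BitVec.le_def, Inner.infty, BitVec.toNat_allOnes]
  have := y.isLt
  omega

namespace Sampler

theorem mass_eq_zero (hS : Sampler U V Good t p e) {r : ℕ} (h : r < t) : U.mass V Good r = 0 := by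
  refine Finset.sum_eq_zero fun x _ => if_neg ?_
  rintro ⟨h1, h2⟩
  have := hS.le_score x h1
  omega

theorem below_le' (hS : Sampler U V Good t p e) (y : BitVec U.W) : U.below V y ≤ 3 / 4 :=
  (U.below_mono V (le_inf y)).trans hS.below_le

/-- A bound for the expected number of calls after the next improvement. -/
noncomputable def laterCost (U : Inner L) (V : Env L n) (Good : Config U.R U.W → Prop) (t r : ℕ) :
    ℝ := 72 / √(U.mass V Good t) - 72 / √(U.cum V Good r)

/-- A bound for the expected number of calls after an improvement to the score `r`. -/
noncomputable def restCost (U : Inner L) (V : Env L n) (Good : Config U.R U.W → Prop) (t r : ℕ) :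
    ℝ := if r = t then 0 else 72 / √(U.mass V Good t) - 36 / √(U.cum V Good r)

theorem mass_le_cum {r : ℕ} (h : t < r) : U.mass V Good t ≤ U.cum V Good r :=
  Finset.single_le_sum (fun i _ => U.mass_nonneg V Good i) (Finset.mem_range.mpr h)

theorem laterCost_nonneg (hm : 0 < U.mass V Good t) {r : ℕ} (h : t < r) :
    0 ≤ laterCost U V Good t r := by
  have := Real.sqrt_le_sqrt (mass_le_cum (U := U) (V := V) (Good := Good) h)
  have h0 := Real.sqrt_pos.mpr hm
  rw [laterCost, sub_nonneg]
  gcongr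

/-- The reason for the form of the potential. With `v` the mass of the minimum and `Q` the mass
below the threshold, averaging `72/√v - 36/√Q_r` over the new score `r ≠ t` gives at most `(72/√v)(Q
- v) - 72(√Q - √v) = Q (72/√v - 72/√Q)`. The gap between `36/√Q` and `72/√Q` is what pays for the
search at the present threshold. -/
theorem sum_restCost_le (hS : Sampler U V Good t p e) (hm : 0 < U.mass V Good t) (y : BitVec U.W)
    (hy : t < y.toNat) :
    ∑ r ∈ Finset.range y.toNat, U.mass V Good r * restCost U V Good t r ≤
      U.below V y * laterCost U V Good t y.toNat := by
  refine le_trans ?_ (mul_le_mul_of_nonneg_right (U.cum_le_below V Good y)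
    (laterCost_nonneg hm hy))
  have h1 := sum_mul_inv_sqrt_ge (U.mass_nonneg V Good) hm (fun r hr => hS.mass_eq_zero hr) hy
  have h2 : ∀ r, U.mass V Good r * restCost U V Good t r =
      72 / √(U.mass V Good t) * U.mass V Good r -
      (if r = t then 72 / √(U.mass V Good t) * U.mass V Good t else 0) -
      36 * (if r = t then 0 else U.mass V Good r / √(∑ i ∈ Finset.range r, U.mass V Good i)) := by
    intro r
    rw [restCost]
    split_ifs with h
    · rw [h]; ring
    · rw [Inner.cum]; ring
  simp only [h2]
  rw [Finset.sum_sub_distrib, Finset.sum_sub_distrib, ← Finset.mul_sum, ← Finset.mul_sum,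
    Finset.sum_ite_eq', if_pos (Finset.mem_range.mpr hy), laterCost]
  change _ ≤ _ at h1
  have hQ := mass_le_cum (U := U) (V := V) (Good := Good) hy
  rw [Inner.cum] at hQ ⊢
  set Q := ∑ r ∈ Finset.range y.toNat, U.mass V Good r
  set v := U.mass V Good t
  have hv := Real.sqrt_pos.mpr hm
  have hQ0 := Real.sqrt_pos.mpr (hm.trans_le hQ)
  have e1 : Q * (72 / √v - 72 / √Q) = 72 / √v * Q - 72 * √Q := by
    have := Real.mul_self_sqrt (hm.trans_le hQ).le
    field_simp
    nlinarith
  have e2 : 72 / √v * v = 72 * √v := by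
    have := Real.mul_self_sqrt hm.le
    field_simp
    nlinarith
  rw [e1, e2]
  linarith

end Sampler

end CTF

/-! ### The failure probability of a run -/

namespace CTF

variable {L n R W : ℕ} {U : Inner L} {V : Env L n} {Good : Config U.R U.W → Prop} {t : ℕ}
  {p e : ℝ}

/-- Quantum minimum finding has not yet met a sample that is neither good nor of score `+∞`. -/
def Clean (Good : Config U.R U.W → Prop) (best : Option (Config U.R U.W)) (y : BitVec U.W) : Prop :=
  (best = none ∧ y = U.infty) ∨ ∃ x, Good x ∧ best = some x ∧ y = x U.score

theorem Clean.le {best : Option (Config U.R U.W)} {y : BitVec U.W} (h : Clean Good best y)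
    (hS : Sampler U V Good t p e) : t ≤ y.toNat := by
  rcases h with ⟨-, rfl⟩ | ⟨x, hx, -, rfl⟩
  · exact hS.le_infty
  · exact hS.le_score x hx

theorem toOuterMeasure_le_one {α : Type*} (μ : PMF α) (s : Set α) : μ.toOuterMeasure s ≤ 1 := by
  rw [PMF.toOuterMeasure_apply, ← μ.tsum_coe]
  exact ENNReal.tsum_le_tsum fun a => Set.indicator_le_self _ _ a

theorem pure_not_le {α : Type*} {Q : α → Prop} {a : α} (h : Q a) (b : ENNReal) :
    (PMF.pure a).toOuterMeasure {x | ¬ Q x} ≤ b := by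
  rw [PMF.toOuterMeasure_pure_apply, if_neg (by simpa using h)]
  exact zero_le

namespace Sampler

open Classical in
-- Wrong samples below the threshold are amplified like the good ones, but their probability grows
-- at most by the square of `2 B + 1`.
theorem junk_amplify (hS : Sampler U V Good t p e) (y : BitVec U.W) {j B : ℕ} (hj : j ≤ B) :
    (∑ x, ‖(U.amplify y j).run V x‖ ^ 2 * if x U.score < y ∧ ¬ Good x then 1 else 0) ≤
      (2 * B + 1) ^ 2 * e := by
  have hA := abs_ampCoef_le (U.below_nonneg V y) (U.below_le_one V y) j
  have hjB : (j : ℝ) ≤ B := by exact_mod_cast hj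
  have hA2 : (ampCoef (U.below V y) j).1 ^ 2 ≤ (2 * B + 1) ^ 2 := by
    rw [← sq_abs]
    exact pow_le_pow_left₀ (abs_nonneg _) (by linarith) 2
  refine le_trans ?_ (mul_le_mul_of_nonneg_left hS.junk (by positivity))
  rw [Finset.mul_sum]
  refine Finset.sum_le_sum fun x _ => ?_
  by_cases h : x U.score < y ∧ ¬ Good x
  · have hlt : x U.score < U.infty := by
      have h1 := h.1
      have h2 := le_inf (U := U) y
      rw [BitVec.lt_def] at *
      rw [BitVec.le_def] at h2
      omega
    rw [if_pos h, if_pos ⟨hlt, h.2⟩, mul_one, Inner.normSq_run_amplify, if_pos h.1]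
    exact mul_le_mul_of_nonneg_right hA2 (by positivity)
  · rw [if_neg h, mul_zero]
    split_ifs <;> positivity

open Classical in
/-- The expected cost of a round and of what follows it. -/
theorem round_le (hS : Sampler U V Good t p e) (hm : 0 < U.mass V Good t) {y : BitVec U.W}
    (hy : t < y.toNat) (j : ℕ) {Φ : ℝ} :
    ∑ x, ‖(U.amplify y j).run V x‖ ^ 2 *
      (if x U.score < y then
        if Good x then 2 * j + 1 + restCost U V Good t (x U.score).toNat else 0
      else 2 * j + 1 + Φ) ≤
    2 * j + 1 + (1 - (ampCoef (U.below V y) j).1 ^ 2 * U.below V y) * Φ +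
      (ampCoef (U.below V y) j).1 ^ 2 * U.below V y * laterCost U V Good t y.toNat := by
  have hnorm := ampCoef_norm (U.below_nonneg V y) (U.below_le_one V y) j
  have hrest := hS.sum_restCost_le hm y hy
  have hgood := U.sum_good V Good y (restCost U V Good t)
  have habove : (∑ x, if x U.score < y then 0 else ‖U.circ.run V x‖ ^ 2) = 1 - U.below V y := by
    rw [← Circuit.norm_run V U.circ, Inner.below, ← Finset.sum_sub_distrib]
    refine Finset.sum_congr rfl fun x _ => ?_
    split_ifs <;> simp
  have hone := Circuit.norm_run V (U.amplify y j)
  have hamp := U.normSq_run_amplify V y j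
  set A := (ampCoef (U.below V y) j).1
  set A' := (ampCoef (U.below V y) j).2
  set P := U.below V y
  calc _ ≤ ∑ x, (‖(U.amplify y j).run V x‖ ^ 2 * (2 * j + 1) +
        A ^ 2 * (if Good x ∧ x U.score < y then
          ‖U.circ.run V x‖ ^ 2 * restCost U V Good t (x U.score).toNat else 0) +
        A' ^ 2 * (if x U.score < y then 0 else ‖U.circ.run V x‖ ^ 2) * Φ) := by
        refine Finset.sum_le_sum fun x _ => ?_
        have hx := hamp x
        have h0 : 0 ≤ ‖(U.amplify y j).run V x‖ ^ 2 * (2 * (j : ℝ) + 1) := by positivity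
        by_cases h1 : x U.score < y
        · by_cases h2 : Good x
          · simp only [h1, h2, and_self, if_true] at hx ⊢
            rw [hx]
            apply le_of_eq
            ring
          · simp only [h1, h2, false_and, if_false, if_true] at hx ⊢
            linarith
        · simp only [h1, and_false, if_false] at hx ⊢
          rw [hx]
          apply le_of_eq
          ring
    _ = 2 * j + 1 + A ^ 2 * (∑ r ∈ Finset.range y.toNat,
          U.mass V Good r * restCost U V Good t r) + A' ^ 2 * (1 - P) * Φ := by
        rw [Finset.sum_add_distrib, Finset.sum_add_distrib, ← Finset.sum_mul, ← Finset.mul_sum,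
          ← Finset.sum_mul, ← Finset.mul_sum, hone, hgood, habove, one_mul]
    _ ≤ _ := by
        have e1 : A' ^ 2 * (1 - P) = 1 - A ^ 2 * P := by linarith
        rw [e1, mul_assoc (A ^ 2)]
        have := mul_le_mul_of_nonneg_left hrest (sq_nonneg A)
        linarith

theorem rangeSize_le (B s : ℕ) : (rangeSize B s : ℝ) ≤ 2 * (6 / 5) ^ s := by
  have h1 : (1 : ℚ) ≤ (6 / 5) ^ s := one_le_pow₀ (by norm_num)
  have h2 := Nat.ceil_lt_add_one (R := ℚ) (a := (6 / 5) ^ s) (by positivity)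
  have h3 : rangeSize B s ≤ ⌈((6 : ℚ) / 5) ^ s⌉₊ := by
    have : 1 ≤ ⌈((6 : ℚ) / 5) ^ s⌉₊ := Nat.one_le_ceil_iff.mpr (by positivity)
    rw [rangeSize]; omega
  have h4 : (rangeSize B s : ℚ) ≤ 2 * (6 / 5) ^ s := by
    have : (rangeSize B s : ℚ) ≤ ⌈((6 : ℚ) / 5) ^ s⌉₊ := by exact_mod_cast h3
    linarith
  have h5 := (Rat.cast_le (K := ℝ)).mpr h4
  push_cast at h5
  exact h5

theorem le_rangeSize {B s : ℕ} {x : ℝ} (h1 : x ≤ B) (h2 : x ≤ (6 / 5) ^ s) :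
    x ≤ rangeSize B s := by
  have h3 : ((6 : ℝ) / 5) ^ s ≤ (⌈((6 : ℚ) / 5) ^ s⌉₊ : ℝ) := by
    have := (Rat.cast_le (K := ℝ)).mpr (Nat.le_ceil (((6 : ℚ) / 5) ^ s))
    push_cast at this
    exact this
  have h4 : min (⌈((6 : ℚ) / 5) ^ s⌉₊) B ≤ rangeSize B s := by rw [rangeSize]; omega
  refine le_trans ?_ (Nat.cast_le.mpr h4)
  rw [Nat.cast_min]
  exact le_min (h2.trans h3) h1

/-- A bound for the expected number of calls before the minimum is found. -/
noncomputable def cost (U : Inner L) (V : Env L n) (Good : Config U.R U.W → Prop) (t : ℕ)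
    (y : BitVec U.W) (s : ℕ) : ℝ :=
  searchCost (U.below V y) ((6 / 5) ^ s) + laterCost U V Good t y.toNat

open Classical in
-- Summed over the choices of `j`, `round_le` takes the form of `searchCost_step`, because the
-- numbers of calls `2 j + 1` add up to the square of the size of the range. So the calls made plus
-- the potential do not increase on average.
theorem sum_round_le (hS : Sampler U V Good t p e) (hm : p ≤ U.mass V Good t) {y : BitVec U.W}
    (hy : t < y.toNat) {B : ℕ} (hB : 1 / √p ≤ B) (s : ℕ) :
    ∑ j ∈ Finset.range (rangeSize B s), ∑ x, ‖(U.amplify y j).run V x‖ ^ 2 *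
      (if x U.score < y then
        if Good x then 2 * j + 1 + restCost U V Good t (x U.score).toNat else 0
      else 2 * j + 1 + cost U V Good t y (s + 1)) ≤ rangeSize B s * cost U V Good t y s := by
  have hm0 := hS.pos.trans_le hm
  have hpP : p ≤ U.below V y := hm.trans ((mass_le_cum hy).trans (U.cum_le_below V Good y))
  have hP0 := hS.pos.trans_le hpP
  have hP : 1 / √(U.below V y) ≤ B := by
    have := Real.sqrt_pos.mpr hS.pos
    refine le_trans ?_ hB
    gcongr
  refine (Finset.sum_le_sum fun j _ => hS.round_le hm0 hy j).trans ?_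
  have hstep := searchCost_step (P := U.below V y) (a := (6 / 5) ^ s) hP0
    (one_le_pow₀ (by norm_num)) (M := rangeSize B s)
    (S := ∑ j ∈ Finset.range (rangeSize B s), (ampCoef (U.below V y) j).1 ^ 2 * U.below V y)
    (by rw [rangeSize]; positivity) (rangeSize_le B s)
    (Finset.sum_nonneg fun j _ => mul_nonneg (sq_nonneg _) hP0.le)
    fun h => sum_ampCoef_ge hP0 (hS.below_le' y) (le_rangeSize hP h)
  rw [cost, cost, pow_succ']
  set S := ∑ j ∈ Finset.range (rangeSize B s), (ampCoef (U.below V y) j).1 ^ 2 * U.below V y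
  rw [Finset.sum_add_distrib, Finset.sum_add_distrib, sum_range_two_mul_add_one,
    ← Finset.sum_mul, ← Finset.sum_mul, Finset.sum_sub_distrib, Finset.sum_const,
    Finset.card_range, nsmul_eq_mul, mul_one]
  change _ + (_ - S) * _ + S * _ ≤ _
  linarith

theorem restCost_nonneg (hm : 0 < U.mass V Good t) {r : ℕ} (h : t ≤ r) :
    0 ≤ restCost U V Good t r := by
  rw [restCost]
  split_ifs with h'
  · rfl
  · have h1 := laterCost_nonneg (U := U) (V := V) (Good := Good) hm (lt_of_le_of_ne h (Ne.symm h'))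
    have h2 : 0 ≤ 36 / √(U.cum V Good r) := by positivity
    have h3 : 72 / √(U.cum V Good r) = 36 / √(U.cum V Good r) + 36 / √(U.cum V Good r) := by ring
    rw [laterCost] at h1
    linarith

theorem below_pos (hS : Sampler U V Good t p e) (hm : p ≤ U.mass V Good t) {y : BitVec U.W}
    (hy : t < y.toNat) : 0 < U.below V y :=
  hS.pos.trans_le (hm.trans ((mass_le_cum hy).trans (U.cum_le_below V Good y)))

theorem cost_nonneg (hS : Sampler U V Good t p e) (hm : p ≤ U.mass V Good t) {y : BitVec U.W}
    (hy : t < y.toNat) (s : ℕ) : 0 ≤ cost U V Good t y s :=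
  add_nonneg (searchCost_nonneg (hS.below_pos hm hy) (by positivity))
    (laterCost_nonneg (hS.pos.trans_le hm) hy)

/-- After an improvement the search starts again from the range one, at a cost of at most `36/√Q`;
this is the difference between `restCost` and `laterCost`. -/
theorem cost_zero_le (hS : Sampler U V Good t p e) (hm : p ≤ U.mass V Good t) {y : BitVec U.W}
    (hy : t < y.toNat) : cost U V Good t y 0 ≤ restCost U V Good t y.toNat := by
  have h1 := searchCost_one_le (hS.below_pos hm hy) (U.below_le_one V y)
  have hc : 0 < U.cum V Good y.toNat := hS.pos.trans_le (hm.trans (mass_le_cum hy))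
  have h2 : 36 / √(U.below V y) ≤ 36 / √(U.cum V Good y.toNat) := by
    have := Real.sqrt_pos.mpr hc
    have := U.cum_le_below V Good y
    gcongr
  have h3 : 72 / √(U.cum V Good y.toNat) =
    36 / √(U.cum V Good y.toNat) + 36 / √(U.cum V Good y.toNat) := by ring
  rw [cost, restCost, if_neg (by omega), laterCost, pow_zero]
  linarith

theorem cost_zero_le_sqrt (hS : Sampler U V Good t p e) (hm : p ≤ U.mass V Good t)
    {y : BitVec U.W} (hy : t < y.toNat) : cost U V Good t y 0 ≤ 72 / √p := by
  refine (hS.cost_zero_le hm hy).trans ?_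
  rw [restCost, if_neg (by omega)]
  have h1 : 72 / √(U.mass V Good t) ≤ 72 / √p := by
    have := Real.sqrt_pos.mpr hS.pos
    gcongr
  have h2 : 0 ≤ 36 / √(U.cum V Good y.toNat) := by positivity
  linarith

/-- The probability that a run meets a sample that is neither good nor of score `+∞`. -/
theorem loop_not_clean_le (hS : Sampler U V Good t p e) (B k : ℕ) (s : QMF U)
    (hs : Clean Good s.best s.y) :
    (qmfLoop V U B k s).toOuterMeasure {s' | ¬ Clean Good s'.best s'.y} ≤
      ENNReal.ofReal (k * ((2 * B + 1) ^ 2 * e)) := by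
  classical
  have hJ : 0 ≤ (2 * (B : ℝ) + 1) ^ 2 * e := mul_nonneg (by positivity) hS.err_nonneg
  induction k generalizing s with
  | zero => exact pure_not_le (Q := fun s : QMF U => Clean Good s.best s.y) hs _
  | succ k ih =>
    rw [qmfLoop]
    split_ifs
    · exact pure_not_le (Q := fun s : QMF U => Clean Good s.best s.y) hs _
    · change ((qmfRound V U B s).bind fun s' => qmfLoop V U B k s').toOuterMeasure _ ≤ _
      rw [PMF.toOuterMeasure_bind_apply]
      -- Each of the remaining rounds is charged with the largest probability that amplification can
      -- give to wrong samples.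
      refine tsum_qmfRound_le V U B s (g := fun j x => k * ((2 * B + 1) ^ 2 * e) +
        if x U.score < s.y ∧ ¬ Good x then 1 else 0)
        (fun j x => by split_ifs <;> positivity) (fun j hj x => ?_) ?_
      · by_cases h : x U.score < s.y ∧ ¬ Good x
        · simp only [if_pos h]
          refine (toOuterMeasure_le_one _ _).trans ?_
          rw [← ENNReal.ofReal_one]
          exact ENNReal.ofReal_le_ofReal (by linarith [mul_nonneg (Nat.cast_nonneg (α := ℝ) k) hJ])
        · simp only [if_neg h, add_zero]
          have hc : Clean Good (qmfNext V U s j x).best (qmfNext V U s j x).y := by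
            rw [qmfNext]
            split_ifs with h1
            · exact Or.inr ⟨x, by tauto, rfl, rfl⟩
            · exact hs
          exact ih _ hc
      · have hM : ∀ j ∈ Finset.range (rangeSize B s.fails),
            ∑ x, ‖(U.amplify s.y j).run V x‖ ^ 2 * (k * ((2 * B + 1) ^ 2 * e) +
              if x U.score < s.y ∧ ¬ Good x then 1 else 0) ≤
            ((k + 1 : ℕ) : ℝ) * ((2 * B + 1) ^ 2 * e) := by
          intro j hj
          have hj : j ≤ B := by
            have := Finset.mem_range.mp hj
            rw [rangeSize] at this
            omega
          have h1 := hS.junk_amplify s.y hj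
          simp only [mul_add]
          rw [Finset.sum_add_distrib, ← Finset.sum_mul, Circuit.norm_run, one_mul]
          push_cast
          linarith
        refine (Finset.sum_le_sum hM).trans_eq ?_
        rw [Finset.sum_const, Finset.card_range, nsmul_eq_mul]

/-- The probability that a run does not find the minimum. -/
theorem loop_miss_le (hS : Sampler U V Good t p e) {B : ℕ} (hB : 1 / √p ≤ B) (k : ℕ) (s : QMF U)
    (hs : Clean Good s.best s.y) (hk : B ≤ s.calls + k) :
    (qmfLoop V U B k s).toOuterMeasure {s' | ¬ (Clean Good s'.best s'.y ∧ s'.y.toNat = t)} ≤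
      ENNReal.ofReal (k * ((2 * B + 1) ^ 2 * e) +
        if s.y.toNat = t then 0 else (s.calls + cost U V Good t s.y s.fails) / B) := by
  classical
  have hJ : 0 ≤ (2 * (B : ℝ) + 1) ^ 2 * e := mul_nonneg (by positivity) hS.err_nonneg
  have hB0 : (0 : ℝ) < B := lt_of_lt_of_le (by have := Real.sqrt_pos.mpr hS.pos; positivity) hB
  have hlt : ∀ {best : Option (Config U.R U.W)} {y : BitVec U.W}, Clean Good best y →
      y.toNat ≠ t → t < y.toNat ∧ p ≤ U.mass V Good t := by
    intro best y hc hne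
    have h1 : t < y.toNat := lt_of_le_of_ne (hc.le hS) hne.symm
    refine ⟨h1, hS.le_mass (h1.trans_le ?_)⟩
    exact BitVec.le_def.mp (le_inf (U := U) y)
  -- Markov's inequality is built into the bound: a run that stops short of the minimum has made `B`
  -- calls, and the quotient by `B` is then at least one.
  have hpure : ∀ s : QMF U, Clean Good s.best s.y → ∀ k : ℕ, B ≤ s.calls →
      (PMF.pure s).toOuterMeasure {s' | ¬ (Clean Good s'.best s'.y ∧ s'.y.toNat = t)} ≤
      ENNReal.ofReal (k * ((2 * B + 1) ^ 2 * e) +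
        if s.y.toNat = t then 0 else (s.calls + cost U V Good t s.y s.fails) / B) := by
    intro s hs k hB'
    by_cases ht : s.y.toNat = t
    · exact pure_not_le (Q := fun s : QMF U => Clean Good s.best s.y ∧ s.y.toNat = t) ⟨hs, ht⟩ _
    · refine (toOuterMeasure_le_one _ _).trans ?_
      rw [if_neg ht, ← ENNReal.ofReal_one]
      obtain ⟨h1, h2⟩ := hlt hs ht
      apply ENNReal.ofReal_le_ofReal
      have h3 := hS.cost_nonneg h2 h1 s.fails
      have h4 : 1 ≤ (s.calls + cost U V Good t s.y s.fails) / B := by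
        rw [le_div_iff₀ hB0, one_mul]
        have : (B : ℝ) ≤ s.calls := by exact_mod_cast hB'
        linarith
      have := mul_nonneg (Nat.cast_nonneg (α := ℝ) k) hJ
      linarith
  induction k generalizing s with
  | zero => exact hpure s hs 0 hk
  | succ k ih =>
    rw [qmfLoop]
    by_cases hcalls : B ≤ s.calls
    · rw [if_pos hcalls]; exact hpure s hs (k + 1) hcalls
    · rw [if_neg hcalls]
      change ((qmfRound V U B s).bind fun s' => qmfLoop V U B k s').toOuterMeasure _ ≤ _
      rw [PMF.toOuterMeasure_bind_apply]
      have hkJ := mul_nonneg (Nat.cast_nonneg (α := ℝ) k) hJ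
      have hnext : ∀ j x, ¬ (x U.score < s.y ∧ ¬ Good x) →
          Clean Good (qmfNext V U s j x).best (qmfNext V U s j x).y := by
        intro j x h
        rw [qmfNext]
        split_ifs with h1
        · exact Or.inr ⟨x, by tauto, rfl, rfl⟩
        · exact hs
      have hcn : ∀ j x, (qmfNext V U s j x).calls = s.calls + (2 * j + 1) := by
        intro j x; rw [qmfNext]; split_ifs <;> rfl
      by_cases ht : s.y.toNat = t
      -- At the minimum no good sample is below the threshold, so only a wrong sample can spoil the
      -- result.
      · refine tsum_qmfRound_le V U B s (g := fun j x => k * ((2 * B + 1) ^ 2 * e) +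
          if x U.score < s.y ∧ ¬ Good x then 1 else 0)
          (fun j x => by split_ifs <;> positivity) (fun j hj x => ?_) ?_
        · by_cases h : x U.score < s.y ∧ ¬ Good x
          · simp only [if_pos h]
            refine (toOuterMeasure_le_one _ _).trans ?_
            rw [← ENNReal.ofReal_one]
            exact ENNReal.ofReal_le_ofReal (by linarith)
          · simp only [if_neg h, add_zero]
            have hge : ¬ x U.score < s.y := by
              intro h1
              have h2 : Good x := by tauto
              have h3 := hS.le_score x h2
              rw [BitVec.lt_def] at h1
              omega
            refine (ih _ (hnext j x h) (by rw [hcn]; omega)).trans (le_of_eq ?_)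
            rw [qmfNext, if_neg hge, if_pos ht, add_zero]
        · have hM : ∀ j ∈ Finset.range (rangeSize B s.fails),
              ∑ x, ‖(U.amplify s.y j).run V x‖ ^ 2 * (k * ((2 * B + 1) ^ 2 * e) +
                if x U.score < s.y ∧ ¬ Good x then 1 else 0) ≤
              ((k + 1 : ℕ) : ℝ) * ((2 * B + 1) ^ 2 * e) := by
            intro j hj
            have hj : j ≤ B := by
              have := Finset.mem_range.mp hj
              rw [rangeSize] at this
              omega
            have h1 := hS.junk_amplify s.y hj
            simp only [mul_add]
            rw [Finset.sum_add_distrib, ← Finset.sum_mul, Circuit.norm_run, one_mul]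
            push_cast
            linarith
          refine (Finset.sum_le_sum hM).trans_eq ?_
          rw [Finset.sum_const, Finset.card_range, nsmul_eq_mul, if_pos ht, add_zero]
      · obtain ⟨hty, hm⟩ := hlt hs ht
        have hm0 := hS.pos.trans_le hm
        have hcost := hS.cost_nonneg hm hty (s.fails + 1)
        have hh : ∀ (j : ℕ) (x : Config U.R U.W), 0 ≤ (if x U.score < s.y then
            if Good x then 2 * j + 1 + restCost U V Good t (x U.score).toNat else 0
            else 2 * j + 1 + cost U V Good t s.y (s.fails + 1)) := by
          intro j x
          split_ifs with h1 h2
          · have := restCost_nonneg (U := U) (V := V) (Good := Good) hm0 (hS.le_score x h2)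
            positivity
          · rfl
          · positivity
        -- The three terms account for wrong samples in later rounds, for a wrong sample now, and
        -- for the expected total number of calls divided by `B`.
        refine tsum_qmfRound_le V U B s (g := fun j x => k * ((2 * B + 1) ^ 2 * e) +
          (if x U.score < s.y ∧ ¬ Good x then 1 else 0) +
          (s.calls + (if x U.score < s.y then
            if Good x then 2 * j + 1 + restCost U V Good t (x U.score).toNat else 0
            else 2 * j + 1 + cost U V Good t s.y (s.fails + 1))) / B)
          (fun j x => ?_) (fun j hj x => ?_) ?_
        · have := hh j x
          have : (0 : ℝ) ≤ if x U.score < s.y ∧ ¬ Good x then 1 else 0 := by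
            split_ifs <;> norm_num
          positivity
        · have hhx := hh j x
          have hq : 0 ≤ (s.calls + (if x U.score < s.y then
            if Good x then 2 * j + 1 + restCost U V Good t (x U.score).toNat else 0
            else 2 * j + 1 + cost U V Good t s.y (s.fails + 1))) / (B : ℝ) := by positivity
          by_cases h : x U.score < s.y ∧ ¬ Good x
          · refine (toOuterMeasure_le_one _ _).trans ?_
            rw [← ENNReal.ofReal_one]
            apply ENNReal.ofReal_le_ofReal
            simp only [if_pos h]
            linarith
          · refine (ih _ (hnext j x h) (by rw [hcn]; omega)).trans ?_
            apply ENNReal.ofReal_le_ofReal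
            simp only [if_neg h, add_zero]
            refine add_le_add_right ?_ _
            rw [qmfNext]
            by_cases h1 : x U.score < s.y
            · have h2 : Good x := by tauto
              simp only [if_pos h1, if_pos h2] at hq ⊢
              by_cases h3 : (x U.score).toNat = t
              · rw [if_pos h3]; exact hq
              · rw [if_neg h3]
                -- An improvement resets the number of failures to zero, so the potential of the new
                -- state is `cost` at `0`, which `restCost` dominates.
                have h4 := hS.cost_zero_le hm (y := x U.score)
                  (lt_of_le_of_ne (hS.le_score x h2) (Ne.symm h3))
                push_cast
                gcongr ?_ / _
                linarith
            · simp only [if_neg h1, if_neg ht]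
              push_cast
              gcongr ?_ / _
              linarith
        · have hsum := hS.sum_round_le hm hty hB s.fails
          have hM : ∑ j ∈ Finset.range (rangeSize B s.fails),
              ∑ x, ‖(U.amplify s.y j).run V x‖ ^ 2 *
                (if x U.score < s.y ∧ ¬ Good x then 1 else 0) ≤
              rangeSize B s.fails * ((2 * B + 1) ^ 2 * e) := by
            refine (Finset.sum_le_sum fun j hj => hS.junk_amplify s.y (B := B) ?_).trans_eq ?_
            · have := Finset.mem_range.mp hj
              rw [rangeSize] at this
              omega
            · rw [Finset.sum_const, Finset.card_range, nsmul_eq_mul]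
          have hsplit : ∀ (j : ℕ) (x : Config U.R U.W) (a b c : ℝ),
              ‖(U.amplify s.y j).run V x‖ ^ 2 * (a + b + (s.calls + c) / B) =
              ‖(U.amplify s.y j).run V x‖ ^ 2 * (a + s.calls / B) +
              ‖(U.amplify s.y j).run V x‖ ^ 2 * b +
              ‖(U.amplify s.y j).run V x‖ ^ 2 * c / B := by
            intro j x a b c; ring
          simp only [hsplit, Finset.sum_add_distrib, ← Finset.sum_div, ← Finset.sum_mul,
            Circuit.norm_run, one_mul]
          simp only [Finset.sum_const, Finset.card_range, nsmul_eq_mul, if_neg ht]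
          have hdiv := div_le_div_of_nonneg_right hsum hB0.le
          refine (add_le_add (add_le_add le_rfl hM) hdiv).trans_eq ?_
          push_cast
          ring

end Sampler

end CTF

/-! ### Repeated runs of quantum minimum finding and their time -/

namespace CTF

variable {L n R W : ℕ} {U : Inner L} {V : Env L n} {Good : Config U.R U.W → Prop} {t : ℕ}
  {p e : ℝ}

namespace Sampler

theorem qmf_not_clean_le (hS : Sampler U V Good t p e) (B : ℕ) :
    (qmf V U B).toOuterMeasure {s' | ¬ Clean Good s'.best s'.y} ≤
      ENNReal.ofReal (B * ((2 * B + 1) ^ 2 * e)) :=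
  hS.loop_not_clean_le B B _ (Or.inl ⟨rfl, rfl⟩)

/-- A whole run needs at most `72/√p` calls on average, whatever the number and the distribution of
the good scores. -/
theorem qmf_miss_le (hS : Sampler U V Good t p e) {B : ℕ} (hB : 1 / √p ≤ B) :
    (qmf V U B).toOuterMeasure {s' | ¬ (Clean Good s'.best s'.y ∧ s'.y.toNat = t)} ≤
      ENNReal.ofReal (B * ((2 * B + 1) ^ 2 * e) + 72 / √p / B) := by
  refine (hS.loop_miss_le hB B _ (Or.inl ⟨rfl, rfl⟩) (by simp)).trans ?_
  apply ENNReal.ofReal_le_ofReal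
  refine add_le_add_right ?_ _
  by_cases ht : U.infty.toNat = t
  · rw [if_pos ht]
    positivity
  · rw [if_neg ht]
    have hlt : t < U.infty.toNat := lt_of_le_of_ne hS.le_infty (Ne.symm ht)
    have := hS.cost_zero_le_sqrt (hS.le_mass hlt) hlt
    gcongr ?_ / _
    push_cast
    linarith

end Sampler

/-- The better one of the best sample so far and the result of a run. -/
def better (U : Inner L) (b : Option (Config U.R U.W) × BitVec U.W × ℕ) (s : QMF U) :
    Option (Config U.R U.W) × BitVec U.W × ℕ :=
  if s.y < b.2.1 then (s.best, s.y, b.2.2 + s.time + U.W)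
    else (b.1, b.2.1, b.2.2 + s.time + U.W)

theorem qmfBest_succ (V : Env L n) (U : Inner L) (B m : ℕ) :
    qmfBest V U B (m + 1) = (qmfBest V U B m).bind fun b => (qmf V U B).map (better U b) := rfl

theorem better_clean {b : Option (Config U.R U.W) × BitVec U.W × ℕ} {s : QMF U}
    (hb : Clean Good b.1 b.2.1) (hs : Clean Good s.best s.y) :
    Clean Good (better U b s).1 (better U b s).2.1 := by
  rw [better]; split_ifs <;> assumption

theorem tsum_mul_indicator {α : Type*} (μ : PMF α) (A : Set α) :
    ∑' a, μ a * A.indicator 1 a = μ.toOuterMeasure A := by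
  rw [PMF.toOuterMeasure_apply]
  refine tsum_congr fun a => ?_
  by_cases h : a ∈ A <;> simp [h]

namespace Sampler

theorem qmfBest_not_clean_le {B : ℕ} {J : ENNReal}
    (hJ : (qmf V U B).toOuterMeasure {s' | ¬ Clean Good s'.best s'.y} ≤ J) (m : ℕ) :
    (qmfBest V U B m).toOuterMeasure {b | ¬ Clean Good b.1 b.2.1} ≤ m * J := by
  induction m with
  | zero => exact pure_not_le (Q := fun b : Option (Config U.R U.W) × BitVec U.W × ℕ =>
      Clean Good b.1 b.2.1) (Or.inl ⟨rfl, rfl⟩) _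
  | succ m ih =>
    rw [qmfBest_succ, PMF.toOuterMeasure_bind_apply]
    calc _ ≤ ∑' b, qmfBest V U B m b * ({b | ¬ Clean Good b.1 b.2.1}.indicator 1 b + J) := by
          refine ENNReal.tsum_le_tsum fun b => mul_le_mul_right ?_ _
          by_cases hb : Clean Good b.1 b.2.1
          · rw [PMF.toOuterMeasure_map_apply]
            refine le_trans (MeasureTheory.measure_mono ?_) (hJ.trans le_add_self)
            intro s hs hc
            exact hs (better_clean hb hc)
          · rw [Set.indicator_of_mem (by exact hb)]
            exact (toOuterMeasure_le_one _ _).trans le_self_add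
      _ = (qmfBest V U B m).toOuterMeasure {b | ¬ Clean Good b.1 b.2.1} + J := by
          simp only [mul_add]
          rw [ENNReal.tsum_add, tsum_mul_indicator, ENNReal.tsum_mul_right, PMF.tsum_coe, one_mul]
      _ ≤ _ := by
          push_cast
          rw [add_mul, one_mul]
          exact add_le_add_left ih _

/-- If no run is spoilt by a wrong sample, the best of `m` runs misses the minimum only if all of
them do, whence `η ^ m`. Spoilt runs are counted apart by a union bound: they can beat the minimum,
and repetition does not help against them. -/
theorem qmfBest_miss_le (hS : Sampler U V Good t p e) {B : ℕ} {J η : ENNReal}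
    (hJ : (qmf V U B).toOuterMeasure {s' | ¬ Clean Good s'.best s'.y} ≤ J)
    (hη : (qmf V U B).toOuterMeasure {s' | ¬ (Clean Good s'.best s'.y ∧ s'.y.toNat = t)} ≤ η)
    (hη1 : η ≤ 1) (m : ℕ) :
    (qmfBest V U B m).toOuterMeasure {b | ¬ (Clean Good b.1 b.2.1 ∧ b.2.1.toNat = t)} ≤
      η ^ m + m ^ 2 * J := by
  induction m with
  | zero => exact (toOuterMeasure_le_one _ _).trans (by simp)
  | succ m ih =>
    rw [qmfBest_succ, PMF.toOuterMeasure_bind_apply]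
    calc _ ≤ ∑' b, qmfBest V U B m b * ({b | ¬ Clean Good b.1 b.2.1}.indicator 1 b + J +
          {b | ¬ (Clean Good b.1 b.2.1 ∧ b.2.1.toNat = t)}.indicator 1 b * η) := by
          refine ENNReal.tsum_le_tsum fun b => mul_le_mul_right ?_ _
          by_cases hb : Clean Good b.1 b.2.1
          · rw [PMF.toOuterMeasure_map_apply]
            by_cases ht : b.2.1.toNat = t
            -- Once the minimum has been reached, only a run that is not clean can displace it.
            · refine le_trans (MeasureTheory.measure_mono (t := {s' | ¬ Clean Good s'.best s'.y})
                ?_) (hJ.trans (le_add_self.trans le_self_add))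
              intro s hs hc
              refine hs ?_
              have hge : ¬ s.y < b.2.1 := by
                have := hc.le hS
                rw [BitVec.lt_def]; omega
              rw [better, if_neg hge]
              exact ⟨hb, ht⟩
            · have hmem : b ∈ {b : Option (Config U.R U.W) × BitVec U.W × ℕ |
                ¬ (Clean Good b.1 b.2.1 ∧ b.2.1.toNat = t)} := fun h => ht h.2
              rw [Set.indicator_of_mem hmem, Pi.one_apply, one_mul]
              refine le_trans (MeasureTheory.measure_mono ?_) (hη.trans le_add_self)
              intro s hs hc
              refine hs ?_
              have hlt : s.y < b.2.1 := by
                have h1 := hb.le hS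
                have h2 := hc.2
                rw [BitVec.lt_def]; omega
              rw [better, if_pos hlt]
              exact hc
          · rw [Set.indicator_of_mem (by exact hb)]
            exact (toOuterMeasure_le_one _ _).trans (le_self_add.trans le_self_add)
      _ = (qmfBest V U B m).toOuterMeasure {b | ¬ Clean Good b.1 b.2.1} + J +
          (qmfBest V U B m).toOuterMeasure {b | ¬ (Clean Good b.1 b.2.1 ∧ b.2.1.toNat = t)} *
            η := by
          simp only [mul_add, ← mul_assoc]
          rw [ENNReal.tsum_add, ENNReal.tsum_add, tsum_mul_indicator, ENNReal.tsum_mul_right,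
            PMF.tsum_coe, one_mul, ENNReal.tsum_mul_right, tsum_mul_indicator]
      _ ≤ m * J + J + (η ^ m * η + m ^ 2 * J) := by
          refine add_le_add (add_le_add_left (qmfBest_not_clean_le hJ m) _) ?_
          refine (mul_le_mul_left ih η).trans ?_
          rw [add_mul]
          exact add_le_add_right (mul_le_of_le_one_right' hη1) _
      _ ≤ _ := by
          rw [← pow_succ, add_left_comm]
          refine add_le_add_right ?_ _
          push_cast
          have : ((m : ENNReal) + 1) ^ 2 * J = m * J + J + m ^ 2 * J + m * J := by ring
          rw [this]
          exact le_self_add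

end Sampler

theorem cost_append (τ : ℕ) (C C' : Circuit L R W) :
    Circuit.cost τ (C ++ C') = Circuit.cost τ C + Circuit.cost τ C' := by
  simp [Circuit.cost]

theorem cost_reverse (τ : ℕ) (C : Circuit L R W) : Circuit.cost τ C.reverse = Circuit.cost τ C := by
  simp [Circuit.cost, List.sum_reverse]

theorem cost_amplify (U : Inner L) (τ : ℕ) (y : BitVec U.W) (j : ℕ) :
    (U.amplify y j).cost τ =
      U.circ.cost τ + j * (2 * U.circ.cost τ + U.W + U.R * U.W + 2) := by
  rw [Inner.amplify, cost_append]
  congr 1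
  induction j with
  | zero => simp [Circuit.cost]
  | succ j ih =>
    rw [List.replicate_succ, List.flatten_cons, cost_append, ih, List.cons_append]
    have h1 : ∀ (g : Gate L U.R U.W) (C : Circuit L U.R U.W),
        Circuit.cost τ (g :: C) = g.cost τ + Circuit.cost τ C := by
      intro g C; simp [Circuit.cost]
    rw [h1, cost_append, h1, cost_reverse]
    simp only [Gate.cost]
    ring

/-- A bound for the time per call. -/
def callTime (U : Inner L) (τ : ℕ) : ℕ := U.circ.cost τ + U.R * U.W + U.W + 2

/-- The last round may overshoot: it starts with at most `B - 1` calls and makes at most `2 B + 1`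
more, whence the factor three. -/
theorem qmfLoop_time {B k : ℕ} {s s' : QMF U} (h : s' ∈ (qmfLoop V U B k s).support)
    (hc : s.calls ≤ 3 * B) (ht : s.time ≤ s.calls * callTime U V.D.opCost) :
    s'.calls ≤ 3 * B ∧ s'.time ≤ s'.calls * callTime U V.D.opCost := by
  induction k generalizing s with
  | zero =>
    have : s' = s := (PMF.mem_support_pure_iff _ _).mp h
    subst this
    exact ⟨hc, ht⟩
  | succ k ih =>
    rw [qmfLoop] at h
    split_ifs at h with hB
    · have : s' = s := (PMF.mem_support_pure_iff _ _).mp h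
      subst this
      exact ⟨hc, ht⟩
    · change s' ∈ ((qmfRound V U B s).bind fun s' => qmfLoop V U B k s').support at h
      rw [PMF.mem_support_bind_iff] at h
      obtain ⟨s₁, h1, h2⟩ := h
      rw [qmfRound_eq, PMF.mem_support_bind_iff] at h1
      obtain ⟨j, -, h1⟩ := h1
      rw [PMF.mem_support_bind_iff] at h1
      obtain ⟨x, -, h1⟩ := h1
      rw [PMF.mem_support_pure_iff] at h1
      have hj : j.val ≤ B :=
        Nat.lt_succ_iff.mp (lt_of_lt_of_le j.2 (Nat.succ_le_succ (min_le_right _ _)))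
      have e1 : s₁.calls = s.calls + (2 * j + 1) := by
        rw [h1, qmfNext]; split_ifs <;> rfl
      have e2 : s₁.time =
          s.time + (U.amplify s.y j).cost V.D.opCost + U.R * U.W + U.W + 1 := by
        rw [h1, qmfNext]; split_ifs <;> rfl
      refine ih h2 (by omega) ?_
      rw [e1, e2, cost_amplify, callTime] at *
      nlinarith [Nat.zero_le (j.val * (U.R * U.W)), Nat.zero_le (j.val * U.W)]

theorem qmf_time {B : ℕ} {s : QMF U} (h : s ∈ (qmf V U B).support) :
    s.time ≤ 3 * B * callTime U V.D.opCost := by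
  obtain ⟨h1, h2⟩ := qmfLoop_time h (Nat.zero_le _) (Nat.zero_le _)
  exact h2.trans (Nat.mul_le_mul_right _ h1)

theorem qmfBest_time {B m : ℕ} {b : Option (Config U.R U.W) × BitVec U.W × ℕ}
    (h : b ∈ (qmfBest V U B m).support) :
    b.2.2 ≤ m * (3 * B * callTime U V.D.opCost + U.W) := by
  induction m generalizing b with
  | zero =>
    have : b = (none, U.infty, 0) := (PMF.mem_support_pure_iff _ _).mp h
    simp [this]
  | succ m ih =>
    rw [qmfBest_succ, PMF.mem_support_bind_iff] at h
    obtain ⟨b', h1, h2⟩ := h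
    rw [PMF.mem_support_map_iff] at h2
    obtain ⟨s, h3, rfl⟩ := h2
    have e : (better U b' s).2.2 = b'.2.2 + s.time + U.W := by
      rw [better]; split_ifs <;> rfl
    rw [e]
    have := ih h1
    have := qmf_time h3
    linarith

end CTF

namespace CTF

variable {L n R W : ℕ}

/-! ## The main loop -/

theorem length_foldl_findStep_le {D : Detector L} {E : Event L n D.w} {lam : ℕ} (ls : List (Fin L))
    {cs : List (Cand L n D.w)} (h : cs.length ≤ lam) :
    (ls.foldl (findStep D E lam) cs).length ≤ lam := by
  induction ls generalizing cs with
  | nil => exact h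
  | cons l ls ih => exact ih (by rw [findStep_eq]; exact List.length_take_le _ _)

theorem length_found_le {D : Detector L} {E : Event L n D.w} {hL : 3 ≤ L} {lam : ℕ}
    (hlam : 1 ≤ lam) : (found D E hL lam).length ≤ lam * n ^ 3 := by
  have hs : (seeds D E hL).length ≤ n * (n * n) := by
    refine (length_flatMap_le _ _ (N := n * n) fun j0 _ => ?_).trans_eq (by simp)
    refine (length_flatMap_le _ _ (N := n) fun j1 _ => ?_).trans_eq (by simp)
    exact (List.length_filterMap_le _ _).trans_eq (by simp)
  refine (length_flatMap_le _ _ (N := lam) fun s _ =>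
    length_foldl_findStep_le _ (by simpa using hlam)).trans ?_
  calc _ ≤ n * (n * n) * lam := Nat.mul_le_mul_right _ hs
    _ = _ := by ring

/-- The basis states that show a valid candidate. -/
def Inner.Good (U : Inner L) (D : Detector L) (E : Event L n D.w) (hL : 3 ≤ L) (lam : ℕ) (f : ℚ)
    (ts : List (Track L n)) (x : Config U.R U.W) : Prop :=
  ∃ c ∈ valid D E hL lam f ts, x ∈ U.shows D c

variable {U : Inner L} {D : Detector L} {E : Event L n D.w} {hL : 3 ≤ L} {lam : ℕ} {f : ℚ}
  {ts : List (Track L n)} {p ε : ℝ}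

theorem Inner.Good.key_eq {x : Config U.R U.W} {c : Cand L n D.w}
    (hx : U.Good D E hL lam f ts x) (h : (x U.score).toNat = key D c) : x ∈ U.shows D c := by
  obtain ⟨c', -, h1, h2, h3⟩ := hx
  have he : key D c' = key D c := h2.symm.trans h
  exact ⟨by rw [h1, hits_eq_of_key_eq he], h, h3⟩

open Classical in
-- Passes from candidates to scores. Keys determine tracks, so the mass at the key of a valid
-- candidate is the probability that it is shown, at least `(1 - ε) p ≥ p / 2`. If nothing is valid,
-- `+∞` plays the role of the minimum.
theorem Inner.Performs.sampler (h : U.Performs D E hL lam f ts p ε) (hp : 0 < p) (hε0 : 0 ≤ ε)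
    (hε : ε ≤ 1 / 4) (hlam : 1 ≤ lam) (hcard : lam * (n : ℝ) ^ 3 * p ≤ 1 / 4) {t : ℕ}
    (ht : (valid D E hL lam f ts = [] ∧ t = U.infty.toNat) ∨ ∃ c ∈ valid D E hL lam f ts,
      t = key D c ∧ ∀ c' ∈ valid D E hL lam f ts, t ≤ key D c') :
    Sampler U ⟨D, E, treeOf f ts⟩ (U.Good D E hL lam f ts) t (p / 2) ε := by
  set V : Env L n := ⟨D, E, treeOf f ts⟩
  set Good := U.Good D E hL lam f ts
  have hmeas : ∀ A : Set (Config U.R U.W), (U.circ.measure V).toOuterMeasure A =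
      ENNReal.ofReal (∑ x, if x ∈ A then ‖U.circ.run V x‖ ^ 2 else 0) := by
    intro A
    rw [measure_apply, missProb]
    congr 1
    refine Finset.sum_congr rfl fun x _ => ?_
    by_cases hx : x ∈ A <;> simp [hx]
  have hnn : ∀ A : Set (Config U.R U.W), 0 ≤ ∑ x, if x ∈ A then ‖U.circ.run V x‖ ^ 2 else 0 :=
    fun A => Finset.sum_nonneg fun x _ => by split_ifs <;> positivity
  have hmass : ∀ c ∈ valid D E hL lam f ts, U.mass V Good (key D c) =
      ∑ x, if x ∈ U.shows D c then ‖U.circ.run V x‖ ^ 2 else 0 := by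
    intro c hc
    refine Finset.sum_congr rfl fun x _ =>
      if_congr ⟨fun hx => hx.1.key_eq hx.2, fun hx => ?_⟩ rfl rfl
    exact ⟨⟨c, hc, hx⟩, hx.2.1⟩
  have hlow : ∀ c ∈ valid D E hL lam f ts, (1 - ε) * p ≤ U.mass V Good (key D c) := by
    intro c hc
    have h1 := (h.1 c hc).1
    rw [hmeas, ENNReal.ofReal_le_ofReal_iff (hnn _)] at h1
    rwa [hmass c hc]
  have hup : ∀ c ∈ valid D E hL lam f ts, U.mass V Good (key D c) ≤ (1 + ε) * p := by
    intro c hc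
    have h1 := (h.1 c hc).2
    rw [hmeas, ENNReal.ofReal_le_ofReal_iff (by positivity)] at h1
    rwa [hmass c hc]
  have hjunk : (∑ x, if x U.score < U.infty ∧ ¬ Good x then ‖U.circ.run V x‖ ^ 2 else 0) ≤ ε := by
    have h1 := h.2
    rw [hmeas, ENNReal.ofReal_le_ofReal_iff hε0] at h1
    refine le_trans (Finset.sum_le_sum fun x _ => ?_) h1
    by_cases hx : x U.score < U.infty ∧ ¬ Good x
    · rw [if_pos hx, if_pos]
      exact ⟨hx.1, fun c hc hxc => hx.2 ⟨c, hc, hxc⟩⟩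
    · rw [if_neg hx]
      split_ifs <;> positivity
  have hlt : ∀ x, Good x → x U.score < U.infty := fun x ⟨c, _, hx⟩ => hx.2.2
  refine ⟨by positivity, hε0, hlt, ?_, ?_, ?_, hjunk, ?_⟩
  · rintro x ⟨c, hc, hx⟩
    rcases ht with ⟨h0, -⟩ | ⟨c0, -, -, h1⟩
    · rw [h0] at hc
      exact absurd hc List.not_mem_nil
    · exact (h1 c hc).trans_eq hx.2.1.symm
  · rcases ht with ⟨-, h0⟩ | ⟨c0, h1, h2, -⟩
    · exact h0.le
    · by_contra hcon
      have h3 := hlow c0 h1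
      have h4 : U.mass V Good (key D c0) = 0 := by
        refine Finset.sum_eq_zero fun x _ => if_neg ?_
        rintro ⟨hx, hk⟩
        have := BitVec.lt_def.mp (hlt x hx)
        omega
      rw [h4] at h3
      nlinarith
  · intro hti
    rcases ht with ⟨-, h0⟩ | ⟨c0, h1, h2, -⟩
    · omega
    · rw [h2]
      refine le_trans ?_ (hlow c0 h1)
      nlinarith
  -- A finite score has probability at most `(5/4) * (1/4) + 1/4`, which is below `3/4`: the first
  -- term is for good samples, the second for wrong ones.
  · have hsplit : U.below V U.infty ≤ U.cum V Good U.infty.toNat + ε := by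
      refine le_trans ?_ (add_le_add_right hjunk _)
      have hg := U.sum_good V Good U.infty fun _ => 1
      simp only [mul_one] at hg
      rw [Inner.cum, ← hg, Inner.below, ← Finset.sum_add_distrib]
      refine Finset.sum_le_sum fun x _ => ?_
      by_cases h1 : x U.score < U.infty <;> by_cases h2 : Good x <;> simp [h1, h2]
    -- The sum runs over keys rather than candidates, because candidates with the same key are shown
    -- by the same basis states.
    set K : Finset ℕ := ((valid D E hL lam f ts).map (key D)).toFinset
    have hK : K.card ≤ lam * n ^ 3 := by
      refine (List.toFinset_card_le _).trans ?_
      rw [List.length_map]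
      exact ((List.length_filter_le _ _).trans (List.length_filter_le _ _)).trans
        (length_found_le hlam)
    have hcum : U.cum V Good U.infty.toNat ≤ K.card * ((1 + ε) * p) := by
      have h0 : ∀ r ∉ K, U.mass V Good r = 0 := by
        intro r hr
        refine Finset.sum_eq_zero fun x _ => if_neg ?_
        rintro ⟨⟨c, hc, hx⟩, hk⟩
        exact hr (List.mem_toFinset.mpr (List.mem_map.mpr ⟨c, hc, hx.2.1.symm.trans hk⟩))
      have h1 : U.cum V Good U.infty.toNat ≤ ∑ r ∈ K, U.mass V Good r := by
        rw [Inner.cum, ← Finset.sum_filter_add_sum_filter_not _ (· ∈ K)]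
        rw [Finset.sum_eq_zero (s := Finset.filter (· ∉ K) _) fun r hr =>
          h0 r (Finset.mem_filter.mp hr).2, add_zero]
        refine Finset.sum_le_sum_of_subset_of_nonneg (fun r hr => (Finset.mem_filter.mp hr).2)
          fun r _ _ => U.mass_nonneg V Good r
      refine h1.trans ((Finset.sum_le_card_nsmul K _ ((1 + ε) * p) fun r hr => ?_).trans_eq ?_)
      · obtain ⟨c, hc, rfl⟩ := List.mem_map.mp (List.mem_toFinset.mp hr)
        exact hup c hc
      · rw [nsmul_eq_mul]
    have hK' : (K.card : ℝ) * p ≤ 1 / 4 := by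
      refine le_trans (mul_le_mul_of_nonneg_right ?_ hp.le) hcard
      exact_mod_cast hK
    nlinarith

theorem insertTrack_treeOf (f : ℚ) (ts : List (Track L n)) (t : Track L n) :
    insertTrack f (treeOf f ts) t = treeOf f (ts ++ [t]) := by
  simp [treeOf]

/-- What one round of the main loop does with the best sample. -/
noncomputable def recoCont (D : Detector L) (E : Event L n D.w) (f : ℚ) (U : Inner L)
    (T : Ordnode ℕ) (rest : Track L n → PMF (List (Track L n) × ℕ))
    (b : Option (Config U.R U.W) × BitVec U.W × ℕ) : PMF (List (Track L n) × ℕ) :=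
  match b.1.bind (U.decode n) with
  | none => PMF.pure ([], b.2.2)
  | some t =>
      if Selected D E t ∧ ∀ q ∈ probeKeys f t, q ∉ T then
        (rest t).map fun r => (t :: r.1, b.2.2 + D.opCost + treeTime f T t U.W + r.2)
      else PMF.pure ([], b.2.2 + D.opCost + treeTime f T t U.W)

theorem recoLoop_succ (B k : ℕ) (T : Ordnode ℕ) :
    recoLoop D E lam f U B (k + 1) T =
      (qmfBest ⟨D, E, T⟩ U B (Nat.clog 2 (2 * lam * n ^ 3))).bind
        (recoCont D E f U T fun t => recoLoop D E lam f U B k (insertTrack f T t)) := by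
  rw [recoLoop]
  rfl

theorem not_mem_tree (hf0 : 0 < f) (hf1 : f ≤ 1) {t : Track L n} (ht : 1 ≤ rOf f t)
    (hts : ∀ t' ∈ ts, 1 ≤ rOf f t') (h : ∀ t' ∈ ts, ¬ Overlap f t t') :
    ∀ q ∈ probeKeys f t, q ∉ treeOf f ts := by
  intro q hq hT
  obtain ⟨t', ht', hk⟩ := ((treeOf_spec f ts fun t => length_insertKeys_le hf1 t).2.1 q).mp hT
  exact h t' ht' ((overlap_iff_probe hf0 hf1 ht (hts t' ht')).mpr ⟨q, hq, hk⟩)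

/-- A bound for the classical time of a round. -/
def treeTimeBound (L N W : ℕ) : ℕ :=
  (2 * L + 1 + L) * 2 ^ L * (N * (L * 2 ^ L) + L * 2 ^ L + 1) * (W + 1)

theorem treeTime_le (hf1 : f ≤ 1) (ts : List (Track L n)) {N : ℕ} (hN : ts.length ≤ N)
    (t : Track L n) (W : ℕ) : treeTime f (treeOf f ts) t W ≤ treeTimeBound L N W := by
  have h1 := length_probeKeys_le hf1 t
  have h2 := length_insertKeys_le hf1 t
  have h3 := (treeOf_spec f ts fun t => length_insertKeys_le hf1 t).2.2
  have h4 : ts.length * (L * 2 ^ L) ≤ N * (L * 2 ^ L) := Nat.mul_le_mul_right _ hN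
  rw [treeTime, treeTimeBound, add_mul (2 * L + 1)]
  gcongr
  exact h3.trans h4

theorem one_le_rOf_of_mem_recoOutput (hf0 : 0 < f) (hf1 : f ≤ 1) (hlam : 1 ≤ lam)
    {t : Track L n} (ht : t ∈ recoOutput D E hL lam f) : 1 ≤ rOf f t := by
  obtain ⟨i, hi, rfl⟩ := List.getElem_of_mem ht
  obtain ⟨c, hc, hc', -⟩ := recoOutput_next hf1 hi
  rw [← hc']
  exact one_le_rOf_of_mem_found hf0 hlam (List.mem_filter.mp (mem_valid.mp hc).1).1

/-- The main loop finds the rest of the output, with its failure probability and its time. -/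
theorem recoLoop_miss_le (hf0 : 0 < f) (hf1 : f ≤ 1) (hlam : 1 ≤ lam) {B Y : ℕ} {δ : ENNReal}
    {Q : List (Track L n)} (hQ : Q = recoOutput D E hL lam f)
    (hsam : ∀ i ≤ Q.length, ∀ t,
      (i = Q.length ∧ t = U.infty.toNat) ∨ (∃ c ∈ valid D E hL lam f (Q.take i),
        t = key D c ∧ t < U.infty.toNat ∧
        ∀ c' ∈ valid D E hL lam f (Q.take i), t ≤ key D c') →
      (qmfBest ⟨D, E, treeOf f (Q.take i)⟩ U B (Nat.clog 2 (2 * lam * n ^ 3))).toOuterMeasure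
        {b | ¬ (Clean (U.Good D E hL lam f (Q.take i)) b.1 b.2.1 ∧ b.2.1.toNat = t)} ≤ δ)
    (hinf : ∀ c ∈ found D E hL lam, key D c < U.infty.toNat)
    (hY : Nat.clog 2 (2 * lam * n ^ 3) * (3 * B * callTime U D.opCost + U.W) + D.opCost +
      treeTimeBound L Q.length U.W ≤ Y) (j k i : ℕ) (hj : i + j = Q.length) (hk : j + 1 ≤ k) :
    (recoLoop D E lam f U B k (treeOf f (Q.take i))).toOuterMeasure
      {o | ¬ (o.1 = Q.drop i ∧ o.2 ≤ (j + 1) * Y)} ≤ ((j + 1 : ℕ) : ENNReal) * δ := by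
  have hrQ : ∀ t ∈ Q, 1 ≤ rOf f t := fun t ht =>
    one_le_rOf_of_mem_recoOutput hf0 hf1 hlam (hQ ▸ ht)
  induction j generalizing i k with
  | zero =>
    obtain ⟨k, rfl⟩ := Nat.exists_eq_add_of_le' hk
    have hi : i = Q.length := hj
    -- After all tracks have been found there is no good sample; a clean result then consists of no
    -- sample at all, and the loop stops.
    have hv : valid D E hL lam f (Q.take i) = [] := by
      rw [hi, List.take_length, hQ]; exact valid_recoOutput hf1
    have hm := hsam i hi.le _ (Or.inl ⟨hi, rfl⟩)
    have h1δ : ((0 + 1 : ℕ) : ENNReal) * δ = δ := by simp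
    rw [h1δ, show k + (0 + 1) = k + 1 from rfl, recoLoop_succ, PMF.toOuterMeasure_bind_apply]
    refine le_trans ?_ hm
    rw [← tsum_mul_indicator]
    refine ENNReal.tsum_le_tsum fun b => ?_
    by_cases hb0 : b ∈ (qmfBest ⟨D, E, treeOf f (Q.take i)⟩ U B
        (Nat.clog 2 (2 * lam * n ^ 3))).support
    · refine mul_le_mul_right ?_ _
      by_cases hb : Clean (U.Good D E hL lam f (Q.take i)) b.1 b.2.1 ∧ b.2.1.toNat = U.infty.toNat
      · rcases hb.1 with ⟨h1, -⟩ | ⟨x, ⟨c, hc, -⟩, -⟩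
        · rw [recoCont, h1]
          refine pure_not_le (Q := fun o : List (Track L n) × ℕ =>
            o.1 = Q.drop i ∧ o.2 ≤ (0 + 1) * Y) ⟨?_, ?_⟩ _
          · rw [hi, List.drop_length]
          · have := qmfBest_time hb0
            change b.2.2 ≤ _
            change b.2.2 ≤
              Nat.clog 2 (2 * lam * n ^ 3) * (3 * B * callTime U D.opCost + U.W) at this
            omega
        · rw [hv] at hc
          exact absurd hc List.not_mem_nil
      · rw [Set.indicator_of_mem (by exact hb)]
        exact toOuterMeasure_le_one _ _
    · have : (qmfBest ⟨D, E, treeOf f (Q.take i)⟩ U B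
        (Nat.clog 2 (2 * lam * n ^ 3))) b = 0 := by
        simpa [PMF.mem_support_iff] using hb0
      rw [this, zero_mul]
      exact zero_le
  | succ j ih =>
    obtain ⟨k, rfl⟩ := Nat.exists_eq_add_of_le' hk
    have hi : i < Q.length := by omega
    obtain ⟨c, hc, hch, hmin⟩ : ∃ c ∈ valid D E hL lam f (Q.take i), c.hits = Q[i] ∧
        ∀ c' ∈ valid D E hL lam f (Q.take i), key D c ≤ key D c' := by
      subst hQ; exact recoOutput_next hf1 hi
    have hcv := mem_valid.mp hc
    have hcm := List.mem_filter.mp hcv.1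
    have hkey := hinf c hcm.1
    have hm := hsam i hi.le (key D c) (Or.inr ⟨c, hc, rfl, hkey, hmin⟩)
    have hsel : Selected D E Q[i] := by rw [← hch]; simpa using hcm.2
    have hfree : ∀ q ∈ probeKeys f Q[i], q ∉ treeOf f (Q.take i) := by
      refine not_mem_tree hf0 hf1 (hrQ _ (List.getElem_mem hi))
        (fun t' ht' => hrQ t' (List.mem_of_mem_take ht')) ?_
      rw [← hch]
      exact hcv.2
    have htree : insertTrack f (treeOf f (Q.take i)) Q[i] = treeOf f (Q.take (i + 1)) := by
      rw [insertTrack_treeOf, List.take_succ_eq_append_getElem hi]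
    have ih := ih (k + 1 + j) (i + 1) (by omega) (by omega)
    have hkk : k + (j + 1 + 1) = (k + 1 + j) + 1 := by omega
    rw [hkk, recoLoop_succ, PMF.toOuterMeasure_bind_apply]
    refine le_trans (b := ∑' b, qmfBest ⟨D, E, treeOf f (Q.take i)⟩ U B
      (Nat.clog 2 (2 * lam * n ^ 3)) b * ({b | ¬ (Clean (U.Good D E hL lam f (Q.take i)) b.1 b.2.1 ∧
        b.2.1.toNat = key D c)}.indicator 1 b + ((j + 1 : ℕ) : ENNReal) * δ)) ?_ ?_
    · refine ENNReal.tsum_le_tsum fun b => ?_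
      by_cases hb0 : b ∈ (qmfBest ⟨D, E, treeOf f (Q.take i)⟩ U B
          (Nat.clog 2 (2 * lam * n ^ 3))).support
      · refine mul_le_mul_right ?_ _
        by_cases hb : Clean (U.Good D E hL lam f (Q.take i)) b.1 b.2.1 ∧ b.2.1.toNat = key D c
        · refine le_trans ?_ le_add_self
          -- A good sample with the least key shows the track of the best valid candidate, which is
          -- the next track of the output. The initial value `+∞` is ruled out, since keys are
          -- smaller.
          have hdec : b.1.bind (U.decode n) = some Q[i] := by
            rcases hb.1 with ⟨-, h2⟩ | ⟨x, hx, h1, h2⟩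
            · have := hb.2
              rw [h2] at this
              omega
            · have hs := hx.key_eq (c := c) (by rw [← h2]; exact hb.2)
              rw [h1, Option.bind_some, hs.1, hch]
          have hcont : recoCont D E f U (treeOf f (Q.take i)) (fun t => recoLoop D E lam f U B
              (k + 1 + j) (insertTrack f (treeOf f (Q.take i)) t)) b =
              (recoLoop D E lam f U B (k + 1 + j) (treeOf f (Q.take (i + 1)))).map fun r =>
                (Q[i] :: r.1, b.2.2 + D.opCost + treeTime f (treeOf f (Q.take i)) Q[i] U.W +
                  r.2) := by
            rw [recoCont, hdec]
            simp only
            rw [if_pos ⟨hsel, hfree⟩, htree]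
          rw [hcont, PMF.toOuterMeasure_map_apply]
          refine le_trans (MeasureTheory.measure_mono ?_) ih
          intro o ho hgood
          refine ho ⟨?_, ?_⟩
          · change Q[i] :: o.1 = _
            rw [hgood.1, List.drop_eq_getElem_cons hi]
          · change b.2.2 + D.opCost + treeTime f (treeOf f (Q.take i)) Q[i] U.W + o.2 ≤ _
            have h1 := qmfBest_time hb0
            change b.2.2 ≤ Nat.clog 2 (2 * lam * n ^ 3) * (3 * B * callTime U D.opCost + U.W) at h1
            have h2 := treeTime_le hf1 (Q.take i) (N := Q.length) (by simp) Q[i] U.W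
            have h3 := hgood.2
            rw [add_mul _ 1, one_mul]
            omega
        · rw [Set.indicator_of_mem (by exact hb)]
          exact (toOuterMeasure_le_one _ _).trans le_self_add
      · have : (qmfBest ⟨D, E, treeOf f (Q.take i)⟩ U B
          (Nat.clog 2 (2 * lam * n ^ 3))) b = 0 := by
          simpa [PMF.mem_support_iff] using hb0
        rw [this, zero_mul]
        exact zero_le
    · simp only [mul_add]
      rw [ENNReal.tsum_add, tsum_mul_indicator, ENNReal.tsum_mul_right, PMF.tsum_coe, one_mul,
        Nat.cast_add (j + 1), Nat.cast_one, add_mul, one_mul, add_comm]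
      exact add_le_add_right hm _

end CTF

namespace CTF

/-! ## The choice of the parameters -/

/-- The constants on which the parameters depend. -/
structure Consts where
  lam : ℕ
  C : ℕ
  /-- the inverse of the failure probability -/
  q : ℕ
  L : ℕ

/-- Bits for the number of a hit. -/
def hitBits (n : ℕ) : ℕ := Nat.log 2 n + 1

namespace Consts

variable (k : Consts) (n w : ℕ)

def g : ℕ := Nat.clog 2 k.lam

/-- Half the number of bits of a continuation number, rounded up: `4 ^ m` exceeds `λ * 2 ^ hitBits
n` and `2 ^ m` is of order `√n`. The same `2 m` bits are used for the hit numbers in the input. -/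
def m : ℕ := (k.g + hitBits n + 1) / 2

/-- More bits than the `λ` slots need. The total exponent `6 m + kq` becomes even, so `√p` is a
power of two, and at least two spare bits leave room in `card_mul_prob_le`. -/
def kq : ℕ := 2 * (k.g + 1)

/-- The number of runs of quantum minimum finding. -/
def runs : ℕ := Nat.clog 2 (2 * k.lam * n ^ 3)

/-- A bound for the depth of the search tree. -/
def Dp : ℕ := 3 * (k.C + hitBits n + 2 * k.L + 1)

/-- A sum that dominates the bits of the candidate keys, of the tuple keys and of the addresses on
the way down the tree. -/
def kb : ℕ := 2 * w + 2 * k.L + 1 + hitBits n * k.L + k.Dp n + 1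

/-- The number of calls, in units of the square root of the inverse of the probability. -/
def Q : ℕ := 576 * k.q

/-- The total error probability of the circuit is at most `2 ^ (-errBits)`. -/
def errBits : ℕ := 6 + 3 * (k.Q + (3 * k.m n + k.g + 1)) + k.q + 2 * k.runs n + hitBits n

/-- The exponents of all factors in `bodyErr`, of the desired error, and of the probability of an
input: the error of the program has to be small compared with `p`. -/
def reps : ℕ := k.kb n w + 2 + k.L + k.lam + k.errBits n + (6 * k.m n + k.kq)

def par : Par := ⟨k.m n, Nat.clog 3 (3 * 2 ^ k.m n), k.reps n w, k.kb n w⟩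

def W : ℕ := k.kb n w + 2 * k.m n + k.kq + 1

def R : ℕ := 4 + (k.par n w).bodyLen k.L k.lam (k.Dp n)

/-- The number of calls of a run of quantum minimum finding. -/
def B : ℕ := k.Q * 2 ^ (3 * k.m n + k.g + 1)

instance : NeZero (k.R n w) := ⟨by rw [R]; omega⟩

theorem lam_le : k.lam ≤ 2 ^ k.g := Nat.le_pow_clog (by norm_num) _

theorem lt_two_pow_hitBits : n < 2 ^ hitBits n := Nat.lt_pow_succ_log_self (by norm_num) n

theorem two_pow_hitBits_le (hn : n ≠ 0) : 2 ^ hitBits n ≤ 2 * n := by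
  rw [hitBits, pow_succ, mul_comm]
  exact Nat.mul_le_mul_left _ (Nat.pow_log_le_self 2 hn)

theorem le_two_mul_m : k.g + hitBits n ≤ 2 * k.m n := by rw [m]; omega

theorem two_mul_m_le : 2 * k.m n ≤ k.g + hitBits n + 1 := by rw [m]; omega

theorem idx_le : k.lam * 2 ^ hitBits n ≤ 2 ^ (2 * k.m n) := by
  refine (Nat.mul_le_mul_right _ k.lam_le).trans ?_
  rw [← pow_add]
  exact Nat.pow_le_pow_right (by norm_num) (k.le_two_mul_m n)

theorem two_pow_two_mul_m_le (hn : n ≠ 0) : 2 ^ (2 * k.m n) ≤ 2 ^ (k.g + 2) * n := by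
  calc 2 ^ (2 * k.m n) ≤ 2 ^ (k.g + hitBits n + 1) :=
        Nat.pow_le_pow_right (by norm_num) (k.two_mul_m_le n)
    _ = 2 ^ (k.g + 1) * 2 ^ hitBits n := by rw [← pow_add]; congr 1; omega
    _ ≤ 2 ^ (k.g + 1) * (2 * n) := Nat.mul_le_mul_left _ (two_pow_hitBits_le n hn)
    _ = 2 ^ (k.g + 2) * n := by ring

theorem runs_le : k.runs n ≤ 1 + k.g + 3 * hitBits n := by
  refine Nat.clog_le_of_le_pow ?_
  have h1 := k.lam_le
  have h2 : n ^ 3 ≤ (2 ^ hitBits n) ^ 3 := Nat.pow_le_pow_left (lt_two_pow_hitBits n).le 3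
  calc 2 * k.lam * n ^ 3 ≤ 2 * 2 ^ k.g * (2 ^ hitBits n) ^ 3 := by gcongr
    _ = 2 ^ (1 + k.g + 3 * hitBits n) := by rw [← pow_mul, pow_add, pow_add, pow_one]; ring

theorem succ_pow_le : (n + 1) ^ k.L ≤ 2 ^ (hitBits n * k.L) := by
  rw [pow_mul]
  exact Nat.pow_le_pow_left (lt_two_pow_hitBits n) _

variable {n}

theorem ready (hL : 3 ≤ k.L) (hlam : 1 ≤ k.lam) {f : ℚ} (hf1 : f ≤ 1) (D : Detector k.L)
    (E : Event k.L n D.w) {ts : List (Track k.L n)} (hts : ts.length ≤ k.C * n) :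
    Ready (k.par n D.w) ⟨D, E, treeOf f ts⟩ (k.R n D.w) (k.W n D.w) k.lam (hitBits n) (k.Dp n)
      k.kq where
  m_le := by change 2 * k.m n ≤ _; rw [W]; omega
  kb_lt := by change k.kb n D.w < _; rw [W]; omega
  stages := Nat.le_pow_clog (by norm_num) _
  keys := by
    change _ ≤ 2 ^ k.kb n D.w
    set w := D.w
    have h1 : 1 ≤ 2 ^ w := Nat.one_le_two_pow
    have h2 : 2 * k.L + 1 ≤ 2 ^ (2 * k.L + 1) := Nat.lt_two_pow_self.le
    calc (2 ^ w * k.L + 2 ^ w * (k.L * 2 ^ w) + 1) * (n + 1) ^ k.L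
        ≤ (2 ^ w * 2 ^ w * (2 * k.L + 1)) * 2 ^ (hitBits n * k.L) := by
          refine Nat.mul_le_mul ?_ (k.succ_pow_le n)
          have h3 : 2 ^ w ≤ 2 ^ w * 2 ^ w := Nat.le_mul_of_pos_left _ h1
          nlinarith
      _ ≤ (2 ^ w * 2 ^ w * 2 ^ (2 * k.L + 1)) * 2 ^ (hitBits n * k.L) := by gcongr
      _ = 2 ^ (2 * w + 2 * k.L + 1 + hitBits n * k.L) := by
          rw [← pow_add, ← pow_add, ← pow_add]; congr 1; ring
      _ ≤ 2 ^ k.kb n w := Nat.pow_le_pow_right (by norm_num) (by rw [kb]; omega)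
  lt_b := lt_two_pow_hitBits n
  idx := k.idx_le n
  one_le := hlam
  w_lt := by change D.w < _; rw [W, kb]; omega
  layers := hL
  tuples := by
    change _ ≤ 2 ^ k.kb n D.w
    have h1 : k.L + 1 ≤ 2 ^ k.L := Nat.lt_two_pow_self
    calc (k.L + 1) ^ 2 * (n + 1) ^ k.L ≤ (2 ^ k.L) ^ 2 * 2 ^ (hitBits n * k.L) :=
          Nat.mul_le_mul (Nat.pow_le_pow_left h1 2) (k.succ_pow_le n)
      _ = 2 ^ (2 * k.L + hitBits n * k.L) := by rw [← pow_mul, ← pow_add]; congr 1; ring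
      _ ≤ 2 ^ k.kb n D.w := Nat.pow_le_pow_right (by norm_num) (by rw [kb]; omega)
  depth_le := by change _ ≤ k.kb n D.w; rw [kb]; omega
  tree := by
    refine all_treeOf (fun t q hq => ?_) ts
    obtain ⟨S, -, h2, -, rfl⟩ := mem_insertKeys.mp hq
    have h3 : rOf f t ≤ k.L := (rOf_le_numHits hf1 t).trans (numHits_le t)
    refine (tupleKey_lt (h2.trans h3) h3 _).trans_le ?_
    change _ ≤ 2 ^ k.kb n D.w
    have h1 : k.L + 1 ≤ 2 ^ k.L := Nat.lt_two_pow_self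
    calc (k.L + 1) ^ 2 * (n + 1) ^ k.L ≤ (2 ^ k.L) ^ 2 * 2 ^ (hitBits n * k.L) :=
          Nat.mul_le_mul (Nat.pow_le_pow_left h1 2) (k.succ_pow_le n)
      _ = 2 ^ (2 * k.L + hitBits n * k.L) := by rw [← pow_mul, ← pow_add]; congr 1; ring
      _ ≤ 2 ^ k.kb n D.w := Nat.pow_le_pow_right (by norm_num) (by rw [kb]; omega)
  depth := by
    have hspec := treeOf_spec f ts fun t => length_insertKeys_le hf1 t
    refine treeDepth_le hspec.1 ?_
    -- The promise on the number of tracks enters here: the tree has `O(n)` nodes, so its depth is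
    -- logarithmic.
    have h1 : (treeOf f ts).size ≤ k.C * n * (k.L * 2 ^ k.L) :=
      hspec.2.2.trans (Nat.mul_le_mul_right _ hts)
    have h2 : k.C * n * (k.L * 2 ^ k.L) ≤
        2 ^ k.C * 2 ^ hitBits n * (2 ^ k.L * 2 ^ k.L) := by
      have := (lt_two_pow_hitBits n).le
      have : k.C ≤ 2 ^ k.C := Nat.lt_two_pow_self.le
      have : k.L ≤ 2 ^ k.L := Nat.lt_two_pow_self.le
      gcongr
    have h3 : 2 ^ k.C * 2 ^ hitBits n * (2 ^ k.L * 2 ^ k.L) =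
        2 ^ (k.C + hitBits n + 2 * k.L) := by
      rw [← pow_add, ← pow_add, ← pow_add]; congr 1; ring
    have h4 := Nat.one_le_two_pow (n := k.C + hitBits n + 2 * k.L)
    change (treeOf f ts).size + 1 ≤ _
    rw [pow_succ]
    omega
  regs := le_rfl
  kq_le := by rw [W]; omega
  slots := k.lam_le.trans (Nat.pow_le_pow_right (by norm_num) (by rw [kq]; omega))

/-- The error probability of the circuit. -/
noncomputable def err (n : ℕ) : ℝ := (1 / 2) ^ k.errBits n

theorem bodyErr_le : (k.par n w).bodyErr k.L k.lam ≤ k.err n * (k.par n w).prob k.kq := by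
  have h2 : ∀ x : ℕ, (x : ℝ) ≤ 2 ^ x := fun x => by exact_mod_cast Nat.lt_two_pow_self.le
  have hkb : (k.kb n w : ℝ) + 2 ≤ 2 ^ (k.kb n w + 2) := by exact_mod_cast h2 (k.kb n w + 2)
  have hpow : ∀ x : ℕ, (1 / 2 : ℝ) ^ x = (2 ^ x)⁻¹ := fun x => by rw [one_div, inv_pow]
  rw [Par.bodyErr, Par.err, Par.prob, err, hpow, hpow, ← mul_inv, ← pow_add]
  change (k.L : ℝ) * (k.lam * ((k.kb n w + 2) * ((2 : ℝ) ^ k.reps n w)⁻¹)) ≤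
    ((2 : ℝ) ^ (k.errBits n + (6 * k.m n + k.kq)))⁻¹
  calc (k.L : ℝ) * (k.lam * ((k.kb n w + 2) * ((2 : ℝ) ^ k.reps n w)⁻¹))
      ≤ 2 ^ k.L * (2 ^ k.lam * (2 ^ (k.kb n w + 2) * ((2 : ℝ) ^ k.reps n w)⁻¹)) := by
        gcongr
        · exact h2 _
        · exact h2 _
    _ = ((2 : ℝ) ^ (k.errBits n + (6 * k.m n + k.kq)))⁻¹ := by
        have e : k.reps n w = k.L + (k.lam + (k.kb n w + 2)) +
          (k.errBits n + (6 * k.m n + k.kq)) := by rw [reps]; ring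
        rw [e, pow_add _ (k.L + (k.lam + (k.kb n w + 2))), pow_add _ k.L, pow_add _ k.lam]
        field_simp

theorem prob_eq : (k.par n w).prob k.kq = ((2 ^ (3 * k.m n + k.g + 1) : ℝ) ^ 2)⁻¹ := by
  rw [Par.prob, ← pow_mul]
  change ((2 : ℝ) ^ (6 * k.m n + k.kq))⁻¹ = _
  congr 2
  rw [kq]; ring

theorem sqrt_prob : 1 / √((k.par n w).prob k.kq / 2) ≤ 2 * 2 ^ (3 * k.m n + k.g + 1) := by
  rw [prob_eq]
  set S : ℝ := 2 ^ (3 * k.m n + k.g + 1)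
  have hS : 0 < S := by positivity
  have h1 : (2 * S)⁻¹ ≤ √((S ^ 2)⁻¹ / 2) := by
    apply Real.le_sqrt_of_sq_le
    rw [inv_pow, mul_pow, mul_inv, div_eq_inv_mul]
    gcongr
    norm_num
  rw [one_div, inv_le_comm₀ (by positivity) (by positivity)]
  exact h1

/-- Bounds the probability of all candidates together, so that a finite score stays below
probability `3/4`. -/
theorem card_mul_prob_le : k.lam * (n : ℝ) ^ 3 * (k.par n w).prob k.kq ≤ 1 / 4 := by
  rw [Par.prob]
  change k.lam * (n : ℝ) ^ 3 * ((2 : ℝ) ^ (6 * k.m n + k.kq))⁻¹ ≤ 1 / 4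
  rw [← div_eq_mul_inv, div_le_iff₀ (by positivity)]
  have h1 : k.lam * n ≤ 2 ^ (2 * k.m n) :=
    (Nat.mul_le_mul_left _ (lt_two_pow_hitBits n).le).trans (k.idx_le n)
  have h3 : k.lam * n ^ 3 * 4 ≤ 2 ^ (6 * k.m n + k.kq) := by
    have h4 : k.lam * n ^ 3 ≤ (k.lam * n) ^ 3 := by
      rw [mul_pow]
      exact Nat.mul_le_mul_right _ (Nat.le_self_pow (by norm_num) _)
    calc k.lam * n ^ 3 * 4 ≤ (2 ^ (2 * k.m n)) ^ 3 * 2 ^ k.kq := by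
          refine Nat.mul_le_mul (h4.trans (Nat.pow_le_pow_left h1 3)) ?_
          calc 4 = 2 ^ 2 := by norm_num
            _ ≤ 2 ^ k.kq := Nat.pow_le_pow_right (by norm_num) (by rw [kq]; omega)
      _ = _ := by rw [← pow_mul, ← pow_add]; congr 1; ring
  have h5 : (k.lam : ℝ) * (n : ℝ) ^ 3 * 4 ≤ 2 ^ (6 * k.m n + k.kq) := by exact_mod_cast h3
  linarith

/-- The probability that a run of quantum minimum finding meets a wrong sample. -/
noncomputable def junk (n : ℕ) : ℝ := k.B n * ((2 * k.B n + 1) ^ 2 * k.err n)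

/-- The probability of a wrong sample has to outweigh the square of the number of runs per round and
the number of rounds, which is of order `n`. -/
theorem junk_le (hq : 1 ≤ k.q) : k.junk n * (4 * k.q * (k.runs n) ^ 2 * n) ≤ 1 := by
  have hcast : ∀ x : ℕ, (x : ℝ) ≤ 2 ^ x := fun x => by exact_mod_cast Nat.lt_two_pow_self.le
  have hB1 : 1 ≤ k.B n := by
    rw [B, Q]
    exact Nat.mul_pos (by omega) (by positivity)
  have hB1' : (1 : ℝ) ≤ k.B n := by exact_mod_cast hB1
  have hBle : (k.B n : ℝ) ≤ 2 ^ (k.Q + (3 * k.m n + k.g + 1)) := by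
    rw [B, Nat.cast_mul, pow_add (2 : ℝ) k.Q]
    push_cast
    gcongr
    exact hcast _
  have hn : (n : ℝ) ≤ 2 ^ hitBits n := by exact_mod_cast (lt_two_pow_hitBits n).le
  have hX : k.errBits n = 6 + 3 * (k.Q + (3 * k.m n + k.g + 1)) + k.q + 2 * k.runs n +
    hitBits n := rfl
  generalize k.Q + (3 * k.m n + k.g + 1) = X at hBle hX
  -- With `B ≤ 2 ^ X` the power of two needed is `3X` for the calls, `4 + 2` for the numerical
  -- factors, and the rest for `q`, the runs and `n`: exactly `errBits`.
  calc k.junk n * (4 * k.q * (k.runs n) ^ 2 * n)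
      ≤ (2 ^ X * ((4 * 2 ^ X) ^ 2 * k.err n)) *
          (4 * 2 ^ k.q * (2 ^ k.runs n) ^ 2 * 2 ^ hitBits n) := by
        have he : 0 ≤ k.err n := by rw [err]; positivity
        rw [junk]
        gcongr
        · linarith
        · exact hcast _
        · exact hcast _
    _ = 2 ^ (6 + 3 * X + k.q + 2 * k.runs n + hitBits n) * k.err n := by
        rw [pow_add, pow_add, pow_add, pow_add, mul_comm 3 X, mul_comm 2 (k.runs n), pow_mul,
          pow_mul]
        ring
    _ = 1 := by
        rw [err, hX, ← mul_pow]
        norm_num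

end Consts

end CTF

namespace CTF

variable {L R W : ℕ}

/-! ## Time -/

theorem Gate.cost_le {τ a b : ℕ} {g : Gate L R W} (h : g.Within a b) :
    g.cost τ ≤ τ + W ^ 2 + 2 * W + 1 := by
  cases g with
  | flip c t e =>
    have : e.cost τ ≤ τ + W ^ 2 + W := by
      cases e <;> simp only [Expr.cost] <;> omega
    simp only [Gate.cost]; omega
  | phaseZero => exact absurd h id
  | _ => simp only [Gate.cost]; omega

theorem Circuit.cost_le {τ a b : ℕ} {C : Circuit L R W} (h : C.Within a b) :
    C.cost τ ≤ C.length * (τ + W ^ 2 + 2 * W + 1) := by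
  refine (List.sum_le_card_nsmul _ (τ + W ^ 2 + 2 * W + 1) fun x hx => ?_).trans_eq (by simp)
  obtain ⟨g, hg, rfl⟩ := List.mem_map.mp hx
  exact Gate.cost_le (h g hg)

theorem within_hads [NeZero R] (ks : ℕ → ℕ) {d : ℕ} (hd : d ≤ R) :
    (hads ks d : Circuit L R W).Within 0 R := by
  induction d with
  | zero => exact fun _ h => absurd h List.not_mem_nil
  | succ d ih =>
    intro g hg
    rcases List.mem_append.mp hg with h | h
    · exact ih (by omega) g h
    · exact (within_hadBits _ (rg_val (by omega)) g h).mono (Nat.zero_le _) hd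

/-- The parameters on which the time depends. -/
structure Size where
  n : ℕ
  w : ℕ
  τ : ℕ

/-- `F` is bounded by a multiple of the `i`-th power of the square root of the number of hits and
of a power of the logarithm. -/
def Bounded (k : Consts) (a d i j : ℕ) (F : Size → ℕ) : Prop :=
  ∃ c, ∀ s : Size, 2 ≤ s.n → s.w ≤ a * Nat.log 2 s.n ^ d → s.τ ≤ a * Nat.log 2 s.n ^ d →
    F s ≤ c * ((2 ^ k.m s.n) ^ i * (Nat.log 2 s.n ^ (d + 1)) ^ j)

namespace Bounded

variable {k : Consts} {a d i j i' j' : ℕ} {F G : Size → ℕ}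

theorem one_le_log {n : ℕ} (h : 2 ≤ n) : 1 ≤ Nat.log 2 n := Nat.log_pos (by norm_num) h

theorem of_le (hG : Bounded k a d i j G) (h : ∀ s : Size, 2 ≤ s.n → F s ≤ G s) :
    Bounded k a d i j F := by
  obtain ⟨c, hc⟩ := hG
  exact ⟨c, fun s h1 h2 h3 => (h s h1).trans (hc s h1 h2 h3)⟩

theorem mono (hF : Bounded k a d i j F) (hi : i ≤ i') (hj : j ≤ j') : Bounded k a d i' j' F := by
  obtain ⟨c, hc⟩ := hF
  refine ⟨c, fun s h1 h2 h3 => (hc s h1 h2 h3).trans (Nat.mul_le_mul_left _ (Nat.mul_le_mul ?_ ?_))⟩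
  · exact Nat.pow_le_pow_right (by positivity) hi
  · exact Nat.pow_le_pow_right (Nat.pow_pos (one_le_log h1)) hj

theorem add (hF : Bounded k a d i j F) (hG : Bounded k a d i j G) :
    Bounded k a d i j fun s => F s + G s := by
  obtain ⟨c, hc⟩ := hF
  obtain ⟨c', hc'⟩ := hG
  refine ⟨c + c', fun s h1 h2 h3 => ?_⟩
  rw [add_mul]
  exact Nat.add_le_add (hc s h1 h2 h3) (hc' s h1 h2 h3)

theorem mul (hF : Bounded k a d i j F) (hG : Bounded k a d i' j' G) :
    Bounded k a d (i + i') (j + j') fun s => F s * G s := by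
  obtain ⟨c, hc⟩ := hF
  obtain ⟨c', hc'⟩ := hG
  refine ⟨c * c', fun s h1 h2 h3 => ?_⟩
  refine (Nat.mul_le_mul (hc s h1 h2 h3) (hc' s h1 h2 h3)).trans_eq ?_
  rw [pow_add, pow_add]; ring

theorem const (c : ℕ) : Bounded k a d 0 0 fun _ => c := ⟨c, fun s _ _ _ => by simp⟩

theorem smul (c : ℕ) (hF : Bounded k a d i j F) : Bounded k a d i j fun s => c * F s := by
  have := (const (k := k) (a := a) (d := d) c).mul hF
  rwa [zero_add, zero_add] at this

theorem add_const (hF : Bounded k a d i j F) (c : ℕ) : Bounded k a d i j fun s => F s + c :=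
  hF.add ((const c).mono (Nat.zero_le _) (Nat.zero_le _))

theorem log_succ : Bounded k a d 0 1 fun s => hitBits s.n := by
  refine ⟨2, fun s h1 _ _ => ?_⟩
  have h2 := one_le_log h1
  have h3 : Nat.log 2 s.n ≤ Nat.log 2 s.n ^ (d + 1) := Nat.le_self_pow (by omega) _
  rw [pow_zero, one_mul, pow_one]
  change Nat.log 2 s.n + 1 ≤ _
  omega

theorem words : Bounded k a d 0 1 fun s => s.w := by
  refine ⟨a, fun s h1 h2 _ => h2.trans (Nat.mul_le_mul_left _ ?_)⟩
  rw [pow_zero, one_mul, pow_one]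
  exact Nat.pow_le_pow_right (one_le_log h1) (by omega)

theorem opCost : Bounded k a d 0 1 fun s => s.τ := by
  refine ⟨a, fun s h1 _ h2 => h2.trans (Nat.mul_le_mul_left _ ?_)⟩
  rw [pow_zero, one_mul, pow_one]
  exact Nat.pow_le_pow_right (one_le_log h1) (by omega)

theorem m : Bounded k a d 0 1 fun s => k.m s.n :=
  (log_succ.add_const (k.g + 1)).of_le fun s _ => by rw [Consts.m]; omega

theorem pow_m (i : ℕ) : Bounded k a d i 0 fun s => (2 ^ k.m s.n) ^ i :=
  ⟨1, fun s _ _ _ => by simp⟩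

theorem size : Bounded k a d 2 0 fun s => s.n := by
  refine (pow_m 2).of_le fun s _ => ?_
  rw [← pow_mul, mul_comm]
  exact (Consts.lt_two_pow_hitBits s.n).le.trans
    (Nat.pow_le_pow_right (by norm_num) ((Nat.le_add_left _ _).trans (k.le_two_mul_m s.n)))

theorem runs : Bounded k a d 0 1 fun s => k.runs s.n :=
  ((log_succ.smul 3).add_const (1 + k.g)).of_le fun s _ => by have := k.runs_le s.n; omega

theorem depth : Bounded k a d 0 1 fun s => k.Dp s.n :=
  ((log_succ.smul 3).add_const (3 * (k.C + 2 * k.L + 1))).of_le fun s _ => by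
    rw [Consts.Dp]; omega

theorem kb : Bounded k a d 0 1 fun s => k.kb s.n s.w :=
  ((((words.smul 2).add (log_succ.smul k.L)).add depth).add_const (2 * k.L + 2)).of_le fun s _ => by
    rw [Consts.kb, mul_comm (hitBits s.n)]; omega

theorem reps : Bounded k a d 0 1 fun s => k.reps s.n s.w :=
  ((((kb.add (m.smul 15)).add (runs.smul 2)).add log_succ).add_const
    (2 + k.L + k.lam + 6 + 3 * (k.Q + k.g + 1) + k.q + k.kq)).of_le fun s _ => by
      rw [Consts.reps, Consts.errBits]; omega

theorem wordLen : Bounded k a d 0 1 fun s => k.W s.n s.w :=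
  ((kb.add (m.smul 2)).add_const (k.kq + 1)).of_le fun s _ => by rw [Consts.W]; omega

/-- Rounding up to a power of three costs at most another factor three, hence `9 * 2 ^ m`. -/
theorem pow_three : Bounded k a d 1 0 fun s => 3 ^ (k.par s.n s.w).I := by
  refine ((pow_m 1).smul 9).of_le fun s _ => ?_
  change 3 ^ Nat.clog 3 (3 * 2 ^ k.m s.n) ≤ 9 * (2 ^ k.m s.n) ^ 1
  have h0 : 1 < 3 * 2 ^ k.m s.n := by have := Nat.one_le_two_pow (n := k.m s.n); omega
  have h1 := Nat.pow_pred_clog_lt_self (by norm_num : 1 < 3) h0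
  have h2 : 0 < Nat.clog 3 (3 * 2 ^ k.m s.n) := Nat.clog_pos (by norm_num) h0
  have h3 : 3 ^ Nat.clog 3 (3 * 2 ^ k.m s.n) = 3 ^ (Nat.clog 3 (3 * 2 ^ k.m s.n)).pred * 3 := by
    rw [← pow_succ, Nat.pred_eq_sub_one, Nat.sub_add_cancel h2]
  rw [h3, pow_one]
  omega

/-- The only source of `√n` in the circuit: all the Grover rounds of a search together number at
most `3 ^ I * r`. -/
theorem len (N : ℕ) : Bounded k a d 1 2 fun s => (k.par s.n s.w).len N := by
  have hI : Bounded k a d 1 0 fun s => (k.par s.n s.w).I :=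
    pow_three.of_le fun s _ => (Nat.lt_pow_self (by norm_num)).le
  have h1 := (hI.mul reps).mul ((m.smul 2).add_const (10 + N))
  have h2 := ((pow_three (k := k) (a := a) (d := d)).mul reps).mul
    ((m.smul 4).add_const (2 * N + 2))
  refine ((h1.add h2).add_const 2).of_le fun s _ => ?_
  change 2 + (k.par s.n s.w).I * k.reps s.n s.w * (10 + 2 * k.m s.n + N) +
    3 ^ (k.par s.n s.w).I * k.reps s.n s.w * (2 * N + 2 * (2 * k.m s.n) + 2) ≤ _
  apply le_of_eq
  ring

theorem nextLen (N : ℕ) : Bounded k a d 1 3 fun s => (k.par s.n s.w).nextLen k.L N := by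
  have hl := len (k := k) (a := a) (d := d) (N + (6 * k.L + 24))
  have h1 := kb.mul (hl.add_const 7)
  refine ((h1.add (hl.mono le_rfl (by norm_num) : Bounded k a d (0 + 1) (1 + 2) _)).add_const
    (3 + N + (k.L + 4))).of_le fun s _ => ?_
  change 3 + k.kb s.n s.w * ((k.par s.n s.w).len (N + (6 * k.L + 24)) + 7) +
    (k.par s.n s.w).len (N + (6 * k.L + 24)) + N + (k.L + 4) ≤ _
  apply le_of_eq
  ring

theorem bodyLen :
    Bounded k a d 1 3 fun s => (k.par s.n s.w).bodyLen k.L k.lam (k.Dp s.n) := by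
  have h1 := ((len (k := k) (a := a) (d := d) 7).add_const 3).smul k.lam
  have h2 := ((nextLen (k := k) (a := a) (d := d) (extLen k.L k.lam)).smul k.lam).add_const 1
  have h3 := ((h1.mono le_rfl (by norm_num)).add h2).smul k.L
  have h4 := (((depth (k := k) (a := a) (d := d)).smul 17).add_const (9 * k.L + 22)).smul
    (2 ^ k.L * (k.L + 1))
  refine ((h3.add (h4.mono (by norm_num) (by norm_num))).add_const
    ((16 + (k.L + 4) * 3) + ((k.L + 4) * (k.lam * 4 + 1) + 9 * k.L + 30))).of_le fun s _ => ?_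
  rw [Par.bodyLen, Par.layerLen, finishLen]
  apply le_of_eq
  ring

end Bounded

namespace Consts

variable (k : Consts)

/-- A bound for the number of gates. -/
def circTime (s : Size) : ℕ :=
  (6 * k.m s.n + k.kq + (k.par s.n s.w).bodyLen k.L k.lam (k.Dp s.n)) *
    (s.τ + k.W s.n s.w ^ 2 + 2 * k.W s.n s.w + 1)

/-- A bound for the time of a round of the main loop. -/
def roundTime (s : Size) : ℕ :=
  k.runs s.n * (3 * k.B s.n * (k.circTime s + k.R s.n s.w * k.W s.n s.w + k.W s.n s.w + 2) +
    k.W s.n s.w) + s.τ + treeTimeBound k.L (k.C * s.n) (k.W s.n s.w)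

theorem bounded_circTime (a d : ℕ) : Bounded k a d 1 6 k.circTime := by
  have h1 := (((Bounded.m (k := k) (a := a) (d := d)).smul 6).add_const k.kq).mono
    (Nat.zero_le 1) (by norm_num : 1 ≤ 3)
  have hW := Bounded.wordLen (k := k) (a := a) (d := d)
  have h2 := (((Bounded.opCost (k := k) (a := a) (d := d)).mono le_rfl (by norm_num)).add
    (hW.mul hW)).add ((hW.smul 2).mono le_rfl (by norm_num)) |>.add_const 1
  refine (((h1.add Bounded.bodyLen).mul h2).mono (by norm_num)
    (by norm_num : 3 + (1 + 1) ≤ 6)).of_le fun s _ => ?_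
  rw [circTime, sq]

/-- The calls contribute the third power of `2 ^ m` and the circuit one more, so a round takes about
`n²` steps; the pass through the tree is only linear in `n`. -/
theorem bounded_roundTime (a d : ℕ) : Bounded k a d 4 7 k.roundTime := by
  have hW := Bounded.wordLen (k := k) (a := a) (d := d)
  have hB : Bounded k a d 3 0 fun s => 3 * k.B s.n := by
    refine ((Bounded.pow_m 3).smul (3 * k.Q * 2 ^ (k.g + 1))).of_le fun s _ => ?_
    rw [B, add_assoc, pow_add, mul_comm 3 (k.m s.n), pow_mul]
    apply le_of_eq
    ring
  have hR : Bounded k a d 1 3 fun s => k.R s.n s.w :=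
    (Bounded.bodyLen.add_const 4).of_le fun s _ => by rw [R]; omega
  have h1 := (((k.bounded_circTime a d).add ((hR.mul hW).mono (by norm_num) (by norm_num))).add
    (hW.mono (by norm_num) (by norm_num))).add_const 2
  have h2 := (hB.mul h1).add (hW.mono (by norm_num) (by norm_num))
  have h3 := Bounded.runs.mul h2
  have h4 : Bounded k a d 2 1 fun s => treeTimeBound k.L (k.C * s.n) (k.W s.n s.w) :=
    ((((((Bounded.size (k := k) (a := a) (d := d)).smul k.C).mul
      (Bounded.const (k.L * 2 ^ k.L))).add_const (k.L * 2 ^ k.L + 1)).smul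
      ((2 * k.L + 1 + k.L) * 2 ^ k.L)).mul (hW.add_const 1)).of_le fun s _ => le_rfl
  refine ((((h3.mono (by norm_num) (by norm_num)).add
    ((Bounded.opCost (k := k) (a := a) (d := d)).mono (by norm_num) (by norm_num))).add
    (h4.mono (by norm_num) (by norm_num)) : Bounded k a d 4 7 _)).of_le fun s _ => le_rfl

end Consts

end CTF

/-! ### Error and time bounds for the chosen parameters -/

namespace CTF

namespace Consts

variable (k : Consts) {n : ℕ}

/-- The circuit with the chosen parameters. -/
noncomputable def circuit (n : ℕ) (hL : 3 ≤ k.L) (f : ℚ) (D : Detector k.L) : Inner k.L :=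
  inner (k.R n D.w) (k.W n D.w) (k.par n D.w) D n hL f k.lam (hitBits n) (k.Dp n) k.kq

theorem cost_circuit_le (hL : 3 ≤ k.L) (f : ℚ) (D : Detector k.L) :
    (k.circuit n hL f D).circ.cost D.opCost ≤ k.circTime ⟨n, D.w, D.opCost⟩ := by
  have hR : 4 + (k.par n D.w).bodyLen k.L k.lam (k.Dp n) ≤ k.R n D.w := le_rfl
  have hlen := len_body (L := k.L) (n := n) (R := k.R n D.w) (W := k.W n D.w) (k.par n D.w) D hL f
    k.lam (hitBits n) (k.Dp n) 4
  change Circuit.cost D.opCost (innerCirc (k.R n D.w) (k.W n D.w) (k.par n D.w) D n hL f k.lam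
    (hitBits n) (k.Dp n) k.kq) ≤ _
  rw [innerCirc, cost_append, circTime, add_mul]
  refine Nat.add_le_add ((Circuit.cost_le (within_hads _ (by omega))).trans
    (Nat.mul_le_mul_right _ ((length_hads _ _).trans_eq ?_)))
    ((Circuit.cost_le (Bld.within _ 4 (hlen.2.trans hR))).trans (Nat.mul_le_mul_right _ hlen.1))
  simp only [Finset.sum_range_succ, Finset.sum_range_zero]
  change 0 + 2 * k.m n + 2 * k.m n + 2 * k.m n + k.kq = 6 * k.m n + k.kq
  ring

theorem err_nonneg (n : ℕ) : 0 ≤ k.err n := by rw [err]; positivity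

theorem err_le (hq : 1 ≤ k.q) : k.err n ≤ 1 / 4 ∧ k.err n ≤ 1 / k.q := by
  have h1 : k.err n ≤ (1 / 2) ^ (2 + k.q) :=
    pow_le_pow_of_le_one (by norm_num) (by norm_num) (by rw [errBits]; omega)
  have h2 : (k.q : ℝ) ≤ 2 ^ k.q := by exact_mod_cast Nat.lt_two_pow_self.le
  have h3 : (0 : ℝ) < k.q := by exact_mod_cast hq
  have h4 : (1 / 2 : ℝ) ^ k.q ≤ 1 / k.q := by
    rw [one_div, inv_pow, one_div]
    gcongr
  have h5 : (1 / 2 : ℝ) ^ k.q ≤ 1 := pow_le_one₀ (by norm_num) (by norm_num)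
  rw [pow_add] at h1
  have h6 : (0 : ℝ) ≤ (1 / 2) ^ k.q := by positivity
  constructor <;> linarith

theorem performs (hL : 3 ≤ k.L) (hlam : 1 ≤ k.lam) {f : ℚ} (hf0 : 0 < f) (hf1 : f ≤ 1)
    (D : Detector k.L) (E : Event k.L n D.w)
    (hlen : (recoOutput D E hL k.lam f).length ≤ k.C * n) {ε : ℝ}
    (hε : k.err n ≤ ε) (i : ℕ) :
    (k.circuit n hL f D).Performs D E hL k.lam f ((recoOutput D E hL k.lam f).take i)
      ((k.par n D.w).prob k.kq) ε := by
  refine Ready.performs hf0 hf1 (fun t ht =>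
    one_le_rOf_of_mem_recoOutput hf0 hf1 hlam (List.mem_of_mem_take ht))
    (k.ready hL hlam hf1 D E ?_) hL
    ((k.bodyErr_le D.w).trans (mul_le_mul_of_nonneg_right hε (Par.prob_pos _ _).le))
    ((k.err_nonneg n).trans hε)
  exact (by simp : _ ≤ _).trans hlen

theorem key_lt_infty (hL : 3 ≤ k.L) (hlam : 1 ≤ k.lam) {f : ℚ} (hf1 : f ≤ 1)
    (D : Detector k.L) (E : Event k.L n D.w) {c : Cand k.L n D.w} (hc : c ∈ found D E hL k.lam) :
    key D c < (k.circuit n hL f D).infty.toNat := by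
  have h := k.ready hL hlam hf1 D E (ts := []) (Nat.zero_le _)
  obtain ⟨z, -, hz, -⟩ := h.existsUnique_input hc
  have := h.key_lt (List.mem_of_getElem? hz)
  rw [Inner.infty, BitVec.toNat_allOnes]
  exact this

/-- The failure probability of a round of the main loop. -/
noncomputable def fail (n : ℕ) : ℝ :=
  (k.junk n + 1 / (4 * k.q)) ^ k.runs n + (k.runs n : ℝ) ^ 2 * k.junk n

theorem junk_nonneg (n : ℕ) : 0 ≤ k.junk n := by
  have := k.err_nonneg n
  rw [junk]; positivity

theorem junk_le_inv (hq : 1 ≤ k.q) (hr : 1 ≤ k.runs n) (hn : 1 ≤ n) :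
    k.junk n ≤ 1 / (4 * k.q) := by
  have hJ := k.junk_nonneg n
  have h1 := k.junk_le (n := n) hq
  have hq' : (0 : ℝ) < k.q := by exact_mod_cast hq
  rw [le_div_iff₀ (by positivity)]
  refine le_trans (mul_le_mul_of_nonneg_left ?_ hJ) h1
  have h2 : (1 : ℝ) ≤ (k.runs n : ℝ) ^ 2 * n := by
    have : (1 : ℝ) ≤ k.runs n := by exact_mod_cast hr
    have : (1 : ℝ) ≤ n := by exact_mod_cast hn
    nlinarith
  nlinarith

theorem qmfBest_le (hL : 3 ≤ k.L) (hlam : 1 ≤ k.lam) {f : ℚ} (hf0 : 0 < f) (hf1 : f ≤ 1)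
    (D : Detector k.L) (E : Event k.L n D.w)
    (hq : 1 ≤ k.q) (hn : 2 ≤ n)
    (hlen : (recoOutput D E hL k.lam f).length ≤ k.C * n) (i t : ℕ)
    (ht : (valid D E hL k.lam f ((recoOutput D E hL k.lam f).take i) = [] ∧
        t = (k.circuit n hL f D).infty.toNat) ∨
      ∃ c ∈ valid D E hL k.lam f ((recoOutput D E hL k.lam f).take i), t = key D c ∧
        ∀ c' ∈ valid D E hL k.lam f ((recoOutput D E hL k.lam f).take i), t ≤ key D c') :
    (qmfBest ⟨D, E, treeOf f ((recoOutput D E hL k.lam f).take i)⟩ (k.circuit n hL f D) (k.B n)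
      (k.runs n)).toOuterMeasure
        {b | ¬ (Clean ((k.circuit n hL f D).Good D E hL k.lam f
          ((recoOutput D E hL k.lam f).take i)) b.1 b.2.1 ∧ b.2.1.toNat = t)} ≤
      ENNReal.ofReal (k.fail n) := by
  have hq' : (1 : ℝ) ≤ k.q := by exact_mod_cast hq
  have hr : 1 ≤ k.runs n := Nat.clog_pos (by norm_num) (by
    have : 1 ≤ n ^ 3 := Nat.one_le_pow _ _ (by omega)
    nlinarith)
  have hS := (k.performs hL hlam hf0 hf1 D E hlen le_rfl i).sampler (Par.prob_pos _ _)
    (k.err_nonneg n) (k.err_le hq).1 hlam (k.card_mul_prob_le D.w) ht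
  have hsq := k.sqrt_prob (n := n) D.w
  have hBeq : (k.B n : ℝ) = 576 * k.q * 2 ^ (3 * k.m n + k.g + 1) := by
    rw [B, Q]; push_cast; ring
  set S : ℝ := 2 ^ (3 * k.m n + k.g + 1)
  have hS0 : 0 < S := by positivity
  have hB : 1 / √((k.par n D.w).prob k.kq / 2) ≤ k.B n := by
    refine hsq.trans ?_
    rw [hBeq]
    nlinarith
  have hJ := k.junk_nonneg n
  have hJq := k.junk_le_inv hq hr (by omega : 1 ≤ n)
  have hqq : 1 / (4 * (k.q : ℝ)) ≤ 1 / 4 := by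
    gcongr
    linarith
  have hmiss := hS.qmf_miss_le hB
  have hclean := hS.qmf_not_clean_le (k.B n)
  -- The factor `576 = 72 * 2 * 4` in `B`: the expected number of calls is at most `72 * 2 * 2 ^
  -- (3m+g+1)`, and a run shall fail with probability `1 / (4 q)` at most.
  have hη : 72 / √((k.par n D.w).prob k.kq / 2) / k.B n ≤ 1 / (4 * k.q) := by
    have e : 72 / √((k.par n D.w).prob k.kq / 2) =
      72 * (1 / √((k.par n D.w).prob k.kq / 2)) := by ring
    rw [e, div_le_iff₀ (by rw [hBeq]; positivity), hBeq]
    have e2 : 1 / (4 * (k.q : ℝ)) * (576 * k.q * S) = 144 * S := by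
      field_simp
      norm_num
    rw [e2]
    linarith
  have hη' : (qmf ⟨D, E, treeOf f ((recoOutput D E hL k.lam f).take i)⟩ (k.circuit n hL f D)
      (k.B n)).toOuterMeasure {s' | ¬ (Clean ((k.circuit n hL f D).Good D E hL k.lam f
        ((recoOutput D E hL k.lam f).take i)) s'.best s'.y ∧ s'.y.toNat = t)} ≤
      ENNReal.ofReal (k.junk n + 1 / (4 * k.q)) :=
    hmiss.trans (ENNReal.ofReal_le_ofReal (add_le_add_right hη _))
  refine (hS.qmfBest_miss_le hclean hη' ?_ (k.runs n)).trans (le_of_eq ?_)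
  · rw [← ENNReal.ofReal_one]
    exact ENNReal.ofReal_le_ofReal (by linarith)
  · have h0 : 0 ≤ k.junk n + 1 / (4 * k.q) := by positivity
    rw [fail, ENNReal.ofReal_add (pow_nonneg h0 _) (by positivity), ENNReal.ofReal_pow h0,
      ENNReal.ofReal_mul (p := (k.runs n : ℝ) ^ 2) (by positivity),
      ENNReal.ofReal_pow (by positivity), ENNReal.ofReal_natCast]
    rfl

/-- A run fails with probability at most `1 / (2 q)`. The power `runs` turns the factor `1/2` into
at most `1 / (2 n)`, because `2 ^ runs ≥ 2 λ n³`, while one factor `1 / q` is kept. Wrong samples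
add at most `1 / (4 n q)`. So a round fails with probability at most `1 / (n q)`, and at most `(C +
1) n` rounds with `(C + 1) / q ≤ ε`. -/
theorem mul_fail_le (hlam : 1 ≤ k.lam) (hq : 1 ≤ k.q) (hn : 2 ≤ n) {ε : ℝ}
    (hε : (k.C + 1 : ℝ) ≤ ε * k.q) {l : ℕ}
    (hl : l ≤ k.C * n) : ((l + 1 : ℕ) : ℝ) * k.fail n ≤ ε := by
  have hq' : (1 : ℝ) ≤ k.q := by exact_mod_cast hq
  have hn' : (1 : ℝ) ≤ n := by exact_mod_cast (by omega : 1 ≤ n)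
  have hlam' : (1 : ℝ) ≤ k.lam := by exact_mod_cast hlam
  have hr : 1 ≤ k.runs n := Nat.clog_pos (by norm_num) (by
    have : 1 ≤ n ^ 3 := Nat.one_le_pow _ _ (by omega)
    nlinarith)
  have hJ := k.junk_nonneg n
  have hJq := k.junk_le_inv hq hr (by omega : 1 ≤ n)
  have hJ1 := k.junk_le (n := n) hq
  have hl1 : ((l + 1 : ℕ) : ℝ) ≤ (k.C + 1) * n := by
    have : l + 1 ≤ (k.C + 1) * n := by rw [add_mul]; omega
    exact_mod_cast this
  have hpow : (2 : ℝ) * k.lam * n ^ 3 ≤ 2 ^ k.runs n := by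
    exact_mod_cast Nat.le_pow_clog (by norm_num : 1 < 2) (2 * k.lam * n ^ 3)
  have h1 : (k.junk n + 1 / (4 * k.q)) ^ k.runs n ≤ 1 / (2 * n) * (1 / k.q) := by
    have e : (1 / 2 : ℝ) * (1 / k.q) = 1 / (4 * k.q) + 1 / (4 * k.q) := by
      field_simp; norm_num
    calc (k.junk n + 1 / (4 * k.q)) ^ k.runs n ≤ (1 / 2 * (1 / k.q)) ^ k.runs n := by
          gcongr
          linarith
      _ = (1 / 2) ^ k.runs n * (1 / k.q) ^ k.runs n := mul_pow _ _ _
      _ ≤ 1 / (2 * n) * (1 / k.q) := by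
          gcongr
          · rw [one_div, inv_pow, one_div]
            gcongr
            refine le_trans ?_ hpow
            have h3 : (n : ℝ) ≤ n ^ 3 := le_self_pow₀ hn' (by norm_num)
            nlinarith
          · exact pow_le_of_le_one (by positivity) (by rw [div_le_one (by positivity)]; exact hq')
              (by omega)
  have h2 : (k.runs n : ℝ) ^ 2 * k.junk n ≤ 1 / (4 * n) * (1 / k.q) := by
    have e : (1 : ℝ) / (4 * n) * (1 / k.q) = 1 / (4 * k.q * n) := by
      field_simp
    rw [e, le_div_iff₀ (by positivity)]
    linarith
  have h3 : k.fail n ≤ 1 / n * (1 / k.q) := by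
    have e : (1 : ℝ) / n * (1 / k.q) = 1 / (2 * n) * (1 / k.q) + 1 / (4 * n) * (1 / k.q) +
      1 / (4 * n) * (1 / k.q) := by field_simp; norm_num
    have : 0 ≤ (1 : ℝ) / (4 * n) * (1 / k.q) := by positivity
    rw [fail, e]
    linarith
  calc ((l + 1 : ℕ) : ℝ) * k.fail n ≤ (k.C + 1) * n * (1 / n * (1 / k.q)) :=
        mul_le_mul hl1 h3 (by rw [fail]; positivity) (by positivity)
    _ = (k.C + 1) / k.q := by field_simp
    _ ≤ ε := by rw [div_le_iff₀ (by positivity)]; exact hε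

theorem reconstruct_le (hL : 3 ≤ k.L) (hlam : 1 ≤ k.lam) {f : ℚ} (hf0 : 0 < f) (hf1 : f ≤ 1)
    (D : Detector k.L) (E : Event k.L n D.w)
    (hq : 1 ≤ k.q) (hn : 2 ≤ n)
    (hlen : (recoOutput D E hL k.lam f).length ≤ k.C * n) {ε : ℝ}
    (hε : (k.C + 1 : ℝ) ≤ ε * k.q) :
    ENNReal.ofReal (1 - ε) ≤ (reconstruct D E k.lam f (k.circuit n hL f D) (k.B n)).toOuterMeasure
      {o | o.1 = recoOutput D E hL k.lam f ∧
        o.2 ≤ (k.C * n + 1) * k.roundTime ⟨n, D.w, D.opCost⟩} := by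
  set Q := recoOutput D E hL k.lam f with hQ
  have hfail : 0 ≤ k.fail n := by
    have := k.junk_nonneg n
    rw [fail]; positivity
  -- The fuel `(n + 1) ^ L + 1` covers all tracks of the output and the final round that finds
  -- nothing.
  have hmiss := recoLoop_miss_le (Q := Q) (Y := k.roundTime ⟨n, D.w, D.opCost⟩) hf0 hf1 hlam hQ
    (fun i _ t ht => k.qmfBest_le hL hlam hf0 hf1 D E hq hn hlen i t (ht.imp
      (fun h => ⟨by rw [h.1, hQ, List.take_length]; exact valid_recoOutput hf1, h.2⟩)
      fun ⟨c, h1, h2, _, h3⟩ => ⟨c, h1, h2, h3⟩))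
    (fun c hc => k.key_lt_infty hL hlam hf1 D E hc) ?_ Q.length ((n + 1) ^ k.L + 1) 0
    (zero_add _) (Nat.succ_le_succ (length_recoOutput_le hf1))
  · rw [List.take_zero, List.drop_zero] at hmiss
    have hbound : ((Q.length + 1 : ℕ) : ENNReal) * ENNReal.ofReal (k.fail n) ≤
        ENNReal.ofReal ε := by
      rw [← ENNReal.ofReal_natCast, ← ENNReal.ofReal_mul (by positivity)]
      exact ENNReal.ofReal_le_ofReal (k.mul_fail_le hlam hq hn hε hlen)
    set μ := (reconstruct D E k.lam f (k.circuit n hL f D) (k.B n)).toOuterMeasure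
    set A : Set (List (Track k.L n) × ℕ) := {o | ¬ (o.1 = Q ∧
      o.2 ≤ (Q.length + 1) * k.roundTime ⟨n, D.w, D.opCost⟩)}
    have hA : μ A ≤ ENNReal.ofReal ε := le_trans hmiss hbound
    have huniv : μ Set.univ = 1 :=
      (PMF.toOuterMeasure_apply_eq_one_iff _ _).mpr (Set.subset_univ _)
    have hε0 : 0 ≤ ε := by
      have hq' : (0 : ℝ) < k.q := by exact_mod_cast hq
      by_contra hneg
      have : ε * k.q < 0 := mul_neg_of_neg_of_pos (not_le.mp hneg) hq'
      linarith [Nat.cast_nonneg (α := ℝ) k.C]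
    rw [ENNReal.ofReal_sub _ hε0, ENNReal.ofReal_one, tsub_le_iff_right, ← huniv]
    refine (MeasureTheory.measure_mono (t := {o | o.1 = Q ∧
      o.2 ≤ (k.C * n + 1) * k.roundTime ⟨n, D.w, D.opCost⟩} ∪ A) fun o _ => ?_).trans
      ((MeasureTheory.measure_union_le _ _).trans (add_le_add_right hA _))
    by_cases h : o.1 = Q ∧ o.2 ≤ (Q.length + 1) * k.roundTime ⟨n, D.w, D.opCost⟩
    · exact Or.inl ⟨h.1, h.2.trans (Nat.mul_le_mul_right _ (Nat.succ_le_succ hlen))⟩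
    · exact Or.inr h
  · have h1 : callTime (k.circuit n hL f D) D.opCost ≤ k.circTime ⟨n, D.w, D.opCost⟩ +
        k.R n D.w * k.W n D.w + k.W n D.w + 2 := by
      have := k.cost_circuit_le (n := n) hL f D
      rw [callTime]
      change _ + k.R n D.w * k.W n D.w + k.W n D.w + 2 ≤ _
      omega
    have h2 : treeTimeBound k.L Q.length (k.W n D.w) ≤ treeTimeBound k.L (k.C * n) (k.W n D.w) := by
      unfold treeTimeBound
      gcongr
    rw [roundTime]
    refine Nat.add_le_add (Nat.add_le_add_right (Nat.mul_le_mul_left _ (Nat.add_le_add_right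
      (Nat.mul_le_mul_left _ h1) _)) _) h2

theorem two_pow_m_le (hn : n ≠ 0) : (2 : ℝ) ^ k.m n ≤ 2 ^ (k.g + 2) * √n := by
  have h := k.two_pow_two_mul_m_le n hn
  have h' : ((2 : ℝ) ^ k.m n) ^ 2 ≤ 2 ^ (k.g + 2) * n := by
    rw [← pow_mul, mul_comm]; exact_mod_cast h
  have hG : (1 : ℝ) ≤ 2 ^ (k.g + 2) := one_le_pow₀ (by norm_num)
  refine (abs_le_of_sq_le_sq' (a := (2 : ℝ) ^ k.m n) (h'.trans ?_) (by positivity)).2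
  rw [mul_pow, Real.sq_sqrt (Nat.cast_nonneg _)]
  gcongr
  exact le_self_pow₀ hG (by norm_num)

theorem B_le (hn : n ≠ 0) :
    (k.B n : ℝ) ≤ (k.Q * (2 ^ (k.g + 2)) ^ 3 * 2 ^ (k.g + 1) : ℕ) * √((n : ℝ) ^ 3) := by
  have h := pow_le_pow_left₀ (by positivity) (k.two_pow_m_le hn) 3
  have hs : √(n : ℝ) ^ 3 = √((n : ℝ) ^ 3) := by
    rw [Real.sqrt_eq_rpow, Real.sqrt_eq_rpow, ← Real.rpow_natCast, ← Real.rpow_natCast,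
      ← Real.rpow_mul (by positivity), ← Real.rpow_mul (by positivity), mul_comm]
  rw [mul_pow, hs, ← pow_mul] at h
  rw [B, add_assoc, pow_add, mul_comm 3]
  push_cast
  calc (k.Q : ℝ) * (2 ^ (k.m n * 3) * 2 ^ (k.g + 1))
      ≤ k.Q * (((2 ^ (k.g + 2)) ^ 3 * √((n : ℝ) ^ 3)) * 2 ^ (k.g + 1)) := by gcongr
    _ = _ := by ring

theorem le_prob (hn : n ≠ 0) (w : ℕ) :
    1 / (((2 ^ (k.g + 2)) ^ 3 * 2 ^ k.kq : ℕ) * (n : ℝ) ^ 3) ≤ (k.par n w).prob k.kq := by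
  have hn' : (0 : ℝ) < n := by exact_mod_cast Nat.pos_of_ne_zero hn
  rw [Par.prob, one_div]
  gcongr
  change (2 : ℝ) ^ (6 * k.m n + k.kq) ≤ _
  have h := Nat.pow_le_pow_left (k.two_pow_two_mul_m_le n hn) 3
  have h' : ((2 : ℝ) ^ (2 * k.m n)) ^ 3 ≤ (2 ^ (k.g + 2) * n) ^ 3 := by exact_mod_cast h
  rw [pow_add, show 6 * k.m n = 2 * k.m n * 3 by ring, pow_mul 2 (2 * k.m n)]
  push_cast
  calc ((2 : ℝ) ^ (2 * k.m n)) ^ 3 * 2 ^ k.kq ≤ (2 ^ (k.g + 2) * n) ^ 3 * 2 ^ k.kq := by gcongr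
    _ = _ := by ring

end Consts

end CTF
-- The choice of the constants and the conclusion
open CTF in
theorem mainTheorem1 (L lam : ℕ) (hL : 3 ≤ L) (hlam : 1 ≤ lam) (f : ℚ) (hf0 : 0 < f) (hf1 : f ≤ 1)
    (C a d : ℕ) (ε : ℝ) (hε0 : 0 < ε) (hε1 : ε < 1) :
    ∃ K k : ℕ, ∀ n : ℕ, 2 ≤ n → ∀ D : Detector L,
      D.w ≤ a * Nat.log 2 n ^ d → D.opCost ≤ a * Nat.log 2 n ^ d →
      ∃ (U : Inner L) (B : ℕ) (p : ℝ),
        (U.circ.cost D.opCost : ℝ) ≤ K * √n * (Nat.log 2 n : ℝ) ^ k ∧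
        (B : ℝ) ≤ K * √((n : ℝ) ^ 3) ∧
        1 / (K * (n : ℝ) ^ 3) ≤ p ∧
        ∀ E : Event L n D.w,
          (SelectionConsistent D E hL lam f → ctfOutput D E hL lam f = recoOutput D E hL lam f) ∧
          ((recoOutput D E hL lam f).length ≤ C * n →
            (∀ i ≤ (recoOutput D E hL lam f).length,
              U.Performs D E hL lam f ((recoOutput D E hL lam f).take i) p ε) ∧
            ENNReal.ofReal (1 - ε) ≤ (reconstruct D E lam f U B).toOuterMeasure
              {o | o.1 = recoOutput D E hL lam f ∧ o.2 ≤ K * n ^ 3 * Nat.log 2 n ^ k}) := by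
  -- The inverse `q` of the tolerated failure probability absorbs the factor `C + 1` of the union
  -- bound over the rounds.
  obtain ⟨q, hqε⟩ := exists_nat_ge ((C + 1 : ℝ) / ε)
  have hε : (C + 1 : ℝ) ≤ ε * q := by
    rw [div_le_iff₀ hε0] at hqε; linarith
  have hq : 1 ≤ q := by
    rcases Nat.eq_zero_or_pos q with rfl | h
    · rw [Nat.cast_zero, mul_zero] at hε
      linarith [Nat.cast_nonneg (α := ℝ) C]
    · exact h
  have hq' : (0 : ℝ) < q := by exact_mod_cast hq
  let k : Consts := ⟨lam, C, q, L⟩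
  obtain ⟨c₁, hc₁⟩ := k.bounded_circTime a d
  obtain ⟨c₂, hc₂⟩ := k.bounded_roundTime a d
  set G : ℕ := 2 ^ (k.g + 2) with hG
  -- The four summands of `K` serve the number of gates, the number `B`, the probability `p` and the
  -- total time. The power of the logarithm is that of `bounded_roundTime`, which exceeds the one
  -- for the circuit.
  refine ⟨c₁ * G + k.Q * G ^ 3 * 2 ^ (k.g + 1) + G ^ 3 * 2 ^ k.kq + (C + 1) * c₂ * G ^ 2,
    (d + 1) * 7, fun n hn D hw hτ => ?_⟩
  have hn0 : n ≠ 0 := by omega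
  have hlog := Bounded.one_le_log hn
  refine ⟨k.circuit n hL f D, k.B n, (k.par n D.w).prob k.kq, ?_, ?_, ?_, fun E => ⟨?_, fun hlen =>
    ⟨fun i _ => k.performs hL hlam hf0 hf1 D E hlen ?_ i, ?_⟩⟩⟩
  · have h1 : ((k.circuit n hL f D).circ.cost D.opCost : ℝ) ≤
        c₁ * (2 ^ k.m n * (Nat.log 2 n : ℝ) ^ ((d + 1) * 7)) := by
      have h2 := (k.cost_circuit_le (n := n) hL f D).trans (hc₁ ⟨n, D.w, D.opCost⟩ hn hw hτ)
      have h3 : (Nat.log 2 n ^ (d + 1)) ^ 6 ≤ Nat.log 2 n ^ ((d + 1) * 7) := by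
        rw [← pow_mul]
        exact Nat.pow_le_pow_right hlog (by omega)
      refine le_trans (Nat.cast_le.mpr (h2.trans (Nat.mul_le_mul_left _
        (Nat.mul_le_mul_left _ h3)))) (le_of_eq ?_)
      push_cast
      ring
    refine h1.trans ?_
    rw [mul_assoc, ← mul_assoc]
    have h4 : (c₁ : ℝ) * 2 ^ k.m n ≤
        (c₁ * G + k.Q * G ^ 3 * 2 ^ (k.g + 1) + G ^ 3 * 2 ^ k.kq + (C + 1) * c₂ * G ^ 2 : ℕ) *
          √n := by
      calc (c₁ : ℝ) * 2 ^ k.m n ≤ c₁ * (2 ^ (k.g + 2) * √n) := by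
            gcongr
            exact k.two_pow_m_le hn0
        _ = ((c₁ * G : ℕ) : ℝ) * √n := by rw [hG]; push_cast; ring
        _ ≤ _ := by
            gcongr
            omega
    rw [← mul_assoc]
    gcongr
  · refine (k.B_le hn0).trans ?_
    gcongr
    rw [← hG]
    omega
  · refine le_trans ?_ (k.le_prob hn0 D.w)
    have hn' : (0 : ℝ) < n := by exact_mod_cast Nat.pos_of_ne_zero hn0
    have hpos : 0 < (2 ^ (k.g + 2)) ^ 3 * 2 ^ k.kq := by positivity
    have hpos' : (0 : ℝ) < ((2 ^ (k.g + 2)) ^ 3 * 2 ^ k.kq : ℕ) := by exact_mod_cast hpos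
    gcongr
    rw [← hG]
    omega
  · exact ctfOutput_eq_recoOutput D E hL lam f
  · refine (k.err_le hq).2.trans ?_
    rw [div_le_iff₀ hq']
    linarith [Nat.cast_nonneg (α := ℝ) C]
  · refine (k.reconstruct_le hL hlam hf0 hf1 D E hq hn hlen hε).trans
      (MeasureTheory.measure_mono fun o ho => ⟨ho.1, ho.2.trans ?_⟩)
    have h1 := hc₂ ⟨n, D.w, D.opCost⟩ hn hw hτ
    have h2 := k.two_pow_two_mul_m_le n hn0
    -- A round takes `(2 ^ m) ^ 4`, of order `n²`, up to logarithms; the `C n + 1` rounds supply the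
    -- third factor `n`.
    have h3 : (2 ^ k.m n) ^ 4 ≤ (G * n) ^ 2 := by
      have e : (2 ^ k.m n) ^ 4 = (2 ^ (2 * k.m n)) ^ 2 := by
        rw [← pow_mul, ← pow_mul]; congr 1; ring
      rw [e]
      exact Nat.pow_le_pow_left h2 2
    have h4 : C * n + 1 ≤ (C + 1) * n := by rw [add_mul]; omega
    calc (C * n + 1) * k.roundTime ⟨n, D.w, D.opCost⟩
        ≤ ((C + 1) * n) * (c₂ * ((G * n) ^ 2 * (Nat.log 2 n ^ (d + 1)) ^ 7)) :=
          Nat.mul_le_mul h4 (h1.trans (Nat.mul_le_mul_left _ (Nat.mul_le_mul_right _ h3)))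
      _ = ((C + 1) * c₂ * G ^ 2) * n ^ 3 * Nat.log 2 n ^ ((d + 1) * 7) := by
          rw [pow_mul (Nat.log 2 n)]; ring
      _ ≤ _ := by
          gcongr
          omega
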